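/- Let $\mathfrak g=\mathfrak g_{\bar 0}\oplus\mathfrak g_{\bar 1}$ be a basic classical Lie superalgebra over $\mathbb C$ (finite dimensional, simple, with $\mathfrak g_{\bar 1}$ a completely reducible $\mathfrak g_{\bar 0}$-module, and admitting a non-degenerate even supersymmetric invariant bilinear form) or $\mathfrak g=\mathfrak{gl}(m|n)$, and fix such a form $(\cdot,\cdot)$. Let $\mathfrak p=\mathfrak l+\mathfrak n$ be a parabolic subalgebra (a graded subalgebra containing a Borel subalgebra) with Levi subalgebra $\mathfrak l$, let $\mathfrak p^*=\overline{\mathfrak n}+\mathfrak l$ be the opposite parabolic subalgebra, so that $\mathfrak g=\overline{\mathfrak n}\oplus\mathfrak l\oplus\mathfrak n$, and let $\mathbb V$ be a finite dimensional irreducible $\mathfrak g$-module. Identify $C^k(\overline{\mathfrak n},\mathbb V)=\mathrm{Hom}(\Lambda^k\overline{\mathfrak n},\mathbb V)$ with $C_k(\mathfrak n,\mathbb V)=\Lambda^k\mathfrak n\otimes\mathbb V$ by means of the form ($\Lambda$ is the exterior power of super vector spaces). Let $\partial^*$ be the boundary operator, $\partial^*(v)=0$ and $\partial^*(X\wedge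 f)=-X\cdot f-X\wedge\partial^*f$, and let $\partial$ be the coboundary operator, $\partial v=\sum_a\xi_a\otimes\xi_a^\ddagger v$ and $\partial(X\wedge f)=\frac12\sum_a\xi_a\wedge[\xi_a^\ddagger,X]_{\mathfrak n}\wedge f-X\wedge\partial f$, for $v\in\mathbb V$, $X\in\mathfrak n$, where $\{\xi_a\}$ is a homogeneous basis of $\mathfrak n$ with dual basis $\{\xi_a^\ddagger\}$ of $\overline{\mathfrak n}$, $(\xi_a^\ddagger,\xi_b)=\delta_{ab}$, and $[\cdot,\cdot]_{\mathfrak n}$ is the projection of the bracket to $\mathfrak n$ along $\mathfrak p^*$. Put $\Box=\partial\partial^*+\partial^*\partial$, let $C^\bullet(\overline{\mathfrak n},\mathbb V)_0$ be the generalised eigenspace of $\Box$ with eigenvalue zero, and let $H_\bullet(\mathfrak n,\mathbb V)=\ker\partial^*/\mathrm{im}\,\partial^*$ and $H^\bullet(\overline{\mathfrak n},\mathbb V)=\ker\partial/\mathrm{im}\,\partial$. Then the following statements are equivalent: 1. $\mathrm{im}\,\partial^*\cap\ker\Box=0$; 2. $\mathrm{im}\,\partial^*\cap C^\bullet(\overline{\mathfrak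 n},\mathbb V)_0=0$; 3. $C^\bullet(\overline{\mathfrak n},\mathbb V)_0\subset\ker\partial^*$; 4. $H_k(\mathfrak n,\mathbb V)\cong C^k(\overline{\mathfrak n},\mathbb V)_0$ as $\mathfrak l$-modules for every $k$; 5. $\mathrm{im}\,\partial\cap\ker\Box=0$; 6. $\mathrm{im}\,\partial\cap C^\bullet(\overline{\mathfrak n},\mathbb V)_0=0$; 7. $C^\bullet(\overline{\mathfrak n},\mathbb V)_0\subset\ker\partial$; 8. $H^k(\overline{\mathfrak n},\mathbb V)\cong C^k(\overline{\mathfrak n},\mathbb V)_0$ as $\mathfrak l$-modules for every $k$; 9. $\partial$ and $\partial^*$ are disjoint, i.e. $\partial\partial^*f=0$ implies $\partial^*f=0$, and $\partial^*\partial f=0$ implies $\partial f=0$. The same equivalences hold for the boundary operator $\delta^*$, the coboundary operator $\delta$ and $\Box=\delta\delta^*+\delta^*\delta$ on $C^\bullet(\mathfrak n,\mathbb V)=\Lambda^\bullet\overline{\mathfrak n}\otimes\mathbb V$, which are defined in the same way with the roles of $(\mathfrak p,\mathfrak n)$ and $(\mathfrak p^*,\overline{\mathfrak n})$ exchanged.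 -/

import Mathlib

open scoped TensorProduct

noncomputable section

namespace KostantSuper

/-! ### Super vector spaces and Lie superalgebras over the complex numbers -/

/-- The Koszul sign `(-1)^{ij}` of two parities. -/
def koszul (i j : ZMod 2) : ℂ := if i = 1 ∧ j = 1 then -1 else 1

/-- A super vector space: a complex vector space `V = V₀ ⊕ V₁`. -/
class SuperSpace (V : Type*) [AddCommGroup V] [Module ℂ V] where
  part : ZMod 2 → Submodule ℂ V
  isCompl : IsCompl (part 0) (part 1)

open SuperSpace (part)

section SuperSpace

variable {V : Type*} [AddCommGroup V] [Module ℂ V] [SuperSpace V]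

/-- A subspace is graded if it is the sum of its even and its odd part. -/
def IsGraded (W : Submodule ℂ V) : Prop := W ≤ (W ⊓ part 0) ⊔ (W ⊓ part 1)

variable (V) in
/-- The even component of a vector. -/
def evenProj : V →ₗ[ℂ] V := (part 0).projection (part 1) SuperSpace.isCompl

variable (V) in
/-- The odd component of a vector. -/
def oddProj : V →ₗ[ℂ] V := (part 1).projection (part 0) SuperSpace.isCompl.symm

variable (V) in
/-- The parity involution `v ↦ (-1)^{|v|} v`. -/
def parityInv : V →ₗ[ℂ] V := evenProj V - oddProj V

end SuperSpace

/-- A complex Lie superalgebra. -/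
class LieSuperalgebra (g : Type*) [AddCommGroup g] [Module ℂ g] extends SuperSpace g where
  bracket : g →ₗ[ℂ] g →ₗ[ℂ] g
  bracket_mem : ∀ {i j : ZMod 2} {x y : g}, x ∈ part i → y ∈ part j → bracket x y ∈ part (i + j)
  bracket_skew : ∀ {i j : ZMod 2} {x y : g}, x ∈ part i → y ∈ part j →
    bracket x y = -(koszul i j • bracket y x)
  bracket_jacobi : ∀ {i j : ZMod 2} {x y : g}, x ∈ part i → y ∈ part j → ∀ z : g,
    bracket x (bracket y z) = bracket (bracket x y) z + koszul i j • bracket y (bracket x z)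

open LieSuperalgebra (bracket)

/-- A supermodule over a Lie superalgebra. -/
class LieSupermodule (g V : Type*) [AddCommGroup g] [Module ℂ g] [LieSuperalgebra g]
    [AddCommGroup V] [Module ℂ V] [SuperSpace V] where
  act : g →ₗ[ℂ] V →ₗ[ℂ] V
  act_mem : ∀ {i j : ZMod 2} {x : g} {v : V}, x ∈ part i → v ∈ part j → act x v ∈ part (i + j)
  act_bracket : ∀ {i j : ZMod 2} {x y : g}, x ∈ part i → y ∈ part j → ∀ v : V,
    act (bracket x y) v = act x (act y v) - koszul i j • act y (act x v)

open LieSupermodule (act)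

/-- A supermodule is irreducible if it is non-zero and has no graded submodules
besides zero and itself. -/
def IsIrreducible (g V : Type*) [AddCommGroup g] [Module ℂ g] [LieSuperalgebra g]
    [AddCommGroup V] [Module ℂ V] [SuperSpace V] [LieSupermodule g V] : Prop :=
  Nontrivial V ∧ ∀ W : Submodule ℂ V, IsGraded W →
    (∀ (x : g), ∀ w ∈ W, act x w ∈ W) → W = ⊥ ∨ W = ⊤

section BasicClassical

variable {g : Type*} [AddCommGroup g] [Module ℂ g] [LieSuperalgebra g]

/-- The even part is a Lie algebra. -/
instance : LieRing (part (V := g) 0) where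
  bracket x y := ⟨bracket x.1 y.1, by
    have h := LieSuperalgebra.bracket_mem x.2 y.2
    rwa [add_zero] at h⟩
  add_lie x y z := Subtype.ext (by
    change bracket (x.1 + y.1) z.1 = bracket x.1 z.1 + bracket y.1 z.1
    simp)
  lie_add x y z := Subtype.ext (by
    change bracket x.1 (y.1 + z.1) = bracket x.1 y.1 + bracket x.1 z.1
    simp)
  lie_self x := Subtype.ext (by
    change bracket x.1 x.1 = 0
    have h := LieSuperalgebra.bracket_skew x.2 x.2
    simp only [koszul, zero_ne_one, and_self, if_false, one_smul] at h
    have h2 : (2 : ℂ) • bracket x.1 x.1 = 0 := by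
      rw [two_smul]
      nth_rewrite 1 [h]
      exact neg_add_cancel _
    exact (smul_eq_zero.mp h2).resolve_left two_ne_zero)
  leibniz_lie x y z := Subtype.ext (by
    change bracket x.1 (bracket y.1 z.1) =
      bracket (bracket x.1 y.1) z.1 + bracket y.1 (bracket x.1 z.1)
    have h := LieSuperalgebra.bracket_jacobi x.2 y.2 z.1
    simpa [koszul] using h)

instance : LieAlgebra ℂ (part (V := g) 0) where
  lie_smul t x y := Subtype.ext (by
    change bracket x.1 (t • y.1) = t • bracket x.1 y.1
    simp)

variable (g) in
/-- A non-degenerate supersymmetric consistent invariant bilinear form (a "Killing form"). -/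
structure KillingForm where
  form : LinearMap.BilinForm ℂ g
  nondegenerate : ∀ x, (∀ y, form x y = 0) → x = 0
  consistent : ∀ x ∈ part (V := g) 0, ∀ y ∈ part (V := g) 1, form x y = 0
  supersymmetric : ∀ {i j : ZMod 2} {x y : g}, x ∈ part i → y ∈ part j →
    form x y = koszul i j * form y x
  invariant : ∀ x y z, form (bracket x y) z = form x (bracket y z)

variable (g) in
/-- Basic classical Lie superalgebras: simple Lie superalgebras for which the representation of
the even part on the odd part is completely reducible (classical) and which admit a non-degenerate
supersymmetric consistent invariant bilinear form (basic). -/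
structure IsBasicClassical : Prop where
  finiteDimensional : FiniteDimensional ℂ g
  nonabelian : ∃ x y : g, bracket x y ≠ 0
  simple : ∀ I : Submodule ℂ g, IsGraded I → (∀ (x : g), ∀ y ∈ I, bracket x y ∈ I) → I = ⊥ ∨ I = ⊤
  classical : ∀ W ≤ part (V := g) 1, (∀ x ∈ part (V := g) 0, ∀ w ∈ W, bracket x w ∈ W) →
    ∃ W' ≤ part (V := g) 1, (∀ x ∈ part (V := g) 0, ∀ w ∈ W', bracket x w ∈ W') ∧
      W ⊓ W' = ⊥ ∧ W ⊔ W' = part 1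
  basic : Nonempty (KillingForm g)

end BasicClassical

/-! ### The Lie superalgebra `gl(m|n)` -/

/-- The parity of an index of an `(m|n)`-matrix. -/
def idxParity {m n : ℕ} : Fin m ⊕ Fin n → ZMod 2 := Sum.elim (fun _ => 0) (fun _ => 1)

/-- The underlying space of `gl(m|n)`. -/
abbrev GLSpace (m n : ℕ) : Type := Matrix (Fin m ⊕ Fin n) (Fin m ⊕ Fin n) ℂ

/-- A matrix is homogeneous of parity `i` if its entry at `(r, c)` vanishes unless
`|r| + |c| = i`. -/
def glPart (m n : ℕ) (i : ZMod 2) : Submodule ℂ (GLSpace m n) where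
  carrier := {A | ∀ r c, idxParity r + idxParity c ≠ i → A r c = 0}
  zero_mem' := fun _ _ _ => rfl
  add_mem' := fun {A A'} hA hA' r c h => by
    rw [Matrix.add_apply, hA r c h, hA' r c h, add_zero]
  smul_mem' := fun t A hA r c h => by
    rw [Matrix.smul_apply, hA r c h, smul_zero]

/-- The supercommutator, `[A, A'] = A A' - (-1)^{|A||A'|} A' A` on homogeneous matrices. -/
def glBracketFun {m n : ℕ} (A A' : GLSpace m n) : GLSpace m n := Matrix.of fun r c =>
  ∑ k, (A r k * A' k c -
    koszul (idxParity k + idxParity c) (idxParity r + idxParity k) * (A' r k * A k c))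

/-- The supercommutator as a bilinear map. -/
def glBracket (m n : ℕ) : GLSpace m n →ₗ[ℂ] GLSpace m n →ₗ[ℂ] GLSpace m n :=
  LinearMap.mk₂ ℂ glBracketFun
    (fun A₁ A₂ A' => by
      ext r c
      simp only [glBracketFun, Matrix.of_apply, Matrix.add_apply]
      rw [← Finset.sum_add_distrib]
      exact Finset.sum_congr rfl fun k _ => by ring)
    (fun t A A' => by
      ext r c
      simp only [glBracketFun, Matrix.of_apply, Matrix.smul_apply, smul_eq_mul]
      rw [Finset.mul_sum]
      exact Finset.sum_congr rfl fun k _ => by ring)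
    (fun A A₁ A₂ => by
      ext r c
      simp only [glBracketFun, Matrix.of_apply, Matrix.add_apply]
      rw [← Finset.sum_add_distrib]
      exact Finset.sum_congr rfl fun k _ => by ring)
    (fun t A A' => by
      ext r c
      simp only [glBracketFun, Matrix.of_apply, Matrix.smul_apply, smul_eq_mul]
      rw [Finset.mul_sum]
      exact Finset.sum_congr rfl fun k _ => by ring)

theorem glBracket_eq {m n : ℕ} {i j : ZMod 2} {A A' : GLSpace m n} (hA : A ∈ glPart m n i)
    (hA' : A' ∈ glPart m n j) : glBracket m n A A' = A * A' - koszul i j • (A' * A) := by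
  ext r c
  have hb : glBracket m n A A' r c = ∑ k, (A r k * A' k c -
    koszul (idxParity k + idxParity c) (idxParity r + idxParity k) * (A' r k * A k c)) := rfl
  rw [hb, Matrix.sub_apply, Matrix.smul_apply, smul_eq_mul, Matrix.mul_apply, Matrix.mul_apply,
    Finset.mul_sum, ← Finset.sum_sub_distrib]
  refine Finset.sum_congr rfl fun k _ => ?_
  by_cases h1 : idxParity k + idxParity c = i
  · by_cases h2 : idxParity r + idxParity k = j
    · rw [h1, h2]
    · rw [hA' r k h2]; ring
  · rw [hA k c h1]; ring

theorem gl_mul_mem {m n : ℕ} {i j : ZMod 2} {A A' : GLSpace m n} (hA : A ∈ glPart m n i)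
    (hA' : A' ∈ glPart m n j) : A * A' ∈ glPart m n (i + j) := by
  intro r c h
  have hsum : (A * A') r c = ∑ k, A r k * A' k c := Matrix.mul_apply
  rw [hsum]
  refine Finset.sum_eq_zero fun k _ => ?_
  by_cases h1 : idxParity r + idxParity k = i
  · by_cases h2 : idxParity k + idxParity c = j
    · exfalso
      apply h
      rw [← h1, ← h2]
      have : idxParity k + idxParity k = 0 := CharTwo.add_self_eq_zero _
      linear_combination -this
    · rw [hA' k c h2, mul_zero]
  · rw [hA r k h1, zero_mul]

theorem koszul_comm (i j : ZMod 2) : koszul i j = koszul j i := by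
  simp only [koszul, and_comm]

theorem koszul_mul_self (i j : ZMod 2) : koszul i j * koszul i j = 1 := by
  unfold koszul; split_ifs <;> norm_num

theorem koszul_add_left (i j k : ZMod 2) : koszul (i + j) k = koszul i k * koszul j k := by
  have h : (1 + 1 : ZMod 2) = 0 := rfl
  have hcases : ∀ a : ZMod 2, a = 0 ∨ a = 1 := by decide
  rcases hcases i with rfl | rfl <;> rcases hcases j with rfl | rfl <;>
    rcases hcases k with rfl | rfl <;> simp [koszul, h]

theorem koszul_add_right (i j k : ZMod 2) : koszul i (j + k) = koszul i j * koszul i k := by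
  rw [koszul_comm, koszul_add_left, koszul_comm j, koszul_comm k]

theorem gl_isCompl (m n : ℕ) : IsCompl (glPart m n 0) (glPart m n 1) := by
  rw [isCompl_iff, Submodule.disjoint_def, codisjoint_iff, Submodule.eq_top_iff']
  constructor
  · intro A h0 h1
    ext r c
    by_cases h : idxParity r + idxParity c = 0
    · exact h1 r c (by rw [h]; exact zero_ne_one)
    · exact h0 r c h
  · intro A
    rw [Submodule.mem_sup]
    refine ⟨Matrix.of fun r c => if idxParity r + idxParity c = 0 then A r c else 0, ?_,
      Matrix.of fun r c => if idxParity r + idxParity c = 0 then 0 else A r c, ?_, ?_⟩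
    · intro r c h
      exact if_neg h
    · intro r c h
      refine if_pos ?_
      generalize idxParity r + idxParity c = a at h
      revert a; decide
    · ext r c
      simp only [Matrix.add_apply, Matrix.of_apply]
      split_ifs <;> simp

instance glLieSuperalgebra (m n : ℕ) : LieSuperalgebra (GLSpace m n) where
  part := glPart m n
  isCompl := gl_isCompl m n
  bracket := glBracket m n
  bracket_mem := fun {i j x y} hx hy => by
    rw [glBracket_eq hx hy]
    refine Submodule.sub_mem _ (gl_mul_mem hx hy) (Submodule.smul_mem _ _ ?_)
    rw [add_comm]
    exact gl_mul_mem hy hx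
  bracket_skew := fun {i j x y} hx hy => by
    rw [glBracket_eq hx hy, glBracket_eq hy hx, koszul_comm j i, smul_sub, smul_smul,
      koszul_mul_self, one_smul, neg_sub]
  bracket_jacobi := fun {i j x y} hx hy z => by
    have key : ∀ k : ZMod 2, ∀ z ∈ glPart m n k,
        glBracket m n x (glBracket m n y z) =
        glBracket m n (glBracket m n x y) z +
          koszul i j • glBracket m n y (glBracket m n x z) := by
      intro k z hz
      have hm : ∀ {i j : ZMod 2} {x y : GLSpace m n}, x ∈ glPart m n i → y ∈ glPart m n j →
          x * y - koszul i j • (y * x) ∈ glPart m n (i + j) := fun {i j x y} hx hy => by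
        refine Submodule.sub_mem _ (gl_mul_mem hx hy) (Submodule.smul_mem _ _ ?_)
        rw [add_comm]
        exact gl_mul_mem hy hx
      rw [glBracket_eq hy hz, glBracket_eq hx hy, glBracket_eq hx hz,
        glBracket_eq hx (hm hy hz), glBracket_eq (hm hx hy) hz, glBracket_eq hy (hm hx hz),
        koszul_add_left, koszul_add_right, koszul_add_right, koszul_comm j i]
      have h1 : koszul i j = 1 ∨ koszul i j = -1 := by
        unfold koszul; split_ifs <;> simp
      simp only [mul_sub, sub_mul, smul_sub, Matrix.mul_smul, Matrix.smul_mul, smul_smul,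
        Matrix.mul_assoc]
      rcases h1 with h1 | h1 <;> rw [h1] <;> module
    obtain ⟨z₀, h₀, z₁, h₁, rfl⟩ := Submodule.mem_sup.mp
      (show z ∈ glPart m n 0 ⊔ glPart m n 1 by
        rw [(gl_isCompl m n).sup_eq_top]; exact Submodule.mem_top)
    simp only [map_add, key 0 z₀ h₀, key 1 z₁ h₁, smul_add]
    abel

/-- `g` is isomorphic, as a Lie superalgebra, to some `gl(m|n)`. -/
def IsGeneralLinear (g : Type*) [AddCommGroup g] [Module ℂ g] [LieSuperalgebra g] : Prop :=
  ∃ (m n : ℕ) (e : g ≃ₗ[ℂ] GLSpace m n),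
    (∀ (i : ZMod 2) (x : g), x ∈ part i ↔ e x ∈ part (V := GLSpace m n) i) ∧
    ∀ x y : g, e (bracket x y) = bracket (e x) (e y)

/-! ### Borel and parabolic subalgebras -/

section Parabolic

variable {g : Type*} [AddCommGroup g] [Module ℂ g] [LieSuperalgebra g]

/-- The orthogonal complement of a subspace with respect to the form. -/
def perp (B : KillingForm g) (W : Submodule ℂ g) : Submodule ℂ g where
  carrier := {x | ∀ y ∈ W, B.form x y = 0}
  zero_mem' := fun y _ => by simp
  add_mem' := fun {a b} ha hb y hy => by simp [ha y hy, hb y hy]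
  smul_mem' := fun t a ha y hy => by simp [ha y hy]

/-- `b = 𝔥 + 𝔫⁺` and `b' = 𝔥 + 𝔫⁻` are opposite Borel subalgebras: there is a grading of the Lie
superalgebra by real numbers whose degree zero part is a Cartan subalgebra `𝔥` of the even part,
`𝔫⁺` and `𝔫⁻` being the parts of positive and of negative degree. (For a system of positive roots
cut out by a linear functional the degree is the value of this functional on the roots. Also for
`psl(n|n)`, where positive roots may add up to zero on the Cartan subalgebra, all systems of
positive roots arise from gradings.) -/
def IsOppositeBorelPair (b b' : Submodule ℂ g) : Prop :=
  ∃ (G : ℝ → Submodule ℂ g) (h : LieSubalgebra ℂ (part (V := g) 0)),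
    DirectSum.IsInternal G ∧ (∀ t, IsGraded (G t)) ∧
    (∀ s t : ℝ, ∀ x ∈ G s, ∀ y ∈ G t, bracket x y ∈ G (s + t)) ∧
    h.IsCartanSubalgebra ∧ G 0 = h.toSubmodule.map (part (V := g) 0).subtype ∧
    b = (⨆ (t : ℝ) (_ : 0 ≤ t), G t) ∧ b' = (⨆ (t : ℝ) (_ : t ≤ 0), G t)

/-- A graded subalgebra. -/
structure IsSubsuperalgebra (p : Submodule ℂ g) : Prop where
  graded : IsGraded p
  bracket_mem : ∀ x ∈ p, ∀ y ∈ p, bracket x y ∈ p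

/-- A parabolic subalgebra `p = 𝔩 + 𝔫`, that is, a subalgebra containing a Borel subalgebra,
together with the opposite parabolic subalgebra `p* = 𝔫⁻ + 𝔩`, which contains the opposite Borel
subalgebra. The nilradical `𝔫` of `p` is the orthogonal complement of `p`, the nilradical `𝔫⁻` of
`p*` is the orthogonal complement of `p*`, and the Levi subalgebra is `𝔩 = p ∩ p*`. -/
structure Parabolic (B : KillingForm g) where
  p : Submodule ℂ g
  pOpp : Submodule ℂ g
  p_sub : IsSubsuperalgebra p
  pOpp_sub : IsSubsuperalgebra pOpp
  borel : ∃ b b' : Submodule ℂ g, IsOppositeBorelPair b b' ∧ b ≤ p ∧ b' ≤ pOpp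
  isCompl_n : IsCompl (perp B p) pOpp
  isCompl_nOpp : IsCompl (perp B pOpp) p

namespace Parabolic

variable {B : KillingForm g}

/-- The opposite parabolic subalgebra, with the roles of `𝔫` and `𝔫⁻` exchanged. -/
def opp (P : Parabolic B) : Parabolic B where
  p := P.pOpp
  pOpp := P.p
  p_sub := P.pOpp_sub
  pOpp_sub := P.p_sub
  borel := by
    obtain ⟨b, b', ⟨G, h, h1, h2, h3, h4, h5, rfl, rfl⟩, hp, hp'⟩ := P.borel
    have hneg : Function.Bijective (fun t : ℝ => -t) := (Equiv.neg ℝ).bijective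
    refine ⟨_, _, ⟨fun t => G (-t), h, ?_, fun t => h2 _, ?_, h4, by simpa using h5, rfl, rfl⟩,
      ?_, ?_⟩
    · rw [DirectSum.isInternal_submodule_iff_iSupIndep_and_iSup_eq_top] at h1 ⊢
      refine ⟨h1.1.comp hneg.1, ?_⟩
      rw [← h1.2]
      exact hneg.2.iSup_comp G
    · intro s t x hx y hy
      have h6 := h3 _ _ x hx y hy
      rwa [← neg_add] at h6
    · refine le_trans (iSup₂_le fun t ht => ?_) hp'
      exact le_iSup₂_of_le (-t) (by simpa using ht) le_rfl
    · refine le_trans (iSup₂_le fun t ht => ?_) hp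
      exact le_iSup₂_of_le (-t) (by simpa using ht) le_rfl
  isCompl_n := P.isCompl_nOpp
  isCompl_nOpp := P.isCompl_n

/-- The nilradical `𝔫`. -/
def n (P : Parabolic B) : Submodule ℂ g := perp B P.p

/-- The opposite nilradical `𝔫⁻` (written `n` with a bar). -/
def nbar (P : Parabolic B) : Submodule ℂ g := perp B P.pOpp

/-- The Levi subalgebra `𝔩`. -/
def levi (P : Parabolic B) : Submodule ℂ g := P.p ⊓ P.pOpp

/-- The homogeneous parts of `𝔫`. -/
def nPart (P : Parabolic B) (i : ZMod 2) : Submodule ℂ P.n := (part i).comap P.n.subtype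

/-- The projection `x ↦ x_𝔫` of `g = 𝔫 ⊕ p*` onto `𝔫`. -/
def projN (P : Parabolic B) : g →ₗ[ℂ] P.n := P.n.projectionOnto P.pOpp P.isCompl_n

end Parabolic

/-- A homogeneous basis `ξ a` of `𝔫` with its dual basis `ξd a` of `𝔫⁻`, `(ξd a, ξ b) = δ_{ab}`. -/
structure DualBases {B : KillingForm g} (P : Parabolic B) (r : ℕ) where
  ξ : Module.Basis (Fin r) ℂ P.n
  ξd : Module.Basis (Fin r) ℂ P.nbar
  deg : Fin r → ZMod 2
  ξ_mem : ∀ a, (ξ a : g) ∈ part (deg a)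
  ξd_mem : ∀ a, (ξd a : g) ∈ part (deg a)
  dual : ∀ a b, B.form (ξd a) (ξ b) = if a = b then 1 else 0

end Parabolic

/-! ### The exterior algebra of a super vector space -/

section Exterior

variable {N : Type*} [AddCommGroup N] [Module ℂ N]

/-- The relations `x ∧ y = -(-1)^{|x||y|} y ∧ x` for homogeneous vectors. -/
inductive ExteriorRel (D : ZMod 2 → Submodule ℂ N) :
    TensorAlgebra ℂ N → TensorAlgebra ℂ N → Prop
  | skew {i j : ZMod 2} {x y : N} (hx : x ∈ D i) (hy : y ∈ D j) : ExteriorRel D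
      (TensorAlgebra.ι ℂ x * TensorAlgebra.ι ℂ y +
        koszul i j • (TensorAlgebra.ι ℂ y * TensorAlgebra.ι ℂ x)) 0

/-- The exterior algebra `Λ N` of the super vector space `N` with homogeneous parts `D i`. -/
def SuperExterior (D : ZMod 2 → Submodule ℂ N) : Type _ := RingQuot (ExteriorRel D)

instance (D : ZMod 2 → Submodule ℂ N) : Ring (SuperExterior D) :=
  inferInstanceAs (Ring (RingQuot (ExteriorRel D)))

instance (D : ZMod 2 → Submodule ℂ N) : Algebra ℂ (SuperExterior D) :=
  inferInstanceAs (Algebra ℂ (RingQuot (ExteriorRel D)))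

/-- The quotient map from the tensor algebra to the exterior algebra. -/
def extMk (D : ZMod 2 → Submodule ℂ N) : TensorAlgebra ℂ N →ₐ[ℂ] SuperExterior D :=
  RingQuot.mkAlgHom ℂ (ExteriorRel D)

/-- The inclusion of `N` into `Λ N`. -/
def extι (D : ZMod 2 → Submodule ℂ N) : N →ₗ[ℂ] SuperExterior D :=
  (extMk D).toLinearMap ∘ₗ TensorAlgebra.ι ℂ

/-- The space `Λ N ⊗ V`. -/
def Chains (D : ZMod 2 → Submodule ℂ N) (V : Type*) [AddCommGroup V] [Module ℂ V] : Type _ :=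
  SuperExterior D ⊗[ℂ] V

instance (D : ZMod 2 → Submodule ℂ N) (V : Type*) [AddCommGroup V] [Module ℂ V] :
    AddCommGroup (Chains D V) := inferInstanceAs (AddCommGroup (SuperExterior D ⊗[ℂ] V))

instance (D : ZMod 2 → Submodule ℂ N) (V : Type*) [AddCommGroup V] [Module ℂ V] :
    Module ℂ (Chains D V) := inferInstanceAs (Module ℂ (SuperExterior D ⊗[ℂ] V))

/-- The element `a ⊗ v` of `Λ N ⊗ V`. -/
def tens (D : ZMod 2 → Submodule ℂ N) (V : Type*) [AddCommGroup V] [Module ℂ V] :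
    SuperExterior D →ₗ[ℂ] V →ₗ[ℂ] Chains D V :=
  TensorProduct.mk ℂ (SuperExterior D) V

variable {D : ZMod 2 → Submodule ℂ N} {V : Type*} [AddCommGroup V] [Module ℂ V]

theorem extι_skew {i j : ZMod 2} {x y : N} (hx : x ∈ D i) (hy : y ∈ D j) :
    extι D x * extι D y + koszul i j • (extι D y * extι D x) = 0 := by
  have h : extMk D _ = extMk D _ := RingQuot.mkAlgHom_rel ℂ (ExteriorRel.skew hx hy)
  rwa [map_add, map_smul, map_mul, map_mul, map_zero] at h

/-- Left multiplication by elements of `Λ N` on `Λ N ⊗ V`. -/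
def leftMul (D : ZMod 2 → Submodule ℂ N) (V : Type*) [AddCommGroup V] [Module ℂ V] :
    SuperExterior D →ₐ[ℂ] Module.End ℂ (Chains D V) :=
  Algebra.lsmul ℂ ℂ (SuperExterior D ⊗[ℂ] V)

theorem leftMul_tmul (a b : SuperExterior D) (v : V) :
    leftMul D V a (tens D V b v) = tens D V (a * b) v := rfl

theorem chains_induction {motive : Chains D V → Prop}
    (tmul : ∀ a v, motive (tens D V a v))
    (add : ∀ f f', motive f → motive f' → motive (f + f')) (f : Chains D V) : motive f :=
  TensorProduct.induction_on (motive := motive) f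
    (by
      have h := tmul 0 0
      rwa [map_zero] at h) tmul add

/-- The operator `f ↦ X ∧ f` on `Λ N ⊗ V`. -/
def wedge (D : ZMod 2 → Submodule ℂ N) (V : Type*) [AddCommGroup V] [Module ℂ V] :
    N →ₗ[ℂ] Chains D V →ₗ[ℂ] Chains D V :=
  (leftMul D V).toLinearMap ∘ₗ extι D

theorem wedge_skew {i j : ZMod 2} {x y : N} (hx : x ∈ D i) (hy : y ∈ D j) (f : Chains D V) :
    wedge D V x (wedge D V y f) + koszul i j • wedge D V y (wedge D V x f) = 0 := by
  have h := congrArg (fun a => leftMul D V a f) (extι_skew hx hy)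
  simp only [map_add, map_mul, map_smul, map_zero] at h
  exact h

/-- The part `Λ^k N ⊗ V` of `Λ N ⊗ V`. -/
def chainDeg (D : ZMod 2 → Submodule ℂ N) (V : Type*) [AddCommGroup V] [Module ℂ V] :
    ℕ → Submodule ℂ (Chains D V)
  | 0 => Submodule.span ℂ {f | ∃ v : V, f = tens D V 1 v}
  | k + 1 => Submodule.span ℂ {f | ∃ x : N, ∃ f' ∈ chainDeg D V k, f = wedge D V x f'}

/-- The part of `Λ^k N ⊗ V` of parity `i`, where
`|x₁ ∧ ⋯ ∧ x_k ⊗ v| = |x₁| + ⋯ + |x_k| + |v|`. -/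
def chainPart (D : ZMod 2 → Submodule ℂ N) (V : Type*) [AddCommGroup V] [Module ℂ V]
    [SuperSpace V] : ℕ → ZMod 2 → Submodule ℂ (Chains D V)
  | 0, i => Submodule.span ℂ {f | ∃ v ∈ part (V := V) i, f = tens D V 1 v}
  | k + 1, i => Submodule.span ℂ
      {f | ∃ j : ZMod 2, ∃ x ∈ D j, ∃ f' ∈ chainPart D V k (i + j), f = wedge D V x f'}

section Recursion

variable {E : Type*} [AddCommMonoid E] [Module ℂ E]

/-- Compatibility of the recursion `F (X ∧ f) = Φ X f + S X (F f)` with the relations of the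
exterior algebra. -/
structure RecCompatible (Φ : N →ₗ[ℂ] Chains D V →ₗ[ℂ] E) (S : N →ₗ[ℂ] E →ₗ[ℂ] E) : Prop where
  fst : ∀ {i j : ZMod 2} {x y : N}, x ∈ D i → y ∈ D j → ∀ f : Chains D V,
    Φ x (wedge D V y f) + S x (Φ y f) +
      koszul i j • (Φ y (wedge D V x f) + S y (Φ x f)) = 0
  snd : ∀ {i j : ZMod 2} {x y : N}, x ∈ D i → y ∈ D j → ∀ e : E,
    S x (S y e) + koszul i j • S y (S x e) = 0

/-- One step of the recursion, as an operator on `(Λ N ⊗ V) × E`. -/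
def recStep (Φ : N →ₗ[ℂ] Chains D V →ₗ[ℂ] E) (S : N →ₗ[ℂ] E →ₗ[ℂ] E) :
    N →ₗ[ℂ] Module.End ℂ (Chains D V × E) where
  toFun x := LinearMap.prod (wedge D V x ∘ₗ LinearMap.fst ℂ _ _)
    (Φ x ∘ₗ LinearMap.fst ℂ _ _ + S x ∘ₗ LinearMap.snd ℂ _ _)
  map_add' x y := by
    refine LinearMap.ext fun z => Prod.ext ?_ ?_
    · simp
    · simp only [LinearMap.prod_apply, Function.prod_apply, LinearMap.add_apply,
        LinearMap.comp_apply, map_add, Prod.snd_add]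
      abel
  map_smul' t x := by
    refine LinearMap.ext fun z => Prod.ext ?_ ?_ <;> simp

theorem recStep_apply (Φ : N →ₗ[ℂ] Chains D V →ₗ[ℂ] E) (S : N →ₗ[ℂ] E →ₗ[ℂ] E) (x : N)
    (z : Chains D V × E) : recStep Φ S x z = (wedge D V x z.1, Φ x z.1 + S x z.2) := rfl

/-- The iterated recursion step. -/
def recHom (Φ : N →ₗ[ℂ] Chains D V →ₗ[ℂ] E) (S : N →ₗ[ℂ] E →ₗ[ℂ] E)
    (h : RecCompatible Φ S) : SuperExterior D →ₐ[ℂ] Module.End ℂ (Chains D V × E) :=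
  RingQuot.liftAlgHom ℂ ⟨TensorAlgebra.lift ℂ (recStep Φ S), by
    rintro _ _ ⟨hx, hy⟩
    rw [map_add, map_smul, map_mul, map_mul, map_zero, TensorAlgebra.lift_ι_apply,
      TensorAlgebra.lift_ι_apply]
    refine LinearMap.ext fun z => Prod.ext ?_ ?_
    · simp only [LinearMap.add_apply, LinearMap.smul_apply, Module.End.mul_apply, recStep_apply,
        Prod.fst_add, Prod.smul_fst, LinearMap.zero_apply, Prod.fst_zero]
      exact wedge_skew hx hy z.1
    · have h1 := h.fst hx hy z.1
      have h2 := h.snd hx hy z.2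
      simp only [LinearMap.add_apply, LinearMap.smul_apply, Module.End.mul_apply, recStep_apply,
        Prod.snd_add, Prod.smul_snd, LinearMap.zero_apply, Prod.snd_zero, map_add]
      rw [← add_zero (0 : E)]
      nth_rewrite 1 [← h1]
      rw [← h2]
      simp only [smul_add]
      abel⟩

theorem recHom_ι (Φ : N →ₗ[ℂ] Chains D V →ₗ[ℂ] E) (S : N →ₗ[ℂ] E →ₗ[ℂ] E)
    (h : RecCompatible Φ S) (x : N) : recHom Φ S h (extι D x) = recStep Φ S x := by
  refine (RingQuot.liftAlgHom_mkAlgHom_apply ℂ _ _ _).trans ?_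
  rw [TensorAlgebra.lift_ι_apply]

/-- The linear map `F` on `Λ N ⊗ V` with `F (1 ⊗ v) = F₀ v` and
`F (X ∧ f) = Φ X f + S X (F f)`. -/
def recMap (Φ : N →ₗ[ℂ] Chains D V →ₗ[ℂ] E) (S : N →ₗ[ℂ] E →ₗ[ℂ] E)
    (h : RecCompatible Φ S) (F₀ : V →ₗ[ℂ] E) : Chains D V →ₗ[ℂ] E :=
  TensorProduct.lift (LinearMap.mk₂ ℂ
    (fun a v => (recHom Φ S h a (tens D V 1 v, F₀ v)).2)
    (fun a b v => by simp)
    (fun t a v => by simp)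
    (fun a v w => by
      rw [← Prod.snd_add, ← map_add, Prod.mk_add_mk, ← map_add, ← map_add])
    (fun t a v => by
      rw [← Prod.smul_snd, ← map_smul, Prod.smul_mk, ← map_smul, ← map_smul]))

theorem recMap_tmul (Φ : N →ₗ[ℂ] Chains D V →ₗ[ℂ] E) (S : N →ₗ[ℂ] E →ₗ[ℂ] E)
    (h : RecCompatible Φ S) (F₀ : V →ₗ[ℂ] E) (a : SuperExterior D) (v : V) :
    recMap Φ S h F₀ (tens D V a v) = (recHom Φ S h a (tens D V 1 v, F₀ v)).2 := rfl

theorem recMap_one (Φ : N →ₗ[ℂ] Chains D V →ₗ[ℂ] E) (S : N →ₗ[ℂ] E →ₗ[ℂ] E)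
    (h : RecCompatible Φ S) (F₀ : V →ₗ[ℂ] E) (v : V) :
    recMap Φ S h F₀ (tens D V 1 v) = F₀ v := by
  rw [recMap_tmul, map_one]; rfl

theorem recHom_fst (Φ : N →ₗ[ℂ] Chains D V →ₗ[ℂ] E) (S : N →ₗ[ℂ] E →ₗ[ℂ] E)
    (h : RecCompatible Φ S) (a : SuperExterior D) (z : Chains D V × E) :
    (recHom Φ S h a z).1 = leftMul D V a z.1 := by
  have key : ∀ t : TensorAlgebra ℂ N, ∀ z : Chains D V × E,
      (recHom Φ S h (extMk D t) z).1 = leftMul D V (extMk D t) z.1 := by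
    intro t
    induction t using TensorAlgebra.induction with
    | algebraMap c => intro z; simp [Algebra.algebraMap_eq_smul_one]
    | ι x =>
      intro z
      have h1 : recHom Φ S h (extMk D (TensorAlgebra.ι ℂ x)) = _ := recHom_ι Φ S h x
      rw [h1]
      rfl
    | mul a b ha hb =>
      intro z
      rw [map_mul, map_mul, map_mul, Module.End.mul_apply, Module.End.mul_apply, ha, hb]
    | add a b ha hb =>
      intro z
      rw [map_add, map_add, map_add, LinearMap.add_apply, LinearMap.add_apply, Prod.fst_add,
        ha, hb]
  obtain ⟨t, rfl⟩ := RingQuot.mkAlgHom_surjective ℂ (ExteriorRel D) a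
  exact key t z

theorem recMap_wedge (Φ : N →ₗ[ℂ] Chains D V →ₗ[ℂ] E) (S : N →ₗ[ℂ] E →ₗ[ℂ] E)
    (h : RecCompatible Φ S) (F₀ : V →ₗ[ℂ] E) (x : N) (f : Chains D V) :
    recMap Φ S h F₀ (wedge D V x f) = Φ x f + S x (recMap Φ S h F₀ f) := by
  refine chains_induction
    (motive := fun f => recMap Φ S h F₀ (wedge D V x f) = Φ x f + S x (recMap Φ S h F₀ f))
    (fun a v => ?_) (fun f f' hf hf' => ?_) f
  · have h1 : wedge D V x (tens D V a v) = tens D V (extι D x * a) v := rfl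
    rw [h1, recMap_tmul, map_mul, Module.End.mul_apply, recHom_ι, recStep_apply, recHom_fst,
      recMap_tmul, leftMul_tmul, mul_one]
  · rw [map_add, map_add, hf, hf', map_add, map_add, map_add]
    abel

end Recursion

end Exterior

/-! ### The boundary and the coboundary operator -/

section Graded

variable {W : Type*} [AddCommGroup W] [Module ℂ W] [SuperSpace W]

/-- The projection along a decomposition into graded subspaces is even. -/
theorem projectionOnto_mem_part {p q : Submodule ℂ W} (hp : IsGraded p) (hq : IsGraded q)
    (h : IsCompl p q) {i : ZMod 2} {x : W} (hx : x ∈ part i) :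
    (p.projectionOnto q h x : W) ∈ part (V := W) i := by
  have hx' : x ∈ p ⊔ q := by rw [h.sup_eq_top]; exact Submodule.mem_top
  obtain ⟨a, ha, b, hb, rfl⟩ := Submodule.mem_sup.mp hx'
  obtain ⟨a₀, ⟨ha₀, ha₀'⟩, a₁, ⟨ha₁, ha₁'⟩, rfl⟩ := Submodule.mem_sup.mp (hp ha)
  obtain ⟨b₀, ⟨hb₀, hb₀'⟩, b₁, ⟨hb₁, hb₁'⟩, rfl⟩ := Submodule.mem_sup.mp (hq hb)
  have hproj : (p.projectionOnto q h (a₀ + a₁ + (b₀ + b₁)) : W) = a₀ + a₁ := by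
    rw [map_add, Submodule.projectionOnto_apply_of_mem_left h ha,
      Submodule.projectionOnto_apply_of_mem_right h hb, add_zero]
  rw [hproj]
  have hpq := Submodule.disjoint_def.mp h.disjoint
  have h01 := Submodule.disjoint_def.mp (SuperSpace.isCompl (V := W)).disjoint
  have hcases : ∀ a : ZMod 2, a = 0 ∨ a = 1 := by decide
  rcases hcases i with rfl | rfl
  · have h1 : a₁ + b₁ = 0 := by
      refine h01 _ ?_ (Submodule.add_mem _ ha₁' hb₁')
      have h2 := Submodule.sub_mem _ hx (Submodule.add_mem _ ha₀' hb₀')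
      have h3 : a₀ + a₁ + (b₀ + b₁) - (a₀ + b₀) = a₁ + b₁ := by abel
      rwa [h3] at h2
    have h4 : a₁ = 0 := hpq _ ha₁ (by
      rw [eq_neg_of_add_eq_zero_left h1]; exact Submodule.neg_mem _ hb₁)
    rw [h4, add_zero]; exact ha₀'
  · have h1 : a₀ + b₀ = 0 := by
      refine h01 _ (Submodule.add_mem _ ha₀' hb₀') ?_
      have h2 := Submodule.sub_mem _ hx (Submodule.add_mem _ ha₁' hb₁')
      have h3 : a₀ + a₁ + (b₀ + b₁) - (a₁ + b₁) = a₀ + b₀ := by abel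
      rwa [h3] at h2
    have h4 : a₀ = 0 := hpq _ ha₀ (by
      rw [eq_neg_of_add_eq_zero_left h1]; exact Submodule.neg_mem _ hb₀)
    rw [h4, zero_add]; exact ha₁'

theorem evenProj_add_oddProj (x : W) : evenProj W x + oddProj W x = x := by
  have hx : x ∈ part (V := W) 0 ⊔ part 1 := by
    rw [(SuperSpace.isCompl (V := W)).sup_eq_top]; exact Submodule.mem_top
  obtain ⟨a, ha, b, hb, rfl⟩ := Submodule.mem_sup.mp hx
  unfold evenProj oddProj
  rw [map_add, map_add, Submodule.projection_apply_of_mem_left _ ha,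
    Submodule.projection_apply_of_mem_right _ hb, Submodule.projection_apply_of_mem_left _ hb,
    Submodule.projection_apply_of_mem_right _ ha, add_zero, zero_add]

theorem evenProj_mem (x : W) : evenProj W x ∈ part (V := W) 0 :=
  Submodule.projection_apply_mem _ x

theorem oddProj_mem (x : W) : oddProj W x ∈ part (V := W) 1 :=
  Submodule.projection_apply_mem _ x

theorem evenProj_of_even {x : W} (hx : x ∈ part (V := W) 0) : evenProj W x = x :=
  Submodule.projection_apply_of_mem_left _ hx

theorem evenProj_of_odd {x : W} (hx : x ∈ part (V := W) 1) : evenProj W x = 0 :=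
  Submodule.projection_apply_of_mem_right _ hx

theorem oddProj_of_odd {x : W} (hx : x ∈ part (V := W) 1) : oddProj W x = x :=
  Submodule.projection_apply_of_mem_left _ hx

theorem oddProj_of_even {x : W} (hx : x ∈ part (V := W) 0) : oddProj W x = 0 :=
  Submodule.projection_apply_of_mem_right _ hx

theorem parityInv_of_mem {i : ZMod 2} {x : W} (hx : x ∈ part (V := W) i) :
    parityInv W x = koszul 1 i • x := by
  have hcases : ∀ a : ZMod 2, a = 0 ∨ a = 1 := by decide
  rcases hcases i with rfl | rfl
  · simp [parityInv, evenProj_of_even hx, oddProj_of_even hx, koszul]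
  · simp [parityInv, evenProj_of_odd hx, oddProj_of_odd hx, koszul]

end Graded

namespace Parabolic

variable {g : Type*} [AddCommGroup g] [Module ℂ g] [LieSuperalgebra g] {B : KillingForm g}
  (P : Parabolic B)

theorem perp_isGraded {p : Submodule ℂ g} (hp : IsGraded p) : IsGraded (perp B p) := by
  intro x hx
  have hx' : x ∈ part (V := g) 0 ⊔ part 1 := by
    rw [(SuperSpace.isCompl (V := g)).sup_eq_top]; exact Submodule.mem_top
  obtain ⟨a, ha, b, hb, rfl⟩ := Submodule.mem_sup.mp hx'
  have h10 : ∀ u ∈ part (V := g) 1, ∀ v ∈ part (V := g) 0, B.form u v = 0 := fun u hu v hv => by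
    rw [B.supersymmetric hu hv, B.consistent v hv u hu, mul_zero]
  refine Submodule.add_mem_sup ⟨?_, ha⟩ ⟨?_, hb⟩
  · intro y hy
    obtain ⟨c, ⟨hc, hc'⟩, d, ⟨hd, hd'⟩, rfl⟩ := Submodule.mem_sup.mp (hp hy)
    have h := hx c hc
    rw [map_add, LinearMap.add_apply, h10 b hb c hc', add_zero] at h
    rw [map_add, h, B.consistent a ha d hd', add_zero]
  · intro y hy
    obtain ⟨c, ⟨hc, hc'⟩, d, ⟨hd, hd'⟩, rfl⟩ := Submodule.mem_sup.mp (hp hy)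
    have h := hx d hd
    rw [map_add, LinearMap.add_apply, B.consistent a ha d hd', zero_add] at h
    rw [map_add, h, h10 b hb c hc', add_zero]

theorem projN_mem {i : ZMod 2} {x : g} (hx : x ∈ part i) : P.projN x ∈ P.nPart i :=
  projectionOnto_mem_part (perp_isGraded P.p_sub.graded) P.pOpp_sub.graded P.isCompl_n hx

theorem projN_coe (x : P.n) : P.projN (x : g) = x :=
  Submodule.projectionOnto_apply_left P.isCompl_n x

variable (V : Type*) [AddCommGroup V] [Module ℂ V]

/-- The space `C_•(𝔫, V) = Λ 𝔫 ⊗ V`, identified by means of the form with the space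
`C^•(𝔫⁻, V) = Hom(Λ 𝔫⁻, V)`. -/
abbrev C : Type _ := Chains P.nPart V

/-- The operator `f ↦ X ∧ f`, for `X ∈ 𝔫`. -/
abbrev w : P.n →ₗ[ℂ] P.C V →ₗ[ℂ] P.C V := wedge P.nPart V

/-- The inhomogeneous term `[A, X]_𝔫 ∧ f` of `A[X ∧ f]`, as a function of `A`. -/
def actionΦ : P.n →ₗ[ℂ] P.C V →ₗ[ℂ] g →ₗ[ℂ] P.C V :=
  LinearMap.mk₂ ℂ (fun X f => (P.w V).flip f ∘ₗ P.projN ∘ₗ bracket.flip (X : g))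
    (fun X Y f => by ext A; simp)
    (fun t X f => by ext A; simp)
    (fun X f f' => by ext A; simp)
    (fun t X f => by ext A; simp)

/-- The operator taking `A ↦ φ A` to `A ↦ (-1)^{|A||X|} X ∧ φ A`. -/
def actionS : P.n →ₗ[ℂ] (g →ₗ[ℂ] P.C V) →ₗ[ℂ] g →ₗ[ℂ] P.C V :=
  LinearMap.mk₂ ℂ (fun X φ => P.w V X ∘ₗ φ ∘ₗ evenProj g +
      P.w V (P.projN (parityInv g X)) ∘ₗ φ ∘ₗ oddProj g)
    (fun X Y φ => by ext A; simp; abel)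
    (fun t X φ => by ext A; simp)
    (fun X φ φ' => by ext A; simp; abel)
    (fun t X φ => by ext A; simp)

variable {V}

theorem actionΦ_apply (X : P.n) (f : P.C V) (A : g) :
    P.actionΦ V X f A = P.w V (P.projN (bracket A (X : g))) f := rfl

theorem actionS_apply {i j : ZMod 2} {X : P.n} (hX : X ∈ P.nPart j) (φ : g →ₗ[ℂ] P.C V) {A : g}
    (hA : A ∈ part i) : P.actionS V X φ A = koszul i j • P.w V X (φ A) := by
  have h : P.actionS V X φ A = P.w V X (φ (evenProj g A)) +
    P.w V (P.projN (parityInv g X)) (φ (oddProj g A)) := rfl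
  have hcases : ∀ a : ZMod 2, a = 0 ∨ a = 1 := by decide
  rw [h]
  rcases hcases i with rfl | rfl
  · simp [evenProj_of_even hA, oddProj_of_even hA, koszul]
  · rw [evenProj_of_odd hA, oddProj_of_odd hA, parityInv_of_mem (W := g) (x := (X : g)) hX, map_smul, projN_coe]
    simp

theorem ext_homogeneous {E : Type*} [AddCommMonoid E] [Module ℂ E] {φ ψ : g →ₗ[ℂ] E}
    (h : ∀ (i : ZMod 2), ∀ A ∈ part (V := g) i, φ A = ψ A) : φ = ψ := by
  ext A
  rw [← evenProj_add_oddProj A, map_add, map_add, h 0 _ (evenProj_mem A), h 1 _ (oddProj_mem A)]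

theorem action_compatible : RecCompatible (P.actionΦ V) (P.actionS V) where
  fst {i j x y} hx hy f := by
    refine ext_homogeneous fun a A hA => ?_
    simp only [LinearMap.add_apply, LinearMap.smul_apply, actionΦ_apply,
      P.actionS_apply hx _ hA, P.actionS_apply hy _ hA, LinearMap.zero_apply]
    have hx' : P.projN (bracket A (x : g)) ∈ P.nPart (a + i) :=
      P.projN_mem (LieSuperalgebra.bracket_mem hA hx)
    have hy' : P.projN (bracket A (y : g)) ∈ P.nPart (a + j) :=
      P.projN_mem (LieSuperalgebra.bracket_mem hA hy)
    have h1 := wedge_skew (V := V) hx' hy f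
    have h2 := wedge_skew (V := V) hx hy' f
    have h3 : koszul i j = 1 ∨ koszul i j = -1 := by
      unfold koszul; split_ifs <;> simp
    have h4 : koszul a i = 1 ∨ koszul a i = -1 := by
      unfold koszul; split_ifs <;> simp
    have h5 : koszul a j = 1 ∨ koszul a j = -1 := by
      unfold koszul; split_ifs <;> simp
    rw [koszul_add_left] at h1
    rw [koszul_add_right, koszul_comm i a] at h2
    rcases h3 with h3 | h3 <;> rcases h4 with h4 | h4 <;> rcases h5 with h5 | h5 <;>
      simp only [h3, h4, h5] at h1 h2 ⊢ <;>
      first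
      | linear_combination (norm := module) (1 : ℂ) • h1 + (1 : ℂ) • h2
      | linear_combination (norm := module) (1 : ℂ) • h1 - (1 : ℂ) • h2
  snd {i j x y} hx hy φ := by
    refine ext_homogeneous fun a A hA => ?_
    simp only [LinearMap.add_apply, LinearMap.smul_apply, P.actionS_apply hx _ hA,
      P.actionS_apply hy _ hA, LinearMap.zero_apply, map_smul]
    have h1 := wedge_skew (V := V) hx hy (φ A)
    linear_combination (norm := module) (koszul a i * koszul a j) • h1

section Operators

variable (V)

variable {P}
variable {r : ℕ} (ξ : DualBases P r)

/-- The element `½ ∑ₐ ξₐ ∧ [ξₐ‡, X]_𝔫` of `Λ² 𝔫`. -/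
def coboundaryTerm : P.n →ₗ[ℂ] SuperExterior P.nPart :=
  (1 / 2 : ℂ) • ∑ a, LinearMap.mulLeft ℂ (extι P.nPart (ξ.ξ a)) ∘ₗ extι P.nPart ∘ₗ P.projN ∘ₗ
    bracket (ξ.ξd a : g) ∘ₗ P.n.subtype

theorem coboundaryTerm_apply (X : P.n) : coboundaryTerm ξ X = (1 / 2 : ℂ) • ∑ a,
    extι P.nPart (ξ.ξ a) * extι P.nPart (P.projN (bracket (ξ.ξd a : g) (X : g))) := by
  simp [coboundaryTerm]

theorem coboundaryTerm_comm {i j : ZMod 2} {x y : P.n} (hx : x ∈ P.nPart i) (hy : y ∈ P.nPart j) :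
    coboundaryTerm ξ x * extι P.nPart y =
      koszul i j • (extι P.nPart y * coboundaryTerm ξ x) := by
  rw [coboundaryTerm_apply, smul_mul_assoc, mul_smul_comm, smul_comm (koszul i j),
    Finset.sum_mul, Finset.mul_sum]
  congr 1
  rw [Finset.smul_sum]
  refine Finset.sum_congr rfl fun a _ => ?_
  have hz : P.projN (bracket (ξ.ξd a : g) (x : g)) ∈ P.nPart (ξ.deg a + i) :=
    P.projN_mem (LieSuperalgebra.bracket_mem (ξ.ξd_mem a) hx)
  have h1 := extι_skew (D := P.nPart) hz hy
  have h2 := extι_skew (D := P.nPart) (x := ξ.ξ a) (ξ.ξ_mem a) hy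
  rw [koszul_add_left] at h1
  have h3 := congrArg (fun t => extι P.nPart (ξ.ξ a) * t) h1
  have h4 := congrArg
    (fun t => t * extι P.nPart (P.projN (bracket (ξ.ξd a : g) (x : g)))) h2
  simp only [mul_add, add_mul, mul_smul_comm, smul_mul_assoc, mul_zero, zero_mul, mul_assoc]
    at h3 h4 ⊢
  have h5 : koszul (ξ.deg a) j = 1 ∨ koszul (ξ.deg a) j = -1 := by
    unfold koszul; split_ifs <;> simp
  rcases h5 with h5 | h5 <;> simp only [h5, one_mul, neg_mul] at h3 h4 <;>
  first
  | linear_combination (norm := module) (1 : ℂ) • h3 - koszul i j • h4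
  | linear_combination (norm := module) (1 : ℂ) • h3 + koszul i j • h4

theorem coboundary_compatible :
    RecCompatible ((leftMul P.nPart V).toLinearMap ∘ₗ coboundaryTerm ξ) (-(P.w V)) where
  fst {i j x y} hx hy f := by
    have h1 := congrArg (fun t => leftMul P.nPart V t f) (coboundaryTerm_comm ξ hx hy)
    have h2 := congrArg (fun t => leftMul P.nPart V t f) (coboundaryTerm_comm ξ hy hx)
    simp only [map_mul, map_smul] at h1 h2
    rw [koszul_comm j i] at h2
    have h3 : koszul i j = 1 ∨ koszul i j = -1 := by
      unfold koszul; split_ifs <;> simp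
    change leftMul P.nPart V (coboundaryTerm ξ x) (leftMul P.nPart V (extι P.nPart y) f) +
      -(leftMul P.nPart V (extι P.nPart x)) (leftMul P.nPart V (coboundaryTerm ξ y) f) +
      koszul i j • (leftMul P.nPart V (coboundaryTerm ξ y)
        (leftMul P.nPart V (extι P.nPart x) f) +
      -(leftMul P.nPart V (extι P.nPart y)) (leftMul P.nPart V (coboundaryTerm ξ x) f)) = 0
    have h1' : leftMul P.nPart V (coboundaryTerm ξ x) (leftMul P.nPart V (extι P.nPart y) f) =
      koszul i j • leftMul P.nPart V (extι P.nPart y)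
        (leftMul P.nPart V (coboundaryTerm ξ x) f) := h1
    have h2' : leftMul P.nPart V (coboundaryTerm ξ y) (leftMul P.nPart V (extι P.nPart x) f) =
      koszul i j • leftMul P.nPart V (extι P.nPart x)
        (leftMul P.nPart V (coboundaryTerm ξ y) f) := h2
    rw [h1', h2']
    rcases h3 with h3 | h3 <;> rw [h3] <;> module
  snd {i j x y} hx hy f := by
    simp only [LinearMap.neg_apply, map_neg, neg_neg]
    exact wedge_skew hx hy f

variable [SuperSpace V] [LieSupermodule g V]

/-- The coboundary operator `∂` on `C^•(𝔫⁻, V) = C_•(𝔫, V)`, in terms of a basis `ξₐ` of `𝔫` with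
dual basis `ξₐ‡` of `𝔫⁻`: `∂ v = ∑ₐ ξₐ ⊗ ξₐ‡ v` for `v ∈ V = C^0(𝔫⁻, V)`, and
`∂(X ∧ f) = ½ ∑ₐ ξₐ ∧ [ξₐ‡, X]_𝔫 ∧ f - X ∧ ∂ f`. Under the evaluation of chains on `Λ 𝔫⁻`, this is
the usual coboundary operator of Lie superalgebra cohomology. -/
def coboundary : P.C V →ₗ[ℂ] P.C V :=
  recMap ((leftMul P.nPart V).toLinearMap ∘ₗ coboundaryTerm ξ) (-(P.w V))
    (coboundary_compatible V ξ)
    (∑ a, tens P.nPart V (extι P.nPart (ξ.ξ a)) ∘ₗ act (ξ.ξd a : g))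

theorem coboundary_one (v : V) : coboundary V ξ (tens P.nPart V 1 v) =
    ∑ a, P.w V (ξ.ξ a) (tens P.nPart V 1 (act (ξ.ξd a : g) v)) := by
  unfold coboundary
  rw [recMap_one, LinearMap.sum_apply]
  refine Finset.sum_congr rfl fun a _ => ?_
  have h : P.w V (ξ.ξ a) (tens P.nPart V 1 (act (ξ.ξd a : g) v)) =
    tens P.nPart V (extι P.nPart (ξ.ξ a) * 1) (act (ξ.ξd a : g) v) := rfl
  rw [h, mul_one]
  rfl

theorem coboundary_wedge (X : P.n) (f : P.C V) : coboundary V ξ (P.w V X f) =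
    (1 / 2 : ℂ) • (∑ a, P.w V (ξ.ξ a) (P.w V (P.projN (bracket (ξ.ξd a : g) (X : g))) f)) -
      P.w V X (coboundary V ξ f) := by
  unfold coboundary
  rw [recMap_wedge, sub_eq_add_neg]
  congr 1
  rw [LinearMap.comp_apply, coboundaryTerm_apply, AlgHom.toLinearMap_apply, map_smul, map_sum,
    LinearMap.smul_apply, LinearMap.sum_apply]
  congr 1
  refine Finset.sum_congr rfl fun a _ => ?_
  rw [map_mul]
  rfl

variable (P)

/-- The action `A[f]` of `A ∈ g` on `f ∈ C_•(𝔫, V)`, determined by `A[v] = A v` and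
`A[X ∧ f] = [A, X]_𝔫 ∧ f + (-1)^{|A||X|} X ∧ A[f]`. For `A` in `p`, in particular in the Levi
subalgebra, this is the tensor product of the adjoint action on `Λ 𝔫` and the action on `V`. -/
def action : g →ₗ[ℂ] P.C V →ₗ[ℂ] P.C V :=
  (recMap (P.actionΦ V) (P.actionS V) P.action_compatible
    ((tens P.nPart V 1).compRight ℂ ∘ₗ
      (act (g := g) (V := V)).flip)).flip

theorem action_one (A : g) (v : V) : P.action V A (tens P.nPart V 1 v) = tens P.nPart V 1 (act A v) := by
  unfold action
  rw [LinearMap.flip_apply, recMap_one]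
  rfl

theorem action_wedge {i j : ZMod 2} {A : g} {X : P.n} (hA : A ∈ part i) (hX : X ∈ P.nPart j)
    (f : P.C V) : P.action V A (P.w V X f) =
      P.w V (P.projN (bracket A (X : g))) f + koszul i j • P.w V X (P.action V A f) := by
  unfold action
  rw [LinearMap.flip_apply, recMap_wedge, LinearMap.add_apply, P.actionS_apply hX _ hA]
  rfl

theorem boundary_compatible : RecCompatible (-(P.action V ∘ₗ P.n.subtype)) (-(P.w V)) where
  fst {i j x y} hx hy f := by
    have h1 := P.action_wedge V (A := (x : g)) hx hy f
    have h2 := P.action_wedge V (A := (y : g)) hy hx f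
    have h3 : P.projN (bracket (x : g) (y : g)) =
        -(koszul i j • P.projN (bracket (y : g) (x : g))) := by
      rw [LieSuperalgebra.bracket_skew (x := (x : g)) (y := (y : g)) hx hy, map_neg,
        map_smul]
    simp only [LinearMap.neg_apply, LinearMap.comp_apply, Submodule.subtype_apply]
    rw [h3, map_neg, map_smul, LinearMap.neg_apply, LinearMap.smul_apply] at h1
    rw [koszul_comm j i] at h2
    have h4 : koszul i j = 1 ∨ koszul i j = -1 := by
      unfold koszul; split_ifs <;> simp
    rw [h1, h2, map_neg, map_neg]
    rcases h4 with h4 | h4 <;> rw [h4] <;> module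
  snd {i j x y} hx hy f := by
    simp only [LinearMap.neg_apply, map_neg, neg_neg]
    exact wedge_skew hx hy f

/-- The boundary operator `∂*` on `C_•(𝔫, V)`: it vanishes on `C_0(𝔫, V) = V` and
`∂*(X ∧ f) = - X f - X ∧ ∂* f`. -/
def boundary : P.C V →ₗ[ℂ] P.C V :=
  recMap (-(P.action V ∘ₗ P.n.subtype)) (-(P.w V)) (P.boundary_compatible V) 0

theorem boundary_one (v : V) : P.boundary V (tens P.nPart V 1 v) = 0 :=
  recMap_one _ _ (P.boundary_compatible V) 0 v

theorem boundary_wedge (X : P.n) (f : P.C V) :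
    P.boundary V (P.w V X f) = -P.action V (X : g) f - P.w V X (P.boundary V f) := by
  unfold boundary
  rw [recMap_wedge, sub_eq_add_neg]
  rfl

variable {P}

/-- The Kostant quabla operator `□ = ∂ ∂* + ∂* ∂`. -/
def quabla : P.C V →ₗ[ℂ] P.C V :=
  coboundary V ξ ∘ₗ P.boundary V + P.boundary V ∘ₗ coboundary V ξ

/-- The generalised eigenspace of `□` with eigenvalue zero. -/
def genKer : Submodule ℂ (P.C V) := Module.End.maxGenEigenspace (quabla V ξ) 0

variable (P)

/-- `Λ^k 𝔫 ⊗ V`. -/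
def deg (k : ℕ) : Submodule ℂ (P.C V) := chainDeg P.nPart V k

/-- The `k`-cycles, the kernel of `∂*` on `C_k(𝔫, V)`. -/
def cycles (k : ℕ) : Submodule ℂ (P.C V) := LinearMap.ker (P.boundary V) ⊓ P.deg V k

/-- The `k`-boundaries, the image of `∂*` on `C_{k+1}(𝔫, V)`. -/
def boundaries (k : ℕ) : Submodule ℂ (P.C V) := (P.deg V (k + 1)).map (P.boundary V)

variable {P}

/-- The `k`-cocycles, the kernel of `∂` on `C^k(𝔫⁻, V)`. -/
def cocycles (k : ℕ) : Submodule ℂ (P.C V) := LinearMap.ker (coboundary V ξ) ⊓ P.deg V k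

/-- The `k`-coboundaries, the image of `∂` on `C^{k-1}(𝔫⁻, V)`. -/
def coboundaries : ℕ → Submodule ℂ (P.C V)
  | 0 => ⊥
  | k + 1 => (P.deg V k).map (coboundary V ξ)

variable (P)

/-- For subspaces `K ⊇ I` and `E` of `Λ^k 𝔫 ⊗ V`, the quotient `K / I` and `E` are isomorphic as
(super)modules over the Levi subalgebra: there is an even linear bijection which commutes with the
action of the Levi subalgebra. -/
def LeviIsomorphic (k : ℕ) (K I E : Submodule ℂ (P.C V)) : Prop :=
  ∃ e : (K ⧸ I.submoduleOf K) ≃ₗ[ℂ] E,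
    (∀ A ∈ P.levi, ∀ x : K, ∃ h : P.action V A x ∈ K,
      (e (Submodule.Quotient.mk ⟨P.action V A x, h⟩) : P.C V) =
        P.action V A (e (Submodule.Quotient.mk x))) ∧
    ∀ i : ZMod 2, ∀ x : K, (x : P.C V) ∈ chainPart P.nPart V k i →
      (e (Submodule.Quotient.mk x) : P.C V) ∈ chainPart P.nPart V k i

variable {P}

/-- `H_•(𝔫, V) ≅ C^•(𝔫⁻, V)_0` as modules over the Levi subalgebra, in each degree. -/
def HomologyIso : Prop :=
  ∀ k, P.LeviIsomorphic V k (P.cycles V k) (P.boundaries V k) (genKer V ξ ⊓ P.deg V k)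

/-- `H^•(𝔫⁻, V) ≅ C^•(𝔫⁻, V)_0` as modules over the Levi subalgebra, in each degree. -/
def CohomologyIso : Prop :=
  ∀ k, P.LeviIsomorphic V k (cocycles V ξ k) (coboundaries V ξ k) (genKer V ξ ⊓ P.deg V k)

/-- `∂` and `∂*` are disjoint operators. -/
def AreDisjoint : Prop :=
  (∀ f, coboundary V ξ (P.boundary V f) = 0 → P.boundary V f = 0) ∧
    ∀ f, P.boundary V (coboundary V ξ f) = 0 → coboundary V ξ f = 0

end Operators

end Parabolic

end KostantSuper

end

open KostantSuper KostantSuper.Parabolic LinearMap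

/-! The theorem rests on a non-degenerate bilinear form β on the chains for which ∂* and -∂ are
adjoint, in both orders, so that □ is self-adjoint. Given β, everything is linear algebra. Each Λ^k
𝔫 ⊗ V is finite dimensional and stable under □, so the chains split into C_0 and a complement on
which □ is invertible. The projection π onto C_0 commutes with every operator that commutes with □,
in particular with ∂, ∂* and the Levi subalgebra. A cycle x in the complement is a boundary: x = □
q(□)x for some polynomial q, and q(□)x is again a cycle, so x = ∂*∂ q(□)x. Hence only C_0
contributes to homology, and by counting dimensions degree by degree the homology is as large as C_0
exactly when ∂* vanishes on C_0. The same holds for ∂ and cohomology. Since the two summands are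
β-orthogonal, ∂* vanishes on C_0 if and only if ∂ does; this links the statements about ∂* with
those about ∂. Disjointness enters because □ is ∂*∂ on im ∂* and ∂∂* on im ∂.

The form β extends a form J on V: the product with X ∈ 𝔫 is adjoint to the contraction by τX, where
τ is a parity preserving antiautomorphism of g without signs, exchanging 𝔫 and 𝔫⁻ and preserving 𝔩,
and J(xv, u) = J(v, τ(x)u). That ∂* and -∂ are adjoint then follows by comparing the recursion for
∂* with Cartan's formula ι_A ∂ + ∂ ι_A = A, valid for A ∈ 𝔫⁻ (`contraction_coboundary`). The
identity ∂² = 0 and the Levi equivariance of ∂ are read off from those of ∂*.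

The transposition τ is constructed from a grading of g with G 0 = 𝔥. A faithful completely reducible
representation of the even part forces 𝔥 to act diagonalizably and even roots to be non-isotropic
(`RootGrading.of_completelyReducible`). Let E be the part of 𝔫⁺ orthogonal to [𝔫⁻, 𝔫⁻]. Root strings
show E ∩ [𝔫⁺, 𝔫⁺] = 0 (`eq_zero_of_mem_derived_of_homPart`), and a dimension count for 𝔫⁺ and 𝔫⁻
together gives 𝔫⁺ = E ⊕ [𝔫⁺, 𝔫⁺], so E generates 𝔫⁺. Dual bases e_i of E and f_i of its counterpart
satisfy [e_i, f_j] = 0 for i ≠ j and [e_i, f_i] ∈ 𝔥. The pairs of corresponding words in the e_i and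
f_i, together with the diagonal of 𝔥, span the graph of τ; it is a graph because an x paired with
zero is orthogonal to all words in the f_i.

The form J is obtained in the same spirit: the submodule of V ⊕ V* generated by a highest weight
vector and a dual highest weight vector is, by irreducibility, the graph of an injective map V → V*.
-/

noncomputable section

set_option linter.unusedSectionVars false

namespace LieModule

/-! ### Cartan subalgebras acting on irreducible representations -/

section LieTheory

open LieModule LieAlgebra Module

attribute [local instance] LieRing.ofAssociativeRing

variable {K L W : Type*} [Field K] [CharZero K] [IsAlgClosed K]
  [LieRing L] [LieAlgebra K L] [FiniteDimensional K L]
  [AddCommGroup W] [Module K W] [LieRingModule L W] [LieModule K L W] [FiniteDimensional K W]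

variable (K L W) in
/-- The radical of the trace form, as an ideal. -/
def traceRadical : LieIdeal K L where
  carrier := {x | ∀ y, traceForm K L W x y = 0}
  zero_mem' := fun y => by simp
  add_mem' := fun {a b} ha hb y => by
    rw [map_add, LinearMap.add_apply, ha y, hb y, add_zero]
  smul_mem' := fun t a ha y => by rw [map_smul, LinearMap.smul_apply, ha y, smul_zero]
  lie_mem := fun {x m} hm y => by
    rw [traceForm_apply_lie_apply', hm, neg_zero]

/-- By Engel's theorem only the nilpotency of each `ad x` is needed. If x acts nilpotently on W,
then so does the commutator with x on End W, and faithfulness embeds L equivariantly there. -/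
theorem isNilpotent_of_isNilpotent_of_isFaithful [IsFaithful K L W]
    (h : LieModule.IsNilpotent L W) : LieRing.IsNilpotent L := by
  rw [LieAlgebra.isNilpotent_iff_forall (R := K)]
  intro x
  have h1 : _root_.IsNilpotent (toEnd K L W x) := (LieModule.isNilpotent_iff_forall' (R := K)).mp h x
  have h2 : _root_.IsNilpotent (ad K (Module.End K W) (toEnd K L W x)) :=
    LieAlgebra.ad_nilpotent_of_nilpotent h1
  obtain ⟨n, hn⟩ := h2
  refine ⟨n, LinearMap.ext fun y => ?_⟩
  apply IsFaithful.injective_toEnd (R := K) (M := W)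
  have key : ∀ m : ℕ, toEnd K L W (((ad K L x) ^ m) y) =
      ((ad K (Module.End K W) (toEnd K L W x)) ^ m) (toEnd K L W y) := by
    intro m
    induction m with
    | zero => rfl
    | succ m ih =>
      rw [pow_succ', pow_succ', Module.End.mul_apply, Module.End.mul_apply, ← ih, ad_apply,
        ad_apply, LieHom.map_lie]
  rw [key, hn]
  simp

/-- Cartan's criterion: the derived ideal of the trace radical acts nilpotently, so the trace
radical is solvable and lies in the radical of L. The latter is central for a faithful irreducible
representation, so x acts by a scalar t, and the trace form of x with itself is t² dim W. -/
theorem eq_zero_of_traceForm_eq_zero_of_isFaithful [LieModule.IsIrreducible K L W] [IsFaithful K L W]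
    {x : L} (hx : ∀ y, traceForm K L W x y = 0) : x = 0 := by
  have hnt := nontrivial_of_isIrreducible K L W
  let J := traceRadical K L W
  have h1 : traceForm K J W = 0 := by
    ext a b
    exact a.2 b
  have h2 := isNilpotent_derivedSeries_of_traceForm_eq_zero h1
  have : IsFaithful K (derivedSeries K J 1) W := ⟨by
    intro a b hab
    apply Subtype.ext; apply Subtype.ext
    exact IsFaithful.injective_toEnd (R := K) (L := L) (M := W) hab⟩
  have h3 : LieRing.IsNilpotent (derivedSeries K J 1) :=
    isNilpotent_of_isNilpotent_of_isFaithful (K := K) (W := W) h2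
  have h4 : IsSolvable J := by
    obtain ⟨k, hk⟩ := (isSolvable_iff K (derivedSeries K J 1)).mp inferInstance
    rw [LieIdeal.derivedSeries_eq_bot_iff] at hk
    refine IsSolvable.mk (R := K) (k := k + 1) ?_
    rw [derivedSeries_def, derivedSeriesOfIdeal_add]
    exact hk
  have h5 : J ≤ radical K L := (LieIdeal.solvable_iff_le_radical K L J).mp h4
  obtain ⟨h6, h7⟩ := hasCentralRadical_and_of_isIrreducible_of_isFaithful K L W
  have hxJ : x ∈ J := hx
  have h8 : x ∈ center K L := by
    rw [← (hasCentralRadical_iff K L).mp h6]; exact h5 hxJ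
  obtain ⟨t, ht⟩ := Submodule.mem_span_singleton.mp ((h7 x).mp h8)
  have h9 := hx x
  rw [traceForm_apply_apply, ← ht, LinearMap.smul_comp, LinearMap.comp_smul, map_smul, map_smul,
    LinearMap.comp_id, LinearMap.trace_id, smul_eq_mul, smul_eq_mul] at h9
  have h10 : (finrank K W : K) ≠ 0 := by
    exact_mod_cast (finrank_pos (R := K) (M := W)).ne'
  have h11 : t = 0 := by
    rcases mul_eq_zero.mp h9 with h | h
    · exact h
    · exact (mul_eq_zero.mp h).resolve_right h10
  apply IsFaithful.injective_toEnd (R := K) (M := W)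
  rw [← ht, h11, zero_smul, map_zero]

/-- In an irreducible representation, the radical of the trace form acts by zero. -/
theorem toEnd_eq_zero_of_traceForm_eq_zero [LieModule.IsIrreducible K L W]
    {x : L} (hx : ∀ y, traceForm K L W x y = 0) : toEnd K L W x = 0 := by
  -- Passing to the image in End W makes the representation faithful without changing its submodules
  -- or its trace form.
  let R := (toEnd K L W).range
  have hnt := nontrivial_of_isIrreducible K L W
  have : LieModule.IsIrreducible K R W := LieModule.IsIrreducible.mk fun N hN => by
    let N' : LieSubmodule K L W := ⟨N.toSubmodule, fun {a m} hm =>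
      N.lie_mem (x := (⟨toEnd K L W a, ⟨a, rfl⟩⟩ : R)) hm⟩
    have hN' : N' ≠ ⊥ := fun h => by
      apply hN
      rw [← LieSubmodule.toSubmodule_inj] at h ⊢
      exact h
    have : Nontrivial N' := (LieSubmodule.nontrivial_iff_ne_bot K L W).mpr hN'
    have h : N' = ⊤ := LieSubmodule.eq_top_of_isIrreducible K L W N'
    rw [← LieSubmodule.toSubmodule_inj] at h ⊢
    exact h
  have h := eq_zero_of_traceForm_eq_zero_of_isFaithful (K := K) (L := R) (W := W)
    (x := ⟨toEnd K L W x, ⟨x, rfl⟩⟩) (by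
      rintro ⟨_, ⟨y, rfl⟩⟩
      exact hx y)
  exact congrArg Subtype.val h

/-- An element of a Cartan subalgebra which acts nilpotently on an irreducible representation acts
by zero. -/
theorem toEnd_eq_zero_of_isNilpotent_of_mem_cartan [LieModule.IsIrreducible K L W] (H : LieSubalgebra K L)
    [H.IsCartanSubalgebra] {c : H} (hc : _root_.IsNilpotent (toEnd K L W (c : L))) :
    toEnd K L W (c : L) = 0 := by
  classical
  -- It suffices that c is orthogonal to each root space under the trace form. On H itself this
  -- holds because all weights vanish on c; for a root β ≠ 0, the product of y and c shifts every
  -- weight space by β and so has trace zero.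
  apply toEnd_eq_zero_of_traceForm_eq_zero
  have htop : (⨆ χ : H → K, rootSpace H χ) = ⊤ := iSup_genWeightSpace_eq_top K H L
  have hχ : ∀ χ : Weight K H W, χ c = 0 := fun χ =>
    (Weight.hasEigenvalueAt χ c).isNilpotent_of_isNilpotent hc |>.eq_zero
  intro y
  have hy : y ∈ (⨆ χ : H → K, rootSpace H χ) := by rw [htop]; trivial
  induction hy using LieSubmodule.iSup_induction' with
  | mem β y hy =>
    by_cases hβ : β = 0
    · subst hβ
      rw [rootSpace_zero_eq] at hy
      have h1 : traceForm K L W c y = traceForm K H W c ⟨y, hy⟩ := rfl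
      rw [h1, traceForm_eq_sum_finrank_nsmul_mul]
      exact Finset.sum_eq_zero fun χ _ => by rw [hχ χ]; simp
    · let σ : (H → K) → (H → K) := fun γ => β + γ
      have hσ : ∀ γ, σ γ ≠ γ := fun γ => by simpa [σ] using hβ
      rw [traceForm_comm]
      let f : Module.End K W := toEnd K L W y ∘ₗ toEnd K L W (c : L)
      have hf : ∀ γ, Set.MapsTo f (genWeightSpace W γ) (genWeightSpace W (σ γ)) := fun γ m hm =>
        lie_mem_genWeightSpace_of_mem_genWeightSpace hy
          ((genWeightSpace W γ).lie_mem (x := c) hm)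
      have hds := DirectSum.isInternal_submodule_of_iSupIndep_of_iSup_eq_top
        (LieSubmodule.iSupIndep_toSubmodule.mpr <| iSupIndep_genWeightSpace K H W)
        (LieSubmodule.iSup_toSubmodule_eq_top.mpr <| iSup_genWeightSpace_eq_top K H W)
      exact LinearMap.trace_eq_zero_of_mapsTo_ne hds σ hσ hf
  | zero => simp
  | add a b _ _ ha hb => rw [map_add, ha, hb, add_zero]

end LieTheory

/-! ### A positivity criterion for traces -/

section TraceLemma
open Module
variable {K R : Type*} [Field K] [CharZero K] [IsAlgClosed K]
  [AddCommGroup R] [Module K R] [FiniteDimensional K R]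

/-- An endomorphism whose eigenvalues are positive integer multiples of a non-zero scalar has
non-zero trace. -/
theorem trace_ne_zero_of_eigenvalues_pos [Nontrivial R] {f : Module.End K R} {c : K} (hc : c ≠ 0)
    (h : ∀ μ, f.HasEigenvalue μ → ∃ k : ℕ, 0 < k ∧ μ = k * c) : LinearMap.trace K R f ≠ 0 := by
  rw [Module.End.trace_eq_sum_roots_charpoly_of_splits (IsAlgClosed.splits _)]
  have h1 : ∀ s : Multiset K, (∀ μ ∈ s, ∃ k : ℕ, 0 < k ∧ μ = k * c) →
      ∃ k : ℕ, s.sum = k * c ∧ (s ≠ 0 → 0 < k) := by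
    intro s
    induction s using Multiset.induction with
    | empty => exact fun _ => ⟨0, by simp, by simp⟩
    | cons a s ih =>
      intro hs
      obtain ⟨k, hk, -⟩ := ih fun μ hμ => hs μ (Multiset.mem_cons_of_mem hμ)
      obtain ⟨l, hl, ha⟩ := hs a (Multiset.mem_cons_self a s)
      exact ⟨l + k, by rw [Multiset.sum_cons, hk, ha]; push_cast; ring, fun _ => by omega⟩
  obtain ⟨k, hk, hk0⟩ := h1 f.charpoly.roots fun μ hμ => h μ (by
    rw [Module.End.hasEigenvalue_iff_isRoot_charpoly]
    exact (Polynomial.mem_roots'.mp hμ).2)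
  rw [hk]
  -- There is at least one root, since the number of roots is the dimension of R.
  have h2 : 0 < k := hk0 (by
    intro h0
    have h3 := Polynomial.splits_iff_card_roots.mp (IsAlgClosed.splits f.charpoly)
    rw [h0, Multiset.card_zero, LinearMap.charpoly_natDegree] at h3
    exact (finrank_pos (R := K) (M := R)).ne h3)
  exact mul_ne_zero (by exact_mod_cast h2.ne') hc

end TraceLemma

/-! ### Weights of a Cartan subalgebra and invariant forms -/

section CartanOfFaithful

open LieAlgebra Module

attribute [local instance] LieRing.ofAssociativeRing

variable {K L M : Type*} [Field K] [CharZero K] [IsAlgClosed K]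
  [LieRing L] [LieAlgebra K L] [FiniteDimensional K L]
  [AddCommGroup M] [Module K M] [LieRingModule L M] [LieModule K L M] [FiniteDimensional K M]
  {H : LieSubalgebra K L} [H.IsCartanSubalgebra]

/-- M is the sum of its generalised weight spaces, each of which lies in the generalised kernel of
c. -/
theorem isNilpotent_toEnd_of_forall_weight_eq_zero {c : H} (h : ∀ χ : Weight K H M, χ c = 0) :
    _root_.IsNilpotent (toEnd K L M (c : L)) := by
  have h1 : (toEnd K H M c).maxGenEigenspace 0 = ⊤ := by
    rw [eq_top_iff]
    have h2 : (⨆ χ : Weight K H M, genWeightSpace M χ) = ⊤ := iSup_genWeightSpace_eq_top' K H M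
    rw [← LieSubmodule.toSubmodule_inj, LieSubmodule.iSup_toSubmodule,
      LieSubmodule.top_toSubmodule] at h2
    rw [← h2]
    refine iSup_le fun χ => ?_
    have h3 : (genWeightSpace M χ).toSubmodule ≤ (genWeightSpaceOf M (χ c) c).toSubmodule :=
      genWeightSpace_le_genWeightSpaceOf M c χ
    rw [h χ] at h3
    exact h3
  rw [Module.End.maxGenEigenspace_eq, Module.End.genEigenspace_nat, zero_smul, sub_zero] at h1
  exact ⟨_, LinearMap.ker_eq_top.mp h1⟩

/-- A Cartan subalgebra is abelian if its non-zero elements do not act nilpotently on some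
representation. -/
theorem lie_eq_zero_of_mem_cartan
    (hM : ∀ c : H, _root_.IsNilpotent (toEnd K L M (c : L)) → c = 0) (x y : H) : ⁅x, y⁆ = 0 :=
  -- In characteristic zero weights are characters, hence vanish on commutators.
  hM _ (isNilpotent_toEnd_of_forall_weight_eq_zero fun χ => χ.apply_lie x y)

variable {B : LinearMap.BilinForm K L} (hB : ∀ x y z : L, B ⁅x, y⁆ z = B x ⁅y, z⁆)

include hB in
-- The root spaces are only generalised eigenspaces here, so the usual argument is run by induction
-- on the sum of the nilpotency orders n of `ad h - α h` at x and m of `ad h - β h` at y: by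
-- invariance, (α h + β h) B(x, y) is minus a sum of two values with a smaller order.
theorem invariant_apply_eq_zero_of_add_ne_zero {α β : H → K} {x y : L} (hx : x ∈ rootSpace H α)
    (hy : y ∈ rootSpace H β) (hαβ : α + β ≠ 0) : B x y = 0 := by
  obtain ⟨h, hh⟩ := Function.ne_iff.mp hαβ
  have key : ∀ N n m : ℕ, n + m ≤ N → ∀ x y : L,
      ((ad K L (h : L) - α h • 1) ^ n) x = 0 → ((ad K L (h : L) - β h • 1) ^ m) y = 0 →
      B x y = 0 := by
    intro N
    induction N with
    | zero =>
      intro n m hnm x y hx _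
      obtain rfl : n = 0 := by omega
      have : x = 0 := by simpa using hx
      rw [this, map_zero, LinearMap.zero_apply]
    | succ N ih =>
      intro n m hnm x y hx hy
      rcases n with - | n
      · have : x = 0 := by simpa using hx
        rw [this, map_zero, LinearMap.zero_apply]
      rcases m with - | m
      · have : y = 0 := by simpa using hy
        rw [this, map_zero]
      have h1 := ih n (m + 1) (by omega) ((ad K L (h : L) - α h • 1) x) y (by
        rwa [← Module.End.mul_apply, ← pow_succ]) hy
      have h2 := ih (n + 1) m (by omega) x ((ad K L (h : L) - β h • 1) y) hx (by
        rwa [← Module.End.mul_apply, ← pow_succ])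
      have h3 : B ⁅(h : L), x⁆ y = - B x ⁅(h : L), y⁆ := by
        rw [← lie_skew, map_neg, LinearMap.neg_apply, hB]
      simp only [LinearMap.sub_apply, ad_apply, LinearMap.smul_apply, Module.End.one_apply,
        map_sub, map_smul, smul_eq_mul] at h1 h2
      have h4 : (α h + β h) * B x y = 0 := by linear_combination h3 - h1 - h2
      exact (mul_eq_zero.mp h4).resolve_left hh
  have hx' := (genWeightSpace_le_genWeightSpaceOf L h α) hx
  have hy' := (genWeightSpace_le_genWeightSpaceOf L h β) hy
  obtain ⟨n, hn⟩ := (mem_genWeightSpaceOf L (α h) h x).mp hx'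
  obtain ⟨m, hm⟩ := (mem_genWeightSpaceOf L (β h) h y).mp hy'
  exact key _ n m le_rfl x y hn hm

variable (hnd : ∀ x, (∀ y, B x y = 0) → x = 0)

include hB hnd in
/-- Root spaces of opposite roots are paired by an invariant non-degenerate form. -/
theorem exists_invariant_apply_ne_zero {α : H → K} {x : L} (hx : x ∈ rootSpace H α) (hx0 : x ≠ 0) :
    ∃ y ∈ rootSpace H (-α), B x y ≠ 0 := by
  by_contra! hcon
  apply hx0
  refine hnd x fun y => ?_
  have hy : y ∈ (⨆ χ : H → K, rootSpace H χ) := by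
    rw [iSup_genWeightSpace_eq_top K H L]; trivial
  induction hy using LieSubmodule.iSup_induction' with
  | mem β y hy =>
    by_cases hβ : α + β = 0
    · rw [eq_neg_of_add_eq_zero_right hβ] at hy
      exact hcon y hy
    · exact invariant_apply_eq_zero_of_add_ne_zero hB hx hy hβ
  | zero => simp
  | add a b _ _ ha hb => rw [map_add, ha, hb, add_zero]

end CartanOfFaithful

/-! ### Coroots and one-dimensional root spaces -/

section RootLines

open LieAlgebra Module

attribute [local instance] LieRing.ofAssociativeRing

variable {K L M : Type*} [Field K] [CharZero K] [IsAlgClosed K]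
  [LieRing L] [LieAlgebra K L] [FiniteDimensional K L]
  [AddCommGroup M] [Module K M] [LieRingModule L M] [LieModule K L M] [FiniteDimensional K M]
  {H : LieSubalgebra K L} [H.IsCartanSubalgebra]
  {B : LinearMap.BilinForm K L} (hB : ∀ x y z : L, B ⁅x, y⁆ z = B x ⁅y, z⁆)

include hB in
/-- If the non-zero elements of a Cartan subalgebra do not act nilpotently on some representation,
then roots are not isotropic for an invariant form. -/
theorem exists_coroot (hM : ∀ c : H, _root_.IsNilpotent (toEnd K L M (c : L)) → c = 0)
    {α : H → K} (hα : α ≠ 0) {u v : L} (hu : u ∈ rootSpace H α) (hv : v ∈ rootSpace H (-α))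
    (hv' : ∀ h : H, ⁅(h : L), v⁆ = -α h • v) (huv : B u v = 1) :
    ∃ t : H, (t : L) = ⁅u, v⁆ ∧ (∀ h : H, B t h = α h) ∧ α t ≠ 0 := by
  have h0 : ⁅u, v⁆ ∈ H := by
    have h1 : ⁅u, v⁆ ∈ rootSpace H (α + -α) := lie_mem_genWeightSpace_of_mem_genWeightSpace hu hv
    rw [add_neg_cancel, rootSpace_zero_eq] at h1
    exact h1
  have ht : ∀ h : H, B ⁅u, v⁆ h = α h := fun h => by
    rw [hB, ← lie_skew, hv', neg_smul, neg_neg, map_smul, huv, smul_eq_mul, mul_one]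
  refine ⟨⟨⁅u, v⁆, h0⟩, rfl, ht, fun hcon => hα ?_⟩
  have hcor : (⟨⁅u, v⁆, h0⟩ : H) ∈ corootSpace α :=
    (mem_corootSpace α).mpr (Submodule.subset_span ⟨u, hu, v, hv, rfl⟩)
  -- On the coroot space every weight χ satisfies a α + b χ = 0 with b ≠ 0. So if α vanished on [u,
  -- v], all weights would, and [u, v] would act nilpotently and be zero.
  have h2 : (⟨⁅u, v⁆, h0⟩ : H) = 0 := hM _ (isNilpotent_toEnd_of_forall_weight_eq_zero fun χ => by
    obtain ⟨a, b, hb, hab⟩ :=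
      exists_forall_mem_corootSpace_smul_add_eq_zero M α χ hα χ.genWeightSpace_ne_bot
    have h3 := hab _ hcor
    rw [Pi.add_apply, Pi.smul_apply, Pi.smul_apply, hcon, smul_zero, zero_add, zsmul_eq_mul] at h3
    exact (mul_eq_zero.mp h3).resolve_left (by exact_mod_cast hb.ne'))
  have h4 : ⁅u, v⁆ = 0 := congrArg Subtype.val h2
  funext h
  rw [← ht h, h4, map_zero, LinearMap.zero_apply, Pi.zero_apply]

variable (hnd : ∀ x, (∀ y, B x y = 0) → x = 0)

include hB hnd in
-- The subspace R of ⨁_{k ≥ 1} L_{kα} orthogonal to v is stable under `ad u` and `ad v`. On R their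
-- commutator `ad t` has trace zero, while its eigenvalues are positive multiples of α t ≠ 0; hence
-- R = 0. As L_{kα} is orthogonal to v for k ≥ 2, this gives both that L_α is a line and that L_{kα}
-- = 0 for k ≥ 2.
theorem iSup_rootSpace_inf_ker_eq_bot
    {α : H → K} (hα : α ≠ 0) {u v : L} (hu : u ∈ rootSpace H α) (hv : v ∈ rootSpace H (-α))
    (hv' : ∀ h : H, ⁅(h : L), v⁆ = -α h • v) {t : H} (htuv : (t : L) = ⁅u, v⁆) (ht : ∀ h : H, B t h = α h) (hαt : α t ≠ 0) :
    (⨆ k : ℕ, (rootSpace H ((k + 1) • α)).toSubmodule) ⊓ LinearMap.ker (B.flip v) = ⊥ := by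
  set P : Submodule K L := ⨆ k : ℕ, (rootSpace H ((k + 1) • α)).toSubmodule with hP
  set R := P ⊓ LinearMap.ker (B.flip v) with hR
  have hle : ∀ k : ℕ, (rootSpace H ((k + 1) • α)).toSubmodule ≤ P := fun k => le_iSup
    (fun k : ℕ => (rootSpace H ((k + 1) • α)).toSubmodule) k
  have hkα : ∀ k : ℕ, 0 < k → k • α ≠ 0 := fun k hk h => hα (by
    rcases smul_eq_zero.mp h with h | h
    · omega
    · exact h)
  have hx0 : ∀ x : L, x ∈ rootSpace H 0 → ∃ h : H, (h : L) = x := fun x hx => by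
    rw [rootSpace_zero_eq] at hx; exact ⟨⟨x, hx⟩, rfl⟩
  -- lowering
  have hlow : ∀ y ∈ P, ⁅v, y⁆ + B y v • (t : L) ∈ P := by
    intro y hy
    induction hy using Submodule.iSup_induction' with
    | mem k y hy =>
      rcases k with - | k
      · have hy' : y ∈ rootSpace H α := by simpa using hy
        -- This element lies in H and is orthogonal to H, on which the form is non-degenerate.
        have h1 : ⁅v, y⁆ + B y v • (t : L) = 0 := by
          by_contra hne
          have h2 : ⁅v, y⁆ + B y v • (t : L) ∈ rootSpace H (0 : H → K) := by
            refine Submodule.add_mem _ ?_ (Submodule.smul_mem _ _ ?_)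
            · have h3 := lie_mem_genWeightSpace_of_mem_genWeightSpace hv hy'
              rwa [neg_add_cancel] at h3
            · exact (by rw [rootSpace_zero_eq]; exact t.2 : (t : L) ∈ rootSpace H (0 : H → K))
          obtain ⟨z, hz, hz'⟩ := exists_invariant_apply_ne_zero hB hnd h2 hne
          rw [neg_zero] at hz
          obtain ⟨h, rfl⟩ := hx0 z hz
          apply hz'
          rw [map_add, LinearMap.add_apply, map_smul, LinearMap.smul_apply, ht, ← lie_skew,
            map_neg, LinearMap.neg_apply, hB, ← lie_skew, hv', map_neg, map_smul]
          simp [mul_comm]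
        rw [h1]; exact P.zero_mem
      · rw [invariant_apply_eq_zero_of_add_ne_zero hB hy hv (by
          rw [succ_nsmul, add_neg_cancel_right]; exact hkα _ (by omega)), zero_smul, add_zero]
        have h1 : ⁅v, y⁆ ∈ rootSpace H (-α + (k + 1 + 1) • α) :=
          lie_mem_genWeightSpace_of_mem_genWeightSpace hv hy
        rw [succ_nsmul, add_comm, add_neg_cancel_right] at h1
        exact hle k h1
    | zero => simp
    | add a b _ _ ha hb =>
      have := P.add_mem ha hb
      rw [lie_add, map_add, LinearMap.add_apply, add_smul]
      convert this using 1
      abel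
  have hvR : ∀ y ∈ R, ⁅v, y⁆ ∈ R := by
    rintro y ⟨hy, hyv⟩
    have hyv' : B y v = 0 := hyv
    have h1 := hlow y hy
    rw [hyv', zero_smul, add_zero] at h1
    refine ⟨h1, ?_⟩
    change B ⁅v, y⁆ v = 0
    rw [← lie_skew, map_neg, LinearMap.neg_apply, hB, lie_self, map_zero, neg_zero]
  have huP : ∀ y ∈ P, ⁅u, y⁆ ∈ P := by
    intro y hy
    induction hy using Submodule.iSup_induction' with
    | mem k y hy =>
      have h1 : ⁅u, y⁆ ∈ rootSpace H (α + (k + 1) • α) :=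
          lie_mem_genWeightSpace_of_mem_genWeightSpace hu hy
      rw [add_comm, ← succ_nsmul] at h1
      exact hle (k + 1) h1
    | zero => simp
    | add a b _ _ ha hb => rw [lie_add]; exact P.add_mem ha hb
  have hPt : ∀ y ∈ P, B y t = 0 := by
    intro y hy
    induction hy using Submodule.iSup_induction' with
    | mem k y hy =>
      refine invariant_apply_eq_zero_of_add_ne_zero (β := 0) hB hy ?_ (by
        rw [add_zero]; exact hkα _ (by omega))
      rw [rootSpace_zero_eq]; exact t.2
    | zero => simp
    | add a b _ _ ha hb => rw [map_add, LinearMap.add_apply, ha, hb, add_zero]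
  have huR : ∀ y ∈ R, ⁅u, y⁆ ∈ R := by
    rintro y ⟨hy, -⟩
    refine ⟨huP y hy, ?_⟩
    change B ⁅u, y⁆ v = 0
    rw [← lie_skew, map_neg, LinearMap.neg_apply, hB, ← htuv, hPt y hy, neg_zero]
  by_contra hcon
  have hnt : Nontrivial R := Submodule.nontrivial_iff_ne_bot.mpr hcon
  let U : Module.End K R := (ad K L u).restrict huR
  let W : Module.End K R := (ad K L v).restrict hvR
  -- The commutator of the restrictions is the restriction of `ad t`; its trace vanishes but its
  -- eigenvalues on R are among k α t with k > 0.
  have htr : LinearMap.trace K R (U * W - W * U) = 0 := by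
    rw [map_sub, LinearMap.trace_mul_comm, sub_self]
  refine trace_ne_zero_of_eigenvalues_pos (f := U * W - W * U) hαt (fun μ hμ => ?_) htr
  obtain ⟨w, hw⟩ := hμ.exists_hasEigenvector
  have hw1 : ⁅(t : L), (w : L)⁆ = μ • (w : L) := by
    have h1 := congrArg Subtype.val hw.apply_eq_smul
    have h2 : (((U * W - W * U) w : R) : L) = ⁅u, ⁅v, (w : L)⁆⁆ - ⁅v, ⁅u, (w : L)⁆⁆ := rfl
    rw [h2, ← lie_lie, ← htuv] at h1
    exact h1
  by_contra! hne
  have h3 := (ad K L (t : L)).independent_maxGenEigenspace.disjoint_biSup (x := μ)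
    (y := {ν | ∃ k : ℕ, 0 < k ∧ ν = k * α t}) (by
      rintro ⟨k, hk, hk'⟩; exact hne k hk hk')
  have h4 : (w : L) ∈ (ad K L (t : L)).maxGenEigenspace μ := by
    apply Module.End.mem_maxGenEigenspace _ _ _ |>.mpr
    exact ⟨1, by simp [hw1]⟩
  have h5 : P ≤ ⨆ ν ∈ {ν | ∃ k : ℕ, 0 < k ∧ ν = k * α t}, (ad K L (t : L)).maxGenEigenspace ν := by
    refine iSup_le fun k => ?_
    refine le_trans ?_ (le_iSup₂_of_le ((k + 1) • α t)
      ⟨k + 1, by omega, by rw [nsmul_eq_mul]⟩ le_rfl)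
    exact genWeightSpace_le_genWeightSpaceOf L t ((k + 1) • α)
  exact hw.2 (Subtype.ext (Submodule.disjoint_def.mp h3 _ h4 (h5 w.2.1)))

include hB hnd in
/-- If the non-zero elements of a Cartan subalgebra do not act nilpotently on some representation,
and there is an invariant non-degenerate form, then root spaces are one-dimensional, roots are not
isotropic and proper multiples `k α`, `k ≥ 2`, of roots are not roots. -/
theorem exists_rootSpace_eq (hs : ∀ x y, B x y = B y x)
    (hM : ∀ c : H, _root_.IsNilpotent (toEnd K L M (c : L)) → c = 0)
    {α : H → K} (hα : α ≠ 0) (hne : rootSpace H α ≠ ⊥) :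
    (∃ t : H, (∀ h : H, B t h = α h) ∧ α t ≠ 0) ∧
    (∀ x ∈ rootSpace H α, ∀ h : H, ⁅(h : L), x⁆ = α h • x) ∧
    ∀ k : ℕ, rootSpace H ((k + 2) • α) = ⊥ := by
  -- A generalised root space contains a genuine eigenvector; this first yields diagonalizability on
  -- a single vector, and the whole root space turns out to be its line.
  obtain ⟨u₀, hu₀, hu₀0, hu₀'⟩ : ∃ u ∈ rootSpace H α, u ≠ 0 ∧ ∀ h : H, ⁅(h : L), u⁆ = α h • u := by
    obtain ⟨m, hm0, hm⟩ := exists_forall_lie_eq_smul K H L ⟨α, hne⟩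
    exact ⟨m, weightSpace_le_genWeightSpace L α ((mem_weightSpace α m).mpr hm), hm0, hm⟩
  obtain ⟨v₁, hv₁, hv₁0⟩ := exists_invariant_apply_ne_zero hB hnd hu₀ hu₀0
  have hne' : rootSpace H (-α) ≠ ⊥ := fun h => by
    rw [h, LieSubmodule.mem_bot] at hv₁
    rw [hv₁, map_zero] at hv₁0
    exact hv₁0 rfl
  obtain ⟨v, hv, hv0, hv'⟩ : ∃ v ∈ rootSpace H (-α), v ≠ 0 ∧ ∀ h : H, ⁅(h : L), v⁆ = -α h • v := by
    obtain ⟨m, hm0, hm⟩ := exists_forall_lie_eq_smul K H L ⟨-α, hne'⟩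
    exact ⟨m, weightSpace_le_genWeightSpace L (-α) ((mem_weightSpace (-α) m).mpr hm), hm0, hm⟩
  obtain ⟨u₁, hu₁, huv₁⟩ : ∃ u ∈ rootSpace H α, B u v ≠ 0 := by
    by_contra! hcon
    obtain ⟨u, hu, huv⟩ := exists_invariant_apply_ne_zero hB hnd hv hv0
    rw [neg_neg] at hu
    exact huv (by rw [hs, hcon u hu])
  have hu : (B u₁ v)⁻¹ • u₁ ∈ rootSpace H α := Submodule.smul_mem _ _ hu₁
  have huv : B ((B u₁ v)⁻¹ • u₁) v = 1 := by
    rw [map_smul, LinearMap.smul_apply, smul_eq_mul, inv_mul_cancel₀ huv₁]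
  generalize (B u₁ v)⁻¹ • u₁ = u at hu huv
  obtain ⟨t, htuv, ht, hαt⟩ := exists_coroot hB hM hα hu hv hv' huv
  have hbot := iSup_rootSpace_inf_ker_eq_bot hB hnd hα hu hv hv' htuv ht hαt
  have hle : ∀ k : ℕ, (rootSpace H ((k + 1) • α)).toSubmodule ≤
      ⨆ k : ℕ, (rootSpace H ((k + 1) • α)).toSubmodule := fun k => le_iSup
    (fun k : ℕ => (rootSpace H ((k + 1) • α)).toSubmodule) k
  -- The difference of the two sides lies in the root space and is orthogonal to v.
  have hline : ∀ x ∈ rootSpace H α, x = B x v • u := by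
    intro x hx
    have h1 : x - B x v • u ∈ (⨆ k : ℕ, (rootSpace H ((k + 1) • α)).toSubmodule) ⊓
        LinearMap.ker (B.flip v) := by
      refine ⟨hle 0 ?_, ?_⟩
      · rw [zero_add, one_smul]
        exact Submodule.sub_mem _ hx (Submodule.smul_mem _ _ hu)
      · change B (x - B x v • u) v = 0
        rw [map_sub, LinearMap.sub_apply, map_smul, LinearMap.smul_apply, huv]
        simp
    rw [hbot, Submodule.mem_bot] at h1
    exact sub_eq_zero.mp h1
  refine ⟨⟨t, ht, hαt⟩, fun x hx h => ?_, fun k => ?_⟩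
  · have h0 : B u₀ v ≠ 0 := fun h0 => hu₀0 (by rw [hline u₀ hu₀, h0, zero_smul])
    have h1 : x = (B x v * (B u₀ v)⁻¹) • u₀ := by
      rw [hline u₀ hu₀, smul_smul, mul_assoc, map_smul, LinearMap.smul_apply, huv, smul_eq_mul,
        mul_one, inv_mul_cancel₀ h0, mul_one]
      exact hline x hx
    rw [h1, lie_smul, hu₀', smul_comm]
  · rw [LieSubmodule.eq_bot_iff]
    intro x hx
    have h1 : x ∈ (⨆ k : ℕ, (rootSpace H ((k + 1) • α)).toSubmodule) ⊓
        LinearMap.ker (B.flip v) := by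
      refine ⟨hle (k + 1) hx, ?_⟩
      change B x v = 0
      refine invariant_apply_eq_zero_of_add_ne_zero hB hx hv ?_
      rw [show k + 2 = (k + 1) + 1 from rfl, succ_nsmul, add_neg_cancel_right]
      intro h
      rcases smul_eq_zero.mp h with h | h
      · omega
      · exact hα h
    rwa [hbot, Submodule.mem_bot] at h1

end RootLines

/-! ### Cartan subalgebras acting on completely reducible representations -/

section Complemented

open LieAlgebra Module

attribute [local instance] LieRing.ofAssociativeRing

variable {K L M : Type*} [Field K] [CharZero K] [IsAlgClosed K]
  [LieRing L] [LieAlgebra K L] [FiniteDimensional K L]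
  [AddCommGroup M] [Module K M] [LieRingModule L M] [LieModule K L M] [FiniteDimensional K M]
  (hM : ∀ N : LieSubmodule K L M, ∃ N' : LieSubmodule K L M, IsCompl N N')
  {H : LieSubalgebra K L} [H.IsCartanSubalgebra]

include hM in
/-- An element of a Cartan subalgebra which acts nilpotently on a completely reducible
representation acts by zero. -/
theorem lie_eq_zero_of_isNilpotent_of_mem_cartan {c : H}
    (hc : _root_.IsNilpotent (toEnd K L M (c : L))) (m : M) : ⁅(c : L), m⁆ = 0 := by
  -- U is the largest submodule killed by c. A non-zero complement would contain an irreducible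
  -- submodule, on which c acts by zero, and which would therefore lie in U.
  let U : LieSubmodule K L M := sSup {N | ∀ m ∈ N, ⁅(c : L), m⁆ = 0}
  have hU : ∀ m ∈ U, ⁅(c : L), m⁆ = 0 := by
    intro m hm
    have h1 : U.toSubmodule ≤ LinearMap.ker (toEnd K L M (c : L)) := by
      rw [LieSubmodule.sSup_toSubmodule]
      refine sSup_le ?_
      rintro _ ⟨N, hN, rfl⟩ m hm
      exact hN m hm
    exact h1 hm
  obtain ⟨U', hUU'⟩ := hM U
  have hU' : U' = ⊥ := by
    rcases IsAtomic.eq_bot_or_exists_atom_le U' with h | ⟨N, hN, hNU'⟩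
    · exact h
    exfalso
    have hnt : Nontrivial N := (LieSubmodule.nontrivial_iff_ne_bot K L M).mpr hN.1
    have : LieModule.IsIrreducible K L N := LieModule.IsIrreducible.mk fun N' hN' => by
      have h1 : N'.map N.incl ≤ N := by
        rintro _ ⟨x, -, rfl⟩; exact x.2
      rcases hN.le_iff.mp h1 with h2 | h2
      · exact absurd ((LieSubmodule.eq_bot_iff N').mpr fun x hx => by
          have h3 : (x : M) ∈ N'.map N.incl := ⟨x, hx, rfl⟩
          rw [h2] at h3
          exact Subtype.ext h3) hN'
      · rw [eq_top_iff]
        intro x _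
        have h3 : (x : M) ∈ N'.map N.incl := by rw [h2]; exact x.2
        obtain ⟨y, hy, hyx⟩ := h3
        rwa [← (Subtype.ext hyx : y = x)]
    have h1 : toEnd K L N (c : L) = 0 := toEnd_eq_zero_of_isNilpotent_of_mem_cartan (W := N) H (by
      obtain ⟨n, hn⟩ := hc
      refine ⟨n, LinearMap.ext fun x => Subtype.ext ?_⟩
      have h2 : ∀ n : ℕ, ((((toEnd K L N (c : L)) ^ n) x : N) : M) =
          ((toEnd K L M (c : L)) ^ n) x := by
        intro n
        induction n with
        | zero => rfl
        | succ n ih => rw [pow_succ', pow_succ', Module.End.mul_apply, Module.End.mul_apply, ← ih]; rfl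
      rw [h2, hn]; rfl)
    have h2 : N ≤ U := le_sSup (by
      intro m hm
      exact congrArg Subtype.val (LinearMap.congr_fun h1 ⟨m, hm⟩))
    exact hN.1 (le_bot_iff.mp ((le_inf h2 hNU').trans hUU'.inf_eq_bot.le))
  rw [hU'] at hUU'
  have h3 : U = ⊤ := by simpa using hUU'.sup_eq_top
  exact hU m (by rw [h3]; trivial)

include hM in
/-- If a Cartan subalgebra acts diagonalizably on the Lie algebra, it acts diagonalizably on each
completely reducible representation. -/
theorem iSup_weightSpace_eq_top
    (hL : ∀ β : H → K, ∀ x ∈ rootSpace H β, ∀ h : H, ⁅(h : L), x⁆ = β h • x) :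
    (⨆ χ : H → K, (weightSpace M χ).toSubmodule) = ⊤ := by
  -- The sum of the genuine weight spaces is a submodule because genuine root vectors shift weights.
  -- A non-zero complement would contain a genuine weight vector of its own.
  let D : LieSubmodule K L M := 
    { toSubmodule := ⨆ χ : H → K, (weightSpace M χ).toSubmodule
      lie_mem := fun {x m} hm => by
        have hx : x ∈ (⨆ χ : H → K, rootSpace H χ) := by
          rw [iSup_genWeightSpace_eq_top K H L]; trivial
        change ⁅x, m⁆ ∈ ⨆ χ : H → K, (weightSpace M χ).toSubmodule
        replace hm : m ∈ ⨆ χ : H → K, (weightSpace M χ).toSubmodule := hm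
        induction hx using LieSubmodule.iSup_induction' with
        | mem β x hx =>
          induction hm using Submodule.iSup_induction' with
          | mem χ m hm =>
            refine Submodule.mem_iSup_of_mem (β + χ) ?_
            rw [LieSubmodule.mem_toSubmodule, mem_weightSpace] at hm ⊢
            intro h
            have h1 := hm h
            have h2 := hL β x hx h
            have h3 : ⁅h, ⁅x, m⁆⁆ = ⁅(h : L), ⁅x, m⁆⁆ := rfl
            have h4 : ⁅h, m⁆ = ⁅(h : L), m⁆ := rfl
            rw [h3, leibniz_lie, h2, ← h4, h1, smul_lie, lie_smul, Pi.add_apply, add_smul]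
          | zero => simp
          | add a b _ _ ha hb => rw [lie_add]; exact Submodule.add_mem _ ha hb
        | zero => simp
        | add a b _ _ ha hb => rw [add_lie]; exact Submodule.add_mem _ ha hb }
  obtain ⟨D', hD⟩ := hM D
  have hD' : D' = ⊥ := by
    by_contra hne
    have hnt : Nontrivial D' := (LieSubmodule.nontrivial_iff_ne_bot K L M).mpr hne
    obtain ⟨χ, hχ⟩ := exists_nontrivial_weightSpace_of_isNilpotent K H D'
    obtain ⟨⟨m, hm⟩, hm0⟩ := exists_ne (0 : weightSpace D' χ)
    rw [mem_weightSpace] at hm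
    apply hm0
    apply Subtype.ext
    change m = 0
    have h1 : (m : M) ∈ D := by
      refine Submodule.mem_iSup_of_mem (χ : H → K) ?_
      rw [LieSubmodule.mem_toSubmodule, mem_weightSpace]
      intro h
      exact congrArg Subtype.val (hm h)
    have h2 : (m : M) ∈ D ⊓ D' := ⟨h1, m.2⟩
    rw [hD.inf_eq_bot] at h2
    exact Subtype.ext h2
  rw [hD'] at hD
  have h3 : D = ⊤ := by simpa using hD.sup_eq_top
  exact congrArg LieSubmodule.toSubmodule h3

end Complemented

end LieModule

namespace KostantSuper

open KostantSuper.SuperSpace (part)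
open KostantSuper.LieSuperalgebra (bracket)
open KostantSuper.LieSupermodule (act)
open scoped TensorProduct

/-! ### Gradings with a Cartan subalgebra in degree zero -/

section RootGrading

variable {g : Type*} [AddCommGroup g] [Module ℂ g] [LieSuperalgebra g]

/-- The simultaneous eigenspace of the operators `ad x`, `x ∈ H`, with eigenvalues `χ x`. -/
def eigenPart (H : Submodule ℂ g) (χ : g → ℂ) : Submodule ℂ g where
  carrier := {v | ∀ x ∈ H, bracket x v = χ x • v}
  zero_mem' := fun x _ => by simp
  add_mem' := fun {a b} ha hb x hx => by rw [map_add, ha x hx, hb x hx, smul_add]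
  smul_mem' := fun c a ha x hx => by rw [map_smul, ha x hx, smul_comm]

/-- A grading of `g` by real numbers such that the part of degree zero is an abelian even subalgebra
with diagonalizable adjoint action, which is its own centralizer, and such that the even roots
are not isotropic. -/
structure RootGrading (B : KillingForm g) (G : ℝ → Submodule ℂ g) : Prop where
  finiteDimensional : FiniteDimensional ℂ g
  internal : DirectSum.IsInternal G
  graded : ∀ t, IsGraded (G t)
  bracket_mem : ∀ s t : ℝ, ∀ x ∈ G s, ∀ y ∈ G t, bracket x y ∈ G (s + t)
  even : G 0 ≤ part 0
  abelian : ∀ x ∈ G 0, ∀ y ∈ G 0, bracket x y = 0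
  iSup_eigenPart : (⨆ t : G 0, eigenPart (G 0) (B.form t)) = ⊤
  mem_of_commute : ∀ v, (∀ x ∈ G 0, bracket x v = 0) → v ∈ G 0
  form_ne_zero : ∀ t ∈ G 0, t ≠ 0 → ∀ v ∈ eigenPart (G 0) (B.form t), v ∈ part 0 → v ≠ 0 →
    B.form t t ≠ 0
  exists_form_eq : ∀ φ : Module.Dual ℂ (G 0), ∃ t ∈ G 0, ∀ x : G 0, B.form t x = φ x

variable (B : KillingForm g)

instance : LieRingModule (part (V := g) 0) g where
  bracket x v := bracket x.1 v
  add_lie x y v := by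
    change bracket (x.1 + y.1) v = bracket x.1 v + bracket y.1 v
    rw [map_add, LinearMap.add_apply]
  lie_add x v w := map_add _ v w
  leibniz_lie x y v := by
    have h := LieSuperalgebra.bracket_jacobi x.2 y.2 v
    simp only [koszul, zero_ne_one, and_self, if_false, one_smul] at h
    exact h

instance : LieModule ℂ (part (V := g) 0) g where
  smul_lie t x v := by
    change bracket (t • x.1) v = t • bracket x.1 v
    rw [map_smul, LinearMap.smul_apply]
  lie_smul t x v := map_smul _ t v

theorem parity_cases (i : ZMod 2) : i = 0 ∨ i = 1 := by revert i; decide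

theorem koszul_zero_left (j : ZMod 2) : koszul 0 j = 1 := by simp [koszul]

theorem koszul_zero_right (j : ZMod 2) : koszul j 0 = 1 := by simp [koszul]

theorem koszul_self_one : koszul 1 1 = -1 := by simp [koszul]

namespace KillingForm

theorem apply_eq_zero_of_ne {i j : ZMod 2} (hij : i ≠ j) {x y : g} (hx : x ∈ part i)
    (hy : y ∈ part j) : B.form x y = 0 := by
  rcases parity_cases i with rfl | rfl <;> rcases parity_cases j with rfl | rfl
  · exact absurd rfl hij
  · exact B.consistent x hx y hy
  · rw [B.supersymmetric hx hy, B.consistent y hy x hx, mul_zero]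
  · exact absurd rfl hij

theorem apply_comm_of_even {x y : g} (hx : x ∈ part 0) : B.form x y = B.form y x := by
  rw [← evenProj_add_oddProj y, map_add, map_add, LinearMap.add_apply,
    B.supersymmetric hx (evenProj_mem y), B.supersymmetric hx (oddProj_mem y), koszul_zero_left,
    koszul_zero_left, one_mul, one_mul]

theorem eq_zero_of_forall_mem_part {i : ZMod 2} {x : g} (hx : x ∈ part i)
    (h : ∀ y ∈ part i, B.form x y = 0) : x = 0 := by
  refine B.nondegenerate x fun y => ?_
  rw [← evenProj_add_oddProj y, map_add]
  rcases parity_cases i with rfl | rfl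
  · rw [h _ (evenProj_mem y), B.consistent x hx _ (oddProj_mem y), add_zero]
  · rw [h _ (oddProj_mem y), B.apply_eq_zero_of_ne one_ne_zero hx (evenProj_mem y), add_zero]

end KillingForm

theorem part_inf_eq_zero {i j : ZMod 2} (hij : i ≠ j) {V : Type*} [AddCommGroup V] [Module ℂ V]
    [SuperSpace V] {x : V} (hx : x ∈ part (V := V) i) (hy : x ∈ part (V := V) j) : x = 0 := by
  have h := Submodule.disjoint_def.mp (SuperSpace.isCompl (V := V)).disjoint
  rcases parity_cases i with rfl | rfl <;> rcases parity_cases j with rfl | rfl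
  · exact absurd rfl hij
  · exact h _ hx hy
  · exact h _ hy hx
  · exact absurd rfl hij

theorem bracket_skew_of_even {x y : g} (hx : x ∈ part (V := g) 0) : bracket x y = -bracket y x := by
  rw [← evenProj_add_oddProj y, map_add, map_add, LinearMap.add_apply,
    LieSuperalgebra.bracket_skew hx (evenProj_mem y),
    LieSuperalgebra.bracket_skew hx (oddProj_mem y), koszul_zero_left,
    koszul_zero_left, one_smul, one_smul, neg_add]

theorem bracket_jacobi_of_even {x : g} (hx : x ∈ part (V := g) 0) (y z : g) :
    bracket x (bracket y z) = bracket (bracket x y) z + bracket y (bracket x z) := by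
  rw [← evenProj_add_oddProj y]
  simp only [map_add, LinearMap.add_apply]
  rw [LieSuperalgebra.bracket_jacobi hx (evenProj_mem y),
    LieSuperalgebra.bracket_jacobi hx (oddProj_mem y), koszul_zero_left, koszul_zero_left,
    one_smul, one_smul]
  abel

theorem form_bracket_of_even {x : g} (hx : x ∈ part (V := g) 0) (y z : g) :
    B.form (bracket x y) z = -B.form y (bracket x z) := by
  rw [bracket_skew_of_even hx, map_neg, LinearMap.neg_apply, B.invariant]

/-- The restriction of the form to the even part. -/
def evenForm : LinearMap.BilinForm ℂ (part (V := g) 0) :=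
  B.form.compl₁₂ (part (V := g) 0).subtype (part (V := g) 0).subtype

theorem evenForm_invariant (x y z : part (V := g) 0) :
    evenForm B ⁅x, y⁆ z = evenForm B x ⁅y, z⁆ := B.invariant x.1 y.1 z.1

theorem evenForm_nondegenerate (x : part (V := g) 0) (h : ∀ y, evenForm B x y = 0) : x = 0 :=
  Subtype.ext (B.eq_zero_of_forall_mem_part x.2 fun y hy => h ⟨y, hy⟩)

theorem evenForm_comm (x y : part (V := g) 0) : evenForm B x y = evenForm B y x :=
  B.apply_comm_of_even x.2

section Core

open LieAlgebra LieModule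

variable [FiniteDimensional ℂ g] {h : LieSubalgebra ℂ (part (V := g) 0)} [h.IsCartanSubalgebra]

/-- The Cartan subalgebra is the root space of the zero root, which is paired with itself. -/
theorem eq_zero_of_forall_evenForm_eq_zero {x : h} (hx : ∀ y : h, evenForm B x y = 0) : x = 0 := by
  by_contra hne
  have hx0 : (x : part (V := g) 0) ∈ rootSpace h (0 : h → ℂ) := by
    rw [rootSpace_zero_eq]; exact x.2
  obtain ⟨y, hy, hxy⟩ := exists_invariant_apply_ne_zero (evenForm_invariant B)
    (evenForm_nondegenerate B) hx0 (fun h0 => hne (Subtype.ext h0))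
  rw [neg_zero, rootSpace_zero_eq] at hy
  exact hxy (hx ⟨y, hy⟩)

theorem exists_evenForm_eq (φ : Module.Dual ℂ h) : ∃ t : h, ∀ x : h, evenForm B t x = φ x := by
  let F : h →ₗ[ℂ] Module.Dual ℂ h := 
    (evenForm B).compl₁₂ h.toSubmodule.subtype h.toSubmodule.subtype
  have hF : Function.Injective F := by
    rw [← LinearMap.ker_eq_bot, LinearMap.ker_eq_bot']
    exact fun x hx => eq_zero_of_forall_evenForm_eq_zero B (LinearMap.congr_fun hx)
  have hF' : Function.Surjective F := (LinearMap.injective_iff_surjective_of_finrank_eq_finrank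
    (Subspace.dual_finrank_eq).symm).mp hF
  obtain ⟨t, ht⟩ := hF' φ
  exact ⟨t, fun x => LinearMap.congr_fun ht x⟩

end Core

end RootGrading

/-! ### Root decomposition from a completely reducible representation of the even part -/

section RootGrading

variable {g : Type*} [AddCommGroup g] [Module ℂ g] [LieSuperalgebra g] (B : KillingForm g)

open LieAlgebra LieModule

theorem evenProj_mem_eigenPart {H : Submodule ℂ g} (hH : H ≤ part 0) {χ : g → ℂ} {v : g}
    (hv : v ∈ eigenPart H χ) : evenProj g v ∈ eigenPart H χ ∧ oddProj g v ∈ eigenPart H χ := by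
  have key : ∀ x ∈ H, bracket x (evenProj g v) - χ x • evenProj g v = 0 := fun x hx => by
    refine part_inf_eq_zero (i := 0) (j := 1) zero_ne_one ?_ ?_
    · refine Submodule.sub_mem _ ?_ (Submodule.smul_mem _ _ (evenProj_mem v))
      simpa using LieSuperalgebra.bracket_mem (hH hx) (evenProj_mem v)
    · have h1 : bracket x (evenProj g v) - χ x • evenProj g v =
          -(bracket x (oddProj g v) - χ x • oddProj g v) := by
        have h2 := hv x hx
        rw [← evenProj_add_oddProj v, map_add, smul_add] at h2
        linear_combination (norm := module) h2
      rw [h1]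
      refine Submodule.neg_mem _ (Submodule.sub_mem _ ?_ (Submodule.smul_mem _ _ (oddProj_mem v)))
      simpa using LieSuperalgebra.bracket_mem (hH hx) (oddProj_mem v)
  have h0 : evenProj g v ∈ eigenPart H χ := fun x hx => sub_eq_zero.mp (key x hx)
  refine ⟨h0, ?_⟩
  have h1 : oddProj g v = v - evenProj g v := by
    rw [eq_sub_iff_add_eq, add_comm]; exact evenProj_add_oddProj v
  rw [h1]
  exact Submodule.sub_mem _ hv h0

theorem bracket_mem_eigenPart {H : Submodule ℂ g} (hH : H ≤ part 0) {χ ψ : g → ℂ} {v w : g}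
    (hv : v ∈ eigenPart H χ) (hw : w ∈ eigenPart H ψ) : bracket v w ∈ eigenPart H (χ + ψ) := by
  intro x hx
  rw [bracket_jacobi_of_even (hH hx), hv x hx, hw x hx, map_smul, map_smul, LinearMap.smul_apply,
    Pi.add_apply, add_smul]

variable {h : LieSubalgebra ℂ (part (V := g) 0)} [h.IsCartanSubalgebra]

theorem mem_rootSpace_of_forall {β : h → ℂ} {v : part (V := g) 0}
    (hv : ∀ x : h, ⁅(x : part (V := g) 0), v⁆ = β x • v) : v ∈ rootSpace h β :=
  weightSpace_le_genWeightSpace _ β ((mem_weightSpace β v).mpr hv)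

variable [FiniteDimensional ℂ g]

variable {M : Type*} [AddCommGroup M] [Module ℂ M] [LieRingModule (part (V := g) 0) M]
  [LieModule ℂ (part (V := g) 0) M] [FiniteDimensional ℂ M]

section

variable (hM : ∀ c : h, _root_.IsNilpotent (toEnd ℂ (part (V := g) 0) M (c : part (V := g) 0)) → c = 0)

include B hM in
-- For β = 0 this is the commutativity of the Cartan subalgebra; for β ≠ 0 it holds because root
-- spaces are lines.
theorem lie_eq_smul_of_mem_rootSpace {β : h → ℂ} {x : part (V := g) 0} (hx : x ∈ rootSpace h β)
    (y : h) : ⁅(y : part (V := g) 0), x⁆ = β y • x := by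
  by_cases hβ : β = 0
  · subst hβ
    rw [rootSpace_zero_eq] at hx
    have h1 := lie_eq_zero_of_mem_cartan hM y ⟨x, hx⟩
    rw [Pi.zero_apply, zero_smul]
    exact congrArg Subtype.val h1
  · by_cases hne : rootSpace h β = ⊥
    · rw [hne, LieSubmodule.mem_bot] at hx
      rw [hx, lie_zero, smul_zero]
    · exact (exists_rootSpace_eq (evenForm_invariant B) (evenForm_nondegenerate B)
        (evenForm_comm B) hM hβ hne).2.1 x hx y

include B hM in
/-- Odd root spaces of even roots vanish, if the odd part is spanned by weight vectors. -/
theorem eq_zero_of_mem_part_one_of_rootSpace_ne_bot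
    (htop : (⨆ χ : g → ℂ, eigenPart (h.toSubmodule.map (part (V := g) 0).subtype) χ) = ⊤)
    {β : h → ℂ} (hβ : β ≠ 0) (hne : rootSpace h β ≠ ⊥) {u : g} (hu : u ∈ part 1)
    (hu' : ∀ x : h, bracket (x : g) u = β x • u) : u = 0 := by
  have hHp : h.toSubmodule.map (part (V := g) 0).subtype ≤ part 0 := by
    rintro _ ⟨x, -, rfl⟩; exact x.2
  have hmem : ∀ x : h, (x : g) ∈ h.toSubmodule.map (part (V := g) 0).subtype :=
    fun x => ⟨x, x.2, rfl⟩
  obtain ⟨⟨t, ht, hβt⟩, -, h2⟩ := exists_rootSpace_eq (evenForm_invariant B)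
    (evenForm_nondegenerate B) (evenForm_comm B) hM hβ hne
  by_contra hu0
  -- An odd weight vector v paired with u has weight -β, so [u, v] lies in the Cartan subalgebra and
  -- equals B(u, v) t, where t represents β.
  obtain ⟨χ, v, hv, hv1, huv⟩ : ∃ χ, ∃ v ∈ eigenPart (h.toSubmodule.map (part (V := g) 0).subtype) χ,
      v ∈ part 1 ∧ B.form u v ≠ 0 := by
    by_contra! hcon
    apply hu0
    refine B.nondegenerate u fun y => ?_
    have hy : y ∈ (⨆ χ : g → ℂ, eigenPart (h.toSubmodule.map (part (V := g) 0).subtype) χ) := by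
      rw [htop]; trivial
    induction hy using Submodule.iSup_induction' with
    | mem χ y hy =>
      rw [← evenProj_add_oddProj y, map_add, B.apply_eq_zero_of_ne one_ne_zero hu (evenProj_mem y),
        zero_add]
      exact hcon χ _ (evenProj_mem_eigenPart hHp hy).2 (oddProj_mem y)
    | zero => exact map_zero _
    | add a b _ _ ha hb => rw [map_add, ha, hb, add_zero]
  have hβχ : ∀ x : h, β x + χ x = 0 := fun x => by
    have h3 := form_bracket_of_even B (x : part (V := g) 0).2 u v
    rw [hu' x, hv _ (hmem x), map_smul, map_smul, LinearMap.smul_apply, smul_eq_mul, smul_eq_mul] at h3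
    have h4 : (β x + χ x) * B.form u v = 0 := by linear_combination h3
    exact (mul_eq_zero.mp h4).resolve_right huv
  have huv0 : bracket u v ∈ part (V := g) 0 := LieSuperalgebra.bracket_mem hu hv1
  have huvh : (⟨bracket u v, huv0⟩ : part (V := g) 0) ∈ h := by
    rw [← LieSubalgebra.mem_toLieSubmodule, ← rootSpace_zero_eq]
    refine mem_rootSpace_of_forall fun x => Subtype.ext ?_
    change bracket (x : g) (bracket u v) = ((0 : ℂ) • (⟨bracket u v, huv0⟩ : part (V := g) 0) : part (V := g) 0)
    rw [bracket_jacobi_of_even (x : part (V := g) 0).2, hu', hv _ (hmem x), map_smul, map_smul,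
      LinearMap.smul_apply, ← add_smul, hβχ]
    simp
  have huvt : (⟨⟨bracket u v, huv0⟩, huvh⟩ : h) = B.form u v • t := by
    rw [← sub_eq_zero]
    refine eq_zero_of_forall_evenForm_eq_zero B fun x => ?_
    change B.form (bracket u v - B.form u v • (t : g)) (x : g) = 0
    have h3 : B.form (t : g) (x : g) = β x := ht x
    have h4 : B.form v (bracket (x : g) u) = β x * B.form v u := by
      rw [hu', map_smul, smul_eq_mul]
    rw [map_sub, map_smul, LinearMap.sub_apply, LinearMap.smul_apply, h3, B.invariant,
      ← neg_eq_iff_eq_neg.mpr (bracket_skew_of_even (x : part (V := g) 0).2 (y := v)),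
      hv _ (hmem x), map_neg, map_smul, smul_eq_mul, smul_eq_mul]
    linear_combination (-B.form u v) * hβχ x
  have huu0 : bracket u u ∈ part (V := g) 0 := LieSuperalgebra.bracket_mem hu hu
  -- [u, u] is even of weight 2β, and twice an even root is not an even root.
  have huu : bracket u u = 0 := by
    have h3 : (⟨bracket u u, huu0⟩ : part (V := g) 0) ∈ rootSpace h ((0 + 2) • β) := by
      refine mem_rootSpace_of_forall fun x => Subtype.ext ?_
      change bracket (x : g) (bracket u u) = _
      rw [bracket_jacobi_of_even (x : part (V := g) 0).2, hu', map_smul, map_smul,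
        LinearMap.smul_apply, ← add_smul]
      change _ = (((0 + 2) • β) x) • bracket u u
      rw [zero_add, two_nsmul, Pi.add_apply]
    rw [h2 0, LieSubmodule.mem_bot] at h3
    exact congrArg Subtype.val h3
  -- With [u, u] = 0 the Jacobi identity says 2 [u, [u, v]] = 0, while [[u, v], u] = B(u, v) β(t) u
  -- with β(t) ≠ 0.
  have hjac := LieSuperalgebra.bracket_jacobi hu hu v
  have h5 : bracket (bracket u v) u = (B.form u v * β t) • u := by
    have h6 : bracket u v = ((B.form u v • t : h) : g) := by rw [← huvt]
    rw [h6]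
    change bracket (B.form u v • (t : g)) u = _
    rw [map_smul, LinearMap.smul_apply, hu', smul_smul]
  rw [huu, koszul_self_one, map_zero, LinearMap.zero_apply, zero_add,
    ← neg_eq_iff_eq_neg.mpr (bracket_skew_of_even huv0), h5] at hjac
  have h6 : (2 * (B.form u v * β t)) • u = 0 := by
    linear_combination (norm := module) -hjac
  rcases smul_eq_zero.mp h6 with h7 | h7
  · rcases mul_eq_zero.mp h7 with h8 | h8
    · exact two_ne_zero h8
    · exact mul_ne_zero huv hβt h8
  · exact hu0 h7

end

/-- The root decomposition in terms of a grading, when the even part is reductive in the sense that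
it has a faithful completely reducible representation. -/
theorem RootGrading.of_completelyReducible {G : ℝ → Submodule ℂ g}
    (hint : DirectSum.IsInternal G) (hgr : ∀ t, IsGraded (G t))
    (hbr : ∀ s t : ℝ, ∀ x ∈ G s, ∀ y ∈ G t, bracket x y ∈ G (s + t))
    (hG : G 0 = h.toSubmodule.map (part (V := g) 0).subtype)
    (hM : ∀ c : h, _root_.IsNilpotent (toEnd ℂ (part (V := g) 0) M (c : part (V := g) 0)) → c = 0)
    (hdiag : (∀ β : h → ℂ, ∀ x ∈ rootSpace h β, ∀ y : h, ⁅(y : part (V := g) 0), x⁆ = β y • x) →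
      part (V := g) 1 ≤ ⨆ χ : g → ℂ, eigenPart (G 0) χ)
    (hcent : ∀ x ∈ part (V := g) 1, (∀ y ∈ part (V := g) 0, bracket y x = 0) → x = 0) :
    RootGrading B G := by
  have hHp : G 0 ≤ part 0 := by
    rw [hG]; rintro _ ⟨x, -, rfl⟩; exact x.2
  have hmem : ∀ x : h, (x : g) ∈ G 0 := by
    rw [hG]; exact fun x => ⟨x, x.2, rfl⟩
  have hmem' : ∀ x ∈ G 0, ∃ y : h, (y : g) = x := by
    rw [hG]; rintro _ ⟨x, hx, rfl⟩; exact ⟨⟨x, hx⟩, rfl⟩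
  have hL : ∀ β : h → ℂ, ∀ x ∈ rootSpace h β, ∀ y : h, ⁅(y : part (V := g) 0), x⁆ = β y • x :=
    fun β x hx y => lie_eq_smul_of_mem_rootSpace B hM hx y
  have hab : ∀ x ∈ G 0, ∀ y ∈ G 0, bracket x y = 0 := fun x hx y hy => by
    obtain ⟨x, rfl⟩ := hmem' x hx
    obtain ⟨y, rfl⟩ := hmem' y hy
    have h1 := lie_eq_zero_of_mem_cartan hM x y
    exact congrArg (fun z : h => (z : g)) h1
  have heven : ∀ y : part (V := g) 0, y ∈ ⨆ β : h → ℂ, rootSpace h β := fun y => by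
    rw [iSup_genWeightSpace_eq_top ℂ h (part (V := g) 0)]; trivial
  have htop : (⨆ χ : g → ℂ, eigenPart (G 0) χ) = ⊤ := by
    rw [eq_top_iff, ← (SuperSpace.isCompl (V := g)).sup_eq_top]
    refine sup_le ?_ (hdiag hL)
    intro y hy
    have hy' := heven ⟨y, hy⟩
    have key : ∀ y : part (V := g) 0, y ∈ (⨆ β : h → ℂ, rootSpace h β) →
        (y : g) ∈ ⨆ χ : g → ℂ, eigenPart (G 0) χ := by
      intro y hy
      induction hy using LieSubmodule.iSup_induction' with
      | mem β y hy =>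
        classical
        -- `eigenPart` takes functions on all of g; β is extended by zero outside the Cartan
        -- subalgebra, where the values do not matter.
        refine Submodule.mem_iSup_of_mem
          (fun x => if hx : ∃ z : h, (z : g) = x then β hx.choose else 0) fun x hx => ?_
        have hx' := hmem' x hx
        have h1 := congrArg Subtype.val (hL β y hy hx'.choose)
        change _ = (if hx : ∃ z : h, (z : g) = x then β hx.choose else 0) • (y : g)
        rw [dif_pos hx']
        change bracket ((hx'.choose : h) : g) (y : g) = β hx'.choose • (y : g) at h1
        rwa [hx'.choose_spec] at h1
      | zero => exact Submodule.zero_mem _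
      | add a b _ _ ha hb => exact Submodule.add_mem _ ha hb
    exact key _ hy'
  refine ⟨inferInstance, hint, hgr, hbr, hHp, hab, ?_, ?_, ?_, ?_⟩
  · rw [eq_top_iff, ← htop]
    refine iSup_le fun χ v hv => ?_
    by_cases hv0 : v = 0
    · rw [hv0]; exact Submodule.zero_mem _
    -- The eigenvalue function χ of v was not assumed linear. On 𝔥 it equals the linear functional x
    -- ↦ f([x, v]) / f(v), which the form represents by some t.
    obtain ⟨f, hf⟩ := Module.Projective.exists_dual_ne_zero ℂ hv0
    obtain ⟨t, ht⟩ := exists_evenForm_eq B (h := h)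
      ((f v)⁻¹ • (f ∘ₗ (bracket.flip v) ∘ₗ (part (V := g) 0).subtype ∘ₗ h.toSubmodule.subtype))
    refine Submodule.mem_iSup_of_mem ⟨(t : g), hmem t⟩ fun x hx => ?_
    obtain ⟨y, rfl⟩ := hmem' x hx
    have h1 : B.form (t : g) (y : g) = (f v)⁻¹ * f (bracket (y : g) v) := ht y
    rw [hv _ (hmem y), map_smul, smul_eq_mul, mul_comm, mul_assoc, mul_inv_cancel₀ hf, mul_one] at h1
    rw [hv _ (hmem y), ← h1]
  · intro v hv
    have hv' : v ∈ eigenPart (G 0) 0 := fun x hx => by rw [hv x hx, Pi.zero_apply, zero_smul]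
    obtain ⟨hv0, hv1⟩ := evenProj_mem_eigenPart hHp hv'
    -- An odd vector of weight zero is killed by 𝔥, and also by even root vectors, since the bracket
    -- would be an odd vector whose weight is an even root. So it commutes with the whole even part.
    have h1 : oddProj g v = 0 := by
      refine hcent _ (oddProj_mem v) fun y hy => ?_
      have hy' := heven ⟨y, hy⟩
      have key : ∀ y : part (V := g) 0, y ∈ (⨆ β : h → ℂ, rootSpace h β) →
          bracket (y : g) (oddProj g v) = 0 := by
        intro y hy
        induction hy using LieSubmodule.iSup_induction' with
        | mem β y hy =>
          by_cases hβ : β = 0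
          · rw [hβ, rootSpace_zero_eq] at hy
            have h2 := hv1 _ (hmem ⟨y, hy⟩)
            rwa [Pi.zero_apply, zero_smul] at h2
          by_cases hy0 : y = 0
          · rw [hy0]; simp
          refine eq_zero_of_mem_part_one_of_rootSpace_ne_bot B hM (by rw [← hG]; exact htop) hβ
            (fun h0 => hy0 ?_) ?_ fun x => ?_
          · rwa [h0, LieSubmodule.mem_bot] at hy
          · simpa using LieSuperalgebra.bracket_mem y.2 (oddProj_mem v)
          · have h2 := hv1 _ (hmem x)
            rw [Pi.zero_apply, zero_smul] at h2
            have h3 : bracket (x : g) (y : g) = β x • (y : g) := congrArg Subtype.val (hL β y hy x)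
            rw [bracket_jacobi_of_even (x : part (V := g) 0).2, h2, h3, map_zero, add_zero, map_smul,
              LinearMap.smul_apply]
        | zero => simp
        | add a b _ _ ha hb =>
          change bracket ((a : g) + (b : g)) _ = 0
          rw [map_add, LinearMap.add_apply, ha, hb, add_zero]
      exact key _ hy'
    rw [← evenProj_add_oddProj v, h1, add_zero]
    have h2 : (⟨evenProj g v, evenProj_mem v⟩ : part (V := g) 0) ∈ h := by
      rw [← LieSubalgebra.mem_toLieSubmodule, ← rootSpace_zero_eq]
      refine mem_rootSpace_of_forall fun x => Subtype.ext ?_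
      have h3 := hv0 _ (hmem x)
      exact h3
    exact hmem ⟨_, h2⟩
  · intro t ht ht0 v hv hv0 hvne
    obtain ⟨t, rfl⟩ := hmem' t ht
    have hv1 : (⟨v, hv0⟩ : part (V := g) 0) ∈ rootSpace h (fun x : h => B.form (t : g) (x : g)) :=
      mem_rootSpace_of_forall fun x => Subtype.ext (hv _ (hmem x))
    obtain ⟨⟨t', ht', hβt⟩, -, h2⟩ := exists_rootSpace_eq (evenForm_invariant B)
      (evenForm_nondegenerate B) (evenForm_comm B) hM
      (α := fun x : h => B.form (t : g) (x : g)) (fun h0 => ht0 (by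
        have h3 : t = 0 := eq_zero_of_forall_evenForm_eq_zero B (congrFun h0)
        rw [h3]; rfl)) (fun h0 => hvne (by
        rw [h0, LieSubmodule.mem_bot] at hv1
        exact congrArg Subtype.val hv1))
    have h3 : t' - t = 0 := eq_zero_of_forall_evenForm_eq_zero B fun y => by
      have h4 := ht' y
      change B.form ((t' : g) - (t : g)) (y : g) = 0
      rw [map_sub, LinearMap.sub_apply, sub_eq_zero]
      exact h4
    rw [sub_eq_zero] at h3
    rw [h3] at hβt
    exact hβt
  · intro φ
    obtain ⟨t, ht⟩ := exists_evenForm_eq B (h := h) (φ ∘ₗ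
      ((part (V := g) 0).subtype ∘ₗ h.toSubmodule.subtype).codRestrict (G 0) hmem)
    refine ⟨t, hmem t, fun x => ?_⟩
    obtain ⟨y, hy⟩ := hmem' x x.2
    have h1 : x = ⟨(y : g), hmem y⟩ := Subtype.ext hy.symm
    rw [h1]
    exact ht y

end RootGrading

/-! ### The root decomposition of basic classical Lie superalgebras -/

section BasicCase

variable {g : Type*} [AddCommGroup g] [Module ℂ g] [LieSuperalgebra g]

open LieAlgebra LieModule

/-- The line spanned by x is a graded ideal, and it cannot be everything because g is not abelian.
-/
theorem IsBasicClassical.eq_zero_of_central (hg : IsBasicClassical g) {i : ZMod 2} {x : g} (hx : x ∈ part i)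
    (h : ∀ y, bracket y x = 0) : x = 0 := by
  rcases hg.simple (Submodule.span ℂ {x}) (by
    intro y hy
    obtain ⟨t, rfl⟩ := Submodule.mem_span_singleton.mp hy
    rcases parity_cases i with rfl | rfl
    · exact Submodule.mem_sup_left ⟨hy, Submodule.smul_mem _ _ hx⟩
    · exact Submodule.mem_sup_right ⟨hy, Submodule.smul_mem _ _ hx⟩) (by
    intro y z hz
    obtain ⟨t, rfl⟩ := Submodule.mem_span_singleton.mp hz
    rw [map_smul, h, smul_zero]
    exact Submodule.zero_mem _) with h1 | h1
  · exact Submodule.span_singleton_eq_bot.mp h1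
  · exfalso
    obtain ⟨y, z, hyz⟩ := hg.nonabelian
    have hz : z ∈ Submodule.span ℂ {x} := by rw [h1]; trivial
    obtain ⟨t, rfl⟩ := Submodule.mem_span_singleton.mp hz
    rw [map_smul, h, smul_zero] at hyz
    exact hyz rfl

variable (g) in
/-- The odd part as a representation of the even part. -/
def oddModule : LieSubmodule ℂ (part (V := g) 0) g where
  toSubmodule := part 1
  lie_mem := fun {x m} hm => by
    have h := LieSuperalgebra.bracket_mem x.2 hm
    rw [zero_add] at h
    exact h

theorem IsBasicClassical.exists_isCompl (hg : IsBasicClassical g)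
    (N : LieSubmodule ℂ (part (V := g) 0) (oddModule g)) :
    ∃ N' : LieSubmodule ℂ (part (V := g) 0) (oddModule g), IsCompl N N' := by
  obtain ⟨W', h1, h2, h3, h4⟩ := hg.classical (N.toSubmodule.map (oddModule g).toSubmodule.subtype)
    (by rintro _ ⟨x, -, rfl⟩; exact x.2)
    (by rintro x hx _ ⟨y, hy, rfl⟩
        exact ⟨⟨bracket x y, (oddModule g).lie_mem (x := ⟨x, hx⟩) y.2⟩,
          N.lie_mem (x := ⟨x, hx⟩) hy, rfl⟩)
  refine ⟨⟨W'.comap (oddModule g).toSubmodule.subtype, fun {x m} hm => h2 x x.2 m hm⟩, ?_⟩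
  rw [isCompl_iff, disjoint_iff, codisjoint_iff]
  constructor
  · rw [LieSubmodule.eq_bot_iff]
    intro x hx
    have h5 : (x : g) ∈ N.toSubmodule.map (oddModule g).toSubmodule.subtype ⊓ W' :=
      ⟨⟨x, hx.1, rfl⟩, hx.2⟩
    rw [h3] at h5
    exact Subtype.ext h5
  · rw [← LieSubmodule.toSubmodule_inj, LieSubmodule.sup_toSubmodule, LieSubmodule.top_toSubmodule,
      Submodule.eq_top_iff']
    intro x
    have h5 : (x : g) ∈ N.toSubmodule.map (oddModule g).toSubmodule.subtype ⊔ W' := by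
      rw [h4]; exact x.2
    obtain ⟨_, ⟨a, ha, rfl⟩, b, hb, hab⟩ := Submodule.mem_sup.mp h5
    refine Submodule.mem_sup.mpr ⟨a, ha, ⟨b, h1 hb⟩, hb, Subtype.ext hab⟩

/-- The odd part is a completely reducible representation of the even part, and it is faithful by
simplicity unless g is purely even; in the latter case the adjoint representation takes its place.
-/
theorem IsBasicClassical.rootGrading (hg : IsBasicClassical g) (B : KillingForm g) {G : ℝ → Submodule ℂ g}
    {h : LieSubalgebra ℂ (part (V := g) 0)} (hh : h.IsCartanSubalgebra)
    (hint : DirectSum.IsInternal G) (hgr : ∀ t, IsGraded (G t))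
    (hbr : ∀ s t : ℝ, ∀ x ∈ G s, ∀ y ∈ G t, bracket x y ∈ G (s + t))
    (hG : G 0 = h.toSubmodule.map (part (V := g) 0).subtype) : RootGrading B G := by
  have hfin := hg.finiteDimensional
  -- If x commutes with the even part, then for odd y the even element [y, x] is orthogonal to every
  -- even z, as B([y, x], z) = B(y, [x, z]) = 0. So x is central.
  have hcent : ∀ x ∈ part (V := g) 1, (∀ y ∈ part (V := g) 0, bracket y x = 0) → x = 0 := by
    intro x hx h0
    refine hg.eq_zero_of_central hx fun y => ?_
    rw [← evenProj_add_oddProj y, map_add, LinearMap.add_apply, h0 _ (evenProj_mem y), zero_add]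
    refine B.eq_zero_of_forall_mem_part (LieSuperalgebra.bracket_mem (oddProj_mem y) hx)
      fun z hz => ?_
    rw [B.invariant, ← neg_eq_iff_eq_neg.mpr (bracket_skew_of_even hz), h0 z hz, neg_zero, map_zero]
  have hdiag : (∀ β : h → ℂ, ∀ x ∈ rootSpace h β, ∀ y : h, ⁅(y : part (V := g) 0), x⁆ = β y • x) →
      part (V := g) 1 ≤ ⨆ χ : g → ℂ, eigenPart (G 0) χ := by
    intro hL x hx
    have h1 : (⟨x, hx⟩ : oddModule g) ∈ ⨆ χ : h → ℂ, (weightSpace (oddModule g) χ).toSubmodule := by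
      rw [iSup_weightSpace_eq_top hg.exists_isCompl hL]; trivial
    have key : ∀ x : oddModule g, x ∈ (⨆ χ : h → ℂ, (weightSpace (oddModule g) χ).toSubmodule) →
        (x : g) ∈ ⨆ χ : g → ℂ, eigenPart (G 0) χ := by
      intro x hx
      induction hx using Submodule.iSup_induction' with
      | mem χ m hm =>
        classical
        rw [LieSubmodule.mem_toSubmodule, mem_weightSpace] at hm
        refine Submodule.mem_iSup_of_mem
          (fun x => if hx : ∃ z : h, (z : g) = x then χ hx.choose else 0) fun x hx => ?_
        have hx' : ∃ z : h, (z : g) = x := by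
          rw [hG] at hx
          obtain ⟨z, hz, rfl⟩ := hx
          exact ⟨⟨z, hz⟩, rfl⟩
        have h1 := congrArg Subtype.val (hm hx'.choose)
        change _ = (if hx : ∃ z : h, (z : g) = x then χ hx.choose else 0) • (m : g)
        rw [dif_pos hx']
        change bracket ((hx'.choose : h) : g) (m : g) = χ hx'.choose • (m : g) at h1
        rwa [hx'.choose_spec] at h1
      | zero => exact Submodule.zero_mem _
      | add a b _ _ ha hb => exact Submodule.add_mem _ ha hb
    exact key _ h1
  -- the kernel of the action on the odd part
  let I : Submodule ℂ g := 
    { carrier := {x | x ∈ part 0 ∧ ∀ y ∈ part (V := g) 1, bracket x y = 0}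
      zero_mem' := ⟨Submodule.zero_mem _, by simp⟩
      add_mem' := fun {a b} ha hb => ⟨Submodule.add_mem _ ha.1 hb.1, fun y hy => by
        rw [map_add, LinearMap.add_apply, ha.2 y hy, hb.2 y hy, add_zero]⟩
      smul_mem' := fun t a ha => ⟨Submodule.smul_mem _ _ ha.1, fun y hy => by
        rw [map_smul, LinearMap.smul_apply, ha.2 y hy, smul_zero]⟩ }
  rcases hg.simple I (fun x hx => Submodule.mem_sup_left ⟨hx, hx.1⟩) (by
    intro x y hy
    rw [← evenProj_add_oddProj x, map_add, LinearMap.add_apply]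
    refine Submodule.add_mem _ ⟨?_, fun z hz => ?_⟩ ?_
    · simpa using LieSuperalgebra.bracket_mem (evenProj_mem x) hy.1
    · have h1 := bracket_jacobi_of_even (evenProj_mem x) y z
      rw [hy.2 z hz, map_zero, hy.2 _ (by
        simpa using LieSuperalgebra.bracket_mem (evenProj_mem x) hz), add_zero] at h1
      exact h1.symm
    · have h1 := bracket_skew_of_even hy.1 (y := oddProj g x)
      rw [hy.2 _ (oddProj_mem x)] at h1
      rw [neg_eq_zero.mp h1.symm]
      exact Submodule.zero_mem _) with hI | hI
  -- Here the odd part is a faithful representation.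
  · refine RootGrading.of_completelyReducible (M := oddModule g) B hint hgr hbr hG (fun c hc => ?_)
      hdiag hcent
    have h1 := lie_eq_zero_of_isNilpotent_of_mem_cartan hg.exists_isCompl hc
    have h2 : (c : g) ∈ I := ⟨(c : part (V := g) 0).2, fun y hy => congrArg Subtype.val (h1 ⟨y, hy⟩)⟩
    rw [hI] at h2
    exact Subtype.ext (Subtype.ext h2)
  -- Here the odd part is zero, so g is a simple Lie algebra and its adjoint representation is
  -- completely reducible and faithful.
  · have hodd : ∀ x ∈ part (V := g) 1, x = 0 := fun x hx => by
      have h1 : x ∈ I := by rw [hI]; trivial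
      exact part_inf_eq_zero zero_ne_one h1.1 hx
    refine RootGrading.of_completelyReducible (M := part (V := g) 0) B hint hgr hbr hG (fun c hc => ?_)
      hdiag hcent
    have h1 := lie_eq_zero_of_isNilpotent_of_mem_cartan (fun N => ?_) hc
    · refine Subtype.ext (Subtype.ext (hg.eq_zero_of_central (c : part (V := g) 0).2 fun y => ?_))
      rw [← neg_eq_iff_eq_neg.mpr (bracket_skew_of_even (c : part (V := g) 0).2), 
        ← evenProj_add_oddProj y, hodd _ (oddProj_mem y), add_zero, neg_eq_zero]
      exact congrArg Subtype.val (h1 ⟨_, evenProj_mem y⟩)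
    · rcases hg.simple (N.toSubmodule.map (part (V := g) 0).subtype) (by
        rintro _ ⟨x, hx, rfl⟩
        exact Submodule.mem_sup_left ⟨⟨x, hx, rfl⟩, x.2⟩) (by
        rintro x _ ⟨y, hy, rfl⟩
        rw [← evenProj_add_oddProj x, hodd _ (oddProj_mem x), add_zero]
        exact ⟨⁅(⟨_, evenProj_mem x⟩ : part (V := g) 0), y⁆, N.lie_mem hy, rfl⟩) with h | h
      · refine ⟨⊤, ?_⟩
        have : N = ⊥ := by
          rw [LieSubmodule.eq_bot_iff]
          intro x hx
          have h2 : (x : g) ∈ N.toSubmodule.map (part (V := g) 0).subtype := ⟨x, hx, rfl⟩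
          rw [h] at h2
          exact Subtype.ext h2
        rw [this]; exact isCompl_bot_top
      · refine ⟨⊥, ?_⟩
        have : N = ⊤ := by
          rw [eq_top_iff]
          intro x _
          have h2 : (x : g) ∈ N.toSubmodule.map (part (V := g) 0).subtype := by rw [h]; trivial
          obtain ⟨y, hy, hyx⟩ := h2
          rwa [← (Subtype.ext hyx : y = x)]
        rw [this]; exact isCompl_top_bot

end BasicCase

/-! ### Representations by block diagonal matrices -/

section MatrixRep

open LieAlgebra LieModule

attribute [local instance] LieRing.ofAssociativeRing

variable {L : Type*} [LieRing L] [LieAlgebra ℂ L] {I : Type} [Fintype I] [DecidableEq I]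

/-- The space of column vectors, as a representation of `L` by matrices. -/
def MatrixRep (_ρ : L →ₗ⁅ℂ⁆ Matrix I I ℂ) : Type := I → ℂ

variable (ρ : L →ₗ⁅ℂ⁆ Matrix I I ℂ)

instance : AddCommGroup (MatrixRep ρ) := inferInstanceAs (AddCommGroup (I → ℂ))

instance : Module ℂ (MatrixRep ρ) := inferInstanceAs (Module ℂ (I → ℂ))

instance : FiniteDimensional ℂ (MatrixRep ρ) := inferInstanceAs (FiniteDimensional ℂ (I → ℂ))

instance : LieRingModule L (MatrixRep ρ) where
  bracket x v := (ρ x).mulVec v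
  add_lie x y v := (congrArg (fun A => Matrix.mulVec A v) (map_add ρ x y)).trans
    (Matrix.add_mulVec _ _ _)
  lie_add x v w := Matrix.mulVec_add _ v w
  leibniz_lie x y v := by
    have h : ∀ v : I → ℂ, (ρ x).mulVec ((ρ y).mulVec v) =
        (ρ ⁅x, y⁆).mulVec v + (ρ y).mulVec ((ρ x).mulVec v) := fun v => by
      rw [LieHom.map_lie, Ring.lie_def, Matrix.sub_mulVec, Matrix.mulVec_mulVec,
        Matrix.mulVec_mulVec, sub_add_cancel]
    exact h v

instance : LieModule ℂ L (MatrixRep ρ) where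
  smul_lie t x v := (congrArg (fun A => Matrix.mulVec A v) (map_smul ρ t x)).trans
    (Matrix.smul_mulVec _ _ _)
  lie_smul t _ v := Matrix.mulVec_smul _ t v

variable {ρ}

/-- A representation by matrices whose image is a full set of block diagonal matrices is completely
reducible. -/
theorem MatrixRep.exists_isCompl (π : I → ZMod 2) (h1 : ∀ x r c, π r ≠ π c → ρ x r c = 0)
    (h2 : ∀ r c, π r = π c → ∃ x, ρ x = Matrix.single r c 1)
    (N : LieSubmodule ℂ L (MatrixRep ρ)) : ∃ N' : LieSubmodule ℂ L (MatrixRep ρ), IsCompl N N' := by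
  let S : Submodule ℂ (I → ℂ) := N.toSubmodule
  have hS : ∀ x, ∀ v ∈ S, (ρ x).mulVec v ∈ S := fun x v hv => N.lie_mem (x := x) hv
  have h3 : ∀ v ∈ S, ∀ r c, π r = π c → v c ≠ 0 → (Pi.single r 1 : I → ℂ) ∈ S :=
    fun v hv r c hrc hvc => by
      obtain ⟨x, hx⟩ := h2 r c hrc
      have h4 := S.smul_mem (v c)⁻¹ (hS x v hv)
      rw [hx, Matrix.single_mulVec, one_mul] at h4
      convert h4 using 1
      ext s
      by_cases hs : s = r
      · subst hs; simp [hvc]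
      · simp [hs]
  have h3' : ∀ v ∈ S, ∀ r, v r ≠ 0 → (Pi.single r 1 : I → ℂ) ∈ S := fun v hv r => h3 v hv r r rfl
  -- A submodule contains, along with a vector, the unit vectors of all its non-zero coordinates. It
  -- is thus a coordinate subspace, and the complementary coordinate subspace is stable because unit
  -- vectors within a block move into each other.
  let S' : Submodule ℂ (I → ℂ) :=
    { carrier := {v | ∀ r, (Pi.single r 1 : I → ℂ) ∈ S → v r = 0}
      zero_mem' := fun r _ => rfl
      add_mem' := fun {a b} ha hb r hr => by rw [Pi.add_apply, ha r hr, hb r hr, add_zero]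
      smul_mem' := fun t a ha r hr => by rw [Pi.smul_apply, ha r hr, smul_zero] }
  have hS' : ∀ x, ∀ v ∈ S', (ρ x).mulVec v ∈ S' := fun x v hv r hr => by
    change ∑ c, ρ x r c * v c = 0
    refine Finset.sum_eq_zero fun c _ => ?_
    by_cases hrc : π r = π c
    · rw [hv c (h3 _ hr c r hrc.symm (by simp)), mul_zero]
    · rw [h1 x r c hrc, zero_mul]
  have hdisj : S ⊓ S' = ⊥ := by
    rw [Submodule.eq_bot_iff]
    rintro v ⟨hv, hv'⟩
    funext r
    by_contra hne
    exact hne (hv' r (h3' v hv r hne))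
  have hsup : S ⊔ S' = ⊤ := by
    rw [Submodule.eq_top_iff']
    intro v
    rw [pi_eq_sum_univ' v]
    refine Submodule.sum_mem _ fun r _ => Submodule.smul_mem _ _ ?_
    by_cases hr : (Pi.single r 1 : I → ℂ) ∈ S
    · exact Submodule.mem_sup_left hr
    · refine Submodule.mem_sup_right fun s hs => ?_
      exact Pi.single_eq_of_ne (by rintro rfl; exact hr hs) _
  refine ⟨⟨S', fun {x v} hv => hS' x v hv⟩, ?_⟩
  rw [isCompl_iff, disjoint_iff, codisjoint_iff]
  exact ⟨LieSubmodule.toSubmodule_inj _ _ |>.mp hdisj, LieSubmodule.toSubmodule_inj _ _ |>.mp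
    ((LieSubmodule.sup_toSubmodule _ _).trans hsup)⟩

/-- The simultaneous eigenspaces of the matrices `ρ y`. -/
def matrixEigen (ρ : L →ₗ⁅ℂ⁆ Matrix I I ℂ) {H : LieSubalgebra ℂ L} (χ : H → ℂ) : Submodule ℂ (I → ℂ) where
  carrier := {v | ∀ y : H, (ρ y).mulVec v = χ y • v}
  zero_mem' := fun y => by simp
  add_mem' := fun {a b} ha hb y => by rw [Matrix.mulVec_add, ha y, hb y, smul_add]
  smul_mem' := fun t a ha y => by rw [Matrix.mulVec_smul, ha y, smul_comm]

theorem iSup_matrixEigen_eq_top [FiniteDimensional ℂ L] {H : LieSubalgebra ℂ L} [H.IsCartanSubalgebra]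
    (hρ : ∀ N : LieSubmodule ℂ L (MatrixRep ρ), ∃ N' : LieSubmodule ℂ L (MatrixRep ρ), IsCompl N N')
    (hL : ∀ β : H → ℂ, ∀ x ∈ rootSpace H β, ∀ y : H, ⁅(y : L), x⁆ = β y • x) :
    (⨆ χ : H → ℂ, matrixEigen ρ χ) = ⊤ := by
  have h2 : ∀ χ : H → ℂ, (weightSpace (MatrixRep ρ) χ).toSubmodule = matrixEigen ρ χ := fun χ =>
    Submodule.ext fun v => mem_weightSpace χ v
  exact (iSup_congr h2).symm.trans (iSup_weightSpace_eq_top hρ hL)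

end MatrixRep

/-! ### The root decomposition of the general linear Lie superalgebra -/

section GeneralLinear

open LieAlgebra LieModule

attribute [local instance] LieRing.ofAssociativeRing

theorem glBracket_eq_of_even {m n : ℕ} {A : GLSpace m n} (hA : A ∈ glPart m n 0) (X : GLSpace m n) :
    glBracket m n A X = A * X - X * A := by
  obtain ⟨X₀, h₀, X₁, h₁, rfl⟩ := Submodule.mem_sup.mp
    (show X ∈ glPart m n 0 ⊔ glPart m n 1 by rw [(gl_isCompl m n).sup_eq_top]; trivial)
  rw [map_add, glBracket_eq hA h₀, glBracket_eq hA h₁, koszul_zero_left, koszul_zero_left, one_smul,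
    one_smul, mul_add, add_mul]
  abel

variable {g : Type*} [AddCommGroup g] [Module ℂ g] [LieSuperalgebra g]

theorem IsGeneralLinear.finiteDimensional (hg : IsGeneralLinear g) : FiniteDimensional ℂ g := by
  obtain ⟨m, n, e, -, -⟩ := hg
  exact LinearEquiv.finiteDimensional e.symm

/-- The faithful completely reducible representation is the space of column vectors. The Cartan
subalgebra acts diagonalizably on it and on its dual, hence on matrices, which are sums of products
of a column and a row. -/
theorem IsGeneralLinear.rootGrading (hg : IsGeneralLinear g) (B : KillingForm g) {G : ℝ → Submodule ℂ g}
    {h : LieSubalgebra ℂ (part (V := g) 0)} (hh : h.IsCartanSubalgebra)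
    (hint : DirectSum.IsInternal G) (hgr : ∀ t, IsGraded (G t))
    (hbr : ∀ s t : ℝ, ∀ x ∈ G s, ∀ y ∈ G t, bracket x y ∈ G (s + t))
    (hG : G 0 = h.toSubmodule.map (part (V := g) 0).subtype) : RootGrading B G := by
  have hfin := hg.finiteDimensional
  obtain ⟨m, n, e, hpar, hbrack⟩ := hg
  have he0 : ∀ x : part (V := g) 0, e x ∈ glPart m n 0 := fun x => (hpar 0 x).mp x.2
  have hbr0 : ∀ (x : part (V := g) 0) (y : g), e (bracket (x : g) y) = e x * e y - e y * e x :=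
    fun x y => (hbrack x y).trans (glBracket_eq_of_even (he0 x) (e y))
  let ρ : part (V := g) 0 →ₗ⁅ℂ⁆ GLSpace m n :=
    { toFun := fun x => e x
      map_add' := fun x y => map_add e (x : g) (y : g)
      map_smul' := fun t x => map_smul e t (x : g)
      map_lie' := fun {x y} => hbr0 x y }
  let ρ' : part (V := g) 0 →ₗ⁅ℂ⁆ GLSpace m n :=
    { toFun := fun x => -(e x).transpose
      map_add' := fun x y => by
        rw [Submodule.coe_add, map_add, Matrix.transpose_add, neg_add]
      map_smul' := fun t x => by
        rw [Submodule.coe_smul, map_smul, Matrix.transpose_smul, RingHom.id_apply, smul_neg]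
      map_lie' := fun {x y} => by
        change -(e (bracket (x : g) (y : g))).transpose =
          (-(e x).transpose) * (-(e y).transpose) - (-(e y).transpose) * (-(e x).transpose)
        rw [hbr0, Matrix.transpose_sub, Matrix.transpose_mul, Matrix.transpose_mul, neg_mul_neg,
          neg_mul_neg, neg_sub] }
  have hρ : ∀ x, ρ x = e x := fun x => rfl
  have hρ' : ∀ x, ρ' x = -(e x).transpose := fun x => rfl
  have hne : ∀ r c : Fin m ⊕ Fin n, idxParity r ≠ idxParity c → idxParity r + idxParity c ≠ 0 :=
    fun r c hrc => by
      generalize idxParity r = a at hrc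
      generalize idxParity c = b at hrc
      revert a b; decide
  have hsur : ∀ r c : Fin m ⊕ Fin n, idxParity r = idxParity c → ∃ x : part (V := g) 0,
      e x = Matrix.single r c 1 := fun r c hrc => by
    refine ⟨⟨e.symm (Matrix.single r c 1), ?_⟩, e.apply_symm_apply _⟩
    rw [hpar, e.apply_symm_apply]
    intro r' c' hrc'
    refine Matrix.single_apply_of_ne _ _ _ _ _ ?_
    rintro ⟨rfl, rfl⟩
    exact hrc' (by rw [hrc]; exact CharTwo.add_self_eq_zero _)
  have hc : ∀ N : LieSubmodule ℂ (part (V := g) 0) (MatrixRep ρ),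
      ∃ N' : LieSubmodule ℂ (part (V := g) 0) (MatrixRep ρ), IsCompl N N' :=
    MatrixRep.exists_isCompl idxParity (fun x r c hrc => he0 x r c (hne r c hrc)) hsur
  have hc' : ∀ N : LieSubmodule ℂ (part (V := g) 0) (MatrixRep ρ'),
      ∃ N' : LieSubmodule ℂ (part (V := g) 0) (MatrixRep ρ'), IsCompl N N' :=
    MatrixRep.exists_isCompl idxParity (fun x r c hrc => by
        change -(e x c r) = 0
        rw [he0 x c r (hne c r hrc.symm), neg_zero]) fun r c hrc => by
      obtain ⟨x, hx⟩ := hsur c r hrc.symm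
      refine ⟨-x, ?_⟩
      rw [map_neg, hρ', hx, neg_neg, Matrix.transpose_single]
  refine RootGrading.of_completelyReducible (M := MatrixRep ρ) B hint hgr hbr hG (fun c hcn => ?_)
    (fun hL => ?_) (fun x hx hx0 => ?_)
  · have h1 := lie_eq_zero_of_isNilpotent_of_mem_cartan hc hcn
    refine Subtype.ext (Subtype.ext (e.injective ?_))
    ext r s
    have h2 : ((e (c : g)).mulVec (Pi.single s 1)) r = 0 := congrFun (h1 (Pi.single s 1)) r
    rw [Matrix.mulVec_single_one] at h2
    rw [show (((0 : h) : part (V := g) 0) : g) = 0 from rfl, map_zero]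
    exact h2
  · have h1 := iSup_matrixEigen_eq_top hc hL
    have h2 := iSup_matrixEigen_eq_top hc' hL
    -- The rank one matrix uφᵀ has weight χ + ψ if u has weight χ and φ has weight ψ in the dual
    -- representation.
    have key : ∀ u ∈ (⨆ χ : h → ℂ, matrixEigen ρ χ), ∀ φ ∈ (⨆ χ : h → ℂ, matrixEigen ρ' χ),
        e.symm (Matrix.vecMulVec u φ) ∈ ⨆ χ : g → ℂ, eigenPart (G 0) χ := by
      intro u hu φ hφ
      induction hu using Submodule.iSup_induction' with
      | mem χ u hu =>
        induction hφ using Submodule.iSup_induction' with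
        | mem ψ φ hφ =>
          classical
          refine Submodule.mem_iSup_of_mem
            (fun x => if hx : ∃ z : h, (z : g) = x then (χ + ψ) hx.choose else 0) fun x hx => ?_
          have hx' : ∃ z : h, (z : g) = x := by
            rw [hG] at hx
            obtain ⟨z, hz, rfl⟩ := hx
            exact ⟨⟨z, hz⟩, rfl⟩
          change _ = (if hx : ∃ z : h, (z : g) = x then (χ + ψ) hx.choose else 0) • _
          rw [dif_pos hx']
          nth_rewrite 1 [← hx'.choose_spec]
          generalize hx'.choose = z
          apply e.injective
          have h3 : (e (z : g)).mulVec u = χ z • u := hu z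
          have h4 : (-(e (z : g)).transpose).mulVec φ = ψ z • φ := hφ z
          rw [Matrix.neg_mulVec, Matrix.mulVec_transpose] at h4
          rw [hbr0, map_smul, e.apply_symm_apply, Matrix.mul_vecMulVec, Matrix.vecMulVec_mul, h3,
            neg_eq_iff_eq_neg.mp h4, Matrix.smul_vecMulVec, ← neg_smul, Matrix.vecMulVec_smul,
            Pi.add_apply, ← sub_smul, sub_neg_eq_add]
        | zero =>
          rw [Matrix.vecMulVec_zero, map_zero]
          exact Submodule.zero_mem _
        | add a b _ _ ha hb =>
          rw [Matrix.vecMulVec_add, map_add]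
          exact Submodule.add_mem _ ha hb
      | zero =>
        rw [Matrix.zero_vecMulVec, map_zero]
        exact Submodule.zero_mem _
      | add a b _ _ ha hb =>
        rw [Matrix.add_vecMulVec, map_add]
        exact Submodule.add_mem _ ha hb
    intro x _
    rw [← e.symm_apply_apply x, Matrix.matrix_eq_sum_single (e x), map_sum]
    refine Submodule.sum_mem _ fun r _ => ?_
    rw [map_sum]
    refine Submodule.sum_mem _ fun c _ => ?_
    have h3 := key (Pi.single r 1) (by rw [h1]; trivial) (Pi.single c (e x r c)) (by rw [h2]; trivial)
    convert h3 using 2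
    ext r' c'
    rw [Matrix.vecMulVec_apply, Matrix.single_apply, Pi.single_apply, Pi.single_apply]
    by_cases hr : r = r' <;> by_cases hc : c = c' <;> simp [hr, hc, eq_comm]
  · apply e.injective
    rw [map_zero]
    -- For r ≠ s the entry of x at (r, s) is that of its commutator with the even diagonal matrix
    -- unit E_rr. An odd matrix has no other entries.
    have h3 : ∀ r s, e x r s = 0 := by
      intro r s
      by_cases hrs : idxParity r + idxParity s = 1
      · obtain ⟨y, hy⟩ := hsur r r rfl
        have h4 := hbr0 y x
        rw [hx0 y y.2, map_zero, hy] at h4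
        have h5 := congrFun (congrFun h4 r) s
        have hrs' : r ≠ s := by
          rintro rfl
          rw [CharTwo.add_self_eq_zero] at hrs
          exact zero_ne_one hrs
        have h6 : (e x * Matrix.single r r (1 : ℂ)) r s = 0 :=
          Matrix.mul_single_apply_of_ne _ _ _ _ _ (Ne.symm hrs') _
        rw [Matrix.sub_apply, h6, sub_zero, Matrix.single_mul_apply_same, one_mul] at h5
        exact h5.symm
      · exact (hpar 1 x).mp hx r s hrs
    ext r s
    exact h3 r s

end GeneralLinear

/-! ### Simultaneous eigenspaces -/

section Eigen

/-- A subspace which is stable under a family of operators is the sum of its intersections with the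
simultaneous eigenspaces, if these span the whole space. -/
theorem mem_iSup_inf_of_stable {M ι κ : Type*} [AddCommGroup M] [Module ℂ M]
    (T : ι → M →ₗ[ℂ] M) (χ : κ → ι → ℂ) (F : κ → Submodule ℂ M)
    (hF : ∀ k, ∀ v ∈ F k, ∀ i, T i v = χ k i • v) (hsep : ∀ k l, χ k = χ l → k = l)
    (htop : ⨆ k, F k = ⊤) {U : Submodule ℂ M} (hU : ∀ i, ∀ v ∈ U, T i v ∈ U) {v : M} (hv : v ∈ U) :
    v ∈ ⨆ k, U ⊓ F k := by
  classical
  -- Induction on the number of components: to isolate the component k, another component l is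
  -- removed by an operator `T i - χ l i` with χ k i ≠ χ l i, which only rescales the rest.
  have key : ∀ n : ℕ, ∀ s : Finset κ, s.card ≤ n → ∀ f : κ → M, (∀ k, f k ∈ F k) →
      ∑ k ∈ s, f k ∈ U → ∀ k ∈ s, f k ∈ U := by
    intro n
    induction n with
    | zero =>
      intro s hs f _ _ k hk
      rw [Finset.card_eq_zero.mp (Nat.le_zero.mp hs)] at hk
      exact absurd hk (Finset.notMem_empty k)
    | succ n ih =>
      intro s hs f hf hsum k hk
      by_cases hl : ∃ l ∈ s, l ≠ k
      · obtain ⟨l, hl, hlk⟩ := hl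
        obtain ⟨i, hi⟩ : ∃ i, χ k i ≠ χ l i := by
          by_contra! hcon
          exact hlk (hsep k l (funext hcon)).symm
        have h1 : ∑ j ∈ s.erase l, (χ j i - χ l i) • f j ∈ U := by
          have h2 : ∑ j ∈ s.erase l, (χ j i - χ l i) • f j = T i (∑ j ∈ s, f j) - χ l i • ∑ j ∈ s, f j := by
            rw [map_sum, Finset.smul_sum, ← Finset.sum_sub_distrib, ← Finset.add_sum_erase _ _ hl, hF l _ (hf l),
              sub_self, zero_add]
            exact Finset.sum_congr rfl fun j _ => by rw [hF j _ (hf j), sub_smul]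
          rw [h2]
          exact U.sub_mem (hU i _ hsum) (U.smul_mem _ hsum)
        have h3 := ih (s.erase l) (by rw [Finset.card_erase_of_mem hl]; omega)
          (fun j => (χ j i - χ l i) • f j) (fun j => (F j).smul_mem _ (hf j)) h1 k
          (Finset.mem_erase.mpr ⟨hlk.symm, hk⟩)
        have h4 := U.smul_mem (χ k i - χ l i)⁻¹ h3
        rwa [smul_smul, inv_mul_cancel₀ (sub_ne_zero.mpr hi), one_smul] at h4
      · push Not at hl
        have h1 : s = {k} := Finset.eq_singleton_iff_unique_mem.mpr ⟨hk, hl⟩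
        rwa [h1, Finset.sum_singleton] at hsum
  have hv' : v ∈ ⨆ k, F k := by rw [htop]; trivial
  obtain ⟨f, hf, hsum⟩ := (Submodule.mem_iSup_iff_exists_finsupp _ _).mp hv'
  rw [← hsum]
  rw [← hsum] at hv
  refine Submodule.sum_mem _ fun k hk => Submodule.mem_iSup_of_mem k ⟨?_, hf k⟩
  exact key _ f.support le_rfl f hf hv k hk

end Eigen

/-! ### The parity involution -/

section Parity

variable {V : Type*} [AddCommGroup V] [Module ℂ V] [SuperSpace V]

theorem IsGraded.parityInv_mem {W : Submodule ℂ V} (hW : IsGraded W) {v : V} (hv : v ∈ W) :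
    parityInv V v ∈ W := by
  obtain ⟨a, ha, b, hb, rfl⟩ := Submodule.mem_sup.mp (hW hv)
  rw [map_add, parityInv_of_mem ha.2, parityInv_of_mem hb.2]
  exact W.add_mem (W.smul_mem _ ha.1) (W.smul_mem _ hb.1)

theorem evenProj_eq (v : V) : evenProj V v = (2⁻¹ : ℂ) • (v + parityInv V v) := by
  nth_rewrite 2 [← evenProj_add_oddProj v]
  change _ = (2⁻¹ : ℂ) • (evenProj V v + oddProj V v + (evenProj V v - oddProj V v))
  module

theorem oddProj_eq (v : V) : oddProj V v = (2⁻¹ : ℂ) • (v - parityInv V v) := by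
  nth_rewrite 2 [← evenProj_add_oddProj v]
  change _ = (2⁻¹ : ℂ) • (evenProj V v + oddProj V v - (evenProj V v - oddProj V v))
  module

theorem isGraded_of_parityInv_mem {W : Submodule ℂ V} (hW : ∀ v ∈ W, parityInv V v ∈ W) :
    IsGraded W := by
  intro v hv
  rw [← evenProj_add_oddProj v]
  refine Submodule.add_mem_sup ⟨?_, evenProj_mem v⟩ ⟨?_, oddProj_mem v⟩
  · rw [evenProj_eq]; exact W.smul_mem _ (W.add_mem hv (hW v hv))
  · rw [oddProj_eq]; exact W.smul_mem _ (W.sub_mem hv (hW v hv))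

theorem IsGraded.evenProj_mem {W : Submodule ℂ V} (hW : IsGraded W) {v : V} (hv : v ∈ W) :
    evenProj V v ∈ W := by
  rw [evenProj_eq]; exact W.smul_mem _ (W.add_mem hv (hW.parityInv_mem hv))

theorem IsGraded.oddProj_mem {W : Submodule ℂ V} (hW : IsGraded W) {v : V} (hv : v ∈ W) :
    oddProj V v ∈ W := by
  rw [oddProj_eq]; exact W.smul_mem _ (W.sub_mem hv (hW.parityInv_mem hv))

theorem IsGraded.inf {W W' : Submodule ℂ V} (hW : IsGraded W) (hW' : IsGraded W') :
    IsGraded (W ⊓ W') :=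
  isGraded_of_parityInv_mem fun _ hv => ⟨hW.parityInv_mem hv.1, hW'.parityInv_mem hv.2⟩

theorem IsGraded.iSup {ι : Sort*} {W : ι → Submodule ℂ V} (hW : ∀ i, IsGraded (W i)) :
    IsGraded (⨆ i, W i) := by
  refine isGraded_of_parityInv_mem fun v hv => ?_
  have h : (⨆ i, W i) ≤ (⨆ i, W i).comap (parityInv V) :=
    iSup_le fun i v hv => Submodule.mem_iSup_of_mem i ((hW i).parityInv_mem hv)
  exact h hv

theorem parityInv_bracket {g : Type*} [AddCommGroup g] [Module ℂ g] [LieSuperalgebra g] (x y : g) :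
    parityInv g (bracket x y) = bracket (parityInv g x) (parityInv g y) := by
  have key : ∀ i j : ZMod 2, ∀ x ∈ part (V := g) i, ∀ y ∈ part (V := g) j,
      parityInv g (bracket x y) = bracket (parityInv g x) (parityInv g y) := fun i j x hx y hy => by
    rw [parityInv_of_mem hx, parityInv_of_mem hy, parityInv_of_mem (LieSuperalgebra.bracket_mem hx hy),
      koszul_add_right, map_smul, map_smul, LinearMap.smul_apply, smul_smul, mul_comm]
  rw [← evenProj_add_oddProj x, ← evenProj_add_oddProj y]
  simp only [map_add, LinearMap.add_apply]
  rw [key 0 0 _ (evenProj_mem x) _ (evenProj_mem y), key 1 0 _ (oddProj_mem x) _ (evenProj_mem y),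
    key 0 1 _ (evenProj_mem x) _ (oddProj_mem y), key 1 1 _ (oddProj_mem x) _ (oddProj_mem y)]

theorem parityInv_act {g : Type*} [AddCommGroup g] [Module ℂ g] [LieSuperalgebra g]
    [LieSupermodule g V] (x : g) (y : V) :
    parityInv V (act x y) = act (parityInv g x) (parityInv V y) := by
  have key : ∀ i j : ZMod 2, ∀ x ∈ part (V := g) i, ∀ y ∈ part (V := V) j,
      parityInv V (act x y) = act (parityInv g x) (parityInv V y) := fun i j x hx y hy => by
    rw [parityInv_of_mem hx, parityInv_of_mem hy, parityInv_of_mem (LieSupermodule.act_mem hx hy),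
      koszul_add_right, map_smul, map_smul, LinearMap.smul_apply, smul_smul, mul_comm]
  rw [← evenProj_add_oddProj x, ← evenProj_add_oddProj y]
  simp only [map_add, LinearMap.add_apply]
  rw [key 0 0 _ (evenProj_mem x) _ (evenProj_mem y), key 1 0 _ (oddProj_mem x) _ (evenProj_mem y),
    key 0 1 _ (evenProj_mem x) _ (oddProj_mem y), key 1 1 _ (oddProj_mem x) _ (oddProj_mem y)]

theorem KillingForm.form_parityInv {g : Type*} [AddCommGroup g] [Module ℂ g] [LieSuperalgebra g]
    (B : KillingForm g) (x y : g) : B.form (parityInv g x) y = B.form x (parityInv g y) := by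
  have key : ∀ i j : ZMod 2, ∀ x ∈ part (V := g) i, ∀ y ∈ part (V := g) j,
      B.form (parityInv g x) y = B.form x (parityInv g y) := fun i j x hx y hy => by
    rw [parityInv_of_mem hx, parityInv_of_mem hy, map_smul, map_smul, LinearMap.smul_apply]
    by_cases hij : i = j
    · rw [hij]
    · rw [B.apply_eq_zero_of_ne hij hx hy, smul_zero, smul_zero]
  rw [← evenProj_add_oddProj x, ← evenProj_add_oddProj y]
  simp only [map_add, LinearMap.add_apply]
  rw [key 0 0 _ (evenProj_mem x) _ (evenProj_mem y), key 1 0 _ (oddProj_mem x) _ (evenProj_mem y),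
    key 0 1 _ (evenProj_mem x) _ (oddProj_mem y), key 1 1 _ (oddProj_mem x) _ (oddProj_mem y)]

/-- A version of supersymmetry for arbitrary elements. -/
theorem KillingForm.form_comm {g : Type*} [AddCommGroup g] [Module ℂ g] [LieSuperalgebra g]
    (B : KillingForm g) (x y : g) : B.form x y = B.form y (parityInv g x) := by
  have key : ∀ i j : ZMod 2, ∀ x ∈ part (V := g) i, ∀ y ∈ part (V := g) j,
      B.form x y = B.form y (parityInv g x) := fun i j x hx y hy => by
    rw [parityInv_of_mem hx, map_smul, smul_eq_mul]
    by_cases hij : i = j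
    · subst hij
      rw [B.supersymmetric hx hy]
      rcases parity_cases i with rfl | rfl
      · rw [koszul_zero_left, koszul_zero_right]
      · rfl
    · rw [B.apply_eq_zero_of_ne hij hx hy, B.apply_eq_zero_of_ne (Ne.symm hij) hy hx, mul_zero]
  rw [← evenProj_add_oddProj x, ← evenProj_add_oddProj y]
  simp only [map_add, LinearMap.add_apply]
  rw [key 0 0 _ (evenProj_mem x) _ (evenProj_mem y), key 1 0 _ (oddProj_mem x) _ (evenProj_mem y),
    key 0 1 _ (evenProj_mem x) _ (oddProj_mem y), key 1 1 _ (oddProj_mem x) _ (oddProj_mem y)]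
  ring

end Parity

/-! ### Homogeneous elements and the triangular decomposition -/

section RootGrading

variable {g : Type*} [AddCommGroup g] [Module ℂ g] [LieSuperalgebra g] {B : KillingForm g}
  {G : ℝ → Submodule ℂ g}

/-- The operator which multiplies the elements of degree `t` by `t`. -/
def degreeOp (hG : DirectSum.IsInternal G) : g →ₗ[ℂ] g :=
  DirectSum.coeLinearMap G ∘ₗ DirectSum.lmap (fun t : ℝ => (t : ℂ) • (LinearMap.id : G t →ₗ[ℂ] G t)) ∘ₗ
    (LinearEquiv.ofBijective (DirectSum.coeLinearMap G) hG).symm.toLinearMap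

theorem degreeOp_apply (hG : DirectSum.IsInternal G) {t : ℝ} {x : g} (hx : x ∈ G t) :
    degreeOp hG x = (t : ℂ) • x := by
  have h1 : (LinearEquiv.ofBijective (DirectSum.coeLinearMap G) hG).symm x =
      DirectSum.lof ℂ ℝ (fun t => G t) t ⟨x, hx⟩ := by
    rw [LinearEquiv.symm_apply_eq]
    exact (DirectSum.coeLinearMap_lof G t ⟨x, hx⟩).symm
  have h2 : degreeOp hG x = DirectSum.coeLinearMap G (DirectSum.lmap
    (fun t : ℝ => (t : ℂ) • (LinearMap.id : G t →ₗ[ℂ] G t))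
    ((LinearEquiv.ofBijective (DirectSum.coeLinearMap G) hG).symm x)) := rfl
  rw [h2, h1, DirectSum.lmap_lof, DirectSum.coeLinearMap_lof]
  rfl

/-- Homogeneous elements of degree `t`, parity `i` and weight `a`. -/
def homPart (B : KillingForm g) (G : ℝ → Submodule ℂ g) (t : ℝ) (i : ZMod 2) (a : g) : Submodule ℂ g :=
  G t ⊓ part i ⊓ eigenPart (G 0) (B.form a)

namespace RootGrading

variable (R : RootGrading B G)

include R

theorem opp : RootGrading B (fun t => G (-t)) where
  finiteDimensional := R.finiteDimensional
  internal := by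
    have h1 := R.internal
    have hneg : Function.Bijective (fun t : ℝ => -t) := (Equiv.neg ℝ).bijective
    rw [DirectSum.isInternal_submodule_iff_iSupIndep_and_iSup_eq_top] at h1 ⊢
    refine ⟨h1.1.comp hneg.1, ?_⟩
    rw [← h1.2]
    exact hneg.2.iSup_comp G
  graded t := R.graded _
  bracket_mem s t x hx y hy := by
    have h := R.bracket_mem _ _ x hx y hy
    rwa [← neg_add] at h
  even := by simpa using R.even
  abelian := by simpa using R.abelian
  iSup_eigenPart := by
    have h := R.iSup_eigenPart
    rw [eq_top_iff, ← h]
    refine iSup_le fun t => ?_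
    have ht : (t : g) ∈ G (-0) := by rw [neg_zero]; exact t.2
    refine le_trans ?_ (le_iSup (fun t : G (-0) => eigenPart (G (-0)) (B.form t)) ⟨t, ht⟩)
    exact fun v hv x hx => hv x (by rwa [neg_zero] at hx)
  mem_of_commute := by simpa using R.mem_of_commute
  form_ne_zero := by simpa using R.form_ne_zero
  exists_form_eq := by rw [neg_zero]; exact R.exists_form_eq

theorem form_add_eq_zero {χ ψ : g → ℂ} {x y : g} (hx : x ∈ eigenPart (G 0) χ)
    (hy : y ∈ eigenPart (G 0) ψ) (hxy : B.form x y ≠ 0) {h : g} (hh : h ∈ G 0) : χ h + ψ h = 0 := by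
  have h3 := form_bracket_of_even B (R.even hh) x y
  rw [hx h hh, hy h hh, map_smul, map_smul, LinearMap.smul_apply, smul_eq_mul, smul_eq_mul] at h3
  have h4 : (χ h + ψ h) * B.form x y = 0 := by linear_combination h3
  exact (mul_eq_zero.mp h4).resolve_right hxy

/-- An element of 𝔥 can only pair with vectors of weight zero, and those lie in 𝔥, which is its own
centralizer. -/
theorem eq_zero_of_form_eq_zero {h : g} (hh : h ∈ G 0) (h0 : ∀ k ∈ G 0, B.form h k = 0) : h = 0 := by
  refine B.nondegenerate h fun y => ?_
  have hy : y ∈ ⨆ t : G 0, eigenPart (G 0) (B.form t) := by rw [R.iSup_eigenPart]; trivial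
  induction hy using Submodule.iSup_induction' with
  | mem a y hy =>
    by_contra hne
    refine hne (h0 y (R.mem_of_commute y fun x hx => ?_))
    have h1 : B.form 0 x + B.form a x = 0 := R.form_add_eq_zero (χ := B.form 0) (fun x hx => by
      rw [R.abelian x hx h hh]; simp) hy hne hx
    rw [hy x hx, ← zero_add (B.form a x), ← LinearMap.zero_apply (σ₁₂ := RingHom.id ℂ) x, ← map_zero B.form,
      h1, zero_smul]
  | zero => exact map_zero _
  | add a b _ _ ha hb => rw [map_add, ha, hb, add_zero]

theorem eq_of_form_eq {a b : g} (ha : a ∈ G 0) (hb : b ∈ G 0) (h : ∀ k ∈ G 0, B.form a k = B.form b k) :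
    a = b := by
  rw [← sub_eq_zero]
  refine R.eq_zero_of_form_eq_zero (Submodule.sub_mem _ ha hb) fun k hk => ?_
  rw [map_sub, LinearMap.sub_apply, h k hk, sub_self]

theorem neg_eq_of_form_ne_zero {a b : g} (ha : a ∈ G 0) (hb : b ∈ G 0) {x y : g}
    (hx : x ∈ eigenPart (G 0) (B.form a)) (hy : y ∈ eigenPart (G 0) (B.form b)) (hxy : B.form x y ≠ 0) :
    b = -a :=
  R.eq_of_form_eq hb (Submodule.neg_mem _ ha) fun k hk => by
    rw [map_neg, LinearMap.neg_apply]
    exact eq_neg_of_add_eq_zero_right (R.form_add_eq_zero hx hy hxy hk)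

theorem mem_zero_of_form {v : g} (hv : v ∈ eigenPart (G 0) (B.form 0)) : v ∈ G 0 :=
  R.mem_of_commute v fun x hx => by rw [hv x hx]; simp

theorem add_mem_eigenPart {a b x y : g} (hx : x ∈ eigenPart (G 0) (B.form a))
    (hy : y ∈ eigenPart (G 0) (B.form b)) : bracket x y ∈ eigenPart (G 0) (B.form (a + b)) := by
  have h := bracket_mem_eigenPart R.even hx hy
  rw [map_add]
  exact h

/-- The bracket of two elements of opposite weights, of the same parity. -/
theorem bracket_eq {a : g} (ha : a ∈ G 0) {x y : g} (hx : x ∈ eigenPart (G 0) (B.form a))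
    (hy : y ∈ eigenPart (G 0) (B.form (-a))) : bracket x y = B.form x y • a := by
  have h1 := R.add_mem_eigenPart hx hy
  rw [add_neg_cancel] at h1
  refine R.eq_of_form_eq (R.mem_zero_of_form h1) (Submodule.smul_mem _ _ ha) fun k hk => ?_
  rw [B.invariant, ← neg_eq_iff_eq_neg.mpr (bracket_skew_of_even (R.even hk)), hy k hk, map_neg,
    map_smul, map_smul, LinearMap.smul_apply, map_neg, LinearMap.neg_apply, smul_eq_mul, smul_eq_mul]
  ring

theorem mem_iSup_of_stable {U : Submodule ℂ g} (hU : ∀ h ∈ G 0, ∀ v ∈ U, bracket h v ∈ U) {v : g}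
    (hv : v ∈ U) : v ∈ ⨆ a : G 0, U ⊓ eigenPart (G 0) (B.form a) :=
  mem_iSup_inf_of_stable (fun h : G 0 => bracket (h : g)) (fun (a : G 0) (h : G 0) => B.form (a : g) (h : g))
    (fun a : G 0 => eigenPart (G 0) (B.form a)) (fun a v hv h => hv h h.2)
    (fun a b hab => Subtype.ext (R.eq_of_form_eq a.2 b.2 fun k hk => congrFun hab ⟨k, hk⟩))
    R.iSup_eigenPart (fun h v hv => hU h h.2 v hv) hv

theorem mem_iSup_homPart_of_mem {U : Submodule ℂ g} (hgr : IsGraded U)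
    (hU : ∀ h ∈ G 0, ∀ v ∈ U, bracket h v ∈ U) {t : ℝ} {v : g} (hv : v ∈ U) (hvt : v ∈ G t) :
    v ∈ ⨆ k : ZMod 2 × G 0, U ⊓ homPart B G t k.1 k.2 := by
  have key : ∀ (i : ZMod 2), ∀ v ∈ (U ⊓ G t) ⊓ part i, 
      v ∈ ⨆ k : ZMod 2 × G 0, U ⊓ homPart B G t k.1 k.2 := fun i v hv => by
    have h1 := R.mem_iSup_of_stable (U := (U ⊓ G t) ⊓ part i) (fun h hh v hv => ⟨⟨hU h hh v hv.1.1, by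
      simpa using R.bracket_mem _ _ h hh v hv.1.2⟩, by
      simpa using LieSuperalgebra.bracket_mem (R.even hh) hv.2⟩) hv
    refine (iSup_le fun a => ?_ : _ ≤ ⨆ k : ZMod 2 × G 0, U ⊓ homPart B G t k.1 k.2) h1
    refine le_trans ?_ (le_iSup (fun k : ZMod 2 × G 0 => U ⊓ homPart B G t k.1 k.2) (i, a))
    rintro w ⟨⟨⟨hw1, hw2⟩, hw3⟩, hw4⟩
    exact ⟨hw1, ⟨⟨hw2, hw3⟩, hw4⟩⟩
  rw [← evenProj_add_oddProj v]
  have h2 := hgr.inf (R.graded t)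
  exact Submodule.add_mem _ (key 0 _ ⟨h2.evenProj_mem ⟨hv, hvt⟩, evenProj_mem v⟩)
    (key 1 _ ⟨h2.oddProj_mem ⟨hv, hvt⟩, oddProj_mem v⟩)

theorem mem_iSup_homPart {U : Submodule ℂ g} (hd : ∀ v ∈ U, degreeOp R.internal v ∈ U) (hgr : IsGraded U)
    (hU : ∀ h ∈ G 0, ∀ v ∈ U, bracket h v ∈ U) {v : g} (hv : v ∈ U) :
    v ∈ ⨆ k : ℝ × ZMod 2 × G 0, U ⊓ homPart B G k.1 k.2.1 k.2.2 := by
  have htop : ⨆ t, G t = ⊤ :=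
    ((DirectSum.isInternal_submodule_iff_iSupIndep_and_iSup_eq_top G).mp R.internal).2
  have h1 := mem_iSup_inf_of_stable (fun _ : Unit => degreeOp R.internal) (fun (t : ℝ) _ => (t : ℂ)) G
    (fun t v hv _ => degreeOp_apply R.internal hv) (fun s t hst => by
      exact_mod_cast congrFun hst ()) htop (fun _ => hd) hv
  refine (iSup_le fun t => ?_ : _ ≤ ⨆ k : ℝ × ZMod 2 × G 0, U ⊓ homPart B G k.1 k.2.1 k.2.2) h1
  intro v hv
  have h2 := R.mem_iSup_homPart_of_mem hgr hU hv.1 hv.2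
  refine (iSup_le fun k => ?_ : _ ≤ ⨆ k : ℝ × ZMod 2 × G 0, U ⊓ homPart B G k.1 k.2.1 k.2.2) h2
  exact le_iSup (fun k : ℝ × ZMod 2 × G 0 => U ⊓ homPart B G k.1 k.2.1 k.2.2) (t, k)

theorem iSup_homPart_eq_top : ⨆ k : ℝ × ZMod 2 × G 0, homPart B G k.1 k.2.1 k.2.2 = ⊤ := by
  rw [eq_top_iff]
  intro v hv
  have h := R.mem_iSup_homPart (U := ⊤) (fun _ _ => trivial) (fun v _ => by
    rw [← evenProj_add_oddProj v]
    exact Submodule.add_mem_sup ⟨trivial, evenProj_mem v⟩ ⟨trivial, oddProj_mem v⟩)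
    (fun _ _ _ _ => trivial) hv
  simpa using h

theorem homPart_le (t : ℝ) : G t = ⨆ k : ZMod 2 × G 0, homPart B G t k.1 k.2 := by
  refine le_antisymm (fun v hv => ?_) (iSup_le fun k v hv => hv.1.1)
  have h := R.mem_iSup_homPart_of_mem (U := ⊤) (fun v _ => by
    rw [← evenProj_add_oddProj v]
    exact Submodule.add_mem_sup ⟨trivial, evenProj_mem v⟩ ⟨trivial, oddProj_mem v⟩)
    (fun _ _ _ _ => trivial) trivial hv
  simpa using h

theorem disjoint_grade {s t : ℝ} (hst : s ≠ t) {x : g} (hs : x ∈ G s) (ht : x ∈ G t) : x = 0 := by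
  have h := degreeOp_apply R.internal hs
  rw [degreeOp_apply R.internal ht] at h
  have h1 : ((t : ℂ) - s) • x = 0 := by rw [sub_smul, h, sub_self]
  refine (smul_eq_zero.mp h1).resolve_left fun h2 => hst ?_
  rw [sub_eq_zero] at h2
  exact_mod_cast h2.symm

/-- The degree is not assumed to be a function of the weight, so opposite degrees need an argument:
[x, y] = B(x, y) a has degree s + t as well as degree 0, whence s + t = 0 or a = 0; in the latter
case x and y themselves lie in 𝔥. -/
theorem form_homPart {s t : ℝ} {i j : ZMod 2} {a b : g} (ha : a ∈ G 0) (hb : b ∈ G 0) {x y : g}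
    (hx : x ∈ homPart B G s i a) (hy : y ∈ homPart B G t j b) (hxy : B.form x y ≠ 0) :
    t = -s ∧ j = i ∧ b = -a := by
  have h1 := R.neg_eq_of_form_ne_zero ha hb hx.2 hy.2 hxy
  have h2 : j = i := by
    by_contra hne
    exact hxy (B.apply_eq_zero_of_ne (Ne.symm hne) hx.1.2 hy.1.2)
  refine ⟨?_, h2, h1⟩
  subst h1
  by_contra hne
  have h3 := R.bracket_eq ha hx.2 hy.2
  have h4 : B.form x y • a = 0 := by
    refine R.disjoint_grade (s := s + t) (t := 0) (fun h => hne (by linarith)) ?_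
      (Submodule.smul_mem _ _ ha)
    rw [← h3]
    exact R.bracket_mem _ _ x hx.1.1 y hy.1.1
  have h5 : a = 0 := (smul_eq_zero.mp h4).resolve_left hxy
  subst h5
  have hx0 := R.mem_zero_of_form hx.2
  rw [neg_zero] at hy
  have hy0 := R.mem_zero_of_form hy.2
  have hs : s = 0 := by
    by_contra hs
    exact hxy (by rw [R.disjoint_grade hs hx.1.1 hx0, map_zero, LinearMap.zero_apply])
  have ht : t = 0 := by
    by_contra hs
    exact hxy (by rw [R.disjoint_grade hs hy.1.1 hy0, map_zero])
  exact hne (by rw [hs, ht, neg_zero])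

theorem form_grade {s t : ℝ} (hst : s + t ≠ 0) {x y : g} (hx : x ∈ G s) (hy : y ∈ G t) :
    B.form x y = 0 := by
  rw [R.homPart_le s] at hx
  induction hx using Submodule.iSup_induction' with
  | mem k x hx =>
    rw [R.homPart_le t] at hy
    induction hy using Submodule.iSup_induction' with
    | mem l y hy =>
      by_contra hne
      have h := (R.form_homPart k.2.2 l.2.2 hx hy hne).1
      exact hst (by rw [h, add_neg_cancel])
    | zero => exact map_zero _
    | add a b _ _ ha hb => rw [map_add, ha, hb, add_zero]
  | zero => rw [map_zero, LinearMap.zero_apply]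
  | add a b _ _ ha hb => rw [map_add, LinearMap.add_apply, ha, hb, add_zero]

/-- Homogeneous elements have homogeneous duals. -/
theorem exists_dual {t : ℝ} {i : ZMod 2} {a x : g} (ha : a ∈ G 0) (hx : x ∈ homPart B G t i a) (hx0 : x ≠ 0) :
    ∃ y ∈ homPart B G (-t) i (-a), B.form x y = 1 := by
  obtain ⟨y, hy, hxy⟩ : ∃ y ∈ homPart B G (-t) i (-a), B.form x y ≠ 0 := by
    by_contra! hcon
    refine hx0 (B.nondegenerate x fun y => ?_)
    have hy : y ∈ ⨆ k : ℝ × ZMod 2 × G 0, homPart B G k.1 k.2.1 k.2.2 := by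
      rw [R.iSup_homPart_eq_top]; trivial
    induction hy using Submodule.iSup_induction' with
    | mem k y hy =>
      by_contra hne
      obtain ⟨h1, h2, h3⟩ := R.form_homPart ha k.2.2.2 hx hy hne
      rw [h1, h2, h3] at hy
      exact hne (hcon y hy)
    | zero => exact map_zero _
    | add a b _ _ ha hb => rw [map_add, ha, hb, add_zero]
  refine ⟨(B.form x y)⁻¹ • y, Submodule.smul_mem _ _ hy, ?_⟩
  rw [map_smul, smul_eq_mul, inv_mul_cancel₀ hxy]

theorem induction_grade {p : g → Prop} (h : ∀ t, ∀ x ∈ G t, p x) (h0 : p 0)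
    (hadd : ∀ x y, p x → p y → p (x + y)) (x : g) : p x := by
  have hx : x ∈ ⨆ t, G t := by
    rw [((DirectSum.isInternal_submodule_iff_iSupIndep_and_iSup_eq_top G).mp R.internal).2]; trivial
  induction hx using Submodule.iSup_induction' with
  | mem t x hx => exact h t x hx
  | zero => exact h0
  | add a b _ _ ha hb => exact hadd a b ha hb

theorem degreeOp_bracket (x y : g) : degreeOp R.internal (bracket x y) =
    bracket (degreeOp R.internal x) y + bracket x (degreeOp R.internal y) := by
  refine R.induction_grade (p := fun x => degreeOp R.internal (bracket x y) =
    bracket (degreeOp R.internal x) y + bracket x (degreeOp R.internal y)) (fun s x hx => ?_) 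
    (by simp) (fun a b ha hb => ?_) x
  · refine R.induction_grade (p := fun y => degreeOp R.internal (bracket x y) =
      bracket (degreeOp R.internal x) y + bracket x (degreeOp R.internal y)) (fun t y hy => ?_) 
      (by simp) (fun a b ha hb => ?_) y
    · rw [degreeOp_apply _ hx, degreeOp_apply _ hy, degreeOp_apply _ (R.bracket_mem _ _ x hx y hy),
        map_smul, map_smul, LinearMap.smul_apply, ← add_smul]
      push_cast; rfl
    · simp only [map_add, ha, hb]; abel
  · simp only [map_add, LinearMap.add_apply, ha, hb]; abel

theorem form_degreeOp (x y : g) : B.form (degreeOp R.internal x) y =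
    -B.form x (degreeOp R.internal y) := by
  refine R.induction_grade (p := fun x => B.form (degreeOp R.internal x) y =
    -B.form x (degreeOp R.internal y)) (fun s x hx => ?_) (by simp) (fun a b ha hb => ?_) x
  · refine R.induction_grade (p := fun y => B.form (degreeOp R.internal x) y =
      -B.form x (degreeOp R.internal y)) (fun t y hy => ?_) (by simp) (fun a b ha hb => ?_) y
    · rw [degreeOp_apply _ hx, degreeOp_apply _ hy, map_smul, map_smul, LinearMap.smul_apply]
      by_cases hst : s + t = 0
      · rw [eq_neg_of_add_eq_zero_right hst]
        push_cast; simp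
      · rw [R.form_grade hst hx hy]; simp
    · simp only [map_add, ha, hb]; ring
  · simp only [map_add, LinearMap.add_apply, ha, hb]; ring

end RootGrading

/-- The sum of the parts of positive degree. -/
def posPart (G : ℝ → Submodule ℂ g) : Submodule ℂ g := ⨆ (t : ℝ) (_ : 0 < t), G t

/-- The sum of the parts of negative degree. -/
def negPart (G : ℝ → Submodule ℂ g) : Submodule ℂ g := posPart (fun t => G (-t))

theorem mem_posPart {t : ℝ} (ht : 0 < t) {x : g} (hx : x ∈ G t) : x ∈ posPart G :=
  (le_iSup₂_of_le (f := fun (t : ℝ) (_ : 0 < t) => G t) t ht le_rfl) hx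

theorem mem_negPart {t : ℝ} (ht : t < 0) {x : g} (hx : x ∈ G t) : x ∈ negPart G :=
  mem_posPart (t := -t) (by linarith) (by rwa [neg_neg])

theorem posPart_induction {p : g → Prop} (h : ∀ t, 0 < t → ∀ x ∈ G t, p x) (h0 : p 0)
    (hadd : ∀ x y, p x → p y → p (x + y)) {x : g} (hx : x ∈ posPart G) : p x := by
  unfold posPart at hx
  rw [iSup_subtype'] at hx
  induction hx using Submodule.iSup_induction' with
  | mem t x hx => exact h t t.2 x hx
  | zero => exact h0
  | add a b _ _ ha hb => exact hadd a b ha hb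

theorem negPart_induction {p : g → Prop} (h : ∀ t, t < 0 → ∀ x ∈ G t, p x) (h0 : p 0)
    (hadd : ∀ x y, p x → p y → p (x + y)) {x : g} (hx : x ∈ negPart G) : p x :=
  posPart_induction (G := fun t => G (-t)) (fun t ht => h (-t) (by linarith)) h0 hadd hx

namespace RootGrading

variable (R : RootGrading B G)

include R

/-- The three parts of the triangular decomposition span `g`. -/
theorem posPart_sup : posPart G ⊔ G 0 ⊔ negPart G = ⊤ := by
  rw [Submodule.eq_top_iff']
  refine R.induction_grade (fun t x hx => ?_) (Submodule.zero_mem _) fun x y => Submodule.add_mem _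
  rcases lt_trichotomy t 0 with ht | rfl | ht
  · exact Submodule.mem_sup_right (mem_negPart ht hx)
  · exact Submodule.mem_sup_left (Submodule.mem_sup_right hx)
  · exact Submodule.mem_sup_left (Submodule.mem_sup_left (mem_posPart ht hx))

theorem posPart_graded : IsGraded (posPart G) :=
  IsGraded.iSup fun t => IsGraded.iSup fun _ => R.graded t

theorem negPart_graded : IsGraded (negPart G) := R.opp.posPart_graded

theorem degreeOp_posPart {x : g} (hx : x ∈ posPart G) : degreeOp R.internal x ∈ posPart G :=
  posPart_induction (p := fun x => degreeOp R.internal x ∈ posPart G)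
    (fun t ht x hx => by rw [degreeOp_apply _ hx]; exact Submodule.smul_mem _ _ (mem_posPart ht hx))
    (by rw [map_zero]; exact Submodule.zero_mem _)
    (fun x y hx hy => by rw [map_add]; exact Submodule.add_mem _ hx hy) hx

theorem degreeOp_negPart {x : g} (hx : x ∈ negPart G) : degreeOp R.internal x ∈ negPart G :=
  negPart_induction (p := fun x => degreeOp R.internal x ∈ negPart G)
    (fun t ht x hx => by rw [degreeOp_apply _ hx]; exact Submodule.smul_mem _ _ (mem_negPart ht hx))
    (by rw [map_zero]; exact Submodule.zero_mem _)
    (fun x y hx hy => by rw [map_add]; exact Submodule.add_mem _ hx hy) hx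

theorem bracket_zero_posPart {h x : g} (hh : h ∈ G 0) (hx : x ∈ posPart G) : bracket h x ∈ posPart G :=
  posPart_induction (p := fun x => bracket h x ∈ posPart G)
    (fun t ht x hx => mem_posPart ht (by simpa using R.bracket_mem _ _ h hh x hx))
    (by rw [map_zero]; exact Submodule.zero_mem _)
    (fun x y hx hy => by rw [map_add]; exact Submodule.add_mem _ hx hy) hx

theorem bracket_zero_negPart {h x : g} (hh : h ∈ G 0) (hx : x ∈ negPart G) : bracket h x ∈ negPart G :=
  R.opp.bracket_zero_posPart (by simpa using hh) hx

theorem bracket_posPart {x y : g} (hx : x ∈ posPart G) (hy : y ∈ posPart G) : bracket x y ∈ posPart G := by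
  refine posPart_induction (p := fun x => bracket x y ∈ posPart G) (fun s hs x hx => ?_) (by simp)
    (fun a b ha hb => by rw [map_add, LinearMap.add_apply]; exact Submodule.add_mem _ ha hb) hx
  exact posPart_induction (p := fun y => bracket x y ∈ posPart G) (fun t ht y hy =>
    mem_posPart (add_pos hs ht) (R.bracket_mem _ _ x hx y hy)) (by simp)
    (fun a b ha hb => by rw [map_add]; exact Submodule.add_mem _ ha hb) hy

theorem bracket_negPart {x y : g} (hx : x ∈ negPart G) (hy : y ∈ negPart G) : bracket x y ∈ negPart G :=
  R.opp.bracket_posPart hx hy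

theorem form_posPart {x y : g} (hx : x ∈ posPart G) (hy : y ∈ posPart G) : B.form x y = 0 := by
  refine posPart_induction (p := fun x => B.form x y = 0) (fun s hs x hx => ?_) (by simp)
    (fun a b ha hb => by rw [map_add, LinearMap.add_apply, ha, hb, add_zero]) hx
  exact posPart_induction (p := fun y => B.form x y = 0) (fun t ht y hy =>
    R.form_grade (by linarith) hx hy) (by simp)
    (fun a b ha hb => by rw [map_add, ha, hb, add_zero]) hy

theorem form_negPart {x y : g} (hx : x ∈ negPart G) (hy : y ∈ negPart G) : B.form x y = 0 :=
  R.opp.form_posPart hx hy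

theorem form_zero_posPart {h x : g} (hh : h ∈ G 0) (hx : x ∈ posPart G) : B.form h x = 0 :=
  posPart_induction (p := fun x => B.form h x = 0) (fun t ht x hx => R.form_grade (by linarith) hh hx)
    (by simp) (fun a b ha hb => by rw [map_add, ha, hb, add_zero]) hx

theorem form_zero_negPart {h x : g} (hh : h ∈ G 0) (hx : x ∈ negPart G) : B.form h x = 0 :=
  R.opp.form_zero_posPart (by simpa using hh) hx

theorem form_posPart_zero {h x : g} (hh : h ∈ G 0) (hx : x ∈ posPart G) : B.form x h = 0 := by
  rw [← B.apply_comm_of_even (R.even hh), R.form_zero_posPart hh hx]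

theorem form_negPart_zero {h x : g} (hh : h ∈ G 0) (hx : x ∈ negPart G) : B.form x h = 0 := by
  rw [← B.apply_comm_of_even (R.even hh), R.form_zero_negPart hh hx]

/-- An element of `𝔫⁺` which is orthogonal to `𝔫⁻` vanishes. -/
theorem eq_zero_of_mem_posPart {x : g} (hx : x ∈ posPart G) (h : ∀ y ∈ negPart G, B.form x y = 0) :
    x = 0 := by
  refine B.nondegenerate x fun y => ?_
  have hy : y ∈ posPart G ⊔ G 0 ⊔ negPart G := by rw [R.posPart_sup]; trivial
  obtain ⟨u, hu, c, hc, rfl⟩ := Submodule.mem_sup.mp hy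
  obtain ⟨a, ha, b, hb, rfl⟩ := Submodule.mem_sup.mp hu
  rw [map_add, map_add, R.form_posPart hx ha, R.form_posPart_zero hb hx, h c hc, add_zero, add_zero]

theorem eq_zero_of_mem_negPart {x : g} (hx : x ∈ negPart G) (h : ∀ y ∈ posPart G, B.form x y = 0) :
    x = 0 :=
  R.opp.eq_zero_of_mem_posPart hx (by simpa [negPart] using h)

/-- The elements orthogonal to `𝔫⁺` and `𝔫⁻` are those of degree zero. -/
theorem mem_zero_of_form_eq_zero {x : g} (h1 : ∀ y ∈ posPart G, B.form x y = 0)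
    (h2 : ∀ y ∈ negPart G, B.form x y = 0) : x ∈ G 0 := by
  have hx : x ∈ posPart G ⊔ G 0 ⊔ negPart G := by rw [R.posPart_sup]; trivial
  obtain ⟨u, hu, c, hc, rfl⟩ := Submodule.mem_sup.mp hx
  obtain ⟨a, ha, b, hb, rfl⟩ := Submodule.mem_sup.mp hu
  have ha0 : a = 0 := R.eq_zero_of_mem_posPart ha fun y hy => by
    have h := h2 y hy
    rwa [map_add, map_add, LinearMap.add_apply, LinearMap.add_apply, R.form_zero_negPart hb hy,
      R.form_negPart hc hy, add_zero, add_zero] at h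
  have hc0 : c = 0 := R.eq_zero_of_mem_negPart hc fun y hy => by
    have h := h1 y hy
    rwa [map_add, map_add, LinearMap.add_apply, LinearMap.add_apply, R.form_zero_posPart hb hy,
      R.form_posPart ha hy, zero_add, zero_add] at h
  rw [ha0, hc0, zero_add, add_zero]
  exact hb

/-- Elements of non-zero degree act nilpotently. -/
theorem exists_forall_grade_eq_bot : ∃ N : ℝ, ∀ t, N ≤ |t| → G t = ⊥ := by
  have h1 := ((DirectSum.isInternal_submodule_iff_iSupIndep_and_iSup_eq_top G).mp R.internal).1
  have hfin := R.finiteDimensional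
  have h2 : {t | G t ≠ ⊥}.Finite := WellFoundedGT.finite_ne_bot_of_iSupIndep h1
  obtain ⟨N, hN⟩ := (h2.image fun t => |t|).bddAbove
  refine ⟨N + 1, fun t ht => ?_⟩
  by_contra hne
  have := hN ⟨t, hne, rfl⟩
  simp only at this
  linarith

end RootGrading

end RootGrading

/-! ### Root strings -/

section RootStrings

variable {g : Type*} [AddCommGroup g] [Module ℂ g] [LieSuperalgebra g] {B : KillingForm g}
  {G : ℝ → Submodule ℂ g}

namespace RootGrading

variable (R : RootGrading B G)

include R

/-- The degrees t + N s are unbounded, but only finitely many degrees occur. -/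
theorem exists_pow_eq_zero {s t : ℝ} (hs : s ≠ 0) {y z : g} (hy : y ∈ G s) (hz : z ∈ G t) :
    ∃ N : ℕ, ((bracket y) ^ N : g →ₗ[ℂ] g) z = 0 := by
  obtain ⟨b, hb⟩ := R.exists_forall_grade_eq_bot
  have h1 : ∀ N : ℕ, ((bracket y) ^ N : g →ₗ[ℂ] g) z ∈ G (t + N * s) := by
    intro N
    induction N with
    | zero => simpa using hz
    | succ N ih =>
      rw [pow_succ', Module.End.mul_apply]
      have h2 := R.bracket_mem _ _ y hy _ ih
      have h3 : s + (t + N * s) = t + (N + 1 : ℕ) * s := by push_cast; ring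
      rwa [h3] at h2
  obtain ⟨N, hN⟩ := exists_nat_ge ((b + |t|) / |s|)
  refine ⟨N, ?_⟩
  have h2 : G (t + N * s) = ⊥ := hb _ (by
    have hs' : 0 < |s| := abs_pos.mpr hs
    rw [div_le_iff₀ hs'] at hN
    have h3 : |(N : ℝ) * s| = N * |s| := by rw [abs_mul, Nat.abs_cast]
    have h4 := abs_sub_abs_le_abs_sub ((N : ℝ) * s) (-t)
    rw [abs_neg, sub_neg_eq_add, h3, add_comm] at h4
    linarith)
  have h3 := h1 N
  rwa [h2, Submodule.mem_bot] at h3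

theorem form_comm_zero {a b : g} (ha : a ∈ G 0) : B.form a b = B.form b a :=
  B.apply_comm_of_even (R.even ha)

/-- The action of `x` on the string `p, [y, p], [y, [y, p]], …` of a primitive vector `p`. -/
theorem bracket_string {a c : g} (ha : a ∈ G 0) {i : ZMod 2} {x y p : g}
    (hx : x ∈ eigenPart (G 0) (B.form a)) (hxi : x ∈ part i)
    (hy : y ∈ eigenPart (G 0) (B.form (-a))) (hyi : y ∈ part i) (hxy : B.form x y = 1)
    (hp : p ∈ eigenPart (G 0) (B.form (-c))) (hxp : bracket x p = 0) (μ : ℕ → ℂ)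
    (h0 : μ 0 = -B.form c a)
    (hs : ∀ k, μ (k + 1) = (-B.form c a - (k + 1) * B.form a a) + koszul i i * μ k) (k : ℕ) :
    bracket x (((bracket y) ^ (k + 1) : g →ₗ[ℂ] g) p) = μ k • ((bracket y) ^ k : g →ₗ[ℂ] g) p := by
  have hw : ∀ k : ℕ, ((bracket y) ^ k : g →ₗ[ℂ] g) p ∈ eigenPart (G 0) (B.form (-c - (k : ℂ) • a)) := by
    intro k
    induction k with
    | zero => simpa using hp
    | succ k ih =>
      rw [pow_succ', Module.End.mul_apply]
      have h1 := R.add_mem_eigenPart hy ih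
      have h2 : -a + (-c - (k : ℂ) • a) = -c - ((k + 1 : ℕ) : ℂ) • a := by push_cast; module
      rwa [h2] at h1
  have hw' : ∀ k : ℕ, bracket a (((bracket y) ^ k : g →ₗ[ℂ] g) p) =
      (-B.form c a - k * B.form a a) • ((bracket y) ^ k : g →ₗ[ℂ] g) p := fun k => by
    rw [hw k a ha]
    simp
  have hstep : ∀ z, bracket x (bracket y z) = bracket a z + koszul i i • bracket y (bracket x z) :=
    fun z => by
      rw [LieSuperalgebra.bracket_jacobi hxi hyi, R.bracket_eq ha hx hy, hxy, one_smul]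
  induction k with
  | zero =>
    rw [zero_add, pow_one, hstep, hxp, map_zero, smul_zero, add_zero, h0]
    have h1 := hw' 0
    simpa using h1
  | succ k ih =>
    rw [pow_succ', Module.End.mul_apply, hstep, hw', ih, map_smul, hs, add_smul, smul_smul,
      ← Module.End.mul_apply, ← pow_succ']
    push_cast; rfl

/-- Where the string ends, the coefficient μ_M of `bracket_string` must vanish. Solving the
recursion gives μ_k = -(k+1)(c,a) - k(k+1)/2 (a,a) for even x, y, and μ_{2m} = -(c,a) - m(a,a),
μ_{2m+1} = -(m+1)(a,a) for odd x, y. -/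
theorem exists_string {a c : g} (ha : a ∈ G 0) {i : ZMod 2} {x y p : g}
    (hx : x ∈ eigenPart (G 0) (B.form a)) (hxi : x ∈ part i)
    (hy : y ∈ eigenPart (G 0) (B.form (-a))) (hyi : y ∈ part i) (hxy : B.form x y = 1)
    (hp : p ∈ eigenPart (G 0) (B.form (-c))) (hp0 : p ≠ 0) (hxp : bracket x p = 0)
    (hN : ∃ N : ℕ, ((bracket y) ^ N : g →ₗ[ℂ] g) p = 0) :
    ∃ N : ℕ, (∀ j ≤ N, ((bracket y) ^ j : g →ₗ[ℂ] g) p ≠ 0) ∧ ((bracket y) ^ (N + 1) : g →ₗ[ℂ] g) p = 0 ∧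
      (i = 0 → 2 * B.form c a = -N * B.form a a) ∧
      (i = 1 → (∃ m : ℕ, B.form c a = -m * B.form a a) ∨ B.form a a = 0) := by
  classical
  let N := Nat.find hN
  have h1 : ((bracket y) ^ N : g →ₗ[ℂ] g) p = 0 := Nat.find_spec hN
  have h2 : ∀ j < N, ((bracket y) ^ j : g →ₗ[ℂ] g) p ≠ 0 := fun j hj => Nat.find_min hN hj
  obtain ⟨M, hM⟩ : ∃ M, N = M + 1 := Nat.exists_eq_succ_of_ne_zero (fun h0 => hp0 (by
    rw [h0] at h1; simpa using h1))
  rw [hM] at h1 h2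
  refine ⟨M, fun j hj => h2 j (by omega), h1, fun hi => ?_, fun hi => ?_⟩
  · subst hi
    have h3 := R.bracket_string ha hx hxi hy hyi hxy hp hxp
      (fun k => -(k + 1) * B.form c a - k * (k + 1) / 2 * B.form a a) (by simp) (fun k => by
        rw [koszul_zero_left]; push_cast; ring) M
    rw [h1, map_zero] at h3
    have h4 := (smul_eq_zero.mp h3.symm).resolve_right (h2 M (by omega))
    have h5 : ((M : ℂ) + 1) * (2 * B.form c a + M * B.form a a) = 0 := by linear_combination -2 * h4
    have h6 := (mul_eq_zero.mp h5).resolve_left (by exact_mod_cast (Nat.succ_ne_zero M))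
    linear_combination h6
  · subst hi
    have h3 := R.bracket_string ha hx hxi hy hyi hxy hp hxp
      (fun k => if k % 2 = 0 then -B.form c a - (k / 2 : ℕ) * B.form a a
        else -((k / 2 : ℕ) + 1) * B.form a a) (by simp) (fun k => by
        rw [koszul_self_one]
        rcases Nat.even_or_odd' k with ⟨m, rfl | rfl⟩
        · have e1 : (2 * m + 1) % 2 = 1 := by omega
          have e2 : (2 * m + 1) / 2 = m := by omega
          have e3 : (2 * m) % 2 = 0 := by omega
          have e4 : (2 * m) / 2 = m := by omega
          simp only [e1, e2, e3, e4, one_ne_zero, if_false, if_true]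
          push_cast; ring
        · have e1 : (2 * m + 1 + 1) % 2 = 0 := by omega
          have e2 : (2 * m + 1 + 1) / 2 = m + 1 := by omega
          have e3 : (2 * m + 1) % 2 = 1 := by omega
          have e4 : (2 * m + 1) / 2 = m := by omega
          simp only [e1, e2, e3, e4, one_ne_zero, if_false, if_true]
          push_cast; ring) M
    rw [h1, map_zero] at h3
    have h4 := (smul_eq_zero.mp h3.symm).resolve_right (h2 M (by omega))
    by_cases hM2 : M % 2 = 0
    · rw [if_pos hM2] at h4
      exact Or.inl ⟨M / 2, by linear_combination -h4⟩
    · rw [if_neg hM2] at h4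
      refine Or.inr ((mul_eq_zero.mp h4).resolve_left ?_)
      refine neg_ne_zero.mpr ?_
      exact_mod_cast (Nat.succ_ne_zero (M / 2))

/-- If `u` is an even root vector of weight `b` and `v` is an odd root vector of weight `c`, then
`b + c` cannot be orthogonal to both `b` and `c`. -/
theorem false_of_isotropic {b c : g} (hb : b ∈ G 0) (hc : c ∈ G 0) {s s' : ℝ} (hs : 0 < s) (hs' : 0 < s')
    {u v : g} (hu : u ∈ homPart B G s 0 b) (hv : v ∈ homPart B G s' 1 c) (hu0 : u ≠ 0) (hv0 : v ≠ 0)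
    (hbc : B.form b (b + c) = 0) (hcb : B.form c (b + c) = 0) : False := by
  have hb0 : b ≠ 0 := by
    rintro rfl
    exact hu0 (R.disjoint_grade hs.ne' hu.1.1 (R.mem_zero_of_form hu.2))
  have hbb : B.form b b ≠ 0 := R.form_ne_zero b hb hb0 u hu.2 hu.1.2 hu0
  have h1 : B.form b c = -B.form b b := by rw [map_add] at hbc; linear_combination hbc
  have h2 : B.form c c = B.form b b := by
    rw [map_add, R.form_comm_zero hc] at hcb; linear_combination hcb - h1
  obtain ⟨v', hv', hvv'⟩ := R.exists_dual hc hv hv0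
  obtain ⟨u', hu', huu'⟩ := R.exists_dual hb hu hu0
  -- The two orthogonality conditions give (c, c) = (b, b) ≠ 0. If [v, v] were zero, the Jacobi
  -- identity with v' would give 2 (c, c) v = 0.
  have hw0 : bracket v v ≠ 0 := by
    intro h0
    have h3 := LieSuperalgebra.bracket_jacobi hv.1.2 hv.1.2 v'
    rw [h0, koszul_self_one, R.bracket_eq hc hv.2 hv'.2, hvv', one_smul, map_zero,
      LinearMap.zero_apply, zero_add, ← neg_eq_iff_eq_neg.mpr (bracket_skew_of_even (R.even hc)),
      hv.2 c hc, h2] at h3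
    have h4 : (2 * B.form b b) • v = 0 := by linear_combination (norm := module) -h3
    rcases smul_eq_zero.mp h4 with h5 | h5
    · exact hbb (by simpa using h5)
    · exact hv0 h5
  have hw : bracket v v ∈ eigenPart (G 0) (B.form ((2 : ℂ) • c)) := by
    have := R.add_mem_eigenPart hv.2 hv.2
    rwa [← two_smul ℂ c] at this
  have hweven : bracket v v ∈ part (V := g) 0 := LieSuperalgebra.bracket_mem hv.1.2 hv.1.2
  have hwG := R.bracket_mem _ _ v hv.1.1 v hv.1.1
  -- go to the bottom of the string
  classical
  have hnil := R.exists_pow_eq_zero (neg_ne_zero.mpr hs.ne') hu'.1.1 hwG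
  let K := Nat.find hnil
  have hK1 : ((bracket u') ^ K : g →ₗ[ℂ] g) (bracket v v) = 0 := Nat.find_spec hnil
  have hK2 : ∀ j < K, ((bracket u') ^ j : g →ₗ[ℂ] g) (bracket v v) ≠ 0 := fun j hj => Nat.find_min hnil hj
  obtain ⟨k, hk⟩ : ∃ k, K = k + 1 := Nat.exists_eq_succ_of_ne_zero (fun h0 => hw0 (by
    rw [h0] at hK1; simpa using hK1))
  rw [hk] at hK1 hK2
  let p := ((bracket u') ^ k : g →ₗ[ℂ] g) (bracket v v)
  have hpj : ∀ j : ℕ, ((bracket u') ^ j : g →ₗ[ℂ] g) (bracket v v) ∈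
      eigenPart (G 0) (B.form (-((j : ℂ) • b - (2 : ℂ) • c))) ∧
      ((bracket u') ^ j : g →ₗ[ℂ] g) (bracket v v) ∈ part (V := g) 0 ∧
      ((bracket u') ^ j : g →ₗ[ℂ] g) (bracket v v) ∈ G (s' + s' + j * (-s)) := by
    intro j
    induction j with
    | zero =>
      have h4 : -(((0 : ℕ) : ℂ) • b - (2 : ℂ) • c) = (2 : ℂ) • c := by push_cast; module
      rw [h4, Nat.cast_zero, zero_mul, add_zero]
      exact ⟨hw, hweven, hwG⟩
    | succ j ih =>
      rw [pow_succ', Module.End.mul_apply]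
      refine ⟨?_, ?_, ?_⟩
      · have h3 := R.add_mem_eigenPart hu'.2 ih.1
        have h4 : -b + -((j : ℂ) • b - (2 : ℂ) • c) = -(((j + 1 : ℕ) : ℂ) • b - (2 : ℂ) • c) := by
          push_cast; module
        rwa [h4] at h3
      · simpa using LieSuperalgebra.bracket_mem hu'.1.2 ih.2.1
      · have h3 := R.bracket_mem _ _ u' hu'.1.1 _ ih.2.2
        have h4 : -s + (s' + s' + j * (-s)) = s' + s' + (j + 1 : ℕ) * (-s) := by push_cast; ring
        rwa [h4] at h3
  have hp0 : p ≠ 0 := hK2 k (by omega)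
  have hu'p : bracket u' p = 0 := by
    rw [pow_succ', Module.End.mul_apply] at hK1; exact hK1
  have hu2 : u ∈ eigenPart (G 0) (B.form (-(-b))) := by rw [neg_neg]; exact hu.2
  have hu'u : B.form u' u = 1 := by
    rw [← B.apply_comm_of_even hu.1.2, huu']
  obtain ⟨N, hN1, -, hN3, -⟩ := R.exists_string (Submodule.neg_mem _ hb) hu'.2 hu'.1.2 hu2 hu.1.2 hu'u
    (hpj k).1 hp0 hu'p (R.exists_pow_eq_zero hs.ne' hu.1.1 (hpj k).2.2)
  have hN4 := hN3 rfl
  have h3 : B.form ((k : ℂ) • b - (2 : ℂ) • c) (-b) = -(k + 2) * B.form b b := by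
    simp only [map_sub, map_smul, LinearMap.sub_apply, LinearMap.smul_apply, map_neg, smul_eq_mul]
    rw [R.form_comm_zero hc, h1]
    ring
  have h4 : B.form (-b) (-b) = B.form b b := by simp
  rw [h3, h4] at hN4
  -- The string of the even root b starts at p, of weight 2c - kb, and has length N = 2(k + 2)
  -- because (b, c) = -(b, b). So the (k+2)-nd step, of weight 2(b + c), is not beyond its end.
  have h5 : (2 * (k + 2) : ℂ) = N := by
    have h6 : (2 * (k + 2) - N : ℂ) * B.form b b = 0 := by linear_combination -hN4
    exact sub_eq_zero.mp ((mul_eq_zero.mp h6).resolve_right hbb)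
  have h6 : 2 * (k + 2) = N := by exact_mod_cast h5
  -- the vector of weight `2 (b + c)`
  have hq0 := hN1 (k + 2) (by omega)
  have hq : ∀ j : ℕ, ((bracket u) ^ j : g →ₗ[ℂ] g) p ∈
      eigenPart (G 0) (B.form ((j : ℂ) • b - ((k : ℂ) • b - (2 : ℂ) • c))) ∧
      ((bracket u) ^ j : g →ₗ[ℂ] g) p ∈ part (V := g) 0 := by
    intro j
    induction j with
    | zero =>
      have h4 : ((0 : ℕ) : ℂ) • b - ((k : ℂ) • b - (2 : ℂ) • c) = -((k : ℂ) • b - (2 : ℂ) • c) := by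
        push_cast; module
      rw [h4]
      exact ⟨(hpj k).1, (hpj k).2.1⟩
    | succ j ih =>
      rw [pow_succ', Module.End.mul_apply]
      refine ⟨?_, ?_⟩
      · have h3 := R.add_mem_eigenPart hu.2 ih.1
        have h4 : b + ((j : ℂ) • b - ((k : ℂ) • b - (2 : ℂ) • c)) =
            (((j + 1 : ℕ) : ℂ) • b - ((k : ℂ) • b - (2 : ℂ) • c)) := by
          push_cast; module
        rwa [h4] at h3
      · simpa using LieSuperalgebra.bracket_mem hu.1.2 ih.2
  have hq1 := hq (k + 2)
  have h7 : ((k + 2 : ℕ) : ℂ) • b - ((k : ℂ) • b - (2 : ℂ) • c) = (2 : ℂ) • (b + c) := by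
    push_cast; module
  rw [h7] at hq1
  -- The vector of weight 2(b + c) has degree 2s + 2s' > 0, so it is not in 𝔥.
  have hbc0 : (2 : ℂ) • (b + c) ≠ 0 := by
    intro h0
    have h12 := (hq (k + 2)).1
    rw [h7, h0] at h12
    have h13 := R.mem_zero_of_form h12
    have hdeg : ∀ j : ℕ, ((bracket u) ^ j : g →ₗ[ℂ] g) p ∈ G (s' + s' + k * (-s) + j * s) := by
      intro j
      induction j with
      | zero => simpa [p] using (hpj k).2.2
      | succ j ih =>
        rw [pow_succ', Module.End.mul_apply]
        have h3 := R.bracket_mem _ _ u hu.1.1 _ ih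
        have h4 : s + (s' + s' + k * (-s) + j * s) = s' + s' + k * (-s) + (j + 1 : ℕ) * s := by
          push_cast; ring
        rwa [h4] at h3
    have h14 := hdeg (k + 2)
    refine hq0 (R.disjoint_grade ?_ h14 h13)
    push_cast
    nlinarith
  -- Contradiction: 2(b + c) is an even root, yet isotropic.
  refine R.form_ne_zero _ (Submodule.smul_mem _ _ (Submodule.add_mem _ hb hc)) hbc0 _ hq1.1 hq1.2 hq0 ?_
  have h8 : B.form ((2 : ℂ) • (b + c)) ((2 : ℂ) • (b + c)) =
      4 * (B.form b (b + c) + B.form c (b + c)) := by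
    simp only [map_add, map_smul, LinearMap.add_apply, LinearMap.smul_apply, smul_eq_mul]
    ring
  rw [h8, hbc, hcb, add_zero, mul_zero]

end RootGrading
end RootStrings

/-! ### Elements orthogonal to brackets are not sums of brackets -/

section Generators

variable {g : Type*} [AddCommGroup g] [Module ℂ g] [LieSuperalgebra g] {B : KillingForm g}
  {G : ℝ → Submodule ℂ g}

/-- The span of the brackets of elements of `U`. -/
def derived (U : Submodule ℂ g) : Submodule ℂ g :=
  Submodule.span ℂ {z | ∃ x ∈ U, ∃ y ∈ U, bracket x y = z}

theorem bracket_mem_derived {U : Submodule ℂ g} {x y : g} (hx : x ∈ U) (hy : y ∈ U) :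
    bracket x y ∈ derived U := Submodule.subset_span ⟨x, hx, y, hy, rfl⟩

theorem derived_le {U W : Submodule ℂ g} (h : ∀ x ∈ U, ∀ y ∈ U, bracket x y ∈ W) : derived U ≤ W :=
  Submodule.span_le.mpr (by rintro _ ⟨x, hx, y, hy, rfl⟩; exact h x hx y hy)

namespace RootGrading

variable (R : RootGrading B G)

include R

theorem homPart_bracket {s t : ℝ} {i j : ZMod 2} {a b x y : g} (hx : x ∈ homPart B G s i a)
    (hy : y ∈ homPart B G t j b) : bracket x y ∈ homPart B G (s + t) (i + j) (a + b) :=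
  ⟨⟨R.bracket_mem _ _ x hx.1.1 y hy.1.1, LieSuperalgebra.bracket_mem hx.1.2 hy.1.2⟩,
    R.add_mem_eigenPart hx.2 hy.2⟩

/-- For w ∈ 𝔫⁻ invariance gives B([x, z], w) = B(x, [z, w]) = 0. Thus x behaves like a simple root
vector: bracketing with 𝔫⁻ cannot lead to other elements of 𝔫⁺. -/
theorem bracket_eq_zero_of_form {x z : g} {s : ℝ} (hs : 0 < s)
    (hxE : ∀ z ∈ derived (negPart G), B.form x z = 0) (hz : z ∈ negPart G) (hxz : bracket x z ∈ G s) :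
    bracket x z = 0 :=
  R.eq_zero_of_mem_posPart (mem_posPart hs hxz) fun w hw => by
    rw [B.invariant]; exact hxE _ (bracket_mem_derived hz hw)

/-- Otherwise a = b + c for root vectors u, v in 𝔫⁺, such that, with y dual to x, the vectors [y, u]
of weight -c and [y, v] of weight -b are non-zero and killed by x. Their strings make (c, a) and (b,
a) non-positive rational multiples of (a, a), while their sum is (a, a); hence (a, a) = 0. This is
impossible for an even root; for an odd one it forces (b, a) = (c, a) = 0, excluded by
`false_of_isotropic`. -/
theorem eq_zero_of_mem_derived_of_homPart {t : ℝ} (ht : 0 < t) {i : ZMod 2} {a x : g} (ha : a ∈ G 0)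
    (hx : x ∈ homPart B G t i a) (hxE : ∀ z ∈ derived (negPart G), B.form x z = 0)
    (hxN : x ∈ derived (posPart G)) : x = 0 := by
  by_contra hx0
  obtain ⟨y, hy, hxy⟩ := R.exists_dual ha hx hx0
  -- Since x lies in the span of brackets of 𝔫⁺ and pairs with y, some bracket of homogeneous
  -- vectors pairs with y.
  obtain ⟨s, hs, s', hs', j, b, hb, k, c, hc, u, hu, v, hv, huv⟩ :
      ∃ s : ℝ, 0 < s ∧ ∃ s' : ℝ, 0 < s' ∧ ∃ (j : ZMod 2) (b : g), b ∈ G 0 ∧ ∃ (k : ZMod 2) (c : g), c ∈ G 0 ∧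
        ∃ u ∈ homPart B G s j b, ∃ v ∈ homPart B G s' k c, B.form (bracket u v) y ≠ 0 := by
    by_contra! hcon
    have key : ∀ u ∈ posPart G, ∀ v ∈ posPart G, B.form (bracket u v) y = 0 := by
      intro u hu v hv
      refine posPart_induction (p := fun u => B.form (bracket u v) y = 0) (fun s hs u hu => ?_) (by simp)
        (fun a b ha hb => by
          rw [map_add, LinearMap.add_apply, map_add, LinearMap.add_apply, ha, hb, add_zero]) hu
      refine posPart_induction (p := fun v => B.form (bracket u v) y = 0) (fun s' hs' v hv => ?_) (by simp)
        (fun a b ha hb => by rw [map_add, map_add, LinearMap.add_apply, ha, hb, add_zero]) hv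
      rw [R.homPart_le] at hu hv
      induction hu using Submodule.iSup_induction' with
      | mem l u hu =>
        induction hv using Submodule.iSup_induction' with
        | mem l' v hv => exact hcon s hs s' hs' l.1 l.2 l.2.2 l'.1 l'.2 l'.2.2 u hu v hv
        | zero => simp
        | add a b _ _ ha hb => rw [map_add, map_add, LinearMap.add_apply, ha, hb, add_zero]
      | zero => simp
      | add a b _ _ ha hb =>
        rw [map_add, LinearMap.add_apply, map_add, LinearMap.add_apply, ha, hb, add_zero]
    have h1 : derived (posPart G) ≤ LinearMap.ker (B.form.flip y) := derived_le key
    have h2 : B.form x y = 0 := h1 hxN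
    rw [h2] at hxy
    exact zero_ne_one hxy
  obtain ⟨h1, h2, h3⟩ := R.form_homPart (Submodule.add_mem _ hb hc) (Submodule.neg_mem _ ha)
    (R.homPart_bracket hu hv) hy huv
  rw [neg_inj] at h1 h3
  subst h1 h3 h2
  have ht0 : -(s + s') ≠ 0 := by linarith
  have hyneg : y ∈ negPart G := mem_negPart (by linarith) hy.1.1
  have hp := R.homPart_bracket hy hu
  have hq := R.homPart_bracket hy hv
  rw [show -(s + s') + s = -s' by ring, show -(b + c) + b = -c by abel] at hp
  rw [show -(s + s') + s' = -s by ring, show -(b + c) + c = -b by abel] at hq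
  have hp0 : bracket y u ≠ 0 := by
    intro h0
    apply huv
    rw [LieSuperalgebra.bracket_skew hu.1.2 hv.1.2, map_neg, LinearMap.neg_apply, map_smul,
      LinearMap.smul_apply, B.invariant, LieSuperalgebra.bracket_skew hu.1.2 hy.1.2, h0]
    simp
  have hq0 : bracket y v ≠ 0 := by
    intro h0
    apply huv
    rw [B.invariant, LieSuperalgebra.bracket_skew hv.1.2 hy.1.2, h0]
    simp
  have hxp : bracket x (bracket y u) = 0 := R.bracket_eq_zero_of_form hs hxE
    (mem_negPart (by linarith) hp.1.1) (by
      have := R.bracket_mem _ _ x hx.1.1 _ hp.1.1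
      rwa [show s + s' + -s' = s by ring] at this)
  have hxq : bracket x (bracket y v) = 0 := R.bracket_eq_zero_of_form hs' hxE
    (mem_negPart (by linarith) hq.1.1) (by
      have := R.bracket_mem _ _ x hx.1.1 _ hq.1.1
      rwa [show s + s' + -s = s' by ring] at this)
  obtain ⟨N, -, -, hN0, hN1⟩ := R.exists_string ha hx.2 hx.1.2 hy.2 hy.1.2 hxy hp.2 hp0 hxp
    (R.exists_pow_eq_zero ht0 hy.1.1 hp.1.1)
  obtain ⟨N', -, -, hN0', hN1'⟩ := R.exists_string ha hx.2 hx.1.2 hy.2 hy.1.2 hxy hq.2 hq0 hxq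
    (R.exists_pow_eq_zero ht0 hy.1.1 hq.1.1)
  have ha0 : b + c ≠ 0 := by
    intro h0
    have h4 := hx.2
    rw [h0] at h4
    exact hx0 (R.disjoint_grade (by linarith) hx.1.1 (R.mem_zero_of_form h4))
  have hsum : B.form c (b + c) + B.form b (b + c) = B.form (b + c) (b + c) := by
    rw [map_add B.form b c, LinearMap.add_apply, add_comm]
  rcases parity_cases (j + k) with hi | hi
  · have h4 := hN0 hi
    have h5 := hN0' hi
    have h6 : B.form (b + c) (b + c) ≠ 0 := R.form_ne_zero _ ha ha0 x hx.2 (hi ▸ hx.1.2) hx0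
    have h7 : ((2 + N + N' : ℕ) : ℂ) * B.form (b + c) (b + c) = 0 := by
      push_cast
      linear_combination h4 + h5 - 2 * hsum
    exact absurd ((mul_eq_zero.mp h7).resolve_right h6) (by
      exact_mod_cast (by omega : 2 + N + N' ≠ 0))
  · by_cases h6 : B.form (b + c) (b + c) = 0
    -- Otherwise [y, y] would be an even root vector of the isotropic weight -2a.
    · have hyy : bracket y y = 0 := by
        by_contra hne
        have h7 := R.homPart_bracket hy hy
        refine R.form_ne_zero _ (Submodule.add_mem _ (Submodule.neg_mem _ ha) (Submodule.neg_mem _ ha)) ?_ _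
          h7.2 (by
            have h8 := h7.1.2
            rwa [hi, show (1 : ZMod 2) + 1 = 0 from rfl] at h8) hne ?_
        · intro h0
          rw [← two_smul ℂ, smul_eq_zero] at h0
          exact ha0 (neg_eq_zero.mp (h0.resolve_left two_ne_zero))
        · have h8 : B.form (-(b + c) + -(b + c)) (-(b + c) + -(b + c)) = 4 * B.form (b + c) (b + c) := by
            generalize b + c = e
            simp only [map_add, map_neg, LinearMap.add_apply, LinearMap.neg_apply]
            ring
          rw [h8, h6, mul_zero]
      -- Because [y, y] = 0, y kills [y, z]. As x kills it too, so does a = [x, y], and the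
      -- eigenvalue -(c', a) of a is zero.
      have key : ∀ z c', bracket y z ≠ 0 → bracket y z ∈ eigenPart (G 0) (B.form (-c')) →
          bracket x (bracket y z) = 0 → B.form c' (b + c) = 0 := by
        intro z c' h0 hz hxz
        have hy1 : y ∈ part (V := g) 1 := hi ▸ hy.1.2
        have hx1 : x ∈ part (V := g) 1 := hi ▸ hx.1.2
        have h7 := LieSuperalgebra.bracket_jacobi hy1 hy1 z
        rw [hyy, koszul_self_one, map_zero, LinearMap.zero_apply, zero_add] at h7
        have h8 : (2 : ℂ) • bracket y (bracket y z) = 0 := by linear_combination (norm := module) h7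
        have h9 := (smul_eq_zero.mp h8).resolve_left two_ne_zero
        have h10 := LieSuperalgebra.bracket_jacobi hx1 hy1 (bracket y z)
        rw [h9, hxz, R.bracket_eq ha hx.2 hy.2, hxy, one_smul, map_zero, map_zero, smul_zero, add_zero,
          hz _ ha] at h10
        have h11 := (smul_eq_zero.mp h10.symm).resolve_right h0
        rwa [map_neg, LinearMap.neg_apply, neg_eq_zero] at h11
      have h7 := key u c hp0 hp.2 hxp
      have h8 := key v b hq0 hq.2 hxq
      rcases parity_cases j with rfl | rfl <;> rcases parity_cases k with rfl | rfl
      · exact absurd hi (by decide)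
      · exact R.false_of_isotropic hb hc hs hs' hu hv (by rintro rfl; simp at hp0) (by rintro rfl; simp at hq0) h8 h7
      · exact R.false_of_isotropic hc hb hs' hs hv hu (by rintro rfl; simp at hq0) (by rintro rfl; simp at hp0)
          (by rwa [add_comm]) (by rwa [add_comm])
      · exact absurd hi (by decide)
    · obtain ⟨m, hm⟩ := (hN1 hi).resolve_right h6
      obtain ⟨m', hm'⟩ := (hN1' hi).resolve_right h6
      have h7 : ((1 + m + m' : ℕ) : ℂ) * B.form (b + c) (b + c) = 0 := by
        push_cast
        linear_combination hm + hm' - hsum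
      exact absurd ((mul_eq_zero.mp h7).resolve_right h6) (by
        exact_mod_cast (by omega : 1 + m + m' ≠ 0))

/-- The elements of `𝔫⁺` orthogonal to `[𝔫⁻, 𝔫⁻]`. -/
theorem eq_zero_of_mem_derived {x : g} (hx : x ∈ posPart G)
    (hxE : ∀ z ∈ derived (negPart G), B.form x z = 0) (hxN : x ∈ derived (posPart G)) : x = 0 := by
  -- U is stable under degree, parity and 𝔥, hence spanned by homogeneous elements.
  let U : Submodule ℂ g := (posPart G ⊓ derived (posPart G)) ⊓ perp B (derived (negPart G))
  have hder : ∀ T : g →ₗ[ℂ] g, ∀ U : Submodule ℂ g, (∀ x ∈ U, T x ∈ U) →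
      (∀ x y, T (bracket x y) = bracket (T x) y + bracket x (T y)) → ∀ x ∈ derived U, T x ∈ derived U := by
    intro T U hU hT
    refine derived_le (W := (derived U).comap T) fun x hx y hy => ?_
    rw [Submodule.mem_comap, hT]
    exact Submodule.add_mem _ (bracket_mem_derived (hU x hx) hy) (bracket_mem_derived hx (hU y hy))
  have hpar : ∀ U : Submodule ℂ g, IsGraded U → IsGraded (derived U) := by
    intro U hU
    refine isGraded_of_parityInv_mem ?_
    refine derived_le (W := (derived U).comap (parityInv g)) fun x hx y hy => ?_
    rw [Submodule.mem_comap, parityInv_bracket]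
    exact bracket_mem_derived (hU.parityInv_mem hx) (hU.parityInv_mem hy)
  have hbr : ∀ h ∈ G 0, ∀ x y, bracket h (bracket x y) = bracket (bracket h x) y + bracket x (bracket h y) :=
    fun h hh x y => bracket_jacobi_of_even (R.even hh) x y
  have h1 := R.mem_iSup_homPart (U := U) (fun v hv =>
    ⟨⟨R.degreeOp_posPart hv.1.1, hder _ _ (fun x hx => R.degreeOp_posPart hx) R.degreeOp_bracket _ hv.1.2⟩,
      fun z hz => by
        rw [R.form_degreeOp, hv.2 _ (hder _ _ (fun x hx => R.degreeOp_negPart hx) R.degreeOp_bracket _ hz),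
          neg_zero]⟩)
    ((R.posPart_graded.inf (hpar _ R.posPart_graded)).inf
      (Parabolic.perp_isGraded (hpar _ R.negPart_graded)))
    (fun h hh v hv => ⟨⟨R.bracket_zero_posPart hh hv.1.1, hder _ _
      (fun x hx => R.bracket_zero_posPart hh hx) (hbr h hh) _ hv.1.2⟩, fun z hz => by
        rw [form_bracket_of_even B (R.even hh), hv.2 _ (hder _ _
          (fun x hx => R.bracket_zero_negPart hh hx) (hbr h hh) _ hz), neg_zero]⟩)
    (show x ∈ U from ⟨⟨hx, hxN⟩, hxE⟩)
  have h2 : (⨆ k : ℝ × ZMod 2 × G 0, U ⊓ homPart B G k.1 k.2.1 k.2.2) ≤ ⊥ := by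
    refine iSup_le fun k v hv => ?_
    rw [Submodule.mem_bot]
    by_cases hk : 0 < k.1
    · exact R.eq_zero_of_mem_derived_of_homPart hk k.2.2.2 hv.2 hv.1.2 hv.1.1.2
    · refine R.eq_zero_of_mem_posPart hv.1.1.1 fun y hy => ?_
      exact negPart_induction (p := fun y => B.form v y = 0)
        (fun t ht y hy => R.form_grade (by linarith [not_lt.mp hk]) hv.2.1.1 hy) (map_zero _)
        (fun a b ha hb => by rw [map_add, ha, hb, add_zero]) hy
  exact h2 h1

end RootGrading
end Generators

/-! ### Gradings adapted to a parabolic subalgebra; decomposition of 𝔫⁺ -/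

section Adapted

variable {g : Type*} [AddCommGroup g] [Module ℂ g] [LieSuperalgebra g] {B : KillingForm g}
  {G : ℝ → Submodule ℂ g}

/-- A grading whose non-negative part lies in `p` and whose non-positive part lies in `p*`. -/
structure Parabolic.Adapted (P : Parabolic B) (G : ℝ → Submodule ℂ g) : Prop extends RootGrading B G where
  le_p : ∀ t, 0 ≤ t → G t ≤ P.p
  le_pOpp : ∀ t, t ≤ 0 → G t ≤ P.pOpp

theorem Parabolic.exists_adapted (P : Parabolic B) (hg : IsBasicClassical g ∨ IsGeneralLinear g) :
    ∃ G : ℝ → Submodule ℂ g, P.Adapted G := by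
  obtain ⟨b, b', ⟨G, h, hint, hgr, hbr, hh, hG, rfl, rfl⟩, hp, hp'⟩ := P.borel
  refine ⟨G, ?_, fun t ht => (le_iSup₂_of_le t ht le_rfl).trans hp,
    fun t ht => (le_iSup₂_of_le t ht le_rfl).trans hp'⟩
  rcases hg with hg | hg
  · exact hg.rootGrading B hh hint hgr hbr hG
  · exact hg.rootGrading B hh hint hgr hbr hG

namespace Parabolic.Adapted

variable {P : Parabolic B} (hP : P.Adapted G)

include hP

theorem opp : P.opp.Adapted (fun t => G (-t)) where
  toRootGrading := hP.toRootGrading.opp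
  le_p t ht := hP.le_pOpp _ (by linarith)
  le_pOpp t ht := hP.le_p _ (by linarith)

theorem posPart_le : posPart G ≤ P.p := iSup₂_le fun t ht => hP.le_p t ht.le

/-- An element of 𝔫 is orthogonal to 𝔥 and 𝔫⁺, since p contains both; this kills its components in 𝔥
and in 𝔫⁻. -/
theorem n_le_posPart : P.n ≤ posPart G := by
  intro x hx
  have h1 : x ∈ posPart G ⊔ G 0 ⊔ negPart G := by rw [hP.posPart_sup]; trivial
  obtain ⟨y, hy, c, hc, rfl⟩ := Submodule.mem_sup.mp h1
  obtain ⟨a, ha, b, hb, rfl⟩ := Submodule.mem_sup.mp hy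
  have hb0 : b = 0 := by
    refine hP.eq_zero_of_form_eq_zero hb fun k hk => ?_
    have h := hx k (hP.le_p 0 le_rfl hk)
    rwa [map_add, map_add, LinearMap.add_apply, LinearMap.add_apply, hP.form_posPart_zero hk ha,
      hP.form_negPart_zero hk hc, zero_add, add_zero] at h
  have hc0 : c = 0 := by
    refine hP.eq_zero_of_mem_negPart hc fun k hk => ?_
    have h := hx k (hP.posPart_le hk)
    rwa [map_add, map_add, LinearMap.add_apply, LinearMap.add_apply, hP.form_posPart ha hk,
      hP.form_zero_posPart hb hk, zero_add, zero_add] at h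
  rwa [hb0, hc0, add_zero, add_zero]

theorem n_le : P.n ≤ P.p := hP.n_le_posPart.trans hP.posPart_le

theorem nbar_le : P.nbar ≤ P.pOpp := hP.opp.n_le

omit hP in
theorem form_of_mem_n {x y : g} (hx : x ∈ P.n) (hy : y ∈ P.p) : B.form y x = 0 := by
  rw [B.form_comm]
  exact hx _ (P.p_sub.graded.parityInv_mem hy)

omit hP in
theorem bracket_n_left {x y : g} (hx : x ∈ P.n) (hy : y ∈ P.p) : bracket x y ∈ P.n := fun z hz => by
  rw [B.invariant]
  exact hx _ (P.p_sub.bracket_mem _ hy _ hz)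

omit hP in
theorem bracket_n_right {x y : g} (hx : x ∈ P.n) (hy : y ∈ P.p) : bracket y x ∈ P.n := fun z hz => by
  rw [B.invariant]
  exact form_of_mem_n (bracket_n_left hx hz) hy

omit hP in
theorem eq_zero_of_n {x : g} (hx : x ∈ P.n) (hx' : x ∈ P.pOpp) : x = 0 :=
  Submodule.disjoint_def.mp P.isCompl_n.disjoint x hx hx'

omit hP in
theorem eq_zero_of_nbar {x : g} (hx : x ∈ P.nbar) (hx' : x ∈ P.p) : x = 0 :=
  Submodule.disjoint_def.mp P.isCompl_nOpp.disjoint x hx hx'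

theorem le_levi_sup {U : Submodule ℂ g} (hU : U ≤ P.p) (hn : P.n ≤ U) : U ≤ (U ⊓ P.levi) ⊔ P.n := by
  intro x hx
  have h1 : x ∈ P.n ⊔ P.pOpp := by
    have h := P.isCompl_n.sup_eq_top
    change x ∈ perp B P.p ⊔ P.pOpp
    rw [h]; trivial
  obtain ⟨a, ha, b, hb, rfl⟩ := Submodule.mem_sup.mp h1
  rw [add_comm]
  have hbU : b ∈ U := by simpa using Submodule.sub_mem _ hx (hn ha)
  exact Submodule.add_mem_sup ⟨hbU, hU hbU, hb⟩ ha

theorem zero_le_levi : G 0 ≤ P.levi := le_inf (hP.le_p 0 le_rfl) (hP.le_pOpp 0 le_rfl)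

end Parabolic.Adapted

/-- The operator which is `1` on `𝔫`, `0` on the Levi subalgebra and `-1` on the opposite nilradical. -/
def Parabolic.theta (P : Parabolic B) : g →ₗ[ℂ] g :=
  (perp B P.p).projection P.pOpp P.isCompl_n - (perp B P.pOpp).projection P.p P.isCompl_nOpp

namespace Parabolic.Adapted

variable {P : Parabolic B} (hP : P.Adapted G)

include hP

theorem theta_n {x : g} (hx : x ∈ P.n) : P.theta x = x := by
  rw [Parabolic.theta, LinearMap.sub_apply, Submodule.projection_apply_of_mem_left (p := perp B P.p) _ hx,
    Submodule.projection_apply_of_mem_right _ (hP.n_le hx), sub_zero]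

theorem theta_nbar {x : g} (hx : x ∈ P.nbar) : P.theta x = -x := by
  rw [Parabolic.theta, LinearMap.sub_apply, Submodule.projection_apply_of_mem_left (p := perp B P.pOpp) _ hx,
    Submodule.projection_apply_of_mem_right _ (hP.nbar_le hx), zero_sub]

omit hP in
theorem theta_levi {x : g} (hx : x ∈ P.levi) : P.theta x = 0 := by
  rw [Parabolic.theta, LinearMap.sub_apply, Submodule.projection_apply_of_mem_right _ hx.1,
    Submodule.projection_apply_of_mem_right _ hx.2, sub_zero]

theorem levi_sup (x : g) : ∃ a ∈ P.n, ∃ b ∈ P.levi, ∃ c ∈ P.nbar, a + b + c = x := by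
  have h1 : x ∈ P.nbar ⊔ P.p := by
    have h := P.isCompl_nOpp.sup_eq_top
    change x ∈ perp B P.pOpp ⊔ P.p
    rw [h]; trivial
  obtain ⟨c, hc, d, hd, rfl⟩ := Submodule.mem_sup.mp h1
  obtain ⟨b, hb, a, ha, rfl⟩ := Submodule.mem_sup.mp (hP.le_levi_sup le_rfl hP.n_le hd)
  exact ⟨a, ha, b, hb.2, c, hc, by abel⟩

theorem theta_stable {U : Submodule ℂ g} (hU : U ≤ (U ⊓ P.levi) ⊔ (U ⊓ P.n)) {x : g} (hx : x ∈ U) :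
    P.theta x ∈ U := by
  obtain ⟨b, hb, a, ha, rfl⟩ := Submodule.mem_sup.mp (hU hx)
  rw [map_add, theta_levi hb.2, hP.theta_n ha.2, zero_add]
  exact ha.1

omit hP in
theorem theta_opp : P.opp.theta = -P.theta := by
  change _ - _ = - (_ - _)
  rw [neg_sub]
  rfl

omit hP in
theorem form_levi {x y : g} (hx : x ∈ P.n) (hy : y ∈ P.levi) : B.form x y = 0 := hx y hy.1

omit hP in
theorem form_levi' {x y : g} (hx : x ∈ P.n) (hy : y ∈ P.levi) : B.form y x = 0 := form_of_mem_n hx hy.1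

/-- The form pairs 𝔫 only with 𝔫⁻ and 𝔩 only with itself. Skewness serves to carry the splitting
along 𝔫 and 𝔩 over to orthogonal complements, even though `theta` need not be a derivation. -/
theorem form_theta (x y : g) : B.form (P.theta x) y = -B.form x (P.theta y) := by
  obtain ⟨a, ha, b, hb, c, hc, rfl⟩ := hP.levi_sup x
  obtain ⟨a', ha', b', hb', c', hc', rfl⟩ := hP.levi_sup y
  have hb2 : b ∈ P.opp.levi := ⟨hb.2, hb.1⟩
  have hb2' : b' ∈ P.opp.levi := ⟨hb'.2, hb'.1⟩
  have h1 : B.form a a' = 0 := ha _ (hP.n_le ha')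
  have h2 : B.form c c' = 0 := hc _ (hP.nbar_le hc')
  have h3 : B.form c b' = 0 := form_levi (P := P.opp) hc hb2'
  have h4 : B.form b c' = 0 := form_levi' (P := P.opp) hc' hb2
  simp only [map_add, hP.theta_n ha, hP.theta_n ha', theta_levi hb, theta_levi hb', hP.theta_nbar hc,
    hP.theta_nbar hc', LinearMap.add_apply, map_neg, LinearMap.neg_apply, h1, h2, h3, h4,
    form_levi ha hb', form_levi' ha' hb, add_zero, zero_add]
  abel

theorem posPart_le_sup : posPart G ≤ (posPart G ⊓ P.levi) ⊔ (posPart G ⊓ P.n) := by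
  rw [inf_eq_right.mpr hP.n_le_posPart]
  exact hP.le_levi_sup hP.posPart_le hP.n_le_posPart

/-- Brackets of 𝔩 with itself stay in 𝔩, and all others fall into 𝔫, which is an ideal of p. -/
theorem derived_posPart_le_sup : derived (posPart G) ≤
    (derived (posPart G) ⊓ P.levi) ⊔ (derived (posPart G) ⊓ P.n) := by
  refine derived_le fun x hx y hy => ?_
  obtain ⟨a, ha, b, hb, rfl⟩ := Submodule.mem_sup.mp (hP.posPart_le_sup hx)
  obtain ⟨a', ha', b', hb', rfl⟩ := Submodule.mem_sup.mp (hP.posPart_le_sup hy)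
  rw [map_add, map_add, LinearMap.add_apply, LinearMap.add_apply, add_assoc]
  refine Submodule.add_mem_sup ⟨bracket_mem_derived ha.1 ha'.1, P.p_sub.bracket_mem _ ha.2.1 _ ha'.2.1,
    P.pOpp_sub.bracket_mem _ ha.2.2 _ ha'.2.2⟩ (Submodule.add_mem _ ⟨bracket_mem_derived hb.1 ha'.1,
      bracket_n_left hb.2 ha'.2.1⟩ (Submodule.add_mem _ ⟨bracket_mem_derived ha.1 hb'.1,
      bracket_n_right hb'.2 ha.2.1⟩ ⟨bracket_mem_derived hb.1 hb'.1, bracket_n_left hb.2 (hP.n_le hb'.2)⟩))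

theorem theta_derived_posPart {x : g} (hx : x ∈ derived (posPart G)) : P.theta x ∈ derived (posPart G) :=
  hP.theta_stable hP.derived_posPart_le_sup hx

theorem theta_posPart {x : g} (hx : x ∈ posPart G) : P.theta x ∈ posPart G :=
  hP.theta_stable hP.posPart_le_sup hx

theorem theta_derived_negPart {x : g} (hx : x ∈ derived (negPart G)) :
    P.theta x ∈ derived (negPart G) := by
  have h := hP.opp.theta_derived_posPart hx
  rw [theta_opp, LinearMap.neg_apply] at h
  rwa [Submodule.neg_mem_iff] at h

end Parabolic.Adapted

/-- The elements of `𝔫⁺` orthogonal to `[𝔫⁻, 𝔫⁻]`. -/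
def simplePart (B : KillingForm g) (G : ℝ → Submodule ℂ g) : Submodule ℂ g :=
  posPart G ⊓ perp B (derived (negPart G))

theorem derived_stable {T : g →ₗ[ℂ] g} {U : Submodule ℂ g} (hU : ∀ x ∈ U, T x ∈ U)
    (hT : ∀ x y, T (bracket x y) = bracket (T x) y + bracket x (T y)) :
    ∀ x ∈ derived U, T x ∈ derived U := by
  refine derived_le (W := (derived U).comap T) fun x hx y hy => ?_
  rw [Submodule.mem_comap, hT]
  exact Submodule.add_mem _ (bracket_mem_derived (hU x hx) hy) (bracket_mem_derived hx (hU y hy))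

theorem derived_graded {U : Submodule ℂ g} (hU : IsGraded U) : IsGraded (derived U) := by
  refine isGraded_of_parityInv_mem ?_
  refine derived_le (W := (derived U).comap (parityInv g)) fun x hx y hy => ?_
  rw [Submodule.mem_comap, parityInv_bracket]
  exact bracket_mem_derived (hU.parityInv_mem hx) (hU.parityInv_mem hy)

/-- Rank and nullity of the map from N to the dual of W given by the form. -/
theorem finrank_sub_le_inf_perp [FiniteDimensional ℂ g] (N W : Submodule ℂ g) :
    Module.finrank ℂ N ≤ Module.finrank ℂ (N ⊓ perp B W : Submodule ℂ g) + Module.finrank ℂ W := by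
  let T : N →ₗ[ℂ] Module.Dual ℂ W := (Module.Dual.transpose (R := ℂ) W.subtype) ∘ₗ B.form ∘ₗ N.subtype
  have h1 := T.finrank_range_add_finrank_ker
  have h2 : Module.finrank ℂ (LinearMap.range T) ≤ Module.finrank ℂ W := by
    rw [← Subspace.dual_finrank_eq (K := ℂ) (V := W)]
    exact Submodule.finrank_le _
  have h3 : Module.finrank ℂ (LinearMap.ker T) ≤ Module.finrank ℂ (N ⊓ perp B W : Submodule ℂ g) := by
    rw [← Submodule.finrank_map_subtype_eq N (LinearMap.ker T)]
    refine Submodule.finrank_mono ?_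
    rintro _ ⟨x, hx, rfl⟩
    refine ⟨x.2, fun y hy => ?_⟩
    exact LinearMap.congr_fun hx ⟨y, hy⟩
  omega

namespace RootGrading

variable (R : RootGrading B G)

include R

theorem parityInv_simplePart {x : g} (hx : x ∈ simplePart B G) : parityInv g x ∈ simplePart B G :=
  (R.posPart_graded.inf (Parabolic.perp_isGraded (derived_graded R.negPart_graded))).parityInv_mem hx

theorem bracket_zero_simplePart {h x : g} (hh : h ∈ G 0) (hx : x ∈ simplePart B G) :
    bracket h x ∈ simplePart B G :=
  ⟨R.bracket_zero_posPart hh hx.1, fun z hz => by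
    rw [form_bracket_of_even B (R.even hh), hx.2 _ (derived_stable
      (fun x hx => R.bracket_zero_negPart hh hx) (bracket_jacobi_of_even (R.even hh)) _ hz), neg_zero]⟩

/-- With E and F the parts of 𝔫⁺ and 𝔫⁻ orthogonal to the brackets of the other side, dim 𝔫⁺ ≤ dim E
+ dim [𝔫⁻, 𝔫⁻] and dim 𝔫⁻ ≤ dim F + dim [𝔫⁺, 𝔫⁺], while directness of the sums gives dim E + dim
[𝔫⁺, 𝔫⁺] ≤ dim 𝔫⁺ and dim F + dim [𝔫⁻, 𝔫⁻] ≤ dim 𝔫⁻. Adding up, all four are equalities; neither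
side alone would suffice. -/
theorem simplePart_sup : simplePart B G ⊔ derived (posPart G) = posPart G := by
  have hfd := R.finiteDimensional
  have hle : ∀ G : ℝ → Submodule ℂ g, RootGrading B G → derived (posPart G) ≤ posPart G := fun G R =>
    derived_le fun x hx y hy => R.bracket_posPart hx hy
  have key : ∀ G : ℝ → Submodule ℂ g, RootGrading B G →
      Module.finrank ℂ (simplePart B G) + Module.finrank ℂ (derived (posPart G)) =
      Module.finrank ℂ (simplePart B G ⊔ derived (posPart G) : Submodule ℂ g) := fun G R => by
    have h := Submodule.finrank_sup_add_finrank_inf_eq (simplePart B G) (derived (posPart G))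
    have h0 : simplePart B G ⊓ derived (posPart G) = ⊥ := by
      rw [Submodule.eq_bot_iff]
      exact fun x hx => R.eq_zero_of_mem_derived hx.1.1 hx.1.2 hx.2
    rw [h0, finrank_bot, add_zero] at h
    exact h.symm
  have hsup : ∀ G : ℝ → Submodule ℂ g, RootGrading B G → simplePart B G ⊔ derived (posPart G) ≤ posPart G :=
    fun G R => sup_le inf_le_left (hle G R)
  have hneg : posPart (fun t => G (- -t)) = posPart G := by simp
  have h1 : Module.finrank ℂ (posPart G) ≤ _ := finrank_sub_le_inf_perp (B := B) (posPart G) (derived (negPart G))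
  have h2 : Module.finrank ℂ (negPart G) ≤ _ := finrank_sub_le_inf_perp (B := B) (negPart G) (derived (posPart G))
  have h3 := key G R
  have h4 := key _ R.opp
  have h5 := Submodule.finrank_mono (hsup G R)
  have h6 := Submodule.finrank_mono (hsup _ R.opp)
  have h7 : simplePart B (fun t => G (-t)) = negPart G ⊓ perp B (derived (posPart G)) := by
    unfold simplePart negPart
    rw [hneg]
  rw [h7] at h4 h6
  refine Submodule.eq_of_le_of_finrank_le (hsup G R) ?_
  change Module.finrank ℂ (posPart G) ≤ Module.finrank ℂ (simplePart B G) + _ at h1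
  change Module.finrank ℂ (negPart G ⊓ perp B (derived (posPart G)) : Submodule ℂ g) +
    Module.finrank ℂ (derived (negPart G)) = _ at h4
  change _ ≤ Module.finrank ℂ (negPart G) at h6
  change Module.finrank ℂ (negPart G ⊓ perp B (derived (posPart G)) ⊔ derived (negPart G) : Submodule ℂ g) ≤ _ at h6
  change _ = Module.finrank ℂ (negPart G ⊓ perp B (derived (posPart G)) ⊔ derived (negPart G) : Submodule ℂ g) at h4
  omega

theorem eq_zero_of_mem_simplePart {x : g} (hx : x ∈ simplePart B G)
    (h : ∀ y ∈ simplePart B (fun t => G (-t)), B.form x y = 0) : x = 0 := by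
  refine R.eq_zero_of_mem_posPart hx.1 fun y hy => ?_
  have h1 : y ∈ simplePart B (fun t => G (-t)) ⊔ derived (posPart (fun t => G (-t))) := by
    rw [R.opp.simplePart_sup]; exact hy
  obtain ⟨a, ha, b, hb, rfl⟩ := Submodule.mem_sup.mp h1
  rw [map_add, h a ha, zero_add]
  exact hx.2 b hb

end RootGrading
end Adapted

/-! ### Super identities with one homogeneous argument -/

section ParityTwist

/-- The operator `v ↦ (-1)^{i|v|} v`. -/
def parityTwist (V : Type*) [AddCommGroup V] [Module ℂ V] [SuperSpace V] (i : ZMod 2) : V →ₗ[ℂ] V :=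
  if i = 1 then parityInv V else LinearMap.id

variable {V : Type*} [AddCommGroup V] [Module ℂ V] [SuperSpace V]

theorem parityTwist_of_mem (i : ZMod 2) {j : ZMod 2} {v : V} (hv : v ∈ part j) :
    parityTwist V i v = koszul i j • v := by
  rcases parity_cases i with rfl | rfl
  · simp [parityTwist, koszul_zero_left]
  · rw [← parityInv_of_mem hv]
    rfl

theorem mem_part_of_parityTwist {i : ZMod 2} {v : V} (h : parityTwist V 1 v = koszul 1 i • v) :
    v ∈ part i := by
  have h' : parityInv V v = koszul 1 i • v := h
  rw [← evenProj_add_oddProj v]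
  rcases parity_cases i with rfl | rfl
  · have h1 : oddProj V v = 0 := by rw [oddProj_eq, h', koszul_zero_right, one_smul, sub_self, smul_zero]
    rw [h1, add_zero]
    exact evenProj_mem v
  · have h1 : evenProj V v = 0 := by
      rw [evenProj_eq, h', koszul_self_one, neg_one_smul, add_neg_cancel, smul_zero]
    rw [h1, zero_add]
    exact oddProj_mem v

variable {g : Type*} [AddCommGroup g] [Module ℂ g] [LieSuperalgebra g]

theorem bracket_jacobi_twist {i : ZMod 2} {x : g} (hx : x ∈ part i) (y z : g) :
    bracket x (bracket y z) = bracket (bracket x y) z + bracket (parityTwist g i y) (bracket x z) := by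
  rw [← evenProj_add_oddProj y]
  simp only [map_add, LinearMap.add_apply]
  rw [LieSuperalgebra.bracket_jacobi hx (evenProj_mem y), LieSuperalgebra.bracket_jacobi hx (oddProj_mem y),
    parityTwist_of_mem i (evenProj_mem y), parityTwist_of_mem i (oddProj_mem y)]
  simp only [map_smul, LinearMap.smul_apply]
  abel

theorem bracket_skew_twist {i : ZMod 2} {x : g} (hx : x ∈ part i) (y : g) :
    bracket x y = -bracket (parityTwist g i y) x := by
  rw [← evenProj_add_oddProj y]
  simp only [map_add, LinearMap.add_apply]
  rw [LieSuperalgebra.bracket_skew hx (evenProj_mem y), LieSuperalgebra.bracket_skew hx (oddProj_mem y),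
    parityTwist_of_mem i (evenProj_mem y), parityTwist_of_mem i (oddProj_mem y)]
  simp only [map_smul, LinearMap.smul_apply]
  abel

theorem parityTwist_bracket (i : ZMod 2) (x y : g) :
    parityTwist g i (bracket x y) = bracket (parityTwist g i x) (parityTwist g i y) := by
  unfold parityTwist
  split_ifs
  · exact parityInv_bracket x y
  · rfl

end ParityTwist

/-! ### Generators of 𝔫⁺ and 𝔫⁻ -/

section Generation

variable {g : Type*} [AddCommGroup g] [Module ℂ g] [LieSuperalgebra g] {B : KillingForm g}
  {G : ℝ → Submodule ℂ g}

/-- The span of the iterated brackets of the elements of a family. -/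
def wordSpan {ι : Type*} (e : ι → g) : Submodule ℂ g :=
  sInf {W | (∀ i, e i ∈ W) ∧ ∀ i, ∀ x ∈ W, bracket (e i) x ∈ W}

theorem wordSpan_le {ι : Type*} {e : ι → g} {W : Submodule ℂ g} (h1 : ∀ i, e i ∈ W)
    (h2 : ∀ i, ∀ x ∈ W, bracket (e i) x ∈ W) : wordSpan e ≤ W := sInf_le ⟨h1, h2⟩

theorem mem_wordSpan {ι : Type*} {e : ι → g} (i : ι) : e i ∈ wordSpan e :=
  (Submodule.mem_sInf).mpr fun _ hW => hW.1 i

theorem bracket_mem_wordSpan {ι : Type*} {e : ι → g} (i : ι) {x : g} (hx : x ∈ wordSpan e) :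
    bracket (e i) x ∈ wordSpan e :=
  (Submodule.mem_sInf).mpr fun W hW => hW.2 i x ((Submodule.mem_sInf).mp hx W hW)

/-- Induction on the word x by the Jacobi identity. Words are not known to be homogeneous in
advance, so the induction hypothesis also covers the parity twists of x. -/
theorem bracket_mem_wordSpan' {ι : Type*} {e : ι → g} {par : ι → ZMod 2} (he : ∀ i, e i ∈ part (par i))
    {x y : g} (hx : x ∈ wordSpan e) (hy : y ∈ wordSpan e) : bracket x y ∈ wordSpan e := by
  let W : Submodule ℂ g := ⨅ y : wordSpan e, ⨅ i : ZMod 2,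
    (wordSpan e).comap (bracket.flip (y : g) ∘ₗ parityTwist g i)
  have hmem : ∀ x, x ∈ W ↔ ∀ y ∈ wordSpan e, ∀ i, bracket (parityTwist g i x) y ∈ wordSpan e := by
    intro x
    simp only [W, Submodule.mem_iInf, Submodule.mem_comap, Subtype.forall]
    rfl
  have h := (hmem x).mp (wordSpan_le (W := W) (fun i => (hmem _).mpr fun y hy k => by
    rw [parityTwist_of_mem k (he i), map_smul, LinearMap.smul_apply]
    exact Submodule.smul_mem _ _ (bracket_mem_wordSpan i hy)) (fun i x hx => (hmem _).mpr fun y hy k => by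
    have hx' := (hmem x).mp hx
    have h1 := bracket_jacobi_twist (he i) (parityTwist g k x) y
    have h2 : bracket (bracket (e i) (parityTwist g k x)) y ∈ wordSpan e := by
      rw [← sub_eq_iff_eq_add] at h1
      rw [← h1]
      refine Submodule.sub_mem _ (bracket_mem_wordSpan i (hx' y hy k)) ?_
      have h3 : ∃ l, parityTwist g (par i) (parityTwist g k x) = parityTwist g l x := by
        rcases parity_cases (par i) with h | h <;> rcases parity_cases k with h' | h' <;> rw [h, h']
        · exact ⟨0, rfl⟩
        · exact ⟨1, rfl⟩
        · exact ⟨1, rfl⟩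
        · refine ⟨0, ?_⟩
          rw [← evenProj_add_oddProj x]
          simp only [map_add, parityTwist_of_mem _ (evenProj_mem x), parityTwist_of_mem _ (oddProj_mem x),
            map_smul, smul_smul, koszul_mul_self, koszul_zero_left]
      obtain ⟨l, hl⟩ := h3
      rw [hl]
      exact hx' _ (bracket_mem_wordSpan i hy) l
    rw [parityTwist_bracket, parityTwist_of_mem k (he i)]
    simp only [map_smul, LinearMap.smul_apply]
    exact Submodule.smul_mem _ _ h2) hx) y hy 0
  exact h

/-- The sum of the parts of degree at least `c`. -/
def highPart (G : ℝ → Submodule ℂ g) (c : ℝ) : Submodule ℂ g := ⨆ (t : ℝ) (_ : c ≤ t), G t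

namespace RootGrading

variable (R : RootGrading B G)

include R

theorem bracket_highPart {a b : ℝ} {x y : g} (hx : x ∈ highPart G a) (hy : y ∈ highPart G b) :
    bracket x y ∈ highPart G (a + b) := by
  have h1 : highPart G a ≤ (highPart G (a + b)).comap (bracket.flip y) := by
    refine iSup₂_le fun s hs x hx => ?_
    have h2 : highPart G b ≤ (highPart G (a + b)).comap (bracket x) := by
      refine iSup₂_le fun t ht y hy => ?_
      exact (le_iSup₂_of_le (s + t) (add_le_add hs ht) le_rfl : G (s + t) ≤ highPart G (a + b))
        (R.bracket_mem _ _ x hx y hy)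
    exact h2 hy
  exact h1 hx

theorem exists_posPart_le_highPart : ∃ δ : ℝ, 0 < δ ∧ posPart G ≤ highPart G δ := by
  have h1 := ((DirectSum.isInternal_submodule_iff_iSupIndep_and_iSup_eq_top G).mp R.internal).1
  have hfin := R.finiteDimensional
  have h2 : {t | G t ≠ ⊥}.Finite := WellFoundedGT.finite_ne_bot_of_iSupIndep h1
  have h3 : ({t | G t ≠ ⊥} ∩ Set.Ioi 0).Finite := h2.inter_of_left _
  rcases ({t | G t ≠ ⊥} ∩ Set.Ioi 0).eq_empty_or_nonempty with h4 | h4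
  · refine ⟨1, one_pos, iSup₂_le fun t ht => ?_⟩
    have h5 : G t = ⊥ := by
      by_contra hne
      exact (h4 ▸ (⟨hne, ht⟩ : t ∈ {t | G t ≠ ⊥} ∩ Set.Ioi 0) : t ∈ (∅ : Set ℝ))
    rw [h5]; exact bot_le
  · obtain ⟨δ, hδ, hmin⟩ := Set.exists_min_image _ id h3 h4
    refine ⟨δ, hδ.2, iSup₂_le fun t ht => ?_⟩
    by_cases h5 : G t = ⊥
    · rw [h5]; exact bot_le
    · exact le_iSup₂_of_le t (hmin t ⟨h5, ht⟩) le_rfl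

/-- `𝔫⁺` is generated by the elements orthogonal to `[𝔫⁻, 𝔫⁻]`. -/
theorem posPart_le_wordSpan {ι : Type*} {e : ι → g} {par : ι → ZMod 2} (he : ∀ i, e i ∈ part (par i))
    (hpos : ∀ i, e i ∈ posPart G) (hspan : simplePart B G ≤ Submodule.span ℂ (Set.range e)) :
    posPart G ≤ wordSpan e := by
  obtain ⟨δ, hδ, hle⟩ := R.exists_posPart_le_highPart
  have hW : wordSpan e ≤ posPart G := wordSpan_le hpos fun i x hx => R.bracket_posPart (hpos i) hx
  have hE : simplePart B G ≤ wordSpan e := hspan.trans (Submodule.span_le.mpr (by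
    rintro _ ⟨i, rfl⟩; exact mem_wordSpan i))
  -- Modulo words, elements of 𝔫⁺ can be pushed to degree at least kδ: E consists of words, and each
  -- bracket raises the degree by δ, the least degree that occurs. Degrees are bounded, so for large
  -- k nothing remains.
  have key : ∀ k : ℕ, posPart G ≤ wordSpan e ⊔ highPart G (k * δ) := by
    intro k
    induction k with
    | zero =>
      refine le_sup_of_le_right (iSup₂_le fun t ht => ?_)
      exact le_iSup₂_of_le t (by simpa using ht.le) le_rfl
    | succ k ih =>
      rw [← R.simplePart_sup]
      refine sup_le (le_sup_of_le_left hE) (derived_le fun x hx y hy => ?_)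
      obtain ⟨w, hw, q, hq, hwq⟩ := Submodule.mem_sup.mp (ih hx)
      obtain ⟨w', hw', q', hq', rfl⟩ := Submodule.mem_sup.mp (ih hy)
      have h1 : bracket x (w' + q') = bracket w w' + (bracket w q' + bracket q (w' + q')) := by
        rw [← hwq]
        simp only [map_add, LinearMap.add_apply]
        abel
      rw [h1]
      have h2 : ((k + 1 : ℕ) : ℝ) * δ = δ + k * δ := by push_cast; ring
      refine Submodule.add_mem_sup (bracket_mem_wordSpan' he hw hw') (Submodule.add_mem _ ?_ ?_)
      · rw [h2]; exact R.bracket_highPart (hle (hW hw)) hq'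
      · rw [h2, add_comm]; exact R.bracket_highPart hq (hle hy)
  obtain ⟨N, hN⟩ := R.exists_forall_grade_eq_bot
  obtain ⟨k, hk⟩ := exists_nat_ge (N / δ)
  have h1 : highPart G (k * δ) ≤ ⊥ := iSup₂_le fun t ht => by
    rw [hN t (le_trans (le_trans ((div_le_iff₀ hδ).mp hk) ht) (le_abs_self t))]
  exact (key k).trans (sup_le le_rfl (h1.trans bot_le))

end RootGrading

/-- Generators `e i` of `𝔫⁺` and `f i` of `𝔫⁻`, homogeneous with respect to parity, weights and the
decomposition of `g` given by the parabolic subalgebra, with `[e i, f j] = 0` for `i ≠ j`. -/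
structure Parabolic.Generators (P : Parabolic B) (G : ℝ → Submodule ℂ g) where
  ι : Type
  e : ι → g
  f : ι → g
  par : ι → ZMod 2
  wt : ι → g
  wt_mem : ∀ i, wt i ∈ G 0
  wt_ne : ∀ i, wt i ≠ 0
  e_simple : ∀ i, e i ∈ simplePart B G
  f_simple : ∀ i, f i ∈ simplePart B (fun t => G (-t))
  e_part : ∀ i, e i ∈ part (par i)
  f_part : ∀ i, f i ∈ part (par i)
  e_wt : ∀ i, e i ∈ eigenPart (G 0) (B.form (wt i))
  f_wt : ∀ i, f i ∈ eigenPart (G 0) (B.form (-wt i))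
  cases : ∀ i, (e i ∈ P.n ∧ f i ∈ P.nbar) ∨ (e i ∈ P.levi ∧ f i ∈ P.levi)
  bracket_same : ∀ i, bracket (e i) (f i) ∈ G 0
  bracket_ne : ∀ i j, i ≠ j → bracket (e i) (f j) = 0
  form_ne : ∀ i j, i ≠ j → B.form (e i) (f j) = 0
  posPart_le : posPart G ≤ wordSpan e
  negPart_le : negPart G ≤ wordSpan f

namespace Parabolic.Adapted

variable {P : Parabolic B} (hP : P.Adapted G)

include hP

theorem mem_nbar_of_theta {x : g} (h : P.theta x = -x) : x ∈ P.nbar := by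
  obtain ⟨a, ha, b, hb, c, hc, rfl⟩ := hP.levi_sup x
  rw [map_add, map_add, hP.theta_n ha, theta_levi hb, hP.theta_nbar hc] at h
  have h1 : b = (-2 : ℂ) • a := by linear_combination (norm := module) h
  have h2 : a = 0 := by
    refine eq_zero_of_n ha ?_
    have h3 : a = (-2 : ℂ)⁻¹ • b := by rw [h1, smul_smul]; norm_num
    rw [h3]
    exact Submodule.smul_mem _ _ hb.2
  rw [h1, h2, smul_zero, zero_add, zero_add]
  exact hc

theorem mem_levi_of_theta {x : g} (h : P.theta x = 0) : x ∈ P.levi := by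
  obtain ⟨a, ha, b, hb, c, hc, rfl⟩ := hP.levi_sup x
  rw [map_add, map_add, hP.theta_n ha, theta_levi hb, hP.theta_nbar hc] at h
  have h1 : a = c := by linear_combination (norm := module) h
  have h2 : a = 0 := eq_zero_of_n ha (h1 ▸ hP.nbar_le hc)
  rw [← h1, h2, add_zero, zero_add]
  exact hb

theorem n_graded : IsGraded P.n := perp_isGraded P.p_sub.graded

omit hP in
theorem levi_graded : IsGraded P.levi := P.p_sub.graded.inf P.pOpp_sub.graded

theorem theta_simplePart {x : g} (hx : x ∈ simplePart B G) : P.theta x ∈ simplePart B G :=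
  ⟨hP.theta_posPart hx.1, fun z hz => by
    rw [hP.form_theta, hx.2 _ (hP.theta_derived_negPart hz), neg_zero]⟩

/-- Parity, 𝔥 and `theta` all preserve this space, so its elements can be decomposed simultaneously.
-/
theorem simplePart_le_span : simplePart B G ≤ Submodule.span ℂ {x | x ∈ simplePart B G ∧
    (∃ i : ZMod 2, x ∈ part i) ∧ (∃ a ∈ G 0, x ∈ eigenPart (G 0) (B.form a)) ∧
    (x ∈ P.n ∨ x ∈ P.levi)} := by
  set s := {x | x ∈ simplePart B G ∧
    (∃ i : ZMod 2, x ∈ part i) ∧ (∃ a ∈ G 0, x ∈ eigenPart (G 0) (B.form a)) ∧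
    (x ∈ P.n ∨ x ∈ P.levi)} with hs
  have key : ∀ U : Submodule ℂ g, IsGraded U → (∀ h ∈ G 0, ∀ x ∈ U, bracket h x ∈ U) →
      (∀ x ∈ U, x ∈ P.n ∨ x ∈ P.levi) → simplePart B G ⊓ U ≤ Submodule.span ℂ s := by
    intro U hU hH hc x hx
    have key2 : ∀ i : ZMod 2, ∀ x ∈ (simplePart B G ⊓ U) ⊓ part i, x ∈ Submodule.span ℂ s := by
      intro i x hx
      refine (iSup_le fun a => ?_ : _ ≤ Submodule.span ℂ s) (hP.mem_iSup_of_stable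
        (U := (simplePart B G ⊓ U) ⊓ part i) (fun h hh v hv =>
          ⟨⟨hP.bracket_zero_simplePart hh hv.1.1, hH h hh v hv.1.2⟩, by
            simpa using LieSuperalgebra.bracket_mem (hP.even hh) hv.2⟩) hx)
      exact fun v hv => Submodule.subset_span ⟨hv.1.1.1, ⟨i, hv.1.2⟩, ⟨a, a.2, hv.2⟩, hc v hv.1.1.2⟩
    have hgr : IsGraded (simplePart B G ⊓ U) :=
      (isGraded_of_parityInv_mem fun v hv => hP.parityInv_simplePart hv).inf hU
    rw [← evenProj_add_oddProj x]
    exact Submodule.add_mem _ (key2 0 _ ⟨hgr.evenProj_mem hx, evenProj_mem x⟩)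
      (key2 1 _ ⟨hgr.oddProj_mem hx, oddProj_mem x⟩)
  intro x hx
  obtain ⟨b, hb, a, ha, rfl⟩ := Submodule.mem_sup.mp (hP.posPart_le_sup hx.1)
  have h1 := hP.theta_simplePart hx
  rw [map_add, theta_levi hb.2, hP.theta_n ha.2, zero_add] at h1
  have h2 : b ∈ simplePart B G := by simpa using Submodule.sub_mem _ hx h1
  have hz := hP.zero_le_levi
  exact Submodule.add_mem _
    (key P.levi levi_graded (fun h hh x hx => ⟨P.p_sub.bracket_mem _ (hz hh).1 _ hx.1,
      P.pOpp_sub.bracket_mem _ (hz hh).2 _ hx.2⟩) (fun x hx => Or.inr hx) ⟨h2, hb.2⟩)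
    (key P.n hP.n_graded (fun h hh x hx => bracket_n_right hx (hz hh).1) (fun x hx => Or.inl hx) ⟨h1, ha.2⟩)

theorem eq_zero_of_form_simplePart {y : g} (hy : y ∈ simplePart B (fun t => G (-t)))
    (h : ∀ x ∈ simplePart B G, B.form x y = 0) : y = 0 := by
  refine hP.opp.eq_zero_of_mem_simplePart hy fun x hx => ?_
  have hx' : x ∈ simplePart B G := by simpa using hx
  rw [B.form_comm, ← B.form_parityInv]
  exact h _ (hP.parityInv_simplePart hx')

/-- The e_i are a homogeneous basis of `simplePart` and the f_i the dual basis of its counterpart in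
𝔫⁻. By uniqueness of dual bases the f_i inherit parity, opposite weight and opposite `theta`
eigenvalue. The bracket [e_i, f_j] is orthogonal to 𝔫⁺ and 𝔫⁻, so it lies in 𝔥, and testing it
against 𝔥 gives δ_ij times the weight of e_i. -/
theorem exists_generators : Nonempty (P.Generators G) := by
  have hfd := hP.finiteDimensional
  obtain ⟨e, he, hspan, hli⟩ := Submodule.exists_fun_fin_finrank_span_eq ℂ {x | x ∈ simplePart B G ∧
    (∃ i : ZMod 2, x ∈ part i) ∧ (∃ a ∈ G 0, x ∈ eigenPart (G 0) (B.form a)) ∧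
    (x ∈ P.n ∨ x ∈ P.levi)}
  have hspan' : Submodule.span ℂ (Set.range e) = simplePart B G := by
    rw [hspan]
    exact le_antisymm (Submodule.span_le.mpr fun x hx => hx.1) hP.simplePart_le_span
  generalize Module.finrank ℂ (Submodule.span ℂ {x | x ∈ simplePart B G ∧
    (∃ i : ZMod 2, x ∈ part i) ∧ (∃ a ∈ G 0, x ∈ eigenPart (G 0) (B.form a)) ∧
    (x ∈ P.n ∨ x ∈ P.levi)} : Submodule ℂ g) = m at e
  choose he1 he2 he3 he4 using he
  choose par hpar using he2
  choose wt hwt hewt using he3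
  let T : simplePart B (fun t => G (-t)) →ₗ[ℂ] Module.Dual ℂ (simplePart B G) :=
    Module.Dual.transpose (R := ℂ) (simplePart B G).subtype ∘ₗ B.form.flip ∘ₗ Submodule.subtype _
  let T' : simplePart B G →ₗ[ℂ] Module.Dual ℂ (simplePart B (fun t => G (-t))) :=
    Module.Dual.transpose (R := ℂ) (simplePart B (fun t => G (-t))).subtype ∘ₗ B.form ∘ₗ Submodule.subtype _
  have hTa : ∀ (y : simplePart B (fun t => G (-t))) (x : simplePart B G), T y x = B.form (x : g) y := fun _ _ => rfl
  have hTa' : ∀ (y : simplePart B (fun t => G (-t))) (x : simplePart B G), T' x y = B.form (x : g) y := fun _ _ => rfl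
  have hT : Function.Injective T := by
    rw [← LinearMap.ker_eq_bot, LinearMap.ker_eq_bot']
    intro y hy
    refine Subtype.ext (hP.eq_zero_of_form_simplePart y.2 fun x hx => ?_)
    rw [← hTa y ⟨x, hx⟩, hy, LinearMap.zero_apply]
  have hT' : Function.Injective T' := by
    rw [← LinearMap.ker_eq_bot, LinearMap.ker_eq_bot']
    intro x hx
    refine Subtype.ext (hP.eq_zero_of_mem_simplePart x.2 fun y hy => ?_)
    rw [← hTa' ⟨y, hy⟩ x, hx, LinearMap.zero_apply]
  have hsurj : Function.Surjective T := by
    have h1 := LinearMap.finrank_le_finrank_of_injective hT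
    have h2 := LinearMap.finrank_le_finrank_of_injective hT'
    rw [Subspace.dual_finrank_eq] at h1 h2
    refine (LinearMap.injective_iff_surjective_of_finrank_eq_finrank ?_).mp hT
    rw [Subspace.dual_finrank_eq]
    omega
  let b : Module.Basis (Fin m) ℂ (simplePart B G) :=
    (Module.Basis.span hli).map (LinearEquiv.ofEq _ _ hspan')
  have hb : ∀ i, (b i : g) = e i := fun i => by
    simp [b, Module.Basis.span_apply]
  choose f' hf' using fun j => hsurj (b.coord j)
  have hdual : ∀ i j, B.form (e i) (f' j : g) = if i = j then 1 else 0 := fun i j => by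
    rw [← hb i, ← hTa, hf', Module.Basis.coord_apply, Module.Basis.repr_self, Finsupp.single_apply]
  -- An element is determined by its pairings with the e_i; every property of the f_j below is
  -- checked this way.
  have huniq : ∀ y ∈ simplePart B (fun t => G (-t)), ∀ j c, (∀ i, B.form (e i) y = if i = j then c else 0) →
      y = c • (f' j : g) := by
    intro y hy j c h
    have h1 : T ⟨y, hy⟩ = T (c • f' j) := b.ext fun i => by
      rw [hTa, hTa, hb, h]
      simp [hdual]
    exact congrArg Subtype.val (hT h1)
  have hpart : ∀ j, (f' j : g) ∈ part (par j) := fun j => by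
    refine mem_part_of_parityTwist (huniq _ (hP.opp.parityInv_simplePart (f' j).2) j _ fun i => ?_)
    rw [← B.form_parityInv, parityInv_of_mem (hpar i), map_smul, LinearMap.smul_apply, hdual]
    split_ifs with h
    · rw [h, smul_eq_mul, mul_one]
    · rw [smul_zero]
  have hfwt : ∀ j, (f' j : g) ∈ eigenPart (G 0) (B.form (-wt j)) := fun j h hh => by
    refine huniq _ (hP.opp.bracket_zero_simplePart (by rwa [neg_zero]) (f' j).2) j _ fun i => ?_
    have h1 := form_bracket_of_even B (hP.even hh) (e i) (f' j : g)
    rw [hewt i h hh, map_smul, LinearMap.smul_apply, hdual] at h1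
    rw [← neg_eq_iff_eq_neg.mpr h1]
    split_ifs with h
    · rw [h, smul_eq_mul, mul_one, map_neg, LinearMap.neg_apply]
    · rw [smul_zero, neg_zero]
  have hfth : ∀ j (c : ℂ), P.theta (e j) = c • e j → P.theta (f' j : g) = (-c) • (f' j : g) := by
    intro j c hc
    have hmem : P.theta (f' j : g) ∈ simplePart B (fun t => G (-t)) := by
      have h := hP.opp.theta_simplePart (f' j).2
      rwa [theta_opp, LinearMap.neg_apply, Submodule.neg_mem_iff] at h
    have h0 : ∀ i, B.form (P.theta (e i)) (f' j : g) = if i = j then c else 0 := by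
      intro i
      rcases he4 i with h | h
      · rw [hP.theta_n h, hdual]
        split_ifs with hij
        · subst hij
          rw [hP.theta_n h] at hc
          have h1 := congrArg (fun x => B.form x (f' i : g)) hc
          simpa [hdual] using h1
        · rfl
      · rw [theta_levi h, map_zero, LinearMap.zero_apply]
        split_ifs with hij
        · subst hij
          rw [theta_levi h] at hc
          have h1 := congrArg (fun x => B.form x (f' i : g)) hc
          simpa [hdual] using h1
        · rfl
    refine huniq _ hmem j _ fun i => ?_
    rw [← neg_eq_iff_eq_neg.mpr (hP.form_theta (e i) (f' j : g)), h0]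
    split_ifs
    · rfl
    · exact neg_zero
  have hbr : ∀ i j, bracket (e i) (f' j : g) = if i = j then wt i else 0 := by
    intro i j
    have hfneg : (f' j : g) ∈ negPart G := (f' j).2.1
    have hzero : bracket (e i) (f' j : g) ∈ G 0 := by
      refine hP.mem_zero_of_form_eq_zero (fun y hy => ?_) (fun y hy => ?_)
      · rw [LieSuperalgebra.bracket_skew (hpar i) (hpart j), map_neg, map_smul, LinearMap.neg_apply,
          LinearMap.smul_apply, B.invariant]
        have h1 := (f' j).2.2 (bracket (e i) y)
        rw [h1, smul_zero, neg_zero]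
        have h2 : negPart (fun t => G (-t)) = posPart G := by simp [negPart]
        rw [h2]
        exact bracket_mem_derived (he1 i).1 hy
      · rw [B.invariant]
        exact (he1 i).2 _ (bracket_mem_derived hfneg hy)
    have hw : (if i = j then wt i else 0) ∈ G 0 := by
      split_ifs
      · exact hwt i
      · exact Submodule.zero_mem _
    refine hP.eq_of_form_eq hzero hw fun k hk => ?_
    rw [B.invariant, ← neg_eq_iff_eq_neg.mpr (bracket_skew_of_even (hP.even hk)), hfwt j k hk, map_neg,
      map_smul, hdual]
    split_ifs with hij
    · subst hij
      simp
    · simp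
  have hneg : posPart (fun t => G (-t)) = negPart G := rfl
  exact ⟨{
    ι := Fin m
    e := e
    f := fun i => f' i
    par := par
    wt := wt
    wt_mem := hwt
    wt_ne := fun i h0 => by
      have h1 := hewt i
      rw [h0] at h1
      have h2 : e i = 0 := hP.eq_zero_of_mem_posPart (he1 i).1 fun y hy =>
        hP.form_zero_negPart (hP.mem_zero_of_form h1) hy
      exact hli.ne_zero i h2
    e_simple := he1
    f_simple := fun i => (f' i).2
    e_part := hpar
    f_part := hpart
    e_wt := hewt
    f_wt := hfwt
    cases := fun i => by
      refine (he4 i).imp (fun h => ⟨h, hP.mem_nbar_of_theta ?_⟩) (fun h => ⟨h, hP.mem_levi_of_theta ?_⟩)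
      · rw [hfth i 1 (by rw [hP.theta_n h, one_smul]), neg_one_smul]
      · rw [hfth i 0 (by rw [theta_levi h, zero_smul]), neg_zero, zero_smul]
    bracket_same := fun i => by rw [hbr, if_pos rfl]; exact hwt i
    bracket_ne := fun i j hij => by rw [hbr, if_neg hij]
    form_ne := fun i j hij => by rw [hdual, if_neg hij]
    posPart_le := hP.posPart_le_wordSpan hpar (fun i => (he1 i).1) hspan'.ge
    negPart_le := by
      refine hP.opp.posPart_le_wordSpan (e := fun i => (f' i : g)) hpart (fun i => (f' i).2.1) ?_
      intro y hy
      have h1 := b.dualBasis.sum_repr (T ⟨y, hy⟩)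
      have h2 : (⟨y, hy⟩ : simplePart B (fun t => G (-t))) =
          ∑ i, b.dualBasis.repr (T ⟨y, hy⟩) i • f' i := hT (by
        rw [map_sum]
        simp only [map_smul, hf']
        rw [← h1]
        simp [Module.Basis.coe_dualBasis])
      have h3 := congrArg Subtype.val h2
      rw [Submodule.coe_sum] at h3
      rw [show y = _ from h3]
      exact Submodule.sum_mem _ fun i _ => Submodule.smul_mem _ _ (Submodule.subset_span ⟨i, rfl⟩) }⟩

end Parabolic.Adapted

namespace Parabolic.Generators

variable {P : Parabolic B} (Q : P.Generators G)

/-- The generators with the roles of `𝔫⁺` and `𝔫⁻` exchanged. -/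
def opp : P.opp.Generators (fun t => G (-t)) where
  ι := Q.ι
  e := Q.f
  f := Q.e
  par := Q.par
  wt := fun i => -Q.wt i
  wt_mem := fun i => by rw [neg_zero]; exact Submodule.neg_mem _ (Q.wt_mem i)
  wt_ne := fun i => neg_ne_zero.mpr (Q.wt_ne i)
  e_simple := Q.f_simple
  f_simple := fun i => by simpa using Q.e_simple i
  e_part := Q.f_part
  f_part := Q.e_part
  e_wt := fun i => by rw [neg_zero]; exact Q.f_wt i
  f_wt := fun i => by rw [neg_zero, neg_neg]; exact Q.e_wt i
  cases := fun i => (Q.cases i).imp (fun h => ⟨h.2, h.1⟩) (fun h => ⟨⟨h.2.2, h.2.1⟩, ⟨h.1.2, h.1.1⟩⟩)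
  bracket_same := fun i => by
    rw [neg_zero, LieSuperalgebra.bracket_skew (Q.f_part i) (Q.e_part i)]
    exact Submodule.neg_mem _ (Submodule.smul_mem _ _ (Q.bracket_same i))
  bracket_ne := fun i j hij => by
    rw [LieSuperalgebra.bracket_skew (Q.f_part i) (Q.e_part j), Q.bracket_ne j i hij.symm, smul_zero, neg_zero]
  form_ne := fun i j hij => by
    rw [B.supersymmetric (Q.f_part i) (Q.e_part j), Q.form_ne j i hij.symm, mul_zero]
  posPart_le := Q.negPart_le
  negPart_le := by simpa [negPart] using Q.posPart_le

theorem e_mem (i : Q.ι) : Q.e i ∈ posPart G := (Q.e_simple i).1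

theorem f_mem (i : Q.ι) : Q.f i ∈ negPart G := (Q.f_simple i).1

end Parabolic.Generators
end Generation

/-! ### Construction of the transposition by its graph -/

section Transposition

variable {g : Type*} [AddCommGroup g] [Module ℂ g] [LieSuperalgebra g] {B : KillingForm g}
  {G : ℝ → Submodule ℂ g}

theorem parityTwist_parityTwist {V : Type*} [AddCommGroup V] [Module ℂ V] [SuperSpace V] (i : ZMod 2) (v : V) :
    parityTwist V i (parityTwist V i v) = v := by
  rw [← evenProj_add_oddProj v]
  simp only [map_add, parityTwist_of_mem _ (evenProj_mem v), parityTwist_of_mem _ (oddProj_mem v),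
    map_smul, smul_smul, koszul_mul_self, one_smul]

theorem bracket_bracket_right {i : ZMod 2} {e : g} (he : e ∈ part i) (x y : g) :
    bracket (bracket x y) e = bracket x (bracket y e) + bracket (bracket x e) (parityTwist g i y) := by
  have h := bracket_jacobi_twist he (parityTwist g i x) (parityTwist g i y)
  rw [bracket_skew_twist he, ← parityTwist_bracket, parityTwist_parityTwist, bracket_skew_twist he,
    bracket_skew_twist he (parityTwist g i y)] at h
  simp only [parityTwist_parityTwist, map_neg, LinearMap.neg_apply] at h
  linear_combination (norm := module) -h

/-- The operator `(x, y) ↦ ([x, a], [b, y])`. -/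
def pairOp (a b : g) : g × g →ₗ[ℂ] g × g := (bracket.flip a).prodMap (bracket b)

theorem pairOp_apply (a b : g) (z : g × g) : pairOp a b z = (bracket z.1 a, bracket b z.2) := rfl

/-- Right brackets in the first component and left brackets in the second obey the same commutation
rule with the same sign. This is why an antiautomorphism without any signs exists. -/
theorem pairOp_pairOp {i j : ZMod 2} {a b c d : g} (ha : a ∈ part i) (hc : c ∈ part j) (hd : d ∈ part j)
    (hb : b ∈ part i) (z : g × g) : pairOp c d (pairOp a b z) =
      koszul i j • pairOp a b (pairOp c d z) + pairOp (bracket a c) (bracket d b) z := by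
  simp only [pairOp_apply]
  refine Prod.ext ?_ ?_
  · change bracket (bracket z.1 a) c = koszul i j • bracket (bracket z.1 c) a + bracket z.1 (bracket a c)
    rw [bracket_bracket_right hc, parityTwist_of_mem _ ha, map_smul, koszul_comm, add_comm]
  · change bracket d (bracket b z.2) = koszul i j • bracket b (bracket d z.2) + bracket (bracket d b) z.2
    rw [LieSuperalgebra.bracket_jacobi hd hb, koszul_comm, add_comm]

/-- The span of the pairs of iterated brackets of the elements of two families. -/
def pairSpan {ι : Type*} (e f : ι → g) : Submodule ℂ (g × g) :=
  sInf {W | (∀ i, (e i, f i) ∈ W) ∧ ∀ i, ∀ z ∈ W, pairOp (e i) (f i) z ∈ W}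

section

variable {ι : Type*} {e f : ι → g}

theorem pairSpan_le {W : Submodule ℂ (g × g)} (h1 : ∀ i, (e i, f i) ∈ W)
    (h2 : ∀ i, ∀ z ∈ W, pairOp (e i) (f i) z ∈ W) : pairSpan e f ≤ W := sInf_le ⟨h1, h2⟩

theorem pairSpan_induct {W : Submodule ℂ (g × g)} (h1 : ∀ i, (e i, f i) ∈ W)
    (h2 : ∀ i, ∀ z ∈ pairSpan e f, z ∈ W → pairOp (e i) (f i) z ∈ W) : pairSpan e f ≤ W := by
  have hmem : ∀ i, (e i, f i) ∈ pairSpan e f := fun i => (Submodule.mem_sInf).mpr fun _ hW => hW.1 i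
  have hop : ∀ i, ∀ z ∈ pairSpan e f, pairOp (e i) (f i) z ∈ pairSpan e f := fun i z hz =>
    (Submodule.mem_sInf).mpr fun W hW => hW.2 i z ((Submodule.mem_sInf).mp hz W hW)
  have h : pairSpan e f ≤ pairSpan e f ⊓ W :=
    pairSpan_le (fun i => ⟨hmem i, h1 i⟩) fun i z hz => ⟨hop i z hz.1, h2 i z hz.1 hz.2⟩
  exact h.trans inf_le_right

theorem mem_pairSpan (i : ι) : (e i, f i) ∈ pairSpan e f := (Submodule.mem_sInf).mpr fun _ hW => hW.1 i

theorem pairOp_mem_pairSpan (i : ι) {z : g × g} (hz : z ∈ pairSpan e f) :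
    pairOp (e i) (f i) z ∈ pairSpan e f :=
  (Submodule.mem_sInf).mpr fun W hW => hW.2 i z ((Submodule.mem_sInf).mp hz W hW)

end

/-- The diagonal of a subspace. -/
def diagPairs (H : Submodule ℂ g) : Submodule ℂ (g × g) := H.map (LinearMap.id.prod LinearMap.id)

theorem mem_diagPairs {H : Submodule ℂ g} {h : g} (hh : h ∈ H) : (h, h) ∈ diagPairs H := ⟨h, hh, rfl⟩

namespace Parabolic.Generators

variable {P : Parabolic B} (Q : P.Generators G) (hP : P.Adapted G)

/-- The graph of the transposition. -/
def graph : Submodule ℂ (g × g) := pairSpan Q.e Q.f ⊔ diagPairs (G 0) ⊔ pairSpan Q.f Q.e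

theorem opp_graph : Q.opp.graph = Q.graph := by
  change pairSpan Q.f Q.e ⊔ diagPairs (G (-0)) ⊔ pairSpan Q.e Q.f = _
  rw [neg_zero, sup_comm, ← sup_assoc, sup_right_comm, graph]

include hP

theorem bracket_e {h : g} (hh : h ∈ G 0) (i : Q.ι) : bracket (Q.e i) h = -(B.form (Q.wt i) h • Q.e i) := by
  rw [← Q.e_wt i h hh, bracket_skew_of_even (hP.even hh), neg_neg]

theorem bracket_f {h : g} (hh : h ∈ G 0) (i : Q.ι) : bracket h (Q.f i) = -(B.form (Q.wt i) h • Q.f i) := by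
  rw [Q.f_wt i h hh, map_neg, LinearMap.neg_apply, neg_smul]

theorem pairOp_zero_mem {h : g} (hh : h ∈ G 0) {z : g × g} (hz : z ∈ pairSpan Q.e Q.f) :
    pairOp h h z ∈ pairSpan Q.e Q.f := by
  refine pairSpan_induct (W := (pairSpan Q.e Q.f).comap (pairOp h h)) (fun i => ?_) (fun i z hz ih => ?_) hz
  · rw [Submodule.mem_comap, pairOp_apply, Q.bracket_e hP hh, Q.bracket_f hP hh]
    have h1 : (-(B.form (Q.wt i) h • Q.e i), -(B.form (Q.wt i) h • Q.f i)) =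
        -(B.form (Q.wt i) h • (Q.e i, Q.f i)) := rfl
    rw [h1]
    exact Submodule.neg_mem _ (Submodule.smul_mem _ _ (mem_pairSpan i))
  · rw [Submodule.mem_comap, pairOp_pairOp (Q.e_part i) (hP.even hh) (hP.even hh) (Q.f_part i),
      Q.bracket_e hP hh, Q.bracket_f hP hh]
    refine Submodule.add_mem _ (Submodule.smul_mem _ _ (pairOp_mem_pairSpan i ih)) ?_
    have h1 : pairOp (-(B.form (Q.wt i) h • Q.e i)) (-(B.form (Q.wt i) h • Q.f i)) z =
        -(B.form (Q.wt i) h • pairOp (Q.e i) (Q.f i) z) := by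
      simp [pairOp_apply]
    rw [h1]
    exact Submodule.neg_mem _ (Submodule.smul_mem _ _ (pairOp_mem_pairSpan i hz))

theorem pairOp_diag_mem (i : Q.ι) {z : g × g} (hz : z ∈ diagPairs (G 0)) :
    pairOp (Q.e i) (Q.f i) z ∈ pairSpan Q.e Q.f := by
  obtain ⟨h, hh, rfl⟩ := hz
  have h1 : pairOp (Q.e i) (Q.f i) ((LinearMap.id.prod LinearMap.id : g →ₗ[ℂ] g × g) h) =
      B.form (Q.wt i) h • (Q.e i, Q.f i) := by
    refine Prod.ext ?_ ?_
    · exact Q.e_wt i h hh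
    · change bracket (Q.f i) h = _
      rw [← neg_eq_iff_eq_neg.mpr (bracket_skew_of_even (y := Q.f i) (hP.even hh)), Q.bracket_f hP hh, neg_neg]
      rfl
  rw [h1]
  exact Submodule.smul_mem _ _ (mem_pairSpan i)

/-- Induction on words: the lowering operator is commuted past (e_i, f_i), and the commutator is
zero for i ≠ j and an operator of 𝔥 for i = j. -/
theorem pairOp_opp_mem (j : Q.ι) {z : g × g} (hz : z ∈ pairSpan Q.e Q.f) :
    pairOp (Q.f j) (Q.e j) z ∈ pairSpan Q.e Q.f ⊔ diagPairs (G 0) := by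
  refine pairSpan_induct (W := (pairSpan Q.e Q.f ⊔ diagPairs (G 0)).comap (pairOp (Q.f j) (Q.e j)))
    (fun i => ?_) (fun i z hz ih => ?_) hz
  · rw [Submodule.mem_comap]
    by_cases hij : i = j
    · subst hij
      exact Submodule.mem_sup_right (mem_diagPairs (Q.bracket_same i))
    · have h1 : pairOp (Q.f j) (Q.e j) (Q.e i, Q.f i) = 0 :=
        Prod.ext (Q.bracket_ne i j hij) (Q.bracket_ne j i (Ne.symm hij))
      rw [h1]
      exact Submodule.zero_mem _
  · rw [Submodule.mem_comap, pairOp_pairOp (Q.e_part i) (Q.f_part j) (Q.e_part j) (Q.f_part i)]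
    refine Submodule.add_mem _ (Submodule.smul_mem _ _ (Submodule.mem_sup_left ?_)) ?_
    · obtain ⟨u, hu, v, hv, huv⟩ := Submodule.mem_sup.mp (Submodule.mem_comap.mp ih)
      rw [← huv, map_add]
      exact Submodule.add_mem _ (pairOp_mem_pairSpan i hu) (Q.pairOp_diag_mem hP i hv)
    · by_cases hij : i = j
      · subst hij
        exact Submodule.mem_sup_left (Q.pairOp_zero_mem hP (Q.bracket_same i) hz)
      · rw [Q.bracket_ne i j hij, Q.bracket_ne j i (Ne.symm hij)]
        have h1 : pairOp (0 : g) 0 z = 0 := by simp [pairOp_apply]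
        rw [h1]
        exact Submodule.zero_mem _

theorem pairOp_mem_graph (i : Q.ι) {z : g × g} (hz : z ∈ Q.graph) : pairOp (Q.e i) (Q.f i) z ∈ Q.graph := by
  obtain ⟨u, hu, c, hc, rfl⟩ := Submodule.mem_sup.mp hz
  obtain ⟨a, ha, b, hb, rfl⟩ := Submodule.mem_sup.mp hu
  rw [map_add, map_add]
  have h1 := Q.opp.pairOp_opp_mem hP.opp i hc
  refine Submodule.add_mem _ (Submodule.mem_sup_left (Submodule.mem_sup_left (Submodule.add_mem _
    (pairOp_mem_pairSpan i ha) (Q.pairOp_diag_mem hP i hb)))) ?_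
  rw [← opp_graph]
  exact Submodule.mem_sup_left h1

theorem pairOp_mem_graph' (i : Q.ι) {z : g × g} (hz : z ∈ Q.graph) : pairOp (Q.f i) (Q.e i) z ∈ Q.graph := by
  rw [← opp_graph] at hz ⊢
  exact Q.opp.pairOp_mem_graph hP.opp i hz

theorem pairOp_zero_mem_graph {h : g} (hh : h ∈ G 0) {z : g × g} (hz : z ∈ Q.graph) :
    pairOp h h z ∈ Q.graph := by
  obtain ⟨u, hu, c, hc, rfl⟩ := Submodule.mem_sup.mp hz
  obtain ⟨a, ha, b, ⟨k, hk, rfl⟩, rfl⟩ := Submodule.mem_sup.mp hu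
  rw [map_add, map_add]
  have h1 : pairOp h h ((LinearMap.id.prod LinearMap.id : g →ₗ[ℂ] g × g) k) = 0 :=
    Prod.ext (hP.abelian _ hk _ hh) (hP.abelian _ hh _ hk)
  rw [h1, add_zero]
  exact Submodule.add_mem _ (Submodule.mem_sup_left (Submodule.mem_sup_left (Q.pairOp_zero_mem hP hh ha)))
    (Submodule.mem_sup_right (Q.opp.pairOp_zero_mem hP.opp (by rwa [neg_zero]) hc))

theorem pairSpan_le_prod : pairSpan Q.e Q.f ≤ (posPart G).prod (negPart G) :=
  pairSpan_le (fun i => ⟨Q.e_mem i, Q.f_mem i⟩) fun i _ hz =>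
    ⟨hP.bracket_posPart hz.1 (Q.e_mem i), hP.bracket_negPart (Q.f_mem i) hz.2⟩

theorem pairSpan_opp_le_prod : pairSpan Q.f Q.e ≤ (negPart G).prod (posPart G) :=
  pairSpan_le (fun i => ⟨Q.f_mem i, Q.e_mem i⟩) fun i _ hz =>
    ⟨hP.bracket_negPart hz.1 (Q.f_mem i), hP.bracket_posPart (Q.e_mem i) hz.2⟩

theorem eq_zero_of_sum {a b c : g} (ha : a ∈ posPart G) (hb : b ∈ G 0) (hc : c ∈ negPart G)
    (h : a + b + c = 0) : a = 0 ∧ b = 0 ∧ c = 0 := by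
  have ha0 : a = 0 := hP.eq_zero_of_mem_posPart ha fun y hy => by
    have h1 := congrArg (fun z => B.form z y) h
    simpa [hP.form_zero_negPart hb hy, hP.form_negPart hc hy] using h1
  have hc0 : c = 0 := hP.eq_zero_of_mem_negPart hc fun y hy => by
    have h1 := congrArg (fun z => B.form z y) h
    simpa [hP.form_zero_posPart hb hy, hP.form_posPart ha hy] using h1
  refine ⟨ha0, ?_, hc0⟩
  rwa [ha0, hc0, zero_add, add_zero] at h

/-- No Serre relations are needed. The set of such x lies in 𝔫⁺ and is stable under bracketing with
every f_i. As [x, f_i] ∈ 𝔫⁺ is orthogonal to 𝔥 and the weight of f_i is not zero, B(x, f_i) = 0; by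
B(x, [f_i, y]) = B([x, f_i], y), x is then orthogonal to all words in the f_i, that is, to 𝔫⁻. -/
theorem eq_zero_of_pairSpan {x : g} (hx : (x, (0 : g)) ∈ pairSpan Q.e Q.f) : x = 0 := by
  have hop : ∀ i x, (x, (0 : g)) ∈ pairSpan Q.e Q.f → (bracket x (Q.f i), (0 : g)) ∈ pairSpan Q.e Q.f := by
    intro i x hx
    have h1 := Q.pairOp_opp_mem hP i hx
    obtain ⟨u, hu, v, ⟨h, hh, rfl⟩, huv⟩ := Submodule.mem_sup.mp h1
    have h2 := congrArg Prod.snd huv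
    have h3 : u.2 + h = 0 := by
      refine h2.trans ?_
      rw [pairOp_apply]
      exact map_zero _
    have h4 := eq_zero_of_sum hP (posPart G).zero_mem hh (Q.pairSpan_le_prod hP hu).2 (by
      rw [zero_add, add_comm]; exact h3)
    have h5 : (bracket x (Q.f i), (0 : g)) = u := by
      have h6 : (bracket x (Q.f i), (0 : g)) = pairOp (Q.f i) (Q.e i) (x, 0) := by
        rw [pairOp_apply, map_zero]
      rw [h6, ← huv, h4.2.1, map_zero, add_zero]
    rw [h5]; exact hu
  have hpos : ∀ x, (x, (0 : g)) ∈ pairSpan Q.e Q.f → x ∈ posPart G := fun x hx => (Q.pairSpan_le_prod hP hx).1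
  refine hP.eq_zero_of_mem_posPart (hpos x hx) fun y hy => ?_
  let W : Submodule ℂ g := ⨅ x : {x : g // (x, (0 : g)) ∈ pairSpan Q.e Q.f}, LinearMap.ker (B.form (x : g))
  have hW : ∀ y, y ∈ W ↔ ∀ x, (x, (0 : g)) ∈ pairSpan Q.e Q.f → B.form x y = 0 := fun y => by
    simp [W, Submodule.mem_iInf]
  refine (hW y).mp (wordSpan_le (W := W) (fun i => (hW _).mpr fun x hx => ?_)
    (fun i y hy => (hW _).mpr fun x hx => ?_) (Q.negPart_le hy)) x hx
  · by_contra hne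
    refine Q.wt_ne i (hP.eq_zero_of_form_eq_zero (Q.wt_mem i) fun h hh => ?_)
    have h1 : B.form (bracket x (Q.f i)) h = 0 := hP.form_posPart_zero hh (hpos _ (hop i x hx))
    rw [B.invariant, ← neg_eq_iff_eq_neg.mpr (bracket_skew_of_even (y := Q.f i) (hP.even hh)),
      Q.bracket_f hP hh, neg_neg, map_smul] at h1
    exact (smul_eq_zero.mp h1).resolve_right hne
  · rw [← B.invariant]
    exact (hW y).mp hy _ (hop i x hx)

theorem eq_zero_of_graph {x : g} (hx : (x, (0 : g)) ∈ Q.graph) : x = 0 := by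
  obtain ⟨u, hu, c, hc, hx⟩ := Submodule.mem_sup.mp hx
  obtain ⟨a, ha, b, ⟨h, hh, rfl⟩, rfl⟩ := Submodule.mem_sup.mp hu
  have ha' := Q.pairSpan_le_prod hP ha
  have hc' := Q.pairSpan_opp_le_prod hP hc
  have h1 : c.2 + h + a.2 = 0 := by
    have h2 : a.2 + h + c.2 = 0 := congrArg Prod.snd hx
    rw [← h2]; abel
  obtain ⟨h2, h3, h4⟩ := eq_zero_of_sum hP hc'.2 hh ha'.2 h1
  have h5 : a.1 + h + c.1 = x := congrArg Prod.fst hx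
  have h6 : a.1 = 0 := Q.eq_zero_of_pairSpan hP (by rw [← h4]; exact ha)
  have h7 : c.1 = 0 := Q.opp.eq_zero_of_pairSpan hP.opp (by
    change (c.1, (0 : g)) ∈ pairSpan Q.f Q.e
    rw [← h2]; exact hc)
  rw [← h5, h6, h7, h3, add_zero, add_zero]

theorem negPart_le_map : negPart G ≤ (pairSpan Q.e Q.f).map (LinearMap.snd ℂ g g) :=
  Q.negPart_le.trans (wordSpan_le (fun i => ⟨_, mem_pairSpan i, rfl⟩) (by
    rintro i _ ⟨z, hz, rfl⟩
    exact ⟨_, pairOp_mem_pairSpan i hz, rfl⟩))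

theorem exists_graph (y : g) : ∃ x, (x, y) ∈ Q.graph := by
  have h1 : y ∈ posPart G ⊔ G 0 ⊔ negPart G := by rw [hP.posPart_sup]; trivial
  obtain ⟨u, hu, c, hc, rfl⟩ := Submodule.mem_sup.mp h1
  obtain ⟨a, ha, b, hb, rfl⟩ := Submodule.mem_sup.mp hu
  obtain ⟨⟨c', c''⟩, hc1, rfl⟩ := Q.negPart_le_map hP hc
  obtain ⟨⟨a', a''⟩, ha1, rfl⟩ := Q.opp.negPart_le_map hP.opp (by simpa [negPart] using ha)
  refine ⟨a' + b + c', ?_⟩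
  have h2 : (a' + b + c', a'' + b + c'') = (a', a'') + (b, b) + (c', c'') := rfl
  change (a' + b + c', a'' + b + c'') ∈ _
  rw [h2, add_assoc, add_comm]
  refine Submodule.add_mem _ (Submodule.add_mem _ (Submodule.mem_sup_left (Submodule.mem_sup_right
    (mem_diagPairs hb))) (Submodule.mem_sup_left (Submodule.mem_sup_left hc1))) (Submodule.mem_sup_right ha1)

theorem graph_unique {x x' y : g} (hx : (x, y) ∈ Q.graph) (hx' : (x', y) ∈ Q.graph) : x = x' := by
  rw [← sub_eq_zero]
  refine Q.eq_zero_of_graph hP ?_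
  have h := Submodule.sub_mem _ hx hx'
  rwa [Prod.mk_sub_mk, sub_self] at h

/-- Each generator pair lies either in 𝔫 × 𝔫⁻ or in 𝔩 × 𝔩, and bracketing preserves this
alternative. It makes the transposition compatible with the parabolic decomposition. -/
theorem pairSpan_le_prod_parabolic : pairSpan Q.e Q.f ≤
    (pairSpan Q.e Q.f ⊓ P.n.prod P.nbar) ⊔ (pairSpan Q.e Q.f ⊓ P.levi.prod P.levi) := by
  refine pairSpan_le (fun i => ?_) fun i z hz => ?_
  · rcases Q.cases i with h | h
    · exact Submodule.mem_sup_left ⟨mem_pairSpan i, h⟩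
    · exact Submodule.mem_sup_right ⟨mem_pairSpan i, h⟩
  · obtain ⟨a, ⟨ha, ha'⟩, b, ⟨hb, hb'⟩, rfl⟩ := Submodule.mem_sup.mp hz
    rw [map_add]
    have hn : ∀ x ∈ P.levi, ∀ y ∈ P.levi, bracket x y ∈ P.levi := fun x hx y hy =>
      ⟨P.p_sub.bracket_mem _ hx.1 _ hy.1, P.pOpp_sub.bracket_mem _ hx.2 _ hy.2⟩
    rcases Q.cases i with h | h
    · exact Submodule.mem_sup_left (Submodule.add_mem _
        ⟨pairOp_mem_pairSpan i ha, Adapted.bracket_n_left ha'.1 (hP.n_le h.1),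
          Adapted.bracket_n_left (P := P.opp) h.2 (hP.nbar_le ha'.2)⟩
        ⟨pairOp_mem_pairSpan i hb, Adapted.bracket_n_right h.1 hb'.1.1,
          Adapted.bracket_n_left (P := P.opp) h.2 hb'.2.2⟩)
    · exact Submodule.add_mem_sup ⟨pairOp_mem_pairSpan i ha, Adapted.bracket_n_left ha'.1 h.1.1,
          Adapted.bracket_n_right (P := P.opp) ha'.2 h.2.2⟩
        ⟨pairOp_mem_pairSpan i hb, hn _ hb'.1 _ h.1, hn _ h.2 _ hb'.2⟩

theorem graph_parity {i : ZMod 2} {z : g × g} (hz : z ∈ Q.graph) :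
    (parityTwist g i z.1, parityTwist g i z.2) ∈ Q.graph := by
  have key : ∀ (e f : Q.ι → g), (∀ i, e i ∈ part (Q.par i)) → (∀ i, f i ∈ part (Q.par i)) →
      pairSpan e f ≤ (pairSpan e f).comap ((parityTwist g i).prodMap (parityTwist g i)) := by
    intro e f he hf
    refine pairSpan_induct (fun j => ?_) (fun j z hz ih => ?_)
    · rw [Submodule.mem_comap, LinearMap.prodMap_apply, parityTwist_of_mem _ (he j), parityTwist_of_mem _ (hf j)]
      exact Submodule.smul_mem _ (koszul i (Q.par j)) (mem_pairSpan (e := e) (f := f) j)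
    · have h1 : (parityTwist g i).prodMap (parityTwist g i) (pairOp (e j) (f j) z) =
          koszul i (Q.par j) • pairOp (e j) (f j) ((parityTwist g i).prodMap (parityTwist g i) z) := by
        simp only [LinearMap.prodMap_apply, pairOp_apply, parityTwist_bracket, parityTwist_of_mem _ (he j),
          parityTwist_of_mem _ (hf j), map_smul, LinearMap.smul_apply, Prod.smul_mk]
      rw [Submodule.mem_comap, h1]
      exact Submodule.smul_mem _ _ (pairOp_mem_pairSpan j ih)
  obtain ⟨u, hu, c, hc, rfl⟩ := Submodule.mem_sup.mp hz
  obtain ⟨a, ha, b, ⟨h, hh, rfl⟩, rfl⟩ := Submodule.mem_sup.mp hu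
  have h1 : ((parityTwist g i).prodMap (parityTwist g i))
      (a + (LinearMap.id.prod LinearMap.id : g →ₗ[ℂ] g × g) h + c) ∈ Q.graph := by
    rw [map_add, map_add]
    refine Submodule.add_mem _ (Submodule.mem_sup_left (Submodule.add_mem _ (Submodule.mem_sup_left
      (key _ _ Q.e_part Q.f_part ha)) (Submodule.mem_sup_right ?_)))
      (Submodule.mem_sup_right (key _ _ Q.f_part Q.e_part hc))
    have h2 : (parityTwist g i).prodMap (parityTwist g i) ((LinearMap.id.prod LinearMap.id : g →ₗ[ℂ] g × g) h) =
        (h, h) := by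
      change (parityTwist g i h, parityTwist g i h) = _
      rw [parityTwist_of_mem i (hP.even hh), koszul_zero_right, one_smul]
    rw [h2]
    exact mem_diagPairs hh
  exact h1

/-- Interchanging the roles of the two sides of the bracket. -/
theorem pairOp_swap_mem {i : ZMod 2} {e f : g} (he : e ∈ part i) (hf : f ∈ part i)
    (h : ∀ z ∈ Q.graph, pairOp e f z ∈ Q.graph) {z : g × g} (hz : z ∈ Q.graph) :
    (bracket e z.1, bracket z.2 f) ∈ Q.graph := by
  have h1 := h _ (Q.graph_parity hP (i := i) hz)
  rw [pairOp_apply] at h1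
  have h2 := Submodule.neg_mem _ h1
  have h3 : bracket z.2 f = -bracket f (parityTwist g i z.2) := by
    rw [bracket_skew_twist hf, parityTwist_parityTwist, neg_neg]
  rw [bracket_skew_twist he, h3]
  exact h2

/-- Only words of the opposite sign can contribute. On words of length at least two both sides
vanish, because e_i and f_i are orthogonal to brackets; on generators it is the orthogonality of e_i
and f_j for i ≠ j. -/
theorem form_graph_e (i : Q.ι) {w : g × g} (hw : w ∈ Q.graph) : B.form (Q.e i) w.1 = B.form w.2 (Q.f i) := by
  have hsimple : ∀ {x y}, x ∈ simplePart B (fun t => G (-t)) → y ∈ derived (posPart G) → B.form x y = 0 :=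
    fun {x y} hx hy => hx.2 y (by simpa [negPart] using hy)
  obtain ⟨u, hu, c, hc, rfl⟩ := Submodule.mem_sup.mp hw
  obtain ⟨a, ha, b, ⟨h, hh, rfl⟩, rfl⟩ := Submodule.mem_sup.mp hu
  have ha' := Q.pairSpan_le_prod hP ha
  have h1 : B.form (Q.e i) c.1 = B.form c.2 (Q.f i) := by
    let W : Submodule ℂ (g × g) := LinearMap.ker (B.form (Q.e i) ∘ₗ LinearMap.fst ℂ g g -
      B.form.flip (Q.f i) ∘ₗ LinearMap.snd ℂ g g)
    have hW : ∀ z, z ∈ W ↔ B.form (Q.e i) z.1 = B.form z.2 (Q.f i) := fun z => sub_eq_zero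
    refine (hW c).mp (pairSpan_induct (W := W) (fun j => (hW _).mpr ?_) (fun j z hz _ => (hW _).mpr ?_) hc)
    · by_cases hij : i = j
      · rw [hij]
      · change B.form (Q.e i) (Q.f j) = B.form (Q.e j) (Q.f i)
        rw [Q.form_ne i j hij, Q.form_ne j i (Ne.symm hij)]
    · have hz' := Q.pairSpan_opp_le_prod hP hz
      rw [pairOp_apply]
      change B.form (Q.e i) (bracket z.1 (Q.f j)) = B.form (bracket (Q.e j) z.2) (Q.f i)
      rw [(Q.e_simple i).2 _ (bracket_mem_derived hz'.1 (Q.f_mem j)), B.form_comm, ← B.form_parityInv,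
        parityInv_of_mem (Q.f_part i), map_smul, LinearMap.smul_apply,
        hsimple (Q.f_simple i) (bracket_mem_derived (Q.e_mem j) hz'.2), smul_zero]
  change B.form (Q.e i) (a.1 + h + c.1) = B.form (a.2 + h + c.2) (Q.f i)
  simp only [map_add, LinearMap.add_apply, h1, hP.form_posPart (Q.e_mem i) ha'.1,
    hP.form_posPart_zero hh (Q.e_mem i), hP.form_negPart ha'.2 (Q.f_mem i), hP.form_zero_negPart hh (Q.f_mem i)]

/-- Invariance moves a generator from z to w, for all w in the graph at once; `form_graph_e` starts
the induction. -/
theorem form_graph_pairSpan {z w : g × g} (hz : z ∈ pairSpan Q.e Q.f) (hw : w ∈ Q.graph) :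
    B.form z.1 w.1 = B.form w.2 z.2 := by
  let W : Submodule ℂ (g × g) := ⨅ w : Q.graph, LinearMap.ker (B.form.flip (w : g × g).1 ∘ₗ LinearMap.fst ℂ g g -
      B.form (w : g × g).2 ∘ₗ LinearMap.snd ℂ g g)
  have hW : ∀ z, z ∈ W ↔ ∀ w ∈ Q.graph, B.form z.1 w.1 = B.form w.2 z.2 := fun z => by
    simp only [W, Submodule.mem_iInf, Subtype.forall, LinearMap.mem_ker]
    exact forall₂_congr fun w hw => sub_eq_zero
  refine (hW z).mp (pairSpan_le (W := W) (fun i => (hW _).mpr fun w hw => Q.form_graph_e hP i hw)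
    (fun i z hz => (hW _).mpr fun w hw => ?_) hz) w hw
  rw [pairOp_apply]
  change B.form (bracket z.1 (Q.e i)) w.1 = B.form w.2 (bracket (Q.f i) z.2)
  rw [B.invariant]
  exact ((hW z).mp hz _ (Q.pairOp_swap_mem hP (Q.e_part i) (Q.f_part i)
    (fun z hz => Q.pairOp_mem_graph hP i hz) hw)).trans (B.invariant _ _ _)

theorem form_graph {z w : g × g} (hz : z ∈ Q.graph) (hw : w ∈ Q.graph) : B.form z.1 w.1 = B.form w.2 z.2 := by
  obtain ⟨u, hu, c, hc, rfl⟩ := Submodule.mem_sup.mp hz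
  obtain ⟨a, ha, b, ⟨h, hh, rfl⟩, rfl⟩ := Submodule.mem_sup.mp hu
  have h1 := Q.form_graph_pairSpan hP ha hw
  have h2 := Q.opp.form_graph_pairSpan hP.opp hc (by rw [opp_graph]; exact hw)
  have h3 : B.form h w.1 = B.form w.2 h := by
    obtain ⟨u, hu, c, hc, rfl⟩ := Submodule.mem_sup.mp hw
    obtain ⟨a, ha, b, ⟨k, hk, rfl⟩, rfl⟩ := Submodule.mem_sup.mp hu
    have ha' := Q.pairSpan_le_prod hP ha
    have hc' := Q.pairSpan_opp_le_prod hP hc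
    change B.form h (a.1 + k + c.1) = B.form (a.2 + k + c.2) h
    simp only [map_add, LinearMap.add_apply, hP.form_zero_posPart hh ha'.1, hP.form_zero_negPart hh hc'.1,
      hP.form_negPart_zero hh ha'.2, hP.form_posPart_zero hh hc'.2, B.apply_comm_of_even (y := k) (hP.even hh)]
  change B.form (a.1 + h + c.1) w.1 = B.form w.2 (a.2 + h + c.2)
  simp only [map_add, LinearMap.add_apply, h1, h3, h2]

end Parabolic.Generators

/-- A transposition: an even antiautomorphism of the vector space `g` with its bracket, without signs,
which is the identity on the Cartan subalgebra and exchanges `p` and the opposite parabolic subalgebra. -/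
structure Parabolic.IsTransposition (P : Parabolic B) (G : ℝ → Submodule ℂ g) (τ : g →ₗ[ℂ] g) : Prop where
  apply_bracket : ∀ x y, τ (bracket x y) = bracket (τ y) (τ x)
  mem_part : ∀ {i : ZMod 2} {x : g}, x ∈ part i → τ x ∈ part i
  form_apply : ∀ x y, B.form (τ x) (τ y) = B.form y x
  apply_of_mem_zero : ∀ x ∈ G 0, τ x = x
  mem_negPart : ∀ x ∈ posPart G, τ x ∈ negPart G
  mem_posPart : ∀ x ∈ negPart G, τ x ∈ posPart G
  mem_nbar : ∀ x ∈ P.n, τ x ∈ P.nbar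
  mem_n : ∀ x ∈ P.nbar, τ x ∈ P.n
  mem_levi : ∀ x ∈ P.levi, τ x ∈ P.levi

/-- By `exists_graph` and `graph_unique` the graph defines τ with τ y = x for (x, y) in it.
Stability of the graph under the generators is the antiautomorphism rule for brackets with a
generator, which extends to brackets of arbitrary elements by induction on words. -/
theorem Parabolic.Generators.exists_transposition {P : Parabolic B} (Q : P.Generators G) (hP : P.Adapted G) :
    ∃ τ : g →ₗ[ℂ] g, P.IsTransposition G τ := by
  choose τ' hτ' using Q.exists_graph hP
  have huniq : ∀ {x y}, (x, y) ∈ Q.graph → τ' y = x := fun h => Q.graph_unique hP (hτ' _) h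
  let τ : g →ₗ[ℂ] g :=
    { toFun := τ'
      map_add' := fun x y => huniq (Submodule.add_mem _ (hτ' x) (hτ' y))
      map_smul' := fun c x => huniq (Submodule.smul_mem _ c (hτ' x)) }
  have hτ : ∀ y, (τ y, y) ∈ Q.graph := hτ'
  have hu : ∀ {x y}, (x, y) ∈ Q.graph → τ y = x := huniq
  have he : ∀ i, τ (Q.e i) = Q.f i := fun i => hu (Submodule.mem_sup_right (mem_pairSpan i))
  have hf : ∀ i, τ (Q.f i) = Q.e i := fun i => hu (Submodule.mem_sup_left (Submodule.mem_sup_left (mem_pairSpan i)))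
  have htw : ∀ i y, τ (parityTwist g i y) = parityTwist g i (τ y) := fun i y =>
    hu (Q.graph_parity hP (hτ y))
  -- Stated for two families, so that it serves both 𝔫⁺ and 𝔫⁻. The parity twists of z are carried
  -- along because the Jacobi identity produces them.
  have hword : ∀ (e f : Q.ι → g), (∀ i, e i ∈ part (Q.par i)) → (∀ i, f i ∈ part (Q.par i)) →
      (∀ i y, τ (bracket (f i) y) = bracket (τ y) (e i)) → (∀ i, τ (f i) = e i) →
      ∀ z ∈ wordSpan f, ∀ y, τ (bracket z y) = bracket (τ y) (τ z) := by
    intro e f he hf hop hfe z hz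
    let W : Submodule ℂ g := ⨅ p : g × ZMod 2, LinearMap.ker
      (τ ∘ₗ bracket.flip p.1 ∘ₗ parityTwist g p.2 - bracket (τ p.1) ∘ₗ τ ∘ₗ parityTwist g p.2)
    have hW : ∀ z, z ∈ W ↔ ∀ y i, τ (bracket (parityTwist g i z) y) = bracket (τ y) (τ (parityTwist g i z)) :=
      fun z => by
        simp only [W, Submodule.mem_iInf, Prod.forall, LinearMap.mem_ker]
        exact forall₂_congr fun y i => sub_eq_zero
    have h0 := (hW z).mp (wordSpan_le (W := W) (fun i => (hW _).mpr fun y j => ?_)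
      (fun i w hw => (hW _).mpr fun y j => ?_) hz)
    · exact fun y => h0 y 0
    · rw [parityTwist_of_mem j (hf i), map_smul, map_smul, LinearMap.smul_apply, map_smul, map_smul, hop, hfe]
    · have hw' := (hW w).mp hw
      have htt : ∃ l, parityTwist g (Q.par i) (parityTwist g j w) = parityTwist g l w := by
        rcases parity_cases (Q.par i) with h | h <;> rcases parity_cases j with h' | h' <;> rw [h, h']
        · exact ⟨0, rfl⟩
        · exact ⟨1, rfl⟩
        · exact ⟨1, rfl⟩
        · exact ⟨0, parityTwist_parityTwist 1 w⟩
      obtain ⟨l, hl⟩ := htt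
      have h1 := bracket_jacobi_twist (hf i) (parityTwist g j w) y
      have h2 := congrArg τ h1
      rw [hop, map_add, hw', hl, hw', hop, bracket_bracket_right (he i), ← htw, hl] at h2
      have h3 := add_right_cancel h2
      rw [parityTwist_bracket, parityTwist_of_mem j (hf i)]
      simp only [map_smul, LinearMap.smul_apply, ← h3, hop]
  have hopf : ∀ i y, τ (bracket (Q.f i) y) = bracket (τ y) (Q.e i) := fun i y =>
    hu (Q.pairOp_mem_graph hP i (hτ y))
  have hope : ∀ i y, τ (bracket (Q.e i) y) = bracket (τ y) (Q.f i) := fun i y =>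
    hu (Q.pairOp_mem_graph' hP i (hτ y))
  have hfix : ∀ x ∈ G 0, τ x = x := fun x hx =>
    hu (Submodule.mem_sup_left (Submodule.mem_sup_right (mem_diagPairs hx)))
  have hpos : ∀ x ∈ posPart G, τ x ∈ negPart G := fun x hx => by
    obtain ⟨z, hz, rfl⟩ := Q.opp.negPart_le_map hP.opp (by simpa [negPart] using hx)
    have h1 : τ z.2 = z.1 := hu (Submodule.mem_sup_right hz)
    rw [LinearMap.snd_apply, h1]
    exact (Q.pairSpan_opp_le_prod hP hz).1
  have hneg : ∀ x ∈ negPart G, τ x ∈ posPart G := fun x hx => by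
    obtain ⟨z, hz, rfl⟩ := Q.negPart_le_map hP hx
    have h1 : τ z.2 = z.1 := hu (Submodule.mem_sup_left (Submodule.mem_sup_left hz))
    rw [LinearMap.snd_apply, h1]
    exact (Q.pairSpan_le_prod hP hz).1
  have hsplit : ∀ z ∈ Q.graph, ∃ a ∈ P.n, ∃ b ∈ P.levi, ∃ c ∈ P.nbar, z.2 = a + b + c ∧
      τ a ∈ P.nbar ∧ τ b ∈ P.levi ∧ τ c ∈ P.n := by
    intro z hz
    obtain ⟨u, hu', c, hc, rfl⟩ := Submodule.mem_sup.mp hz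
    obtain ⟨a, ha, b, ⟨h, hh, rfl⟩, rfl⟩ := Submodule.mem_sup.mp hu'
    obtain ⟨a1, ha1, a2, ha2, rfl⟩ := Submodule.mem_sup.mp (Q.pairSpan_le_prod_parabolic hP ha)
    obtain ⟨c1, hc1, c2, hc2, rfl⟩ := Submodule.mem_sup.mp (Q.opp.pairSpan_le_prod_parabolic hP.opp hc)
    have h1 : τ c1.2 = c1.1 := hu (Submodule.mem_sup_right hc1.1)
    have h2 : τ c2.2 = c2.1 := hu (Submodule.mem_sup_right hc2.1)
    have h3 : τ a1.2 = a1.1 := hu (Submodule.mem_sup_left (Submodule.mem_sup_left ha1.1))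
    have h4 : τ a2.2 = a2.1 := hu (Submodule.mem_sup_left (Submodule.mem_sup_left ha2.1))
    have hl := hP.zero_le_levi hh
    refine ⟨c1.2, hc1.2.2, a2.2 + h + c2.2, Submodule.add_mem _ (Submodule.add_mem _ ha2.2.2 hl)
      ⟨hc2.2.2.2, hc2.2.2.1⟩, a1.2, ha1.2.2, ?_, ?_, ?_, ?_⟩
    · change a1.2 + a2.2 + h + (c1.2 + c2.2) = _
      abel
    · rw [h1]; exact hc1.2.1
    · rw [map_add, map_add, h4, h2, hfix h hh]
      exact Submodule.add_mem _ (Submodule.add_mem _ ha2.2.1 hl) ⟨hc2.2.1.2, hc2.2.1.1⟩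
    · rw [h3]; exact ha1.2.1
  have hind : ∀ {a b c a' b' c' : g}, a ∈ P.n → b ∈ P.levi → c ∈ P.nbar → a' ∈ P.n → b' ∈ P.levi → c' ∈ P.nbar →
      a + b + c = a' + b' + c' → a = a' ∧ b = b' ∧ c = c' := by
    intro a b c a' b' c' ha hb hc ha' hb' hc' h
    have h1 : a - a' = 0 := Adapted.eq_zero_of_n (Submodule.sub_mem _ ha ha') (by
      have h2 : a - a' = (b' - b) + (c' - c) := by linear_combination (norm := module) h
      rw [h2]
      exact Submodule.add_mem _ (Submodule.sub_mem _ hb'.2 hb.2)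
        (Submodule.sub_mem _ (hP.nbar_le hc') (hP.nbar_le hc)))
    have h3 : c - c' = 0 := Adapted.eq_zero_of_nbar (Submodule.sub_mem _ hc hc') (by
      have h2 : c - c' = (b' - b) + (a' - a) := by linear_combination (norm := module) h
      rw [h2]
      exact Submodule.add_mem _ (Submodule.sub_mem _ hb'.1 hb.1)
        (Submodule.sub_mem _ (hP.n_le ha') (hP.n_le ha)))
    rw [sub_eq_zero] at h1 h3
    refine ⟨h1, ?_, h3⟩
    rw [h1, h3] at h
    exact add_left_cancel (add_right_cancel h)
  refine ⟨τ, ?_, ?_, fun x y => Q.form_graph hP (hτ x) (hτ y), hfix, hpos, hneg, ?_, ?_, ?_⟩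
  · intro x y
    have h1 : x ∈ posPart G ⊔ G 0 ⊔ negPart G := by rw [hP.posPart_sup]; trivial
    obtain ⟨u, hu', c, hc, rfl⟩ := Submodule.mem_sup.mp h1
    obtain ⟨a, ha, b, hb, rfl⟩ := Submodule.mem_sup.mp hu'
    have h2 := hword Q.e Q.f Q.e_part Q.f_part hopf hf c (Q.negPart_le hc) y
    have h3 := hword Q.f Q.e Q.f_part Q.e_part hope he a (Q.posPart_le ha) y
    have h4 : τ (bracket b y) = bracket (τ y) (τ b) := by
      rw [hfix b hb]
      exact hu (Q.pairOp_zero_mem_graph hP hb (hτ y))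
    simp only [map_add, LinearMap.add_apply, h2, h3, h4]
  · intro i x hx
    refine mem_part_of_parityTwist ?_
    rw [← htw, parityTwist_of_mem 1 hx, map_smul]
  · intro x hx
    obtain ⟨a, ha, b, hb, c, hc, h, h1, h2, h3⟩ := hsplit _ (hτ x)
    obtain ⟨h4, h5, h6⟩ := hind hx (Submodule.zero_mem _) (Submodule.zero_mem _) ha hb hc (by
      rw [add_zero, add_zero]; exact h)
    rw [h4]; exact h1
  · intro x hx
    obtain ⟨a, ha, b, hb, c, hc, h, h1, h2, h3⟩ := hsplit _ (hτ x)
    obtain ⟨h4, h5, h6⟩ := hind (Submodule.zero_mem _) (Submodule.zero_mem _) hx ha hb hc (by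
      rw [add_zero, zero_add]; exact h)
    rw [h6]; exact h3
  · intro x hx
    obtain ⟨a, ha, b, hb, c, hc, h, h1, h2, h3⟩ := hsplit _ (hτ x)
    obtain ⟨h4, h5, h6⟩ := hind (Submodule.zero_mem _) hx (Submodule.zero_mem _) ha hb hc (by
      rw [add_zero, zero_add]; exact h)
    rw [h5]; exact h2

end Transposition

/-! ### Highest weight vectors in representations without a grading -/

section Contravariant

variable {g : Type*} [AddCommGroup g] [Module ℂ g] [LieSuperalgebra g] {B : KillingForm g}
  {G : ℝ → Submodule ℂ g}

/-- A representation on a vector space without a grading. -/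
def IsRep {M : Type*} [AddCommGroup M] [Module ℂ M] (ρ : g →ₗ[ℂ] M →ₗ[ℂ] M) : Prop :=
  ∀ {i j : ZMod 2} {x y : g}, x ∈ part i → y ∈ part j → ∀ m : M,
    ρ (bracket x y) m = ρ x (ρ y m) - koszul i j • ρ y (ρ x m)

theorem exists_minimal_stable {M : Type*} [AddCommGroup M] [Module ℂ M] [FiniteDimensional ℂ M]
    (S : Set (M →ₗ[ℂ] M)) {U : Submodule ℂ M} (hU : U ≠ ⊥) (hS : ∀ T ∈ S, ∀ u ∈ U, T u ∈ U) :
    ∃ W ≤ U, W ≠ ⊥ ∧ (∀ T ∈ S, ∀ u ∈ W, T u ∈ W) ∧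
      ∀ W' ≤ W, W' ≠ ⊥ → (∀ T ∈ S, ∀ u ∈ W', T u ∈ W') → W' = W := by
  obtain ⟨W, ⟨h1, h2, h3⟩, h4⟩ := WellFounded.has_min (wellFounded_lt (α := Submodule ℂ M))
    {W | W ≤ U ∧ W ≠ ⊥ ∧ ∀ T ∈ S, ∀ u ∈ W, T u ∈ W} ⟨U, le_rfl, hU, hS⟩
  refine ⟨W, h1, h2, h3, fun W' h hne hs => ?_⟩
  by_contra hcon
  exact h4 W' ⟨h.trans h1, hne, hs⟩ (lt_of_le_of_ne h hcon)

theorem exists_common_eigenvector {M : Type*} [AddCommGroup M] [Module ℂ M] [FiniteDimensional ℂ M]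
    (S : Set (M →ₗ[ℂ] M)) (hcomm : ∀ T ∈ S, ∀ T' ∈ S, ∀ m, T (T' m) = T' (T m)) {U : Submodule ℂ M}
    (hU : U ≠ ⊥) (hS : ∀ T ∈ S, ∀ u ∈ U, T u ∈ U) :
    ∃ v ∈ U, v ≠ 0 ∧ ∀ T ∈ S, ∃ c : ℂ, T v = c • v := by
  obtain ⟨W, h1, h2, h3, h4⟩ := exists_minimal_stable S hU hS
  obtain ⟨v, hv, hv0⟩ := (Submodule.ne_bot_iff W).mp h2
  refine ⟨v, h1 hv, hv0, fun T hT => ?_⟩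
  have hnt : Nontrivial W := Submodule.nontrivial_iff_ne_bot.mpr h2
  obtain ⟨c, hc⟩ := Module.End.exists_eigenvalue (T.restrict (h3 T hT))
  obtain ⟨u, hu⟩ := hc.exists_hasEigenvector
  refine ⟨c, ?_⟩
  have h5 := h4 (W ⊓ Module.End.eigenspace T c) inf_le_left (by
    rw [Submodule.ne_bot_iff]
    refine ⟨u, ⟨u.2, Module.End.mem_eigenspace_iff.mpr ?_⟩, fun h => hu.2 (Subtype.ext h)⟩
    exact congrArg Subtype.val hu.apply_eq_smul) (fun T' hT' w hw => ⟨h3 T' hT' w hw.1,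
      Module.End.mem_eigenspace_iff.mpr (by
        rw [hcomm T hT T' hT', Module.End.mem_eigenspace_iff.mp hw.2, map_smul])⟩)
  exact Module.End.mem_eigenspace_iff.mp ((h5.ge.trans inf_le_right) hv)

/-- Non-zero powers xⁿ would be eigenvectors of the commutator with h for infinitely many
eigenvalues n. -/
theorem exists_pow_eq_zero_of_commutator {M : Type*} [AddCommGroup M] [Module ℂ M] [FiniteDimensional ℂ M]
    {h x : Module.End ℂ M} (hx : h * x - x * h = x) : ∃ n, x ^ n = 0 := by
  by_contra! hne
  have hpow : ∀ n : ℕ, h * x ^ n - x ^ n * h = (n : ℂ) • x ^ n := by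
    intro n
    induction n with
    | zero => simp
    | succ n ih =>
      have h1 : h * x ^ (n + 1) - x ^ (n + 1) * h = (h * x ^ n - x ^ n * h) * x + x ^ n * (h * x - x * h) := by
        rw [pow_succ]; noncomm_ring
      rw [h1, ih, hx, smul_mul_assoc, ← pow_succ]
      push_cast
      module
  let L : Module.End ℂ (Module.End ℂ M) := LinearMap.mulLeft ℂ h - LinearMap.mulRight ℂ h
  have h2 : ∀ n : ℕ, L.HasEigenvalue (n : ℂ) := fun n =>
    Module.End.hasEigenvalue_of_hasEigenvector (x := x ^ n)
      ⟨Module.End.mem_eigenspace_iff.mpr (hpow n), hne n⟩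
  have h3 : (Set.range fun n : ℕ => (n : ℂ)).Finite :=
    (Module.End.finite_hasEigenvalue L).subset (by rintro _ ⟨n, rfl⟩; exact h2 n)
  exact Set.infinite_range_of_injective Nat.cast_injective h3

/-- No weight decomposition of M is assumed. Let W be a minimal non-zero subspace stable under 𝔫⁺.
If 𝔫⁺ acts on it non-trivially, a homogeneous x of the largest degree acting non-trivially commutes
up to sign with 𝔫⁺ on W, so xW = W by minimality. But x is nilpotent, since [h, x] is a non-zero
multiple of x for some h ∈ 𝔥. -/
theorem RootGrading.exists_killed_by_posPart (R : RootGrading B G) {M : Type*} [AddCommGroup M] [Module ℂ M]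
    [FiniteDimensional ℂ M] [Nontrivial M] {ρ : g →ₗ[ℂ] M →ₗ[ℂ] M} (hρ : IsRep ρ) :
    ∃ v ≠ 0, ∀ x ∈ posPart G, ρ x v = 0 := by
  obtain ⟨W, -, h2, h3, h4⟩ := exists_minimal_stable {T | ∃ x ∈ posPart G, ρ x = T} (U := (⊤ : Submodule ℂ M))
    top_ne_bot (fun _ _ _ _ => trivial)
  obtain ⟨v, hv, hv0⟩ := (Submodule.ne_bot_iff W).mp h2
  by_contra! hcon
  have hstab : ∀ x ∈ posPart G, ∀ w ∈ W, ρ x w ∈ W := fun x hx w hw => h3 _ ⟨x, hx, rfl⟩ w hw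
  have hfd := R.finiteDimensional
  have hind := ((DirectSum.isInternal_submodule_iff_iSupIndep_and_iSup_eq_top G).mp R.internal).1
  have hfin : {t | G t ≠ ⊥}.Finite := WellFoundedGT.finite_ne_bot_of_iSupIndep hind
  let T : Set ℝ := {t | 0 < t ∧ ∃ x ∈ G t, ∃ w ∈ W, ρ x w ≠ 0}
  have hT : T.Finite := hfin.subset (by
    rintro t ⟨-, x, hx, w, -, hxw⟩ hbot
    rw [hbot, Submodule.mem_bot] at hx
    exact hxw (by rw [hx, map_zero, LinearMap.zero_apply]))
  have hTne : T.Nonempty := by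
    by_contra hemp
    obtain ⟨x, hx, hxv⟩ := hcon v hv0
    refine hxv (posPart_induction (p := fun x => ρ x v = 0) (fun t ht x hx => ?_) (by simp)
      (fun a b ha hb => by rw [map_add, LinearMap.add_apply, ha, hb, add_zero]) hx)
    by_contra hne
    exact hemp ⟨t, ht, x, hx, v, hv, hne⟩
  obtain ⟨t, ⟨ht, x₀, hx₀, w₀, hw₀, hne⟩, hmax⟩ := Set.exists_max_image T id hT hTne
  obtain ⟨i, a, x, hx, hxw⟩ : ∃ (i : ZMod 2) (a : G 0), ∃ x ∈ homPart B G t i a, ρ x w₀ ≠ 0 := by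
    by_contra! hall
    refine hne ((iSup_le fun k => ?_ : _ ≤ LinearMap.ker (ρ.flip w₀)) ((R.homPart_le t).le hx₀))
    exact fun y hy => hall k.1 k.2 y hy
  have hxpos : x ∈ posPart G := mem_posPart ht hx.1.1
  have hx0 : x ≠ 0 := by rintro rfl; exact hxw (by simp)
  have hcomm : ∀ (j : ZMod 2) (y : g), y ∈ posPart G → y ∈ part j → ∀ w ∈ W, ρ y (ρ x w) = koszul j i • ρ x (ρ y w) := by
    intro j y hy hyj w hw
    have h5 : ρ (bracket y x) w = 0 := by
      refine posPart_induction (p := fun y => ρ (bracket y x) w = 0) (fun s hs y hy => ?_) (by simp)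
        (fun a b ha hb => by rw [map_add, LinearMap.add_apply, map_add, LinearMap.add_apply, ha, hb, add_zero]) hy
      by_contra hne
      have h6 := hmax (s + t) ⟨add_pos hs ht, _, R.bracket_mem _ _ y hy x hx.1.1, w, hw, hne⟩
      change s + t ≤ t at h6
      linarith
    rw [hρ hyj hx.1.2, sub_eq_zero] at h5
    exact h5
  have hW : W.map (ρ x) = W := by
    refine h4 _ ?_ ?_ ?_
    · rintro _ ⟨w, hw, rfl⟩
      exact hstab x hxpos w hw
    · rw [Submodule.ne_bot_iff]
      exact ⟨_, ⟨w₀, hw₀, rfl⟩, hxw⟩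
    · rintro _ ⟨y, hy, rfl⟩ _ ⟨w, hw, rfl⟩
      rw [← evenProj_add_oddProj y, map_add, LinearMap.add_apply,
        hcomm 0 _ (R.posPart_graded.evenProj_mem hy) (evenProj_mem y) w hw,
        hcomm 1 _ (R.posPart_graded.oddProj_mem hy) (oddProj_mem y) w hw]
      exact Submodule.add_mem _
        (Submodule.smul_mem _ _ ⟨_, hstab _ (R.posPart_graded.evenProj_mem hy) w hw, rfl⟩)
        (Submodule.smul_mem _ _ ⟨_, hstab _ (R.posPart_graded.oddProj_mem hy) w hw, rfl⟩)
  obtain ⟨h, hh, hah⟩ : ∃ h ∈ G 0, B.form (a : g) h ≠ 0 := by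
    by_contra! hall
    have ha : (a : g) = 0 := R.eq_zero_of_form_eq_zero a.2 hall
    have hxa := hx.2
    rw [ha] at hxa
    exact hx0 (R.eq_zero_of_mem_posPart hxpos fun y hy => R.form_zero_negPart (R.mem_zero_of_form hxa) hy)
  have hnil : ∃ n, (ρ x : Module.End ℂ M) ^ n = 0 := by
    refine exists_pow_eq_zero_of_commutator (h := (B.form (a : g) h)⁻¹ • ρ h) ?_
    refine LinearMap.ext fun m => ?_
    have h5 := hρ (R.even hh) hx.1.2 m
    rw [hx.2 h hh, koszul_zero_left, one_smul, map_smul, LinearMap.smul_apply] at h5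
    have h6 : (B.form (a : g) h)⁻¹ • (B.form (a : g) h • ρ x m) = ρ x m := by
      rw [smul_smul, inv_mul_cancel₀ hah, one_smul]
    rw [h5] at h6
    rw [LinearMap.sub_apply, Module.End.mul_apply, Module.End.mul_apply, LinearMap.smul_apply,
      LinearMap.smul_apply, map_smul, ← smul_sub]
    exact h6
  obtain ⟨n, hn⟩ := hnil
  have h5 : ∀ k : ℕ, W.map ((ρ x : Module.End ℂ M) ^ k) = W := by
    intro k
    induction k with
    | zero => rw [pow_zero]; exact Submodule.map_id W
    | succ k ih => rw [pow_succ, Module.End.mul_eq_comp, Submodule.map_comp, hW, ih]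
  have h6 := h5 n
  rw [hn, Submodule.map_zero] at h6
  exact h2 h6.symm

/-- The submodule generated by a vector under `𝔫⁻`. -/
def lowerSpan {M : Type*} [AddCommGroup M] [Module ℂ M] (G : ℝ → Submodule ℂ g) (ρ : g →ₗ[ℂ] M →ₗ[ℂ] M) (m : M) :
    Submodule ℂ M := sInf {W | m ∈ W ∧ ∀ x ∈ negPart G, ∀ w ∈ W, ρ x w ∈ W}

/-- The subspace `𝔫⁻ M`. -/
def lowerImage {M : Type*} [AddCommGroup M] [Module ℂ M] (G : ℝ → Submodule ℂ g) (ρ : g →ₗ[ℂ] M →ₗ[ℂ] M) :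
    Submodule ℂ M := Submodule.span ℂ {m | ∃ x ∈ negPart G, ∃ w, ρ x w = m}

section

variable {M : Type*} [AddCommGroup M] [Module ℂ M] {ρ : g →ₗ[ℂ] M →ₗ[ℂ] M} {m : M}

theorem lowerSpan_le {W : Submodule ℂ M} (h1 : m ∈ W) (h2 : ∀ x ∈ negPart G, ∀ w ∈ W, ρ x w ∈ W) :
    lowerSpan G ρ m ≤ W := sInf_le ⟨h1, h2⟩

theorem mem_lowerSpan : m ∈ lowerSpan G ρ m := (Submodule.mem_sInf).mpr fun _ hW => hW.1

theorem act_mem_lowerSpan {x : g} (hx : x ∈ negPart G) {w : M} (hw : w ∈ lowerSpan G ρ m) :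
    ρ x w ∈ lowerSpan G ρ m :=
  (Submodule.mem_sInf).mpr fun W hW => hW.2 x hx w ((Submodule.mem_sInf).mp hw W hW)

theorem lowerSpan_le_sup : lowerSpan G ρ m ≤ Submodule.span ℂ {m} ⊔ lowerImage G ρ :=
  lowerSpan_le (Submodule.mem_sup_left (Submodule.mem_span_singleton_self m)) fun x hx w _ =>
    Submodule.mem_sup_right (Submodule.subset_span ⟨x, hx, w, rfl⟩)

/-- For a highest weight vector, 𝔫⁻ alone generates the whole submodule: any z is commuted past
elements of 𝔫⁻ until it reaches m. -/
theorem RootGrading.lowerSpan_stable (R : RootGrading B G) (hρ : IsRep ρ) (hpos : ∀ x ∈ posPart G, ρ x m = 0)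
    (hzero : ∀ h ∈ G 0, ρ h m ∈ Submodule.span ℂ {m}) (z : g) {w : M} (hw : w ∈ lowerSpan G ρ m) :
    ρ z w ∈ lowerSpan G ρ m := by
  let W : Submodule ℂ M := lowerSpan G ρ m ⊓ ⨅ z : g, (lowerSpan G ρ m).comap (ρ z)
  have hW : ∀ w, w ∈ W ↔ w ∈ lowerSpan G ρ m ∧ ∀ z, ρ z w ∈ lowerSpan G ρ m := fun w => by
    simp only [W, Submodule.mem_inf, Submodule.mem_iInf, Submodule.mem_comap]
  refine ((hW w).mp (lowerSpan_le (W := W) ((hW m).mpr ⟨mem_lowerSpan, fun z => ?_⟩) (fun x hx w hw =>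
    (hW _).mpr ⟨act_mem_lowerSpan hx ((hW w).mp hw).1, fun z => ?_⟩) hw)).2 z
  · have h1 : z ∈ posPart G ⊔ G 0 ⊔ negPart G := by rw [R.posPart_sup]; trivial
    obtain ⟨u, hu, c, hc, rfl⟩ := Submodule.mem_sup.mp h1
    obtain ⟨a, ha, b, hb, rfl⟩ := Submodule.mem_sup.mp hu
    rw [map_add, map_add, LinearMap.add_apply, LinearMap.add_apply, hpos a ha, zero_add]
    exact Submodule.add_mem _ ((Submodule.span_singleton_le_iff_mem _ _).mpr mem_lowerSpan (hzero b hb))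
      (act_mem_lowerSpan hc mem_lowerSpan)
  · have hw' := ((hW w).mp hw).2
    have key : ∀ i j (z x : g), z ∈ part i → x ∈ part j → x ∈ negPart G → ρ z (ρ x w) ∈ lowerSpan G ρ m := by
      intro i j z x hz hxj hx
      have h1 := hρ hz hxj w
      rw [eq_sub_iff_add_eq] at h1
      rw [← h1]
      exact Submodule.add_mem _ (hw' _) (Submodule.smul_mem _ _ (act_mem_lowerSpan hx (hw' z)))
    have hgr := R.negPart_graded
    rw [← evenProj_add_oddProj z, ← evenProj_add_oddProj x]
    simp only [map_add, LinearMap.add_apply]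
    exact Submodule.add_mem _
      (Submodule.add_mem _ (key 0 0 _ _ (evenProj_mem z) (evenProj_mem x) (hgr.evenProj_mem hx))
        (key 1 0 _ _ (oddProj_mem z) (evenProj_mem x) (hgr.evenProj_mem hx)))
      (Submodule.add_mem _ (key 0 1 _ _ (evenProj_mem z) (oddProj_mem x) (hgr.oddProj_mem hx))
        (key 1 1 _ _ (oddProj_mem z) (oddProj_mem x) (hgr.oddProj_mem hx)))

end
end Contravariant

/-! ### The contravariant form on an irreducible module -/

section ContravariantForm

variable {g : Type*} [AddCommGroup g] [Module ℂ g] [LieSuperalgebra g] {B : KillingForm g}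
  {G : ℝ → Submodule ℂ g} {P : Parabolic B} {τ : g →ₗ[ℂ] g}

namespace Parabolic.IsTransposition

variable (hτ : P.IsTransposition G τ)

include hτ

theorem injective : Function.Injective τ := by
  rw [← LinearMap.ker_eq_bot, LinearMap.ker_eq_bot']
  intro x hx
  refine B.nondegenerate x fun y => ?_
  rw [← hτ.form_apply y x, hx, map_zero]

theorem map_eq [FiniteDimensional ℂ g] {U U' : Submodule ℂ g} (h : ∀ x ∈ U, τ x ∈ U') (h' : ∀ x ∈ U', τ x ∈ U) :
    U.map τ = U' := by
  have h1 : ∀ W : Submodule ℂ g, Module.finrank ℂ (W.map τ) = Module.finrank ℂ W := fun W =>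
    (LinearEquiv.finrank_eq (Submodule.equivMapOfInjective τ hτ.injective W)).symm
  have h2 : U.map τ ≤ U' := by rintro _ ⟨x, hx, rfl⟩; exact h x hx
  have h3 : U'.map τ ≤ U := by rintro _ ⟨x, hx, rfl⟩; exact h' x hx
  refine Submodule.eq_of_le_of_finrank_le h2 ?_
  rw [h1, ← h1 U']
  exact Submodule.finrank_mono h3

theorem apply_parityInv (x : g) : τ (parityInv g x) = parityInv g (τ x) := by
  rw [← evenProj_add_oddProj x]
  simp only [map_add, parityInv_of_mem (evenProj_mem x), parityInv_of_mem (oddProj_mem x),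
    parityInv_of_mem (hτ.mem_part (evenProj_mem x)), parityInv_of_mem (hτ.mem_part (oddProj_mem x)), map_smul]

end Parabolic.IsTransposition

variable {V : Type*} [AddCommGroup V] [Module ℂ V] [SuperSpace V] [LieSupermodule g V]

/-- The action on the dual space by means of a transposition. -/
def dualAct (τ : g →ₗ[ℂ] g) (V : Type*) [AddCommGroup V] [Module ℂ V] [SuperSpace V] [LieSupermodule g V] :
    g →ₗ[ℂ] Module.Dual ℂ V →ₗ[ℂ] Module.Dual ℂ V :=
  Module.Dual.transpose (R := ℂ) ∘ₗ act ∘ₗ τ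

theorem dualAct_apply (x : g) (φ : Module.Dual ℂ V) (u : V) : dualAct τ V x φ u = φ (act (τ x) u) := rfl

theorem isRep_act : IsRep (act (g := g) (V := V)) := fun hx hy v => LieSupermodule.act_bracket hx hy v

/-- Dualizing reverses products and τ reverses them back, with the same sign because τ preserves
parity. -/
theorem Parabolic.IsTransposition.isRep_dualAct (hτ : P.IsTransposition G τ) : IsRep (dualAct τ V) := by
  intro i j x y hx hy φ
  ext u
  rw [LinearMap.sub_apply, LinearMap.smul_apply]
  simp only [dualAct_apply]
  rw [hτ.apply_bracket, LieSupermodule.act_bracket (hτ.mem_part hy) (hτ.mem_part hx), map_sub, map_smul, koszul_comm]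

/-- The direct sum of two representations. -/
def prodAct {M N : Type*} [AddCommGroup M] [Module ℂ M] [AddCommGroup N] [Module ℂ N] (ρ : g →ₗ[ℂ] M →ₗ[ℂ] M)
    (σ : g →ₗ[ℂ] N →ₗ[ℂ] N) : g →ₗ[ℂ] M × N →ₗ[ℂ] M × N where
  toFun x := (ρ x).prodMap (σ x)
  map_add' x y := by ext <;> simp
  map_smul' c x := by ext <;> simp

theorem prodAct_apply {M N : Type*} [AddCommGroup M] [Module ℂ M] [AddCommGroup N] [Module ℂ N]
    (ρ : g →ₗ[ℂ] M →ₗ[ℂ] M) (σ : g →ₗ[ℂ] N →ₗ[ℂ] N) (x : g) (m : M × N) :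
    prodAct ρ σ x m = (ρ x m.1, σ x m.2) := rfl

theorem IsRep.prod {M N : Type*} [AddCommGroup M] [Module ℂ M] [AddCommGroup N] [Module ℂ N]
    {ρ : g →ₗ[ℂ] M →ₗ[ℂ] M} {σ : g →ₗ[ℂ] N →ₗ[ℂ] N} (hρ : IsRep ρ) (hσ : IsRep σ) : IsRep (prodAct ρ σ) :=
  fun hx hy m => Prod.ext (hρ hx hy m.1) (hσ hx hy m.2)

/-- A homogeneous highest weight vector. -/
theorem RootGrading.exists_highest [FiniteDimensional ℂ V] [Nontrivial V] (R : RootGrading B G) :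
    ∃ v : V, v ≠ 0 ∧ (∃ i, v ∈ part i) ∧ (∀ x ∈ posPart G, act x v = 0) ∧ ∀ h ∈ G 0, ∃ c : ℂ, act h v = c • v := by
  let K : Submodule ℂ V := ⨅ x : posPart G, LinearMap.ker (act (x : g))
  have hK : ∀ v, v ∈ K ↔ ∀ x ∈ posPart G, act x v = 0 := fun v => by simp [K]
  obtain ⟨u, hu, hu0⟩ := R.exists_killed_by_posPart (isRep_act (g := g) (V := V))
  have hgr : IsGraded K := isGraded_of_parityInv_mem fun v hv => (hK _).mpr fun x hx => by
    have h1 := parityInv_act (V := V) (parityInv g x) v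
    rw [(hK v).mp hv _ (R.posPart_graded.parityInv_mem hx), map_zero] at h1
    have h2 : parityInv g (parityInv g x) = x := parityTwist_parityTwist 1 x
    rw [h2] at h1
    exact h1.symm
  obtain ⟨i, w, hw, hw0⟩ : ∃ i, ∃ w ∈ K ⊓ part i, w ≠ 0 := by
    by_contra! hall
    have huK := (hK u).mpr hu0
    refine hu ?_
    rw [← evenProj_add_oddProj u, hall 0 _ ⟨hgr.evenProj_mem huK, evenProj_mem u⟩,
      hall 1 _ ⟨hgr.oddProj_mem huK, oddProj_mem u⟩, add_zero]
  obtain ⟨v, hv, hv0, hvS⟩ := exists_common_eigenvector {T | ∃ h ∈ G 0, act (V := V) h = T} (by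
    rintro _ ⟨h, hh, rfl⟩ _ ⟨k, hk, rfl⟩ m
    have h1 := LieSupermodule.act_bracket (R.even hh) (R.even hk) m
    rw [R.abelian h hh k hk, map_zero, LinearMap.zero_apply, koszul_zero_left, one_smul] at h1
    exact sub_eq_zero.mp h1.symm) (U := K ⊓ part i) ((Submodule.ne_bot_iff _).mpr ⟨w, hw, hw0⟩) (by
    rintro _ ⟨h, hh, rfl⟩ u hu
    refine ⟨(hK _).mpr fun x hx => ?_, by simpa using LieSupermodule.act_mem (R.even hh) hu.2⟩
    have key : ∀ j (x : g), x ∈ posPart G → x ∈ part j → act x (act h u) = 0 := by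
      intro j x hx hxj
      have h1 := LieSupermodule.act_bracket (R.even hh) hxj u
      rw [(hK u).mp hu.1 _ (R.bracket_zero_posPart hh hx), (hK u).mp hu.1 x hx, map_zero, zero_sub,
        koszul_zero_left, one_smul, zero_eq_neg] at h1
      exact h1
    rw [← evenProj_add_oddProj x, map_add, LinearMap.add_apply,
      key 0 _ (R.posPart_graded.evenProj_mem hx) (evenProj_mem x),
      key 1 _ (R.posPart_graded.oddProj_mem hx) (oddProj_mem x), add_zero])
  exact ⟨v, hv0, ⟨i, hv.2⟩, (hK v).mp hv.1, fun h hh => hvS _ ⟨h, hh, rfl⟩⟩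

/-- A nondegenerate bilinear form on an irreducible module for which the transposition is the adjoint. -/
theorem Parabolic.IsTransposition.exists_form [FiniteDimensional ℂ V] (hP : P.Adapted G)
    (hτ : P.IsTransposition G τ) (hV : IsIrreducible g V) :
    ∃ J : V →ₗ[ℂ] Module.Dual ℂ V, (∀ x v u, J (act x v) u = J v (act (τ x) u)) ∧ Function.Injective J := by
  have hfd := hP.finiteDimensional
  have hnt := hV.1
  obtain ⟨v, hv0, ⟨i, hvi⟩, hvpos, hvzero⟩ := hP.toRootGrading.exists_highest (V := V)
  have hπact : ∀ (x : g) (u : V), parityInv V (act x u) = act (parityInv g x) (parityInv V u) := parityInv_act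
  have hππ : ∀ x : g, parityInv g (parityInv g x) = x := parityTwist_parityTwist 1
  -- The submodule generated by v is graded, as v is homogeneous, so it is V by irreducibility.
  -- Hence V is the sum of ℂv and 𝔫⁻V.
  have htop : lowerSpan G (act (g := g) (V := V)) v = ⊤ := by
    refine (hV.2 _ ?_ ?_).resolve_left fun h => hv0 ?_
    · refine isGraded_of_parityInv_mem fun w hw => ?_
      refine lowerSpan_le (W := (lowerSpan G (act (g := g) (V := V)) v).comap (parityInv V)) ?_ ?_ hw
      · rw [Submodule.mem_comap, parityInv_of_mem hvi]
        exact Submodule.smul_mem _ _ mem_lowerSpan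
      · intro x hx w hw
        rw [Submodule.mem_comap, hπact]
        exact act_mem_lowerSpan (hP.negPart_graded.parityInv_mem hx) hw
    · exact fun x w hw => hP.lowerSpan_stable isRep_act hvpos (fun h hh => by
        obtain ⟨c, hc⟩ := hvzero h hh
        rw [hc]
        exact Submodule.smul_mem _ _ (Submodule.mem_span_singleton_self v)) x hw
    · have h1 : v ∈ lowerSpan G (act (g := g) (V := V)) v := mem_lowerSpan
      rwa [h, Submodule.mem_bot] at h1
  have hsup : ∀ u : V, ∃ c : ℂ, ∃ n ∈ lowerImage G (act (g := g) (V := V)), u = c • v + n := fun u => by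
    have h1 := lowerSpan_le_sup (htop ▸ Submodule.mem_top : u ∈ lowerSpan G (act (g := g) (V := V)) v)
    obtain ⟨a, ha, n, hn, rfl⟩ := Submodule.mem_sup.mp h1
    obtain ⟨c, rfl⟩ := Submodule.mem_span_singleton.mp ha
    exact ⟨c, n, hn, rfl⟩
  have hmap := hτ.map_eq hτ.mem_negPart hτ.mem_posPart
  have hsurj : ∀ x, ∃ y, τ y = x := fun x => by
    have h1 := hτ.map_eq (U := ⊤) (U' := ⊤) (fun _ _ => trivial) (fun _ _ => trivial)
    have h2 : x ∈ (⊤ : Submodule ℂ g).map τ := by rw [h1]; trivial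
    obtain ⟨y, -, hy⟩ := h2
    exact ⟨y, hy⟩
  -- A functional killed by 𝔫⁺ under the dual action vanishes on 𝔫⁻V, so it is non-zero at v and can
  -- be normalised.
  obtain ⟨f, hfv, hfn⟩ : ∃ f : Module.Dual ℂ V, f v = 1 ∧ ∀ x ∈ negPart G, ∀ u, f (act x u) = 0 := by
    have hne : Nontrivial (Module.Dual ℂ V) := inferInstance
    obtain ⟨φ, hφ, hφ0⟩ := hP.exists_killed_by_posPart (hτ.isRep_dualAct (V := V))
    have h1 : ∀ x ∈ negPart G, ∀ u, φ (act x u) = 0 := fun x hx u => by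
      rw [← hmap] at hx
      obtain ⟨y, hy, rfl⟩ := hx
      exact LinearMap.congr_fun (hφ0 y hy) u
    have h1' : ∀ n ∈ lowerImage G (act (g := g) (V := V)), φ n = 0 := by
      refine fun n hn => (Submodule.span_le (p := LinearMap.ker φ)).mpr ?_ hn
      rintro _ ⟨x, hx, w, rfl⟩
      exact h1 x hx w
    have h2 : φ v ≠ 0 := fun h2 => hφ (LinearMap.ext fun u => by
      obtain ⟨c, n, hn, rfl⟩ := hsup u
      rw [map_add, map_smul, h2, h1' n hn, smul_zero, add_zero, LinearMap.zero_apply])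
    refine ⟨(φ v)⁻¹ • φ, ?_, fun x hx u => ?_⟩
    · rw [LinearMap.smul_apply, smul_eq_mul, inv_mul_cancel₀ h2]
    · rw [LinearMap.smul_apply, h1 x hx u, smul_zero]
  have hfn' : ∀ n ∈ lowerImage G (act (g := g) (V := V)), f n = 0 := by
    refine fun n hn => (Submodule.span_le (p := LinearMap.ker f)).mpr ?_ hn
    rintro _ ⟨x, hx, w, rfl⟩
    exact hfn x hx w
  let ρ : g →ₗ[ℂ] V × Module.Dual ℂ V →ₗ[ℂ] V × Module.Dual ℂ V := prodAct act (dualAct τ V)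
  have hρ : IsRep ρ := isRep_act.prod hτ.isRep_dualAct
  -- D will be the graph of J. Since (v, f) is a highest weight vector, D is a submodule of V ⊕ V*.
  let D := lowerSpan G ρ (v, f)
  have hfh : ∀ h ∈ G 0, ∀ c : ℂ, act h v = c • v → dualAct τ V h f = c • f := by
    intro h hh c hc
    ext u
    obtain ⟨d, n, hn, rfl⟩ := hsup u
    have hn0 : f (act h n) = 0 := by
      refine (Submodule.span_le (p := LinearMap.ker (f ∘ₗ act h))).mpr ?_ hn
      rintro _ ⟨x, hx, w, rfl⟩
      change f (act h (act x w)) = 0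
      have key : ∀ j (x : g), x ∈ negPart G → x ∈ part j → f (act h (act x w)) = 0 := by
        intro j x hx hxj
        have h1 := congrArg f (LieSupermodule.act_bracket (hP.even hh) hxj w)
        rw [hfn _ (hP.bracket_zero_negPart hh hx), map_sub, map_smul, hfn x hx, smul_zero, sub_zero] at h1
        exact h1.symm
      rw [← evenProj_add_oddProj x, map_add, LinearMap.add_apply, map_add, map_add,
        key 0 _ (hP.negPart_graded.evenProj_mem hx) (evenProj_mem x),
        key 1 _ (hP.negPart_graded.oddProj_mem hx) (oddProj_mem x), add_zero]
    rw [dualAct_apply, hτ.apply_of_mem_zero h hh, map_add, map_add, map_smul, hc, LinearMap.smul_apply, map_add, map_smul,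
      map_smul, map_smul, hn0, hfn' n hn, hfv]
    simp [mul_comm]
  have hDstab : ∀ z, ∀ w ∈ D, ρ z w ∈ D := fun z w hw => hP.lowerSpan_stable (m := (v, f)) hρ
    (fun x hx => Prod.ext (show act x v = 0 from hvpos x hx) (LinearMap.ext fun u =>
      show f (act (τ x) u) = 0 from hfn _ (hτ.mem_negPart x hx) u))
    (fun h hh => by
      obtain ⟨c, hc⟩ := hvzero h hh
      have h1 : ρ h (v, f) = c • (v, f) := Prod.ext hc (hfh h hh c hc)
      rw [h1]
      exact Submodule.smul_mem _ _ (Submodule.mem_span_singleton_self _)) z hw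
  -- V* is given no grading; precomposition with the parity involution replaces it and ensures that
  -- the subspaces of V used below are graded.
  have hpar : ∀ w ∈ D, (parityInv V w.1, w.2 ∘ₗ parityInv V) ∈ D := by
    have hfπ : f ∘ₗ parityInv V = koszul 1 i • f := by
      ext u
      obtain ⟨c, n, hn, rfl⟩ := hsup u
      have h1 : f (parityInv V n) = 0 := by
        refine (Submodule.span_le (p := LinearMap.ker (f ∘ₗ parityInv V))).mpr ?_ hn
        rintro _ ⟨x, hx, w, rfl⟩
        change f (parityInv V (act x w)) = 0
        rw [hπact]
        exact hfn _ (hP.negPart_graded.parityInv_mem hx) _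
      rw [LinearMap.comp_apply, LinearMap.smul_apply, map_add, map_smul, parityInv_of_mem hvi, map_add, h1, map_add,
        hfn' n hn, add_zero, add_zero, map_smul, map_smul, map_smul, smul_comm]
    intro w hw
    refine lowerSpan_le (W := D.comap ((parityInv V).prodMap (Module.Dual.transpose (R := ℂ) (parityInv V))))
      ?_ ?_ hw
    · have h1 : ((parityInv V).prodMap (Module.Dual.transpose (R := ℂ) (parityInv V))) (v, f) =
          koszul 1 i • (v, f) := Prod.ext (parityInv_of_mem hvi) hfπ
      rw [Submodule.mem_comap, h1]
      exact Submodule.smul_mem _ _ mem_lowerSpan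
    · intro x hx w hw
      have h1 : ((parityInv V).prodMap (Module.Dual.transpose (R := ℂ) (parityInv V))) (ρ x w) =
          ρ (parityInv g x) (((parityInv V).prodMap (Module.Dual.transpose (R := ℂ) (parityInv V))) w) := by
        refine Prod.ext (hπact x w.1) (LinearMap.ext fun u => ?_)
        change w.2 (act (τ x) (parityInv V u)) = w.2 (parityInv V (act (τ (parityInv g x)) u))
        rw [hπact, hτ.apply_parityInv, hππ]
      rw [Submodule.mem_comap, h1]
      exact act_mem_lowerSpan (hP.negPart_graded.parityInv_mem hx) hw
  -- Holds at (v, f); on 𝔫⁻ applied to V ⊕ V* both sides vanish.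
  have hD0 : ∀ w ∈ D, f w.1 = w.2 v := by
    intro w hw
    obtain ⟨a, ha, n, hn, rfl⟩ := Submodule.mem_sup.mp (lowerSpan_le_sup hw)
    obtain ⟨c, rfl⟩ := Submodule.mem_span_singleton.mp ha
    have h1 : f n.1 = 0 ∧ n.2 v = 0 := by
      have h2 : lowerImage G ρ ≤ LinearMap.ker (f ∘ₗ LinearMap.fst ℂ _ _) ⊓
          LinearMap.ker (Module.Dual.eval ℂ V v ∘ₗ LinearMap.snd ℂ _ _) := by
        refine Submodule.span_le.mpr ?_
        rintro _ ⟨x, hx, w, rfl⟩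
        refine ⟨hfn x hx w.1, ?_⟩
        change w.2 (act (τ x) v) = 0
        rw [hvpos _ (hτ.mem_posPart x hx), map_zero]
      exact h2 hn
    change f (c • v + n.1) = (c • f + n.2) v
    rw [map_add, map_smul, LinearMap.add_apply, LinearMap.smul_apply, h1.1, h1.2]
  have hπV : ∀ u : V, parityInv V (parityInv V u) = u := parityTwist_parityTwist 1
  have hπ0 : (0 : Module.Dual ℂ V) ∘ₗ parityInv V = 0 := LinearMap.zero_comp _
  -- These u form a graded submodule, which by `hD0` does not contain v. This is the injectivity of
  -- J.
  have hD1 : ∀ u, (u, (0 : Module.Dual ℂ V)) ∈ D → u = 0 := by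
    let D1 : Submodule ℂ V := D.comap (LinearMap.inl ℂ V (Module.Dual ℂ V))
    have h1 : D1 = ⊥ := by
      refine (hV.2 D1 (isGraded_of_parityInv_mem fun u hu => ?_) (fun x u hu => ?_)).resolve_right fun h => ?_
      · have h2 := hpar _ hu
        change (parityInv V u, (0 : Module.Dual ℂ V) ∘ₗ parityInv V) ∈ D at h2
        rwa [hπ0] at h2
      · have h2 := hDstab x _ hu
        rw [prodAct_apply] at h2
        change (act x u, dualAct τ V x 0) ∈ D at h2
        rwa [map_zero] at h2
      · have h2 : v ∈ D1 := h ▸ Submodule.mem_top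
        have h3 := hD0 _ h2
        change f v = 0 at h3
        rw [hfv] at h3
        exact one_ne_zero h3
    intro u hu
    have h2 : u ∈ D1 := hu
    rwa [h1, Submodule.mem_bot] at h2
  -- The common kernel of these φ is a graded submodule and contains v by `hD0`, so it is all of V.
  -- This makes J single-valued.
  have hD2 : ∀ φ, ((0 : V), φ) ∈ D → φ = 0 := by
    let K : Submodule ℂ V := ⨅ φ : {φ : Module.Dual ℂ V // ((0 : V), φ) ∈ D}, LinearMap.ker (φ : Module.Dual ℂ V)
    have hK : ∀ u, u ∈ K ↔ ∀ φ, ((0 : V), φ) ∈ D → φ u = 0 := fun u => by simp [K]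
    have h1 : K = ⊤ := by
      refine (hV.2 K (isGraded_of_parityInv_mem fun u hu => (hK _).mpr fun φ hφ => ?_)
        (fun x u hu => (hK _).mpr fun φ hφ => ?_)).resolve_left fun h => ?_
      · have h2 := hpar _ hφ
        change (parityInv V 0, φ ∘ₗ parityInv V) ∈ D at h2
        rw [map_zero] at h2
        exact (hK u).mp hu _ h2
      · obtain ⟨y, rfl⟩ := hsurj x
        have h2 := hDstab y _ hφ
        rw [prodAct_apply] at h2
        change (act y 0, dualAct τ V y φ) ∈ D at h2
        rw [map_zero] at h2
        exact (hK u).mp hu _ h2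
      · have h2 : v ∈ K := (hK v).mpr fun φ hφ => by
          have h3 := hD0 _ hφ
          change f 0 = φ v at h3
          rw [← h3, map_zero]
        rw [h, Submodule.mem_bot] at h2
        exact hv0 h2
    intro φ hφ
    ext u
    exact (hK u).mp (h1 ▸ Submodule.mem_top) φ hφ
  have hD3 : ∀ u, ∃ φ, (u, φ) ∈ D := by
    let D3 : Submodule ℂ V := D.map (LinearMap.fst ℂ V (Module.Dual ℂ V))
    have h1 : D3 = ⊤ := by
      rw [eq_top_iff, ← htop]
      refine lowerSpan_le ⟨(v, f), mem_lowerSpan, rfl⟩ ?_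
      rintro x hx _ ⟨w, hw, rfl⟩
      exact ⟨ρ x w, act_mem_lowerSpan hx hw, rfl⟩
    intro u
    obtain ⟨w, hw, rfl⟩ := (h1 ▸ Submodule.mem_top : u ∈ D3)
    exact ⟨w.2, hw⟩
  choose J' hJ' using hD3
  have huniq : ∀ {u φ}, (u, φ) ∈ D → J' u = φ := fun {u φ} h => by
    rw [← sub_eq_zero]
    refine hD2 _ ?_
    have h1 := Submodule.sub_mem _ (hJ' u) h
    rwa [Prod.mk_sub_mk, sub_self] at h1
  let J : V →ₗ[ℂ] Module.Dual ℂ V :=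
    { toFun := J'
      map_add' := fun x y => huniq (Submodule.add_mem _ (hJ' x) (hJ' y))
      map_smul' := fun c x => huniq (Submodule.smul_mem _ c (hJ' x)) }
  refine ⟨J, fun x u w => ?_, ?_⟩
  · have h1 : J (act x u) = dualAct τ V x (J u) := huniq (hDstab x _ (hJ' u))
    rw [h1]
    rfl
  · rw [← LinearMap.ker_eq_bot, LinearMap.ker_eq_bot']
    intro u hu
    refine hD1 u ?_
    have h1 := hJ' u
    rwa [show J' u = 0 from hu] at h1

end ContravariantForm

/-! ### Contractions and the Euler operator on chains -/

namespace Parabolic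

variable {g : Type*} [AddCommGroup g] [Module ℂ g] [LieSuperalgebra g] {B : KillingForm g}
  {G : ℝ → Submodule ℂ g} {P : Parabolic B} {V : Type*} [AddCommGroup V] [Module ℂ V]

theorem chains_mem (W : Submodule ℂ (P.C V)) (h1 : ∀ v, tens P.nPart V 1 v ∈ W)
    (h2 : ∀ i, ∀ X ∈ P.nPart i, ∀ f ∈ W, P.w V X f ∈ W) (f : P.C V) : f ∈ W := by
  have h3 : ∀ X : P.n, ∀ f ∈ W, P.w V X f ∈ W := by
    intro X f hf
    have hgr : IsGraded P.n := perp_isGraded P.p_sub.graded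
    have hX : X = ⟨_, hgr.evenProj_mem X.2⟩ + ⟨_, hgr.oddProj_mem X.2⟩ :=
      Subtype.ext (evenProj_add_oddProj (X : g)).symm
    rw [hX, map_add, LinearMap.add_apply]
    exact Submodule.add_mem _ (h2 0 _ (evenProj_mem (X : g)) f hf) (h2 1 _ (oddProj_mem (X : g)) f hf)
  have h4 : ∀ t : TensorAlgebra ℂ P.n, ∀ f ∈ W, leftMul P.nPart V (extMk P.nPart t) f ∈ W := by
    intro t
    induction t using TensorAlgebra.induction with
    | algebraMap c =>
      intro f hf
      rw [AlgHom.commutes, AlgHom.commutes, Algebra.algebraMap_eq_smul_one, LinearMap.smul_apply]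
      exact Submodule.smul_mem _ _ hf
    | ι X => exact h3 X
    | mul a b ha hb =>
      intro f hf
      rw [map_mul, map_mul]
      exact ha _ (hb f hf)
    | add a b ha hb =>
      intro f hf
      rw [map_add, map_add]
      exact Submodule.add_mem _ (ha f hf) (hb f hf)
  refine chains_induction (motive := fun f => f ∈ W) (fun a v => ?_) (fun f f' hf hf' => Submodule.add_mem _ hf hf') f
  obtain ⟨t, rfl⟩ := RingQuot.mkAlgHom_surjective ℂ (ExteriorRel P.nPart) a
  have h5 := h4 t _ (h1 v)
  rw [leftMul_tmul, mul_one] at h5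
  exact h5

theorem chains_ext {E : Type*} [AddCommGroup E] [Module ℂ E] {F F' : P.C V →ₗ[ℂ] E}
    (h1 : ∀ v, F (tens P.nPart V 1 v) = F' (tens P.nPart V 1 v))
    (h2 : ∀ i, ∀ X ∈ P.nPart i, ∀ f, F f = F' f → F (P.w V X f) = F' (P.w V X f)) : F = F' :=
  LinearMap.ext fun f => chains_mem (LinearMap.eqLocus F F') h1 h2 f

theorem projN_of_mem {x : g} (hx : x ∈ P.n) : P.projN x = ⟨x, hx⟩ := P.projN_coe ⟨x, hx⟩

theorem form_projN {Y : g} (hY : Y ∈ P.nbar) (x : g) : B.form Y (P.projN x : g) = B.form Y x := by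
  have h1 : x ∈ perp B P.p ⊔ P.pOpp := by rw [P.isCompl_n.sup_eq_top]; trivial
  obtain ⟨a, ha, b, hb, rfl⟩ := Submodule.mem_sup.mp h1
  have h2 : P.projN b = 0 := Submodule.projectionOnto_apply_of_mem_right P.isCompl_n hb
  rw [map_add, h2, projN_of_mem ha, add_zero, map_add, hY b hb, add_zero]

/-! ### Contractions -/

variable (P V) in
/-- The inhomogeneous term `(A, X) f` of the contraction of `X ∧ f` by `A`. -/
def contractionΦ : P.n →ₗ[ℂ] P.C V →ₗ[ℂ] g →ₗ[ℂ] P.C V :=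
  LinearMap.mk₂ ℂ (fun X f => (B.form.flip (X : g)).smulRight f)
    (fun X Y f => by ext A; simp [add_smul])
    (fun t X f => by ext A; simp [mul_smul])
    (fun X f f' => by ext A; simp)
    (fun t X f => by ext A; simp [smul_comm t])

theorem contractionΦ_apply (X : P.n) (f : P.C V) (A : g) :
    P.contractionΦ V X f A = B.form A (X : g) • f := rfl

/-- The signs match because (A, x) vanishes unless A and x have the same parity. -/
theorem contraction_compatible : RecCompatible (P.contractionΦ V) (-(P.actionS V)) where
  fst {i j x y} hx hy f := by
    refine ext_homogeneous fun a A hA => ?_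
    simp only [LinearMap.add_apply, LinearMap.smul_apply, LinearMap.neg_apply, contractionΦ_apply,
      P.actionS_apply hx _ hA, P.actionS_apply hy _ hA, LinearMap.zero_apply, map_smul]
    have h1 : B.form A (x : g) * (1 - koszul i j * koszul a j) = 0 := by
      by_cases h : a = i
      · rw [h, koszul_mul_self, sub_self, mul_zero]
      · rw [B.apply_eq_zero_of_ne (y := (x : g)) h hA hx, zero_mul]
    have h2 : B.form A (y : g) * (koszul i j - koszul a i) = 0 := by
      by_cases h : a = j
      · rw [h, koszul_comm, sub_self, mul_zero]
      · rw [B.apply_eq_zero_of_ne (y := (y : g)) h hA hy, zero_mul]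
    linear_combination (norm := module) h1 • P.w V y f + h2 • P.w V x f
  snd {i j x y} hx hy φ := by
    refine ext_homogeneous fun a A hA => ?_
    simp only [LinearMap.add_apply, LinearMap.smul_apply, LinearMap.neg_apply, map_neg, neg_neg,
      P.actionS_apply hx _ hA, P.actionS_apply hy _ hA, LinearMap.zero_apply, map_smul]
    have h1 := wedge_skew (V := V) hx hy (φ A)
    linear_combination (norm := module) (koszul a i * koszul a j) • h1

variable (P V) in
/-- The contraction by an element of `g`, determined by `ι_A v = 0` and
`ι_A (X ∧ f) = (A, X) f - (-1)^{|A||X|} X ∧ ι_A f`. -/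
def contraction : g →ₗ[ℂ] P.C V →ₗ[ℂ] P.C V :=
  (recMap (P.contractionΦ V) (-(P.actionS V)) P.contraction_compatible 0).flip

theorem contraction_one (A : g) (v : V) : P.contraction V A (tens P.nPart V 1 v) = 0 := by
  unfold contraction
  rw [LinearMap.flip_apply, recMap_one]
  rfl

theorem contraction_wedge {i j : ZMod 2} {A : g} {X : P.n} (hA : A ∈ part i) (hX : X ∈ P.nPart j)
    (f : P.C V) : P.contraction V A (P.w V X f) =
      B.form A (X : g) • f - koszul i j • P.w V X (P.contraction V A f) := by
  unfold contraction
  rw [LinearMap.flip_apply, recMap_wedge, sub_eq_add_neg, LinearMap.flip_apply, ← P.actionS_apply hX _ hA]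
  rfl

theorem contraction_skew {i j : ZMod 2} {A A' : g} (hA : A ∈ part i) (hA' : A' ∈ part j) (f : P.C V) :
    P.contraction V A (P.contraction V A' f) + koszul i j • P.contraction V A' (P.contraction V A f) = 0 := by
  have key : P.contraction V A ∘ₗ P.contraction V A' + koszul i j • P.contraction V A' ∘ₗ P.contraction V A = 0 := by
    refine chains_ext (fun v => ?_) (fun l X hX f ih => ?_)
    · simp [contraction_one]
    · simp only [LinearMap.add_apply, LinearMap.smul_apply, LinearMap.comp_apply, LinearMap.zero_apply] at ih ⊢
      simp only [contraction_wedge hA hX, contraction_wedge hA' hX, map_sub, map_smul]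
      have h1 : B.form A' (X : g) * (1 - koszul i j * koszul i l) = 0 := by
        by_cases h : j = l
        · rw [h, koszul_mul_self, sub_self, mul_zero]
        · rw [B.apply_eq_zero_of_ne (y := (X : g)) h hA' hX, zero_mul]
      have h2 : B.form A (X : g) * (koszul i j - koszul j l) = 0 := by
        by_cases h : i = l
        · rw [h, koszul_comm, sub_self, mul_zero]
        · rw [B.apply_eq_zero_of_ne (y := (X : g)) h hA hX, zero_mul]
      have h3 := congrArg (P.w V X) ih
      rw [map_add, map_smul, map_zero] at h3
      linear_combination (norm := module) h1 • P.contraction V A f + h2 • P.contraction V A' f +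
        (koszul j l * koszul i l) • h3
  exact LinearMap.congr_fun key f

variable {r : ℕ} (ξ : DualBases P r)

theorem sum_form_ξd {A : g} (hA : A ∈ P.nbar) : ∑ a, B.form A (ξ.ξ a : g) • (ξ.ξd a : g) = A := by
  have h1 := congrArg Subtype.val (ξ.ξd.sum_repr ⟨A, hA⟩)
  rw [Submodule.coe_sum] at h1
  have h2 : ∀ a, B.form A (ξ.ξ a : g) = ξ.ξd.repr ⟨A, hA⟩ a := fun a => by
    have h3 := congrArg (fun z => B.form z (ξ.ξ a : g)) h1
    simp only [map_sum, LinearMap.sum_apply, Submodule.coe_smul, map_smul, LinearMap.smul_apply, ξ.dual,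
      smul_eq_mul, mul_ite, mul_one, mul_zero, Finset.sum_ite_eq', Finset.mem_univ, if_true] at h3
    exact h3.symm
  simp only [h2]
  exact h1

theorem sum_form_ξ (X : P.n) : ∑ a, B.form (ξ.ξd a : g) (X : g) • ξ.ξ a = X := by
  have h1 := ξ.ξ.sum_repr X
  have h2 : ∀ a, B.form (ξ.ξd a : g) (X : g) = ξ.ξ.repr X a := fun a => by
    have h3 := congrArg (fun z : P.n => B.form (ξ.ξd a : g) (z : g)) h1
    simp only [Submodule.coe_sum, map_sum, Submodule.coe_smul, map_smul, ξ.dual,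
      smul_eq_mul, mul_ite, mul_one, mul_zero, Finset.sum_ite_eq, Finset.mem_univ, if_true] at h3
    exact h3.symm
  simp only [h2]
  exact h1

/-- The operator `∑ ξ_a ∧ ι_{ξ_a‡}`, which is multiplication by the degree. -/
def euler (V : Type*) [AddCommGroup V] [Module ℂ V] : P.C V →ₗ[ℂ] P.C V :=
  ∑ a, P.w V (ξ.ξ a) ∘ₗ P.contraction V (ξ.ξd a : g)

/-- The contractions reproduce X from its coordinates in the basis ξ_a; in the other terms two
exchange signs cancel. -/
theorem euler_wedge (X : P.n) (f : P.C V) : euler ξ V (P.w V X f) = P.w V X f + P.w V X (euler ξ V f) := by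
  have key : ∀ j, ∀ X ∈ P.nPart j, euler ξ V (P.w V X f) = P.w V X f + P.w V X (euler ξ V f) := by
    intro j X hX
    simp only [euler, LinearMap.sum_apply, LinearMap.comp_apply, map_sum]
    have h1 : ∀ a, P.w V (ξ.ξ a) (P.contraction V (ξ.ξd a : g) (P.w V X f)) =
        P.w V (B.form (ξ.ξd a : g) (X : g) • ξ.ξ a) f +
          P.w V X (P.w V (ξ.ξ a) (P.contraction V (ξ.ξd a : g) f)) := fun a => by
      rw [contraction_wedge (ξ.ξd_mem a) hX, map_sub, map_smul, map_smul, map_smul, LinearMap.smul_apply]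
      have h2 := wedge_skew (D := P.nPart) (V := V) (x := X) (y := ξ.ξ a) hX (ξ.ξ_mem a)
        (P.contraction V (ξ.ξd a : g) f)
      rw [koszul_comm] at h2
      linear_combination (norm := module) -h2
    simp only [h1, Finset.sum_add_distrib]
    rw [← LinearMap.sum_apply, ← map_sum, sum_form_ξ]
  have hgr : IsGraded P.n := perp_isGraded P.p_sub.graded
  have hX : X = ⟨_, hgr.evenProj_mem X.2⟩ + ⟨_, hgr.oddProj_mem X.2⟩ :=
    Subtype.ext (evenProj_add_oddProj (X : g)).symm
  rw [hX, map_add, LinearMap.add_apply, map_add, key 0 _ (evenProj_mem (X : g)), key 1 _ (oddProj_mem (X : g)),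
    LinearMap.add_apply]
  abel

theorem euler_of_mem_deg {k : ℕ} {f : P.C V} (hf : f ∈ P.deg V k) : euler ξ V f = (k : ℂ) • f := by
  have key : ∀ k : ℕ, chainDeg P.nPart V k ≤ LinearMap.ker (euler ξ V - (k : ℂ) • LinearMap.id) := by
    intro k
    induction k with
    | zero =>
      refine Submodule.span_le.mpr ?_
      rintro _ ⟨v, rfl⟩
      simp [euler, contraction_one]
    | succ k ih =>
      refine Submodule.span_le.mpr ?_
      rintro _ ⟨X, f, hf, rfl⟩
      have h1 : euler ξ V f - (k : ℂ) • f = 0 := ih hf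
      change euler ξ V (P.w V X f) - ((k + 1 : ℕ) : ℂ) • P.w V X f = 0
      rw [euler_wedge, sub_eq_zero.mp h1, map_smul]
      push_cast
      module
  exact sub_eq_zero.mp (key k hf)

theorem iSup_deg : ⨆ k, P.deg V k = ⊤ := by
  rw [eq_top_iff]
  intro f _
  refine chains_mem (⨆ k, P.deg V k) (fun v => ?_) (fun i X _ f hf => ?_) f
  · exact (le_iSup (P.deg V) 0) (Submodule.subset_span ⟨v, rfl⟩)
  · refine (iSup_le fun k => ?_ : (⨆ k, P.deg V k) ≤ (⨆ k, P.deg V k).comap (P.w V X)) hf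
    exact fun f hf => (le_iSup (P.deg V) (k + 1)) (Submodule.subset_span ⟨X, f, hf, rfl⟩)

theorem contraction_mem_deg {i : ZMod 2} {A : g} (hA : A ∈ part i) {k : ℕ} {f : P.C V} (hf : f ∈ P.deg V (k + 1)) :
    P.contraction V A f ∈ P.deg V k := by
  have hspan : ∀ (k : ℕ) (W : Submodule ℂ (P.C V)), (∀ i, ∀ X ∈ P.nPart i, ∀ f ∈ P.deg V k, P.w V X f ∈ W) →
      P.deg V (k + 1) ≤ W := fun k W h => by
    refine Submodule.span_le.mpr ?_
    rintro _ ⟨X, f, hf, rfl⟩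
    have hgr : IsGraded P.n := perp_isGraded P.p_sub.graded
    have hX : X = ⟨_, hgr.evenProj_mem X.2⟩ + ⟨_, hgr.oddProj_mem X.2⟩ :=
      Subtype.ext (evenProj_add_oddProj (X : g)).symm
    rw [hX, map_add, LinearMap.add_apply]
    exact Submodule.add_mem _ (h 0 _ (evenProj_mem (X : g)) f hf) (h 1 _ (oddProj_mem (X : g)) f hf)
  have key : ∀ k : ℕ, P.deg V (k + 1) ≤ (P.deg V k).comap (P.contraction V A) := by
    intro k
    induction k with
    | zero =>
      refine hspan 0 _ fun j X hX f hf => ?_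
      have h1 : P.contraction V A f = 0 := by
        refine (Submodule.span_le (p := LinearMap.ker (P.contraction V A))).mpr ?_ hf
        rintro _ ⟨v, rfl⟩
        exact contraction_one A v
      rw [Submodule.mem_comap, contraction_wedge hA hX, h1, map_zero, smul_zero, sub_zero]
      exact Submodule.smul_mem _ _ hf
    | succ k ih =>
      refine hspan (k + 1) _ fun j X hX f hf => ?_
      rw [Submodule.mem_comap, contraction_wedge hA hX]
      exact Submodule.sub_mem _ (Submodule.smul_mem _ _ hf) (Submodule.smul_mem _ _
        (Submodule.subset_span ⟨X, _, ih hf, rfl⟩))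
  exact key k hf

include ξ in
/-- A subspace which is stable under products and contractions vanishes if it does not contain elements of
degree zero. -/
theorem eq_bot_of_stable {L : Submodule ℂ (P.C V)} (h1 : ∀ X : P.n, ∀ f ∈ L, P.w V X f ∈ L)
    (h2 : ∀ A ∈ P.nbar, ∀ f ∈ L, P.contraction V A f ∈ L) (h3 : ∀ v, tens P.nPart V 1 v ∈ L → v = 0) :
    L = ⊥ := by
  have key : ∀ k : ℕ, ∀ f ∈ L ⊓ P.deg V k, f = 0 := by
    intro k
    induction k with
    | zero =>
      rintro f ⟨hf, hf'⟩
      have h4 : ∃ v, f = tens P.nPart V 1 v := by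
        refine Submodule.span_induction (p := fun f _ => ∃ v, f = tens P.nPart V 1 v) ?_ ⟨0, by simp⟩ ?_ ?_ hf'
        · rintro _ ⟨v, rfl⟩; exact ⟨v, rfl⟩
        · rintro _ _ _ _ ⟨v, rfl⟩ ⟨w, rfl⟩; exact ⟨v + w, by simp⟩
        · rintro c _ _ ⟨v, rfl⟩; exact ⟨c • v, by simp⟩
      obtain ⟨v, rfl⟩ := h4
      rw [h3 v hf, map_zero]
    | succ k ih =>
      rintro f ⟨hf, hf'⟩
      have h4 := euler_of_mem_deg ξ hf'
      have h5 : euler ξ V f = 0 := by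
        simp only [euler, LinearMap.sum_apply, LinearMap.comp_apply]
        refine Finset.sum_eq_zero fun a _ => ?_
        rw [ih _ ⟨h2 _ (ξ.ξd a).2 f hf, contraction_mem_deg (ξ.ξd_mem a) hf'⟩, map_zero]
      rw [h5] at h4
      exact (smul_eq_zero.mp h4.symm).resolve_left (by exact_mod_cast Nat.succ_ne_zero k)
  rw [eq_bot_iff]
  intro f hf
  have h4 := mem_iSup_inf_of_stable (fun _ : Unit => euler ξ V) (fun (k : ℕ) _ => (k : ℂ)) (P.deg V)
    (fun k v hv _ => euler_of_mem_deg ξ hv) (fun k l h => by exact_mod_cast congrFun h ()) iSup_deg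
    (U := L) (fun _ f hf => by
      simp only [euler, LinearMap.sum_apply, LinearMap.comp_apply]
      exact Submodule.sum_mem _ fun a _ => h1 _ _ (h2 _ (ξ.ξd a).2 f hf)) hf
  exact (iSup_le fun k f hf => key k f hf : _ ≤ (⊥ : Submodule ℂ (P.C V))) h4

end Parabolic

/-! ### Commutation relations of the operators on chains -/

namespace Parabolic

variable {g : Type*} [AddCommGroup g] [Module ℂ g] [LieSuperalgebra g] {B : KillingForm g}
  {G : ℝ → Submodule ℂ g} {P : Parabolic B} {V : Type*} [AddCommGroup V] [Module ℂ V]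
  [SuperSpace V] [LieSupermodule g V]

theorem action_wedge_of_mem {i j : ZMod 2} {A : g} {X : P.n} (hA : A ∈ part i) (hAp : A ∈ P.p) (hX : X ∈ P.nPart j)
    (f : P.C V) : P.action V A (P.w V X f) =
      P.w V ⟨bracket A (X : g), Adapted.bracket_n_right X.2 hAp⟩ f + koszul i j • P.w V X (P.action V A f) := by
  rw [action_wedge P V hA hX, projN_of_mem (Adapted.bracket_n_right X.2 hAp)]

/-- On `p`, the action is a representation. -/
theorem action_bracket {i j : ZMod 2} {A A' : g} (hA : A ∈ part i) (hA' : A' ∈ part j) (hAp : A ∈ P.p)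
    (hAp' : A' ∈ P.p) (f : P.C V) : P.action V (bracket A A') f =
      P.action V A (P.action V A' f) - koszul i j • P.action V A' (P.action V A f) := by
  have key : P.action V (bracket A A') = P.action V A ∘ₗ P.action V A' -
      koszul i j • P.action V A' ∘ₗ P.action V A := by
    refine chains_ext (fun v => ?_) (fun l X hX f ih => ?_)
    · simp only [LinearMap.sub_apply, LinearMap.smul_apply, LinearMap.comp_apply, action_one,
        LieSupermodule.act_bracket hA hA', map_sub, map_smul]
    · simp only [LinearMap.sub_apply, LinearMap.smul_apply, LinearMap.comp_apply] at ih ⊢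
      have hAX : (⟨bracket A (X : g), Adapted.bracket_n_right X.2 hAp⟩ : P.n) ∈ P.nPart (i + l) :=
        LieSuperalgebra.bracket_mem hA hX
      have hAX' : (⟨bracket A' (X : g), Adapted.bracket_n_right X.2 hAp'⟩ : P.n) ∈ P.nPart (j + l) :=
        LieSuperalgebra.bracket_mem hA' hX
      rw [action_wedge_of_mem (LieSuperalgebra.bracket_mem hA hA') (P.p_sub.bracket_mem _ hAp _ hAp') hX,
        action_wedge_of_mem hA hAp hX, action_wedge_of_mem hA' hAp' hX, map_add, map_add, map_smul, map_smul,
        action_wedge_of_mem hA hAp hAX', action_wedge_of_mem hA' hAp' hAX, action_wedge_of_mem hA hAp hX,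
        action_wedge_of_mem hA' hAp' hX, ih]
      have h1 : (⟨bracket (bracket A A') (X : g), Adapted.bracket_n_right X.2
          (P.p_sub.bracket_mem _ hAp _ hAp')⟩ : P.n) =
          ⟨bracket A (bracket A' (X : g)), Adapted.bracket_n_right (Adapted.bracket_n_right X.2 hAp') hAp⟩ -
          koszul i j • ⟨bracket A' (bracket A (X : g)), Adapted.bracket_n_right
            (Adapted.bracket_n_right X.2 hAp) hAp'⟩ := Subtype.ext (by
        have h2 := LieSuperalgebra.bracket_jacobi hA hA' (X : g)
        exact eq_sub_of_add_eq h2.symm)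
      rw [h1, map_sub, map_smul, LinearMap.sub_apply, LinearMap.smul_apply, koszul_add_left, koszul_add_right,
        koszul_add_right, map_sub, map_smul, koszul_comm j i]
      have h3 := koszul_mul_self i j
      linear_combination (norm := module) (koszul j l) • h3 •
        P.w V ⟨bracket A (X : g), Adapted.bracket_n_right X.2 hAp⟩ (P.action V A' f)
  exact LinearMap.congr_fun key f

/-- For A ∈ p the projection to 𝔫 in the action is superfluous, so the action is a representation
and the terms with [A, X] match. -/
theorem boundary_action {i : ZMod 2} {A : g} (hA : A ∈ part i) (hAp : A ∈ P.p) (hn : P.n ≤ P.p) (f : P.C V) :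
    P.boundary V (P.action V A f) = P.action V A (P.boundary V f) := by
  have key : P.boundary V ∘ₗ P.action V A = P.action V A ∘ₗ P.boundary V := by
    refine chains_ext (fun v => ?_) (fun l X hX f ih => ?_)
    · simp only [LinearMap.comp_apply, action_one, boundary_one, map_zero]
    · simp only [LinearMap.comp_apply] at ih ⊢
      rw [action_wedge_of_mem hA hAp hX, map_add, map_smul, boundary_wedge, boundary_wedge, boundary_wedge, ih,
        map_sub, map_neg, action_wedge_of_mem hA hAp hX]
      have h1 := action_bracket (V := V) (A' := (X : g)) hA hX hAp (hn X.2) f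
      change -P.action V (bracket A (X : g)) f - _ + _ = _
      rw [h1]
      module
  exact LinearMap.congr_fun key f

theorem boundary_boundary (hn : P.n ≤ P.p) (f : P.C V) : P.boundary V (P.boundary V f) = 0 := by
  have key : P.boundary V ∘ₗ P.boundary V = 0 := by
    refine chains_ext (fun v => ?_) (fun l X hX f ih => ?_)
    · simp only [LinearMap.comp_apply, boundary_one, map_zero, LinearMap.zero_apply]
    · simp only [LinearMap.comp_apply, LinearMap.zero_apply] at ih ⊢
      rw [boundary_wedge, map_sub, map_neg, boundary_wedge, boundary_action (A := (X : g)) hX (hn X.2) hn, ih, map_zero]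
      abel
  exact LinearMap.congr_fun key f

/-- This holds for all A, although the action need not be a representation: Y ∈ 𝔫⁻ is orthogonal to
p*, so it does not see the projection of [A, X] to 𝔫. -/
theorem contraction_action {i j : ZMod 2} {Y A : g} (hY : Y ∈ part i) (hYn : Y ∈ P.nbar) (hA : A ∈ part j)
    (f : P.C V) : P.contraction V Y (P.action V A f) =
      koszul j i • P.action V A (P.contraction V Y f) + P.contraction V (bracket Y A) f := by
  have key : P.contraction V Y ∘ₗ P.action V A =
      koszul j i • P.action V A ∘ₗ P.contraction V Y + P.contraction V (bracket Y A) := by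
    refine chains_ext (fun v => ?_) (fun l X hX f ih => ?_)
    · simp only [LinearMap.add_apply, LinearMap.smul_apply, LinearMap.comp_apply, action_one, contraction_one,
        map_zero, smul_zero, add_zero]
    · simp only [LinearMap.add_apply, LinearMap.smul_apply, LinearMap.comp_apply] at ih ⊢
      have hAX : P.projN (bracket A (X : g)) ∈ P.nPart (j + l) := P.projN_mem (LieSuperalgebra.bracket_mem hA hX)
      rw [action_wedge P V hA hX, map_add, map_smul, contraction_wedge hY hAX, contraction_wedge hY hX,
        contraction_wedge hY hX, contraction_wedge (LieSuperalgebra.bracket_mem hY hA) hX, map_sub, map_smul, map_smul,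
        action_wedge P V hA hX, form_projN hYn, ih, B.invariant, map_add, map_smul, koszul_add_left, koszul_add_right,
        koszul_comm i j]
      have h1 : B.form Y (X : g) * (koszul j l - koszul j i) = 0 := by
        by_cases h : i = l
        · rw [h, sub_self, mul_zero]
        · rw [B.apply_eq_zero_of_ne (y := (X : g)) h hY hX, zero_mul]
      linear_combination (norm := module) h1 • P.action V A f
  exact LinearMap.congr_fun key f

variable {r : ℕ} (ξ : DualBases P r)

/-- Cartan's formula. In ½ ∑ ξ_a ∧ [ξ_a‡, X]_𝔫 the contraction of the first and of the second factor
each give ½ [A, X]_𝔫, which accounts for the factor ½. -/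
theorem contraction_coboundary {i : ZMod 2} {A : g} (hA : A ∈ part i) (hAn : A ∈ P.nbar) (f : P.C V) :
    P.contraction V A (coboundary V ξ f) + coboundary V ξ (P.contraction V A f) = P.action V A f := by
  have key : P.contraction V A ∘ₗ coboundary V ξ + coboundary V ξ ∘ₗ P.contraction V A = P.action V A := by
    refine chains_ext (fun v => ?_) (fun l X hX f ih => ?_)
    · simp only [LinearMap.add_apply, LinearMap.comp_apply, contraction_one, map_zero, add_zero, coboundary_one,
        map_sum, action_one]
      have h1 : ∀ a, P.contraction V A (P.w V (ξ.ξ a) (tens P.nPart V 1 (act (ξ.ξd a : g) v))) =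
          tens P.nPart V 1 (act (B.form A (ξ.ξ a : g) • (ξ.ξd a : g)) v) := fun a => by
        rw [contraction_wedge hA (ξ.ξ_mem a), contraction_one, map_zero, smul_zero, sub_zero, map_smul,
          LinearMap.smul_apply, map_smul]
      simp only [h1]
      rw [← map_sum, ← LinearMap.sum_apply, ← map_sum, sum_form_ξd ξ hAn]
    · simp only [LinearMap.add_apply, LinearMap.comp_apply] at ih ⊢
      rw [coboundary_wedge, map_sub, map_smul, map_sum, contraction_wedge hA hX, contraction_wedge hA hX, map_sub,
        map_smul, map_smul, coboundary_wedge, action_wedge P V hA hX, ← ih, map_add]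
      have h1 : ∀ a, P.contraction V A (P.w V (ξ.ξ a) (P.w V (P.projN (bracket (ξ.ξd a : g) (X : g))) f)) =
          P.w V (P.projN (bracket (B.form A (ξ.ξ a : g) • (ξ.ξd a : g)) (X : g))) f +
          P.w V (B.form (ξ.ξd a : g) (P.projN (bracket A (X : g)) : g) • ξ.ξ a) f +
          koszul i l • P.w V (ξ.ξ a) (P.w V (P.projN (bracket (ξ.ξd a : g) (X : g))) (P.contraction V A f)) := by
        intro a
        have hY : P.projN (bracket (ξ.ξd a : g) (X : g)) ∈ P.nPart (ξ.deg a + l) :=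
          P.projN_mem (LieSuperalgebra.bracket_mem (ξ.ξd_mem a) hX)
        rw [contraction_wedge hA (ξ.ξ_mem a), contraction_wedge hA hY, form_projN hAn, form_projN (ξ.ξd a).2,
          ← B.invariant, ← B.invariant, LieSuperalgebra.bracket_skew hA (ξ.ξd_mem a), koszul_add_right]
        simp only [map_smul, map_sub, map_neg, LinearMap.smul_apply, LinearMap.neg_apply, smul_eq_mul]
        have h3 := koszul_mul_self i (ξ.deg a)
        linear_combination (norm := module) (koszul i l) • h3 •
          P.w V (ξ.ξ a) (P.w V (P.projN (bracket (ξ.ξd a : g) (X : g))) (P.contraction V A f)) +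
          (B.form (bracket (ξ.ξd a : g) A) (X : g)) • h3 • P.w V (ξ.ξ a) f
      simp only [h1, Finset.sum_add_distrib]
      have h4 : ∑ a, P.w V (P.projN (bracket (B.form A (ξ.ξ a : g) • (ξ.ξd a : g)) (X : g))) f =
          P.w V (P.projN (bracket A (X : g))) f := by
        rw [← LinearMap.sum_apply, ← map_sum, ← map_sum, ← LinearMap.sum_apply, ← map_sum, sum_form_ξd ξ hAn]
      have h5 : ∑ a, P.w V (B.form (ξ.ξd a : g) (P.projN (bracket A (X : g)) : g) • ξ.ξ a) f =
          P.w V (P.projN (bracket A (X : g))) f := by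
        rw [← LinearMap.sum_apply, ← map_sum, sum_form_ξ]
      rw [h4, h5, ← Finset.smul_sum]
      module
  exact LinearMap.congr_fun key f

variable (P V) in
/-- The component of degree zero. -/
def degZero : P.C V →ₗ[ℂ] V :=
  recMap (0 : P.n →ₗ[ℂ] P.C V →ₗ[ℂ] V) 0 ⟨fun _ _ _ => by simp, fun _ _ _ => by simp⟩ LinearMap.id

omit [SuperSpace V] in
theorem degZero_one (v : V) : P.degZero V (tens P.nPart V 1 v) = v := recMap_one _ _ _ _ v

omit [SuperSpace V] in
theorem degZero_wedge (X : P.n) (f : P.C V) : P.degZero V (P.w V X f) = 0 := by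
  unfold degZero
  rw [recMap_wedge]
  simp

theorem degZero_action {i : ZMod 2} {A : g} (hA : A ∈ part i) (f : P.C V) :
    P.degZero V (P.action V A f) = act A (P.degZero V f) := by
  have key : P.degZero V ∘ₗ P.action V A = act A ∘ₗ P.degZero V := by
    refine chains_ext (fun v => ?_) (fun l X hX f _ => ?_)
    · simp only [LinearMap.comp_apply, action_one, degZero_one]
    · simp only [LinearMap.comp_apply, action_wedge P V hA hX, map_add, map_smul, degZero_wedge, map_zero,
        smul_zero, add_zero]
  exact LinearMap.congr_fun key f

theorem degZero_coboundary (f : P.C V) : P.degZero V (coboundary V ξ f) = 0 := by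
  have key : P.degZero V ∘ₗ coboundary V ξ = 0 := by
    refine chains_ext (fun v => ?_) (fun l X hX f _ => ?_)
    · simp only [LinearMap.comp_apply, coboundary_one, map_sum, degZero_wedge, Finset.sum_const_zero,
        LinearMap.zero_apply]
    · simp only [LinearMap.comp_apply, coboundary_wedge, map_sub, map_smul, map_sum, degZero_wedge,
        Finset.sum_const_zero, smul_zero, sub_zero, LinearMap.zero_apply]
  exact LinearMap.congr_fun key f

end Parabolic

/-! ### The bilinear form on chains and adjoint operators -/

namespace Parabolic

variable {g : Type*} [AddCommGroup g] [Module ℂ g] [LieSuperalgebra g] {B : KillingForm g}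
  {G : ℝ → Submodule ℂ g} {P : Parabolic B} {V : Type*} [AddCommGroup V] [Module ℂ V]
  [SuperSpace V] [LieSupermodule g V] {τ : g →ₗ[ℂ] g}

theorem IsTransposition.pairing_compatible (hτ : P.IsTransposition G τ) :
    RecCompatible (0 : P.n →ₗ[ℂ] P.C V →ₗ[ℂ] Module.Dual ℂ (P.C V))
      (Module.Dual.transpose (R := ℂ) ∘ₗ P.contraction V ∘ₗ τ ∘ₗ P.n.subtype) where
  fst hx hy f := by simp
  snd {i j x y} hx hy φ := by
    ext f
    have h1 := congrArg φ (contraction_skew (V := V) (hτ.mem_part (x := (y : g)) hy)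
      (hτ.mem_part (x := (x : g)) hx) f)
    rw [map_add, map_smul, map_zero, koszul_comm] at h1
    exact h1

/-- The bilinear form on chains determined by a transposition and a bilinear form on `V`:
`β(1 ⊗ v, g) = J(v, g₀)` and `β(X ∧ f, g) = β(f, ι_{τ X} g)`. -/
def pairing (hτ : P.IsTransposition G τ) (J : V →ₗ[ℂ] Module.Dual ℂ V) : P.C V →ₗ[ℂ] Module.Dual ℂ (P.C V) :=
  recMap 0 (Module.Dual.transpose (R := ℂ) ∘ₗ P.contraction V ∘ₗ τ ∘ₗ P.n.subtype) hτ.pairing_compatible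
    (Module.Dual.transpose (R := ℂ) (P.degZero V) ∘ₗ J)

variable (hτ : P.IsTransposition G τ) {J : V →ₗ[ℂ] Module.Dual ℂ V}

theorem pairing_one (v : V) (f : P.C V) : pairing hτ J (tens P.nPart V 1 v) f = J v (P.degZero V f) := by
  unfold pairing
  rw [recMap_one]
  rfl

theorem pairing_wedge (X : P.n) (f f' : P.C V) :
    pairing hτ J (P.w V X f) f' = pairing hτ J f (P.contraction V (τ X) f') := by
  unfold pairing
  rw [recMap_wedge]
  simp only [LinearMap.zero_apply, zero_add]
  rfl

theorem pairing_wedge_one (X : P.n) (f : P.C V) (v : V) :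
    pairing hτ J (P.w V X f) (tens P.nPart V 1 v) = 0 := by
  rw [pairing_wedge, contraction_one, map_zero]

theorem pairing_ext {F F' : P.C V →ₗ[ℂ] Module.Dual ℂ (P.C V)}
    (h1 : ∀ v f', F (tens P.nPart V 1 v) f' = F' (tens P.nPart V 1 v) f')
    (h2 : ∀ i, ∀ X ∈ P.nPart i, ∀ f, (∀ f', F f f' = F' f f') → ∀ f', F (P.w V X f) f' = F' (P.w V X f) f')
    (f f' : P.C V) : F f f' = F' f f' := by
  have h : F = F' := chains_ext (fun v => LinearMap.ext (h1 v)) fun i X hX f hf =>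
    LinearMap.ext (h2 i X hX f fun f' => LinearMap.congr_fun hf f')
  rw [h]

/-- The form is defined by making products adjoint to contractions on the left. The converse
adjunction has to be proved, as the form is not known to be symmetric; it reflects B(τx, τy) = B(y,
x). -/
theorem pairing_contraction {i : ZMod 2} {A : g} (hA : A ∈ part i) (hAn : A ∈ P.nbar) (f f' : P.C V) :
    pairing hτ J (P.contraction V A f) f' = pairing hτ J f (P.w V ⟨τ A, hτ.mem_n A hAn⟩ f') := by
  refine pairing_ext (F := pairing hτ J ∘ₗ P.contraction V A)
    (F' := Module.Dual.transpose (R := ℂ) (P.w V ⟨τ A, hτ.mem_n A hAn⟩) ∘ₗ pairing hτ J)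
    (fun v f' => ?_) (fun l X hX f ih f' => ?_) f f'
  · change pairing hτ J (P.contraction V A (tens P.nPart V 1 v)) f' = pairing hτ J (tens P.nPart V 1 v) _
    rw [contraction_one, map_zero, LinearMap.zero_apply, pairing_one, degZero_wedge, map_zero]
  · change ∀ f', pairing hτ J (P.contraction V A f) f' = pairing hτ J f (P.w V ⟨τ A, hτ.mem_n A hAn⟩ f') at ih
    change pairing hτ J (P.contraction V A (P.w V X f)) f' =
      pairing hτ J (P.w V X f) (P.w V ⟨τ A, hτ.mem_n A hAn⟩ f')
    rw [contraction_wedge hA hX, map_sub, map_smul, map_smul, LinearMap.sub_apply, LinearMap.smul_apply,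
      LinearMap.smul_apply, pairing_wedge, pairing_wedge, ih, contraction_wedge (X := ⟨τ A, hτ.mem_n A hAn⟩)
      (hτ.mem_part (x := (X : g)) hX) (hτ.mem_part hA), hτ.form_apply, koszul_comm l i, map_sub, map_smul, map_smul]

section Adjoint

variable (hJ : ∀ x v u, J (act x v) u = J v (act (τ x) u))

include hJ

/-- Induction on f. As [A, X] needs no projection, τ[A, X] = [τX, τA] applies, and
`contraction_action` gives the matching relation on the other side. -/
theorem pairing_action_of_mem_p {i : ZMod 2} {A : g} (hA : A ∈ part i) (hAp : A ∈ P.p) (f f' : P.C V) :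
    pairing hτ J (P.action V A f) f' = pairing hτ J f (P.action V (τ A) f') := by
  refine pairing_ext (F := pairing hτ J ∘ₗ P.action V A)
    (F' := Module.Dual.transpose (R := ℂ) (P.action V (τ A)) ∘ₗ pairing hτ J)
    (fun v f' => ?_) (fun l X hX f ih f' => ?_) f f'
  · change pairing hτ J (P.action V A (tens P.nPart V 1 v)) f' = pairing hτ J (tens P.nPart V 1 v) _
    rw [action_one, pairing_one, pairing_one, degZero_action (hτ.mem_part hA), hJ]
  · change ∀ f', pairing hτ J (P.action V A f) f' = pairing hτ J f (P.action V (τ A) f') at ih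
    change pairing hτ J (P.action V A (P.w V X f)) f' = pairing hτ J (P.w V X f) (P.action V (τ A) f')
    rw [action_wedge_of_mem hA hAp hX, map_add, map_smul, LinearMap.add_apply, LinearMap.smul_apply,
      pairing_wedge, pairing_wedge, pairing_wedge, ih, contraction_action (hτ.mem_part (x := (X : g)) hX)
      (hτ.mem_nbar _ X.2) (hτ.mem_part hA), ← hτ.apply_bracket, map_add, map_smul, add_comm]

/-- Transposing ∂*(X ∧ f) = -X f - X ∧ ∂*f turns the action of X into that of τX ∈ 𝔫⁻ and X ∧ into
the contraction by τX; what results is Cartan's formula. -/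
theorem pairing_boundary (hn : P.n ≤ P.p) {r : ℕ} (ξ : DualBases P r) (f f' : P.C V) :
    pairing hτ J (P.boundary V f) f' = -pairing hτ J f (coboundary V ξ f') := by
  refine pairing_ext (F := pairing hτ J ∘ₗ P.boundary V)
    (F' := -(Module.Dual.transpose (R := ℂ) (coboundary V ξ) ∘ₗ pairing hτ J))
    (fun v f' => ?_) (fun l X hX f ih f' => ?_) f f'
  · change pairing hτ J (P.boundary V (tens P.nPart V 1 v)) f' = -pairing hτ J (tens P.nPart V 1 v) _
    rw [boundary_one, pairing_one, degZero_coboundary]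
    simp
  · change ∀ f', pairing hτ J (P.boundary V f) f' = -pairing hτ J f (coboundary V ξ f') at ih
    change pairing hτ J (P.boundary V (P.w V X f)) f' = -pairing hτ J (P.w V X f) (coboundary V ξ f')
    rw [boundary_wedge, map_sub, map_neg, LinearMap.sub_apply, LinearMap.neg_apply, pairing_wedge, pairing_wedge,
      ih, pairing_action_of_mem_p hτ hJ (A := (X : g)) hX (hn X.2),
      ← contraction_coboundary ξ (hτ.mem_part (x := (X : g)) hX) (hτ.mem_nbar _ X.2), map_add]
    ring

omit hJ in
theorem exists_apply_eq [FiniteDimensional ℂ g] (X : P.n) : ∃ Y, ∃ hY : Y ∈ P.nbar, X = ⟨τ Y, hτ.mem_n Y hY⟩ := by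
  have h1 : (X : g) ∈ P.nbar.map τ := by
    rw [hτ.map_eq hτ.mem_n hτ.mem_nbar]
    exact X.2
  obtain ⟨Y, hY, hYX⟩ := h1
  exact ⟨Y, hY, Subtype.ext hYX.symm⟩

omit hJ in
theorem exists_apply_eq_of_mem_part [FiniteDimensional ℂ g] {i : ZMod 2} {X : P.n} (hX : X ∈ P.nPart i) :
    ∃ Y, ∃ hY : Y ∈ P.nbar, Y ∈ part i ∧ X = ⟨τ Y, hτ.mem_n Y hY⟩ := by
  obtain ⟨Y, hY, rfl⟩ := exists_apply_eq hτ X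
  refine ⟨Y, hY, mem_part_of_parityTwist (hτ.injective ?_), rfl⟩
  have h1 : τ (parityInv g Y) = koszul 1 i • τ Y := by
    rw [hτ.apply_parityInv, parityInv_of_mem (W := g) (x := τ Y) hX]
  rw [map_smul]
  exact h1

/-- Here [A, X] may leave 𝔫 and the induction on f breaks down; but τA lies in p, so the induction
is run on the second argument. -/
theorem pairing_action_of_mem_nbar [FiniteDimensional ℂ g] (hn : P.n ≤ P.p) (hn' : P.nbar ≤ P.pOpp) {i : ZMod 2}
    {A : g} (hA : A ∈ part i) (hAn : A ∈ P.nbar) (f f' : P.C V) :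
    pairing hτ J (P.action V A f) f' = pairing hτ J f (P.action V (τ A) f') := by
  have h0 : ∀ f (u : V), pairing hτ J (P.action V A f) (tens P.nPart V 1 u) =
      pairing hτ J f (P.action V (τ A) (tens P.nPart V 1 u)) := by
    intro f u
    refine LinearMap.congr_fun (chains_ext (F := (pairing hτ J).flip (tens P.nPart V 1 u) ∘ₗ P.action V A)
      (F' := (pairing hτ J).flip (P.action V (τ A) (tens P.nPart V 1 u))) (fun v => ?_) (fun l X hX f _ => ?_)) f
    · change pairing hτ J (P.action V A (tens P.nPart V 1 v)) _ = pairing hτ J (tens P.nPart V 1 v) _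
      rw [action_one, action_one, pairing_one, pairing_one, degZero_one, degZero_one, hJ]
    · change pairing hτ J (P.action V A (P.w V X f)) _ = pairing hτ J (P.w V X f) _
      rw [action_wedge P V hA hX, action_one, map_add, map_smul, LinearMap.add_apply, LinearMap.smul_apply,
        pairing_wedge_one, pairing_wedge_one, pairing_wedge_one, smul_zero, add_zero]
  have key := chains_mem (⨅ f, LinearMap.eqLocus (pairing hτ J (P.action V A f))
    (pairing hτ J f ∘ₗ P.action V (τ A))) (fun u => (Submodule.mem_iInf _).mpr fun f => h0 f u)
    (fun l X hX f' ih => (Submodule.mem_iInf _).mpr fun f => ?_) f'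
  · exact (Submodule.mem_iInf _).mp key f
  · have ih' : ∀ f, pairing hτ J (P.action V A f) f' = pairing hτ J f (P.action V (τ A) f') :=
      fun f => (Submodule.mem_iInf _).mp ih f
    obtain ⟨Y, hY, hYl, rfl⟩ := exists_apply_eq_of_mem_part hτ hX
    have hYA : bracket Y A ∈ P.nbar := Adapted.bracket_n_left (P := P.opp) hY (hn' hAn)
    change pairing hτ J (P.action V A f) _ = pairing hτ J f (P.action V (τ A) _)
    rw [← pairing_contraction hτ hYl hY, contraction_action hYl hY hA, map_add, map_smul, LinearMap.add_apply,
      LinearMap.smul_apply, ih', pairing_contraction hτ hYl hY,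
      pairing_contraction hτ (LieSuperalgebra.bracket_mem hYl hA) hYA,
      action_wedge_of_mem (hτ.mem_part hA) (hn (hτ.mem_n A hAn)) hX, map_add, map_smul, add_comm]
    simp only [hτ.apply_bracket]

/-- The mirror image of `pairing_boundary`, by induction on the second argument. -/
theorem pairing_coboundary [FiniteDimensional ℂ g] (hn : P.n ≤ P.p) (hn' : P.nbar ≤ P.pOpp) {r : ℕ}
    (ξ : DualBases P r) (f f' : P.C V) :
    pairing hτ J (coboundary V ξ f) f' = -pairing hτ J f (P.boundary V f') := by
  have key := chains_mem (⨅ f, LinearMap.eqLocus (pairing hτ J (coboundary V ξ f))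
    (-(pairing hτ J f ∘ₗ P.boundary V))) (fun u => (Submodule.mem_iInf _).mpr fun f => ?_)
    (fun l X hX f' ih => (Submodule.mem_iInf _).mpr fun f => ?_) f'
  · exact (Submodule.mem_iInf _).mp key f
  · change pairing hτ J (coboundary V ξ f) _ = -pairing hτ J f (P.boundary V _)
    rw [boundary_one, map_zero, neg_zero]
    refine LinearMap.congr_fun (chains_ext (F := (pairing hτ J).flip (tens P.nPart V 1 u) ∘ₗ coboundary V ξ)
      (F' := 0) (fun v => ?_) (fun l X hX f _ => ?_)) f
    · change pairing hτ J (coboundary V ξ (tens P.nPart V 1 v)) _ = 0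
      rw [coboundary_one, map_sum, LinearMap.sum_apply]
      exact Finset.sum_eq_zero fun a _ => pairing_wedge_one hτ _ _ _
    · change pairing hτ J (coboundary V ξ (P.w V X f)) _ = 0
      rw [coboundary_wedge, map_sub, map_smul, map_sum, LinearMap.sub_apply, LinearMap.smul_apply,
        LinearMap.sum_apply, pairing_wedge_one, sub_zero, Finset.sum_eq_zero fun a _ => pairing_wedge_one hτ _ _ _,
        smul_zero]
  · have ih' : ∀ f, pairing hτ J (coboundary V ξ f) f' = -pairing hτ J f (P.boundary V f') :=
      fun f => (Submodule.mem_iInf _).mp ih f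
    obtain ⟨Y, hY, hYl, rfl⟩ := exists_apply_eq_of_mem_part hτ hX
    change pairing hτ J (coboundary V ξ f) _ = -pairing hτ J f (P.boundary V _)
    rw [← pairing_contraction hτ hYl hY, eq_sub_of_add_eq (contraction_coboundary ξ hYl hY f), map_sub,
      LinearMap.sub_apply, ih', pairing_contraction hτ hYl hY, pairing_action_of_mem_nbar hτ hJ hn hn' hYl hY,
      boundary_wedge, map_sub, map_neg]
    ring

theorem pairing_quabla [FiniteDimensional ℂ g] (hn : P.n ≤ P.p) (hn' : P.nbar ≤ P.pOpp) {r : ℕ}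
    (ξ : DualBases P r) (f f' : P.C V) :
    pairing hτ J (quabla V ξ f) f' = pairing hτ J f (quabla V ξ f') := by
  simp only [quabla, LinearMap.add_apply, LinearMap.comp_apply, map_add]
  rw [pairing_coboundary hτ hJ hn hn', pairing_boundary hτ hJ hn, pairing_boundary hτ hJ hn ξ,
    pairing_coboundary hτ hJ hn hn', neg_neg, neg_neg]

end Adjoint

/-- The radical is stable under products and contractions, so `eq_bot_of_stable` reduces the claim
to degree zero, where it is the injectivity of J. -/
theorem pairing_eq_zero {r : ℕ} (ξ : DualBases P r) (hJ : Function.Injective J) {f : P.C V}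
    (hf : ∀ f', pairing hτ J f f' = 0) : f = 0 := by
  have h1 : LinearMap.ker (pairing hτ J) = ⊥ := by
    refine eq_bot_of_stable ξ (fun X f hf => ?_) (fun A hA f hf => ?_) (fun v hv => ?_)
    · ext f'
      rw [pairing_wedge, LinearMap.mem_ker.mp hf]
      rfl
    · rw [← evenProj_add_oddProj A, map_add, LinearMap.add_apply]
      have hgr : IsGraded P.nbar := perp_isGraded P.pOpp_sub.graded
      refine Submodule.add_mem _ ?_ ?_
      · ext f'
        rw [pairing_contraction hτ (evenProj_mem A) (hgr.evenProj_mem hA), LinearMap.mem_ker.mp hf]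
        rfl
      · ext f'
        rw [pairing_contraction hτ (oddProj_mem A) (hgr.oddProj_mem hA), LinearMap.mem_ker.mp hf]
        rfl
    · refine hJ ?_
      ext u
      have h2 := LinearMap.congr_fun (LinearMap.mem_ker.mp hv) (tens P.nPart V 1 u)
      rw [pairing_one, degZero_one] at h2
      rw [h2, map_zero]
      rfl
  exact (Submodule.mem_bot ℂ).mp (h1 ▸ LinearMap.mem_ker.mpr (LinearMap.ext hf))

theorem pairing_eq_zero' [FiniteDimensional ℂ g] [FiniteDimensional ℂ V] {r : ℕ} (ξ : DualBases P r)
    (hJ : Function.Injective J) {f' : P.C V} (hf : ∀ f, pairing hτ J f f' = 0) : f' = 0 := by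
  have h1 : LinearMap.ker (pairing hτ J).flip = ⊥ := by
    refine eq_bot_of_stable ξ (fun X f' hf => ?_) (fun A hA f' hf => ?_) (fun v hv => ?_)
    · have hgr : IsGraded P.nbar := perp_isGraded P.pOpp_sub.graded
      obtain ⟨Y, hY, rfl⟩ := exists_apply_eq hτ X
      have h3 : (⟨τ Y, hτ.mem_n Y hY⟩ : P.n) = ⟨τ (evenProj g Y), hτ.mem_n _ (hgr.evenProj_mem hY)⟩ +
          ⟨τ (oddProj g Y), hτ.mem_n _ (hgr.oddProj_mem hY)⟩ := Subtype.ext (by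
        change τ Y = τ (evenProj g Y) + τ (oddProj g Y)
        rw [← map_add, evenProj_add_oddProj])
      rw [h3, map_add, LinearMap.add_apply]
      refine Submodule.add_mem _ ?_ ?_
      · ext f
        rw [LinearMap.flip_apply, ← pairing_contraction hτ (evenProj_mem Y) (hgr.evenProj_mem hY)]
        exact LinearMap.congr_fun hf _
      · ext f
        rw [LinearMap.flip_apply, ← pairing_contraction hτ (oddProj_mem Y) (hgr.oddProj_mem hY)]
        exact LinearMap.congr_fun hf _
    · have h2 : A ∈ P.n.map τ := by
        rw [hτ.map_eq hτ.mem_nbar hτ.mem_n]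
        exact hA
      obtain ⟨X, hX, rfl⟩ := h2
      ext f
      rw [LinearMap.flip_apply, ← pairing_wedge hτ ⟨X, hX⟩]
      exact LinearMap.congr_fun hf _
    · refine (Module.forall_dual_apply_eq_zero_iff ℂ v).mp fun φ => ?_
      have hsurj : Function.Surjective J :=
        (LinearMap.injective_iff_surjective_of_finrank_eq_finrank Subspace.dual_finrank_eq.symm).mp hJ
      obtain ⟨u, rfl⟩ := hsurj φ
      have h2 := LinearMap.congr_fun (LinearMap.mem_ker.mp hv) (tens P.nPart V 1 u)
      rw [LinearMap.flip_apply, pairing_one, degZero_one] at h2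
      exact h2
  exact (Submodule.mem_bot ℂ).mp (h1 ▸ LinearMap.mem_ker.mpr (LinearMap.ext hf))

section Operators

variable [FiniteDimensional ℂ g] (hJ : ∀ x v u, J (act x v) u = J v (act (τ x) u)) (hJ' : Function.Injective J)
  (hn : P.n ≤ P.p) (hn' : P.nbar ≤ P.pOpp) {r : ℕ} (ξ : DualBases P r)

include hτ hJ hJ' hn hn'

/-- Adjoint to ∂*∂* = 0, so no computation with structure constants is needed. -/
theorem coboundary_coboundary (f : P.C V) : coboundary V ξ (coboundary V ξ f) = 0 := by
  refine pairing_eq_zero hτ ξ hJ' fun f' => ?_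
  rw [pairing_coboundary hτ hJ hn hn', pairing_coboundary hτ hJ hn hn', boundary_boundary hn, map_zero, neg_zero,
    neg_zero]

theorem coboundary_action {i : ZMod 2} {A : g} (hA : A ∈ part i) (hAl : A ∈ P.levi) (f : P.C V) :
    coboundary V ξ (P.action V A f) = P.action V A (coboundary V ξ f) := by
  have hτA := hτ.mem_levi A hAl
  refine sub_eq_zero.mp (pairing_eq_zero hτ ξ hJ' fun f' => ?_)
  rw [map_sub, LinearMap.sub_apply, pairing_coboundary hτ hJ hn hn', pairing_action_of_mem_p hτ hJ hA hAl.1,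
    pairing_action_of_mem_p hτ hJ hA hAl.1, pairing_coboundary hτ hJ hn hn',
    boundary_action (hτ.mem_part hA) hτA.1 hn, sub_self]

end Operators

end Parabolic

/-! ### Degrees and parities of chains -/

namespace Parabolic

variable {g : Type*} [AddCommGroup g] [Module ℂ g] [LieSuperalgebra g] {B : KillingForm g}
  {P : Parabolic B} {V : Type*} [AddCommGroup V] [Module ℂ V] [SuperSpace V] [LieSupermodule g V]

theorem parity_add_add (i j : ZMod 2) : j + (i + j) = i := by
  revert i j; decide

theorem parity_add_add_left (i j : ZMod 2) : j + (j + i) = i := by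
  rw [add_comm j i, parity_add_add]

theorem chainPart_le_deg (k : ℕ) (i : ZMod 2) : chainPart P.nPart V k i ≤ P.deg V k := by
  induction k generalizing i with
  | zero =>
    refine Submodule.span_le.mpr ?_
    rintro _ ⟨v, -, rfl⟩
    exact Submodule.subset_span ⟨v, rfl⟩
  | succ k ih =>
    refine Submodule.span_le.mpr ?_
    rintro _ ⟨j, X, -, f, hf, rfl⟩
    exact Submodule.subset_span ⟨X, f, ih _ hf, rfl⟩

theorem wedge_mem_chainPart {k : ℕ} {i j : ZMod 2} {X : P.n} (hX : X ∈ P.nPart j) {f : P.C V}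
    (hf : f ∈ chainPart P.nPart V k i) : P.w V X f ∈ chainPart P.nPart V (k + 1) (j + i) :=
  Submodule.subset_span ⟨j, X, hX, f, by rwa [add_comm, parity_add_add_left], rfl⟩

theorem deg_le_iSup_chainPart (k : ℕ) : P.deg V k ≤ ⨆ i, chainPart P.nPart V k i := by
  induction k with
  | zero =>
    refine Submodule.span_le.mpr ?_
    rintro _ ⟨v, rfl⟩
    rw [← evenProj_add_oddProj v, map_add]
    exact Submodule.add_mem _ (le_iSup (chainPart P.nPart V 0) 0 (Submodule.subset_span ⟨_, evenProj_mem v, rfl⟩))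
      (le_iSup (chainPart P.nPart V 0) 1 (Submodule.subset_span ⟨_, oddProj_mem v, rfl⟩))
  | succ k ih =>
    refine Submodule.span_le.mpr ?_
    rintro _ ⟨X, f, hf, rfl⟩
    have key : ∀ j, ∀ X ∈ P.nPart j, P.w V X f ∈ ⨆ i, chainPart P.nPart V (k + 1) i := by
      intro j X hX
      refine (iSup_le fun i => ?_ : (⨆ i, chainPart P.nPart V k i) ≤
        (⨆ i, chainPart P.nPart V (k + 1) i).comap (P.w V X)) (ih hf)
      exact fun f hf => le_iSup (chainPart P.nPart V (k + 1)) (j + i) (wedge_mem_chainPart hX hf)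
    have hgr : IsGraded P.n := perp_isGraded P.p_sub.graded
    have hX : X = ⟨_, hgr.evenProj_mem X.2⟩ + ⟨_, hgr.oddProj_mem X.2⟩ :=
      Subtype.ext (evenProj_add_oddProj (X : g)).symm
    rw [SetLike.mem_coe, hX, map_add, LinearMap.add_apply]
    exact Submodule.add_mem _ (key 0 _ (evenProj_mem (X : g))) (key 1 _ (oddProj_mem (X : g)))

/-- A linear map which respects the homogeneous parts respects the degree. -/
theorem map_mem_deg {F : P.C V →ₗ[ℂ] P.C V} {k l : ℕ} {σ : ZMod 2 → ZMod 2}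
    (hF : ∀ i, ∀ f ∈ chainPart P.nPart V k i, F f ∈ chainPart P.nPart V l (σ i)) {f : P.C V} (hf : f ∈ P.deg V k) :
    F f ∈ P.deg V l :=
  (iSup_le fun i f hf => chainPart_le_deg l (σ i) (hF i f hf) : (⨆ i, chainPart P.nPart V k i) ≤
    (P.deg V l).comap F) (deg_le_iSup_chainPart k hf)

theorem action_mem_chainPart {a : ZMod 2} {A : g} (hA : A ∈ part a) (k : ℕ) (i : ZMod 2) {f : P.C V}
    (hf : f ∈ chainPart P.nPart V k i) : P.action V A f ∈ chainPart P.nPart V k (a + i) := by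
  induction k generalizing i f with
  | zero =>
    refine (Submodule.span_le (p := (chainPart P.nPart V 0 (a + i)).comap (P.action V A))).mpr ?_ hf
    rintro _ ⟨v, hv, rfl⟩
    rw [SetLike.mem_coe, Submodule.mem_comap, action_one]
    exact Submodule.subset_span ⟨_, LieSupermodule.act_mem hA hv, rfl⟩
  | succ k ih =>
    refine (Submodule.span_le (p := (chainPart P.nPart V (k + 1) (a + i)).comap (P.action V A))).mpr ?_ hf
    rintro _ ⟨j, X, hX, f, hf, rfl⟩
    change P.action V A (P.w V X f) ∈ chainPart P.nPart V (k + 1) (a + i)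
    rw [action_wedge P V hA hX]
    have h1 : (a + j) + (i + j) = a + i := by rw [add_assoc, parity_add_add]
    have h2 : j + (a + (i + j)) = a + i := by rw [← add_assoc a, parity_add_add]
    refine Submodule.add_mem _ ?_ (Submodule.smul_mem _ _ ?_)
    · rw [← h1]
      exact wedge_mem_chainPart (P.projN_mem (LieSuperalgebra.bracket_mem hA hX)) hf
    · rw [← h2]
      exact wedge_mem_chainPart hX (ih _ hf)

theorem action_mem_deg (A : g) {k : ℕ} {f : P.C V} (hf : f ∈ P.deg V k) : P.action V A f ∈ P.deg V k := by
  rw [← evenProj_add_oddProj A, map_add, LinearMap.add_apply]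
  exact Submodule.add_mem _ (map_mem_deg (fun i f => action_mem_chainPart (evenProj_mem A) k i) hf)
    (map_mem_deg (fun i f => action_mem_chainPart (oddProj_mem A) k i) hf)

theorem boundary_of_mem_deg_zero {f : P.C V} (hf : f ∈ P.deg V 0) : P.boundary V f = 0 := by
  refine (Submodule.span_le (p := LinearMap.ker (P.boundary V))).mpr ?_ hf
  rintro _ ⟨v, rfl⟩
  exact boundary_one P V v

theorem boundary_mem_chainPart (k : ℕ) (i : ZMod 2) {f : P.C V} (hf : f ∈ chainPart P.nPart V (k + 1) i) :
    P.boundary V f ∈ chainPart P.nPart V k i := by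
  induction k generalizing i f with
  | zero =>
    refine (Submodule.span_le (p := (chainPart P.nPart V 0 i).comap (P.boundary V))).mpr ?_ hf
    rintro _ ⟨j, X, hX, f, hf, rfl⟩
    change P.boundary V (P.w V X f) ∈ chainPart P.nPart V 0 i
    rw [boundary_wedge, boundary_of_mem_deg_zero (chainPart_le_deg 0 _ hf), map_zero, sub_zero, ← parity_add_add i j]
    exact Submodule.neg_mem _ (action_mem_chainPart (A := (X : g)) hX 0 _ hf)
  | succ k ih =>
    refine (Submodule.span_le (p := (chainPart P.nPart V (k + 1) i).comap (P.boundary V))).mpr ?_ hf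
    rintro _ ⟨j, X, hX, f, hf, rfl⟩
    change P.boundary V (P.w V X f) ∈ chainPart P.nPart V (k + 1) i
    rw [boundary_wedge, ← parity_add_add i j]
    exact Submodule.sub_mem _ (Submodule.neg_mem _ (action_mem_chainPart (A := (X : g)) hX (k + 1) _ hf))
      (wedge_mem_chainPart hX (ih _ hf))

theorem boundary_mem_deg {k : ℕ} {f : P.C V} (hf : f ∈ P.deg V (k + 1)) : P.boundary V f ∈ P.deg V k :=
  map_mem_deg (fun i _ => boundary_mem_chainPart k i) hf

variable {r : ℕ} (ξ : DualBases P r)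

theorem coboundary_mem_chainPart (k : ℕ) (i : ZMod 2) {f : P.C V} (hf : f ∈ chainPart P.nPart V k i) :
    coboundary V ξ f ∈ chainPart P.nPart V (k + 1) i := by
  induction k generalizing i f with
  | zero =>
    refine (Submodule.span_le (p := (chainPart P.nPart V 1 i).comap (coboundary V ξ))).mpr ?_ hf
    rintro _ ⟨v, hv, rfl⟩
    rw [SetLike.mem_coe, Submodule.mem_comap, coboundary_one]
    refine Submodule.sum_mem _ fun a _ => ?_
    rw [← parity_add_add i (ξ.deg a), add_comm i]
    exact wedge_mem_chainPart (ξ.ξ_mem a) (Submodule.subset_span ⟨_, LieSupermodule.act_mem (ξ.ξd_mem a) hv, rfl⟩)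
  | succ k ih =>
    refine (Submodule.span_le (p := (chainPart P.nPart V (k + 2) i).comap (coboundary V ξ))).mpr ?_ hf
    rintro _ ⟨j, X, hX, f, hf, rfl⟩
    change coboundary V ξ (P.w V X f) ∈ chainPart P.nPart V (k + 2) i
    rw [coboundary_wedge]
    refine Submodule.sub_mem _ (Submodule.smul_mem _ _ (Submodule.sum_mem _ fun a _ => ?_)) ?_
    · have h1 : ξ.deg a + ((ξ.deg a + j) + (i + j)) = i := by
        rw [add_assoc, parity_add_add, add_comm (ξ.deg a) i, parity_add_add]
      rw [← h1]
      exact wedge_mem_chainPart (ξ.ξ_mem a) (wedge_mem_chainPart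
        (P.projN_mem (LieSuperalgebra.bracket_mem (ξ.ξd_mem a) hX)) hf)
    · rw [← parity_add_add i j]
      exact wedge_mem_chainPart hX (ih _ hf)

theorem coboundary_mem_deg {k : ℕ} {f : P.C V} (hf : f ∈ P.deg V k) : coboundary V ξ f ∈ P.deg V (k + 1) :=
  map_mem_deg (fun i _ => coboundary_mem_chainPart ξ k i) hf

theorem quabla_mem_chainPart (k : ℕ) (i : ZMod 2) {f : P.C V} (hf : f ∈ chainPart P.nPart V k i) :
    quabla V ξ f ∈ chainPart P.nPart V k i := by
  refine Submodule.add_mem _ ?_ (boundary_mem_chainPart k i (coboundary_mem_chainPart ξ k i hf))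
  cases k with
  | zero =>
    rw [LinearMap.comp_apply, boundary_of_mem_deg_zero (chainPart_le_deg 0 _ hf), map_zero]
    exact Submodule.zero_mem _
  | succ k => exact coboundary_mem_chainPart ξ k i (boundary_mem_chainPart k i hf)

theorem quabla_mem_deg {k : ℕ} {f : P.C V} (hf : f ∈ P.deg V k) : quabla V ξ f ∈ P.deg V k :=
  map_mem_deg (fun i _ => quabla_mem_chainPart ξ k i) hf

/-- The exterior algebra is infinite dimensional if 𝔫 has an odd part; only its separate degrees are
finite dimensional, so arguments by dimension are made degreewise. -/
theorem finiteDimensional_deg [FiniteDimensional ℂ g] [FiniteDimensional ℂ V] (k : ℕ) :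
    FiniteDimensional ℂ (P.deg V k) := by
  induction k with
  | zero =>
    have h1 : P.deg V 0 ≤ LinearMap.range (tens P.nPart V 1) := by
      refine Submodule.span_le.mpr ?_
      rintro _ ⟨v, rfl⟩
      exact ⟨v, rfl⟩
    exact Submodule.finiteDimensional_of_le h1
  | succ k ih =>
    have h1 : P.deg V (k + 1) ≤ Submodule.map₂ (P.w V) ⊤ (P.deg V k) := by
      refine Submodule.span_le.mpr ?_
      rintro _ ⟨X, f, hf, rfl⟩
      exact Submodule.apply_mem_map₂ _ trivial hf
    have h2 : FiniteDimensional ℂ (Submodule.map₂ (P.w V) ⊤ (P.deg V k)) :=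
      Module.Finite.iff_fg.mpr (Submodule.FG.map₂ _ Module.Finite.fg_top (Module.Finite.iff_fg.mp ih))
    exact Submodule.finiteDimensional_of_le h1

end Parabolic

/-! ### Fitting decomposition of a locally finite operator -/

section Fitting

open Polynomial

variable {M : Type*} [AddCommGroup M] [Module ℂ M] {E : Module.End ℂ M}

theorem aeval_apply_mem {W : Submodule ℂ M} (hW : ∀ x ∈ W, E x ∈ W) (q : ℂ[X]) {x : M} (hx : x ∈ W) :
    aeval E q x ∈ W := by
  induction q using Polynomial.induction_on' with
  | add p q hp hq =>
    rw [map_add]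
    exact Submodule.add_mem _ hp hq
  | monomial n c =>
    have h1 : (E ^ n) x ∈ W := by
      induction n with
      | zero => exact hx
      | succ n ih =>
        rw [pow_succ']
        exact hW _ ih
    rw [aeval_monomial, Module.End.mul_apply, Module.algebraMap_end_apply]
    exact Submodule.smul_mem _ c h1

theorem apply_aeval_apply {F : Module.End ℂ M} (hF : ∀ x, F (E x) = E (F x)) (q : ℂ[X]) (x : M) :
    F (aeval E q x) = aeval E q (F x) := by
  have h1 : Commute F E := LinearMap.ext hF
  have h2 : Commute F (aeval E q) := by
    induction q using Polynomial.induction_on' with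
    | add p q hp hq =>
      rw [map_add]
      exact hp.add_right hq
    | monomial n c =>
      rw [aeval_monomial]
      exact Commute.mul_right (Algebra.commutes c F).symm (h1.pow_right n)
  exact LinearMap.congr_fun h2.eq x

theorem exists_aeval_apply_eq_zero {D : ℕ → Submodule ℂ M} (hfin : ∀ k, FiniteDimensional ℂ (D k))
    (hD : ∀ k, ∀ x ∈ D k, E x ∈ D k) (htop : ⨆ k, D k = ⊤) (x : M) : ∃ p : ℂ[X], p ≠ 0 ∧ aeval E p x = 0 := by
  refine Submodule.iSup_induction D (motive := fun x => ∃ p : ℂ[X], p ≠ 0 ∧ aeval E p x = 0)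
    (htop ▸ Submodule.mem_top : x ∈ ⨆ k, D k) (fun k x hx => ?_) ⟨1, one_ne_zero, map_zero _⟩ ?_
  · by_contra! hcon
    have hmem : ∀ q, (LinearMap.toSpanSingleton (Module.End ℂ M) M x).restrictScalars ℂ (aeval E q) ∈ D k :=
      fun q => aeval_apply_mem (hD k) q hx
    let ev : ℂ[X] →ₗ[ℂ] D k := (((LinearMap.toSpanSingleton (Module.End ℂ M) M x).restrictScalars ℂ) ∘ₗ
      (aeval E).toLinearMap).codRestrict (D k) hmem
    have hinj : Function.Injective ev := by
      rw [← LinearMap.ker_eq_bot, LinearMap.ker_eq_bot']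
      intro p hp
      by_contra hp0
      exact hcon p hp0 (congrArg Subtype.val hp)
    have := hfin k
    exact Polynomial.not_finite (Module.Finite.of_injective ev hinj)
  · rintro x y ⟨p, hp, hpx⟩ ⟨q, hq, hqy⟩
    refine ⟨p * q, mul_ne_zero hp hq, ?_⟩
    rw [map_add, map_mul, Module.End.mul_apply, Module.End.mul_apply, hqy, map_zero, add_zero,
      ← Module.End.mul_apply, ← map_mul, mul_comm, map_mul, Module.End.mul_apply, hpx, map_zero]

variable (E) in
/-- `π` is the projection onto the generalised kernel of `E`. -/
structure IsFittingProjection (π : Module.End ℂ M) : Prop where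
  apply_mem : ∀ x, π x ∈ E.maxGenEigenspace 0
  apply_of_mem : ∀ x ∈ E.maxGenEigenspace 0, π x = x
  exists_aeval : ∀ x, ∃ q : ℂ[X], π x = aeval E q x
  exists_eq : ∀ x, π x = 0 → ∃ q : ℂ[X], x = E (aeval E q x)
  eq_zero : ∀ x, ∀ q : ℂ[X], x = E (aeval E q x) → π x = 0

theorem mem_maxGenEigenspace_zero {x : M} : x ∈ E.maxGenEigenspace 0 ↔ ∃ n : ℕ, (E ^ n) x = 0 := by
  rw [Module.End.mem_maxGenEigenspace, zero_smul, sub_zero]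

/-- M is a torsion module over ℂ[X], and is the direct sum of its X-primary part and of the elements
R killed by a polynomial prime to X. The projection is locally a polynomial in E, so it preserves
every subspace stable under E. -/
theorem exists_fittingProjection {D : ℕ → Submodule ℂ M} (hfin : ∀ k, FiniteDimensional ℂ (D k))
    (hD : ∀ k, ∀ x ∈ D k, E x ∈ D k) (htop : ⨆ k, D k = ⊤) : ∃ π, IsFittingProjection E π := by
  have hcomm : ∀ (p q : ℂ[X]) (x : M), aeval E p (aeval E q x) = aeval E q (aeval E p x) := fun p q x => by
    rw [← Module.End.mul_apply, ← map_mul, mul_comm, map_mul, Module.End.mul_apply]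
  let R : Submodule ℂ M :=
    { carrier := {x | ∃ m : ℂ[X], ¬ X ∣ m ∧ aeval E m x = 0}
      zero_mem' := ⟨1, fun h => not_isUnit_X (isUnit_of_dvd_one h), map_zero _⟩
      add_mem' := by
        rintro x y ⟨p, hp, hpx⟩ ⟨q, hq, hqy⟩
        refine ⟨p * q, fun h => (prime_X.dvd_or_dvd h).elim hp hq, ?_⟩
        rw [map_mul, Module.End.mul_apply, map_add, hqy, add_zero, hcomm, hpx, map_zero]
      smul_mem' := by
        rintro c x ⟨p, hp, hpx⟩
        exact ⟨p, hp, by rw [map_smul, hpx, smul_zero]⟩ }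
  have hcop : ∀ {m : ℂ[X]} (n : ℕ), ¬ X ∣ m → ∃ a b : ℂ[X], a * X ^ n + b * m = 1 := fun n h =>
    IsCoprime.pow_left ((Polynomial.irreducible_X).coprime_iff_not_dvd.mpr h)
  have hsplit : ∀ {a b c d : ℂ[X]}, a * c + b * d = 1 → ∀ x : M,
      x = aeval E a (aeval E c x) + aeval E b (aeval E d x) := fun {a b c d} h x => by
    have h1 := congrArg (fun q => aeval E q x) h
    simp only [map_add, map_mul, map_one, LinearMap.add_apply, Module.End.mul_apply, Module.End.one_apply] at h1
    exact h1.symm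
  have hpow : ∀ n x, aeval E (X ^ n : ℂ[X]) x = (E ^ n) x := fun n x => by rw [map_pow, aeval_X]
  have hdis : Disjoint (E.maxGenEigenspace 0) R := by
    rw [Submodule.disjoint_def]
    rintro x hx ⟨m, hm, hmx⟩
    obtain ⟨n, hn⟩ := mem_maxGenEigenspace_zero.mp hx
    obtain ⟨a, b, hab⟩ := hcop n hm
    rw [hsplit hab x, hpow, hn, hmx, map_zero, map_zero, add_zero]
  have hex : ∀ x, ∃ q : ℂ[X], aeval E q x ∈ E.maxGenEigenspace 0 ∧ x - aeval E q x ∈ R := by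
    intro x
    obtain ⟨p, hp0, hpx⟩ := exists_aeval_apply_eq_zero hfin hD htop x
    obtain ⟨n, m, rfl, hm⟩ : ∃ (n : ℕ) (m : ℂ[X]), p = X ^ n * m ∧ ¬ X ∣ m := by
      obtain ⟨m, h1, h2⟩ := exists_eq_pow_rootMultiplicity_mul_and_not_dvd p hp0 0
      rw [C_0, sub_zero] at h1 h2
      exact ⟨_, m, h1, h2⟩
    obtain ⟨a, b, hab⟩ := hcop n hm
    have h1 := hsplit hab x
    -- If Xⁿ m kills x and a Xⁿ + b m = 1, then b m projects x to the X-primary part and a Xⁿ to R.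
    refine ⟨b * m, mem_maxGenEigenspace_zero.mpr ⟨n, ?_⟩, m, hm, ?_⟩
    · rw [← hpow, map_mul, Module.End.mul_apply, hcomm, ← Module.End.mul_apply (aeval E (X ^ n)), ← map_mul, hpx,
        map_zero]
    · rw [map_mul, Module.End.mul_apply]
      nth_rewrite 1 [h1]
      rw [add_sub_cancel_right, hcomm, ← Module.End.mul_apply (aeval E m), ← map_mul, mul_comm m, hpx, map_zero]
  have hcompl : IsCompl (E.maxGenEigenspace 0) R := by
    refine ⟨hdis, codisjoint_iff.mpr (Submodule.eq_top_iff'.mpr fun x => ?_)⟩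
    obtain ⟨q, h1, h2⟩ := hex x
    rw [← add_sub_cancel (aeval E q x) x]
    exact Submodule.add_mem_sup h1 h2
  refine ⟨(E.maxGenEigenspace 0).projection R hcompl, ⟨fun x => Submodule.projection_apply_mem _ x,
    fun x hx => Submodule.projection_apply_of_mem_left hcompl hx, fun x => ?_, fun x hx => ?_, fun x q hx => ?_⟩⟩
  · obtain ⟨q, h1, h2⟩ := hex x
    refine ⟨q, ?_⟩
    nth_rewrite 1 [← add_sub_cancel (aeval E q x) x]
    rw [map_add, Submodule.projection_apply_of_mem_left hcompl h1, Submodule.projection_apply_of_mem_right hcompl h2,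
      add_zero]
  · have hxR : x ∈ R := (Submodule.projection_apply_eq_zero_iff hcompl).mp hx
    obtain ⟨m, hm, hmx⟩ := hxR
    obtain ⟨a, b, hab⟩ := hcop 1 hm
    refine ⟨a, ?_⟩
    have h1 := hsplit hab x
    rw [hmx, map_zero, add_zero, hpow, pow_one] at h1
    rw [apply_aeval_apply (fun _ => rfl)]
    exact h1
  -- The relation x = E q(E) x says that 1 - X q, which is prime to X, kills x.
  · refine (Submodule.projection_apply_eq_zero_iff hcompl).mpr ⟨1 - X * q, fun h => ?_, ?_⟩
    · have h1 : (X : ℂ[X]) ∣ 1 := by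
        have h2 := dvd_add h (dvd_mul_right X q)
        rwa [sub_add_cancel] at h2
      exact not_isUnit_X (isUnit_of_dvd_one h1)
    · rw [map_sub, map_one, map_mul, aeval_X, LinearMap.sub_apply, Module.End.mul_apply, Module.End.one_apply,
        ← hx, sub_self]

namespace IsFittingProjection

variable {π : Module.End ℂ M} (hπ : IsFittingProjection E π)

include hπ

theorem apply_mem_of_stable {W : Submodule ℂ M} (hW : ∀ x ∈ W, E x ∈ W) {x : M} (hx : x ∈ W) : π x ∈ W := by
  obtain ⟨q, hq⟩ := hπ.exists_aeval x
  rw [hq]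
  exact aeval_apply_mem hW q hx

theorem apply_apply (x : M) : π (π x) = π x := hπ.apply_of_mem _ (hπ.apply_mem x)

/-- An operator commuting with E preserves both summands: the generalised kernel, and the elements
with x = E q(E) x for some q. -/
theorem apply_comm {F : Module.End ℂ M} (hF : ∀ x, F (E x) = E (F x)) (x : M) : F (π x) = π (F x) := by
  have hFn : ∀ y ∈ E.maxGenEigenspace 0, F y ∈ E.maxGenEigenspace 0 := fun y hy => by
    obtain ⟨n, hn⟩ := mem_maxGenEigenspace_zero.mp hy
    refine mem_maxGenEigenspace_zero.mpr ⟨n, ?_⟩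
    have h1 := apply_aeval_apply hF (X ^ n) y
    rw [map_pow, aeval_X] at h1
    rw [← h1, hn, map_zero]
  obtain ⟨q, hq⟩ := hπ.exists_eq (x - π x) (by rw [map_sub, hπ.apply_apply, sub_self])
  have h2 : π (F (x - π x)) = 0 := by
    refine hπ.eq_zero _ q ?_
    nth_rewrite 1 [hq]
    rw [hF, apply_aeval_apply hF]
  rw [map_sub, map_sub, hπ.apply_of_mem _ (hFn _ (hπ.apply_mem x)), sub_eq_zero] at h2
  exact h2.symm

theorem exists_pow {x : M} (hx : π x = 0) (n : ℕ) : ∃ y, x = (E ^ n) y := by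
  suffices h : ∃ y, x = (E ^ n) y ∧ π y = 0 from ⟨h.choose, h.choose_spec.1⟩
  induction n with
  | zero => exact ⟨x, rfl, hx⟩
  | succ n ih =>
    obtain ⟨y, hy, hy0⟩ := ih
    obtain ⟨q, hq⟩ := hπ.exists_eq y hy0
    refine ⟨aeval E q y, ?_, ?_⟩
    · rw [hy, pow_succ, Module.End.mul_apply, ← hq]
    · rw [← hπ.apply_comm (fun x => (apply_aeval_apply (fun _ => rfl) q x).symm), hy0, map_zero]

/-- The two summands of the Fitting decomposition are orthogonal with respect to every form for which `E` is
self-adjoint. -/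
theorem form_eq_zero {β : M →ₗ[ℂ] Module.Dual ℂ M} (hβ : ∀ x y, β (E x) y = β x (E y)) {x y : M} (hx : π x = 0)
    (hy : y ∈ E.maxGenEigenspace 0) : β x y = 0 := by
  obtain ⟨n, hn⟩ := mem_maxGenEigenspace_zero.mp hy
  obtain ⟨z, rfl⟩ := hπ.exists_pow hx n
  have h1 : ∀ (n : ℕ) x y, β ((E ^ n) x) y = β x ((E ^ n) y) := by
    intro n
    induction n with
    | zero => exact fun _ _ => rfl
    | succ n ih =>
      intro x y
      rw [pow_succ, Module.End.mul_apply, ih, hβ, ← pow_succ, pow_succ', Module.End.mul_apply]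
  rw [h1, hn, map_zero]

end IsFittingProjection

variable {S : Module.End ℂ M}

/-- If Sy is in the generalised kernel, then E(Sy) = S(Ey) is again in the image and is killed by a
smaller power of E; so by induction it is zero, and Sy lies in the kernel. -/
theorem range_inf_maxGenEigenspace_eq_bot (hS : ∀ x, S (E x) = E (S x)) (h : LinearMap.range S ⊓ LinearMap.ker E = ⊥) :
    LinearMap.range S ⊓ E.maxGenEigenspace 0 = ⊥ := by
  rw [eq_bot_iff]
  rintro _ ⟨⟨y, rfl⟩, hy⟩
  obtain ⟨n, hn⟩ := mem_maxGenEigenspace_zero.mp hy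
  induction n generalizing y with
  | zero => exact hn
  | succ n ih =>
    have h1 : E (S y) = 0 := by
      have h2 := ih (E y) (mem_maxGenEigenspace_zero.mpr ⟨n, by rwa [hS, ← Module.End.mul_apply, ← pow_succ]⟩)
        (by rwa [hS, ← Module.End.mul_apply, ← pow_succ])
      rwa [hS] at h2
    exact h ▸ ⟨⟨y, rfl⟩, h1⟩

theorem maxGenEigenspace_le_ker (hS : ∀ x, S (E x) = E (S x))
    (h : LinearMap.range S ⊓ E.maxGenEigenspace 0 = ⊥) : E.maxGenEigenspace 0 ≤ LinearMap.ker S := by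
  intro x hx
  have h1 : S x ∈ LinearMap.range S ⊓ E.maxGenEigenspace 0 := by
    refine ⟨⟨x, rfl⟩, ?_⟩
    obtain ⟨n, hn⟩ := mem_maxGenEigenspace_zero.mp hx
    refine mem_maxGenEigenspace_zero.mpr ⟨n, ?_⟩
    have h2 := apply_aeval_apply hS (X ^ n) x
    rw [map_pow, aeval_X] at h2
    rw [← h2, hn, map_zero]
  rw [h] at h1
  exact h1

/-- If Sy is in the kernel of E, then Sy = πSy = Sπy, which vanishes because πy is in the
generalised kernel. -/
theorem range_inf_ker_eq_bot {π : Module.End ℂ M} (hπ : IsFittingProjection E π) (hS : ∀ x, S (E x) = E (S x))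
    (h : E.maxGenEigenspace 0 ≤ LinearMap.ker S) : LinearMap.range S ⊓ LinearMap.ker E = ⊥ := by
  rw [eq_bot_iff]
  rintro _ ⟨⟨y, rfl⟩, hy⟩
  have h1 : S y ∈ E.maxGenEigenspace 0 := mem_maxGenEigenspace_zero.mpr ⟨1, by rw [pow_one]; exact hy⟩
  rw [← hπ.apply_of_mem _ h1, ← hπ.apply_comm hS]
  exact h (hπ.apply_mem y)

/-- The kernel of π on K lies in I, so dim L = dim K/I ≤ dim π(K) ≤ dim (L ∩ K). This recovers an
inclusion from a mere isomorphism. -/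
theorem le_of_quotient_equiv {K I L : Submodule ℂ M} [FiniteDimensional ℂ K] [FiniteDimensional ℂ L]
    {π : Module.End ℂ M} (h1 : ∀ x ∈ K, π x ∈ L ⊓ K) (h2 : ∀ x ∈ K, π x = 0 → x ∈ I)
    (e : (K ⧸ I.submoduleOf K) ≃ₗ[ℂ] L) : L ≤ K := by
  let f : K →ₗ[ℂ] ↥(L ⊓ K) := (π ∘ₗ K.subtype).codRestrict (L ⊓ K) fun x => h1 x x.2
  have h3 : LinearMap.ker f ≤ I.submoduleOf K := fun x hx => h2 x x.2 (congrArg Subtype.val hx)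
  have h4 := Submodule.finrank_mono h3
  have h5 := LinearMap.finrank_range_add_finrank_ker f
  have h6 := Submodule.finrank_quotient_add_finrank (I.submoduleOf K)
  have h7 := e.finrank_eq
  have h8 := Submodule.finrank_le (LinearMap.range f)
  have h9 : L ⊓ K = L := Submodule.eq_of_le_of_finrank_le inf_le_left (by omega)
  exact inf_eq_left.mp h9

end Fitting

/-! ### The equivalences -/

namespace Parabolic

variable {g : Type*} [AddCommGroup g] [Module ℂ g] [LieSuperalgebra g] {B : KillingForm g}
  {G : ℝ → Submodule ℂ g} {P : Parabolic B} {V : Type*} [AddCommGroup V] [Module ℂ V]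
  [SuperSpace V] [LieSupermodule g V]

/-- An operator which commutes with the homogeneous elements of the Levi subalgebra commutes with all elements. -/
theorem comm_of_homogeneous {F : Module.End ℂ (P.C V)}
    (hF : ∀ i, ∀ A ∈ part i, A ∈ P.levi → ∀ f, F (P.action V A f) = P.action V A (F f)) {A : g} (hA : A ∈ P.levi)
    (f : P.C V) : F (P.action V A f) = P.action V A (F f) := by
  have hgr : IsGraded P.levi := Adapted.levi_graded
  rw [← evenProj_add_oddProj A, map_add, LinearMap.add_apply, LinearMap.add_apply, map_add,
    hF 0 _ (evenProj_mem A) (hgr.evenProj_mem hA), hF 1 _ (oddProj_mem A) (hgr.oddProj_mem hA)]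

theorem leviIsomorphic_of_projection {k : ℕ} {K I L : Submodule ℂ (P.C V)} {π : Module.End ℂ (P.C V)}
    (hπK : ∀ x ∈ K, π x ∈ L) (hLK : L ≤ K) (hπL : ∀ x ∈ L, π x = x) (hI : ∀ x ∈ K, π x = 0 ↔ x ∈ I)
    (hact : ∀ A ∈ P.levi, ∀ x, π (P.action V A x) = P.action V A (π x))
    (hK : ∀ A ∈ P.levi, ∀ x ∈ K, P.action V A x ∈ K)
    (hpart : ∀ i, ∀ x ∈ chainPart P.nPart V k i, π x ∈ chainPart P.nPart V k i) : P.LeviIsomorphic V k K I L := by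
  let f : K →ₗ[ℂ] L := (π ∘ₗ K.subtype).codRestrict L fun x => hπK x x.2
  have hker : I.submoduleOf K = LinearMap.ker f := by
    ext x
    rw [LinearMap.mem_ker]
    exact (hI x x.2).symm.trans ⟨fun h => Subtype.ext h, fun h => congrArg Subtype.val h⟩
  have hsurj : Function.Surjective f := fun y => ⟨⟨y, hLK y.2⟩, Subtype.ext (hπL y y.2)⟩
  let e := (Submodule.quotEquivOfEq _ _ hker).trans (f.quotKerEquivOfSurjective hsurj)
  have he : ∀ x : K, (e (Submodule.Quotient.mk x) : P.C V) = π x := fun x => rfl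
  refine ⟨e, fun A hA x => ⟨hK A hA x x.2, ?_⟩, fun i x hx => ?_⟩
  · rw [he, he]
    exact hact A hA x
  · rw [he]
    exact hpart i x hx

theorem exists_transposition_form [FiniteDimensional ℂ g] [FiniteDimensional ℂ V] (hP : P.Adapted G)
    (hV : IsIrreducible g V) : ∃ (τ : g →ₗ[ℂ] g) (J : V →ₗ[ℂ] Module.Dual ℂ V), P.IsTransposition G τ ∧
      (∀ x v u, J (act x v) u = J v (act (τ x) u)) ∧ Function.Injective J := by
  obtain ⟨Q⟩ := hP.exists_generators
  obtain ⟨τ, hτ⟩ := Q.exists_transposition hP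
  obtain ⟨J, hJ, hJ'⟩ := hτ.exists_form hP hV
  exact ⟨τ, J, hτ, hJ, hJ'⟩

theorem tfae_disjoint [FiniteDimensional ℂ g] [FiniteDimensional ℂ V] (hP : P.Adapted G) (hV : IsIrreducible g V)
    {r : ℕ} (ξ : DualBases P r) :
    List.TFAE [LinearMap.range (P.boundary V) ⊓ LinearMap.ker (quabla V ξ) = ⊥,
      LinearMap.range (P.boundary V) ⊓ genKer V ξ = ⊥,
      genKer V ξ ≤ LinearMap.ker (P.boundary V),
      HomologyIso V ξ,
      LinearMap.range (coboundary V ξ) ⊓ LinearMap.ker (quabla V ξ) = ⊥,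
      LinearMap.range (coboundary V ξ) ⊓ genKer V ξ = ⊥,
      genKer V ξ ≤ LinearMap.ker (coboundary V ξ),
      CohomologyIso V ξ,
      AreDisjoint V ξ] := by
  obtain ⟨τ, J, hτ, hJ, hJ'⟩ := exists_transposition_form hP hV
  have hn := hP.n_le
  have hn' := hP.nbar_le
  have hSS : ∀ f, P.boundary V (P.boundary V f) = 0 := boundary_boundary hn
  have hTT : ∀ f, coboundary V ξ (coboundary V ξ f) = 0 := coboundary_coboundary hτ hJ hJ' hn hn' ξ
  have hE : ∀ f, quabla V ξ f = coboundary V ξ (P.boundary V f) + P.boundary V (coboundary V ξ f) := fun _ => rfl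
  have hSE : ∀ f, P.boundary V (quabla V ξ f) = quabla V ξ (P.boundary V f) := fun f => by
    rw [hE, hE, map_add, hSS, hSS, map_zero, zero_add, add_zero]
  have hTE : ∀ f, coboundary V ξ (quabla V ξ f) = quabla V ξ (coboundary V ξ f) := fun f => by
    rw [hE, hE, map_add, hTT, hTT, map_zero, zero_add, add_zero]
  have hSA : ∀ A ∈ P.levi, ∀ f, P.boundary V (P.action V A f) = P.action V A (P.boundary V f) := fun A hA =>
    comm_of_homogeneous (F := P.boundary V) (fun i A hA hAl => boundary_action hA hAl.1 hn) hA
  have hTA : ∀ A ∈ P.levi, ∀ f, coboundary V ξ (P.action V A f) = P.action V A (coboundary V ξ f) := fun A hA =>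
    comm_of_homogeneous (F := coboundary V ξ)
      (fun i A hA hAl => coboundary_action hτ hJ hJ' hn hn' ξ hA hAl) hA
  have hEA : ∀ A ∈ P.levi, ∀ f, P.action V A (quabla V ξ f) = quabla V ξ (P.action V A f) := fun A hA f => by
    rw [hE, hE, map_add, hSA A hA f, hTA A hA f, hTA A hA, hSA A hA]
  obtain ⟨π, hπ⟩ := exists_fittingProjection (E := quabla V ξ) (D := P.deg V) finiteDimensional_deg
    (fun k x => quabla_mem_deg ξ) iSup_deg
  have hSπ := hπ.apply_comm (F := P.boundary V) hSE
  have hTπ := hπ.apply_comm (F := coboundary V ξ) hTE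
  have hAπ : ∀ A ∈ P.levi, ∀ x, π (P.action V A x) = P.action V A (π x) := fun A hA x =>
    (hπ.apply_comm (F := P.action V A) (hEA A hA) x).symm
  have hβ := pairing_quabla hτ hJ hn hn' ξ
  have hπdeg : ∀ k, ∀ x ∈ P.deg V k, π x ∈ P.deg V k := fun k x => hπ.apply_mem_of_stable fun x => quabla_mem_deg ξ
  have hπpart : ∀ k i, ∀ x ∈ chainPart P.nPart V k i, π x ∈ chainPart P.nPart V k i := fun k i x =>
    hπ.apply_mem_of_stable fun x => quabla_mem_chainPart ξ k i
  have hqdeg : ∀ q : Polynomial ℂ, ∀ k, ∀ x ∈ P.deg V k, Polynomial.aeval (quabla V ξ) q x ∈ P.deg V k :=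
    fun q k x => aeval_apply_mem (fun x => quabla_mem_deg ξ) q
  -- In the complement x = □ q(□)x, and q(□)x is a cycle along with x, so only the term ∂*∂ of □
  -- survives.
  have hcyc : ∀ k, ∀ x ∈ P.cycles V k, π x = 0 → x ∈ P.boundaries V k := by
    rintro k x ⟨hx, hxk⟩ hx0
    obtain ⟨q, hq⟩ := hπ.exists_eq x hx0
    refine ⟨coboundary V ξ (Polynomial.aeval (quabla V ξ) q x), coboundary_mem_deg ξ (hqdeg q k x hxk), ?_⟩
    rw [hE, apply_aeval_apply hSE, LinearMap.mem_ker.mp hx, map_zero, map_zero, zero_add] at hq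
    exact hq.symm
  have hcoc : ∀ k, ∀ x ∈ cocycles V ξ k, π x = 0 → x ∈ coboundaries V ξ k := by
    rintro k x ⟨hx, hxk⟩ hx0
    obtain ⟨q, hq⟩ := hπ.exists_eq x hx0
    rw [hE, apply_aeval_apply hTE, LinearMap.mem_ker.mp hx, map_zero, map_zero, add_zero] at hq
    have h1 := hqdeg q k x hxk
    cases k with
    | zero =>
      rw [boundary_of_mem_deg_zero h1, map_zero] at hq
      exact hq
    | succ k => exact ⟨_, boundary_mem_deg h1, hq.symm⟩
  have hfin : ∀ k, FiniteDimensional ℂ (P.deg V k) := finiteDimensional_deg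
  have hfinK : ∀ F : Module.End ℂ (P.C V), ∀ k, FiniteDimensional ℂ ↥(LinearMap.ker F ⊓ P.deg V k) := fun F k =>
    Submodule.finiteDimensional_of_le inf_le_right
  have hfinL : ∀ k, FiniteDimensional ℂ ↥(genKer V ξ ⊓ P.deg V k) := fun k =>
    Submodule.finiteDimensional_of_le inf_le_right
  -- The generalised kernel is the image of π, which preserves degrees, so inclusions can be checked
  -- in each degree.
  have hglue : ∀ F : Module.End ℂ (P.C V),
      (∀ k, genKer V ξ ⊓ P.deg V k ≤ LinearMap.ker F ⊓ P.deg V k) → genKer V ξ ≤ LinearMap.ker F := by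
    intro F h x hx
    have h1 : (⊤ : Submodule ℂ (P.C V)) ≤ LinearMap.ker (F ∘ₗ π) := by
      rw [← iSup_deg]
      exact iSup_le fun k y hy => (h k ⟨hπ.apply_mem y, hπdeg k y hy⟩).1
    have h2 : F (π x) = 0 := h1 trivial
    rwa [hπ.apply_of_mem x hx] at h2
  tfae_have 2 → 1 := fun h => by
    rw [eq_bot_iff, ← h]
    exact inf_le_inf_left _ fun x hx => mem_maxGenEigenspace_zero.mpr ⟨1, by rw [pow_one]; exact hx⟩
  tfae_have 1 → 2 := range_inf_maxGenEigenspace_eq_bot hSE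
  tfae_have 2 → 3 := maxGenEigenspace_le_ker hSE
  tfae_have 3 → 1 := range_inf_ker_eq_bot hπ hSE
  tfae_have 6 → 5 := fun h => by
    rw [eq_bot_iff, ← h]
    exact inf_le_inf_left _ fun x hx => mem_maxGenEigenspace_zero.mpr ⟨1, by rw [pow_one]; exact hx⟩
  tfae_have 5 → 6 := range_inf_maxGenEigenspace_eq_bot hTE
  tfae_have 6 → 7 := maxGenEigenspace_le_ker hTE
  tfae_have 7 → 5 := range_inf_ker_eq_bot hπ hTE
  tfae_have 3 → 4 := fun h k => by
    refine leviIsomorphic_of_projection (π := π) (fun x hx => ⟨hπ.apply_mem x, hπdeg k x hx.2⟩)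
      (fun x hx => ⟨h hx.1, hx.2⟩) (fun x hx => hπ.apply_of_mem x hx.1) (fun x hx => ⟨hcyc k x hx, ?_⟩) hAπ
      (fun A hA x hx => ⟨?_, action_mem_deg A hx.2⟩) (hπpart k)
    · rintro ⟨y, -, rfl⟩
      rw [← hSπ]
      exact h (hπ.apply_mem y)
    · rw [SetLike.mem_coe, LinearMap.mem_ker, hSA A hA, LinearMap.mem_ker.mp hx.1, map_zero]
  -- Only the equality of dimensions is used; the action of the Levi subalgebra and the parity play
  -- no part in this direction.
  tfae_have 4 → 3 := fun h => by
    refine hglue _ fun k => ?_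
    obtain ⟨e, -⟩ := h k
    have := hfinK (P.boundary V) k
    have := hfinL k
    refine le_of_quotient_equiv (π := π) (fun x hx => ⟨⟨hπ.apply_mem x, hπdeg k x hx.2⟩, ?_, hπdeg k x hx.2⟩)
      (hcyc k) e
    rw [SetLike.mem_coe, LinearMap.mem_ker, hSπ, LinearMap.mem_ker.mp hx.1, map_zero]
  tfae_have 7 → 8 := fun h k => by
    refine leviIsomorphic_of_projection (π := π) (fun x hx => ⟨hπ.apply_mem x, hπdeg k x hx.2⟩)
      (fun x hx => ⟨h hx.1, hx.2⟩) (fun x hx => hπ.apply_of_mem x hx.1) (fun x hx => ⟨hcoc k x hx, fun h1 => ?_⟩) hAπ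
      (fun A hA x hx => ⟨?_, action_mem_deg A hx.2⟩) (hπpart k)
    · cases k with
      | zero =>
        have h2 : x = 0 := h1
        rw [h2, map_zero]
      | succ k =>
        obtain ⟨y, -, rfl⟩ := h1
        rw [← hTπ]
        exact h (hπ.apply_mem y)
    · rw [SetLike.mem_coe, LinearMap.mem_ker, hTA A hA, LinearMap.mem_ker.mp hx.1, map_zero]
  tfae_have 8 → 7 := fun h => by
    refine hglue _ fun k => ?_
    obtain ⟨e, -⟩ := h k
    have := hfinK (coboundary V ξ) k
    have := hfinL k
    refine le_of_quotient_equiv (π := π) (fun x hx => ⟨⟨hπ.apply_mem x, hπdeg k x hx.2⟩, ?_, hπdeg k x hx.2⟩)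
      (hcoc k) e
    rw [SetLike.mem_coe, LinearMap.mem_ker, hTπ, LinearMap.mem_ker.mp hx.1, map_zero]
  -- If ∂* vanishes on C_0, then π∂*f' = ∂*πf' = 0, so im ∂* lies in the complement, which is
  -- β-orthogonal to C_0. Thus β(f', ∂f) = -β(∂*f', f) = 0 for f ∈ C_0 and all f', and ∂f = 0.
  tfae_have 3 → 7 := fun h f hf => by
    refine pairing_eq_zero' hτ ξ hJ' fun f' => neg_eq_zero.mp ?_
    rw [← pairing_boundary hτ hJ hn]
    have h1 : π (P.boundary V f') = 0 := by
      rw [← hSπ]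
      exact h (hπ.apply_mem f')
    exact hπ.form_eq_zero hβ h1 hf
  tfae_have 7 → 3 := fun h f hf => by
    refine pairing_eq_zero' hτ ξ hJ' fun f' => neg_eq_zero.mp ?_
    rw [← pairing_coboundary hτ hJ hn hn' ξ]
    have h1 : π (coboundary V ξ f') = 0 := by
      rw [← hTπ]
      exact h (hπ.apply_mem f')
    exact hπ.form_eq_zero hβ h1 hf
  -- For ∂*y in the kernel of □ one has ∂*(∂∂*y) = 0; the second disjointness condition gives ∂∂*y =
  -- 0 and the first ∂*y = 0.
  tfae_have 9 → 1 := fun h => by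
    rw [eq_bot_iff]
    rintro _ ⟨⟨y, rfl⟩, hy⟩
    rw [SetLike.mem_coe, LinearMap.mem_ker, hE, hSS, map_zero, zero_add] at hy
    exact h.1 y (h.2 _ hy)
  tfae_have 1 → 9 := fun h => by
    have h5 : LinearMap.range (coboundary V ξ) ⊓ LinearMap.ker (quabla V ξ) = ⊥ :=
      tfae_7_to_5 (tfae_3_to_7 (tfae_2_to_3 (tfae_1_to_2 h)))
    refine ⟨fun f hf => ?_, fun f hf => ?_⟩
    · have h1 : P.boundary V f ∈ LinearMap.range (P.boundary V) ⊓ LinearMap.ker (quabla V ξ) :=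
        ⟨⟨f, rfl⟩, by rw [SetLike.mem_coe, LinearMap.mem_ker, hE, hSS, hf, map_zero, map_zero, add_zero]⟩
      rw [h] at h1
      exact h1
    · have h1 : coboundary V ξ f ∈ LinearMap.range (coboundary V ξ) ⊓ LinearMap.ker (quabla V ξ) :=
        ⟨⟨f, rfl⟩, by rw [SetLike.mem_coe, LinearMap.mem_ker, hE, hTT, hf, map_zero, map_zero, add_zero]⟩
      rw [h5] at h1
      exact h1
  tfae_finish

end Parabolic

end KostantSuper

end

theorem mainTheorem3 {g V : Type*} [AddCommGroup g] [Module ℂ g] [LieSuperalgebra g]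
    [AddCommGroup V] [Module ℂ V] [SuperSpace V] [LieSupermodule g V] [FiniteDimensional ℂ V]
    (hg : IsBasicClassical g ∨ IsGeneralLinear g) (hV : IsIrreducible g V)
    (B : KillingForm g) (P : Parabolic B) {r s : ℕ}
    (ξ : DualBases P r) (η : DualBases P.opp s) :
    -- the operators `∂`, `∂*` and `□` on `C^•(𝔫⁻, V)`
    List.TFAE [range (P.boundary V) ⊓ ker (quabla V ξ) = ⊥,
      range (P.boundary V) ⊓ genKer V ξ = ⊥,
      genKer V ξ ≤ ker (P.boundary V),
      HomologyIso V ξ,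
      range (coboundary V ξ) ⊓ ker (quabla V ξ) = ⊥,
      range (coboundary V ξ) ⊓ genKer V ξ = ⊥,
      genKer V ξ ≤ ker (coboundary V ξ),
      CohomologyIso V ξ,
      AreDisjoint V ξ] ∧
    -- the operators `δ`, `δ*` and `□` on `C^•(𝔫, V)`
    List.TFAE [range (P.opp.boundary V) ⊓ ker (quabla V η) = ⊥,
      range (P.opp.boundary V) ⊓ genKer V η = ⊥,
      genKer V η ≤ ker (P.opp.boundary V),
      HomologyIso V η,
      range (coboundary V η) ⊓ ker (quabla V η) = ⊥,
      range (coboundary V η) ⊓ genKer V η = ⊥,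
      genKer V η ≤ ker (coboundary V η),
      CohomologyIso V η,
      AreDisjoint V η] := by
  obtain ⟨G, hG⟩ := P.exists_adapted hg
  have hfin := hG.finiteDimensional
  -- The negated grading is adapted to the opposite parabolic subalgebra, so the second half is the
  -- first one for that subalgebra.
  exact ⟨tfae_disjoint hG hV ξ, tfae_disjoint hG.opp hV η⟩
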